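/- **Setting.** Let $\mathcal S$ be a measurable space with a $\sigma$-finite base measure (written $ds$), $\mathcal A$ a finite action set, $A=|\mathcal A|$, $H\ge 1$ a horizon and $s_1\in\mathcal S$ a fixed initial state. A *low-rank step* of dimension $d$ is a pair of measurable maps $\phi:\mathcal S\times\mathcal A\to\mathbb R^d$, $\mu:\mathcal S\to\mathbb R^d$ ($\mu$ integrable) such that $s'\mapsto\langle\phi(s,a),\mu(s')\rangle$ is a probability density for all $(s,a)$, $\|\phi(s,a)\|_2\le 1$, and $\|\int\mu(s)g(s)\,ds\|_2\le\sqrt d$ for all measurable $g:\mathcal S\to[0,1]$. The true transition densities are $P^*_h(s'|s,a)=\langle\phi^*_h(s,a),\mu^*_h(s')\rangle$, $h\in[H]$. The learner knows finite classes $\Phi,\Psi$ such that every $(\phi,\mu)\in\Phi\times\Psi$ is a low-rank step and $\phi_h^*\in\Phi$, $\mu^*_h\in\Psi$ for all $h$ (realizability). A utility is a family of measurable $u_h:\mathcal S\times\mathcal A\to[0,1]$, $h\in[H]$, with $\sum_h u_h(s_h,a_h)\le1$ along every trajectory from $s_1$. Policies are Markov policies; $V^\pi_{P,u}$ is the expected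 total utility from $s_1$, and $\bar V^\pi_{P,u}$ is the truncated value, computed from the recursion $\bar V_h(s)=\min\{1,\mathbb E_{a\sim\pi_h(\cdot|s)}[u_h(s,a)+\int P_h(s'|s,a)\bar V_{h+1}(s')ds']\}$, $\bar V_{H+1}=0$. Put $\Delta(c,\tau)=\tau-\inf_\pi V^\pi_{P^*,c}$. **Feasibility assumption.** $c$ is a utility, $\tau\in(0,1]$, $\kappa\in(0,\tau]$, and the learner knows a policy $\pi^0$ with $V^{\pi^0}_{P^*,c}\le\tau-\kappa$; moreover $\Delta_{\min}>0$ and $\Delta(c,\tau)\ge\Delta_{\min}$. **Algorithm (Low-rank-SWEET).** Let $\epsilon,\delta\in(0,1)$, $\mathfrak U=\min\{\frac\epsilon2,\frac{\Delta_{\min}}2,\frac{\epsilon\Delta_{\min}}5,\frac\tau6,\frac\kappa{24}\}$, $\mathtt T=\Delta(c,\tau)\mathfrak U/3$, $\epsilon_0=\kappa/6$, $\tilde A=A/\epsilon_0$. For a constant $\beta>0$ let $N$ be the least positive integer with $$N\ \ge\ \Big(\frac{2^{10}\beta H^2d^4\tilde A^2}{\mathtt T^2}+\frac{2^{12}3^2\beta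 H^2d^4\tilde A^2}{\kappa^2}\Big)\zeta^2,\qquad \zeta=\log(2|\Phi||\Psi|NH/\delta),$$ and put $\lambda=\beta d\log(2NH|\Phi|/\delta)$, $\hat\alpha=5\sqrt{\beta\zeta(\tilde A+d^2)}$. Set $\pi^{(0)}=\pi^0$. In iteration $n=1,\dots,N$, one episode is sampled for each $k\in[H]$: episode $(n,k)$ follows $\pi^{(n-1)}$, except that at steps $k-1$ and $k$ a uniformly random action is played with probability $\epsilon_0$. For each $h$, $(\hat\phi^{(n)}_h,\hat\mu^{(n)}_h)\in\Phi\times\Psi$ maximises the log-likelihood of the observed triples $(s_h,a_h,s_{h+1})$ of the episodes $(m,h)$, $m\le n$; $\hat P^{(n)}_h=\langle\hat\phi^{(n)}_h,\hat\mu^{(n)}_h\rangle$. Let $\hat U_h^{(n)}=\lambda I+\sum_{m\le n}\hat\phi^{(n)}_h\hat\phi_h^{(n)\top}$, the features being evaluated at $(s_h,a_h)$ of episode $(m,\min\{h+1,H\})$; let $\hat b_h^{(n)}(s,a)=\min\{\hat\alpha\,(\hat\phi_h^{(n)}(s,a)^\top(\hat U_h^{(n)})^{-1}\hat\phi_h^{(n)}(s,a))^{1/2},1\}$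 and $\mathtt U^{(n)}(\pi)=\bar V^\pi_{\hat P^{(n)},\hat b^{(n)}}+\sqrt{\tilde A\zeta/n}$. If $V^{\pi^0}_{\hat P^{(n)},c}+\mathtt U^{(n)}(\pi^0)\ge\tau-2\kappa/3$, let $\mathcal C^{(n)}=\{\pi^0\}$; otherwise let $\mathcal C^{(n)}=\{\pi:V^\pi_{\hat P^{(n)},c}+\mathtt U^{(n)}(\pi)\le\tau-\kappa/3\}$. Let $\pi^{(n)}$ maximise $\mathtt U^{(n)}$ over $\mathcal C^{(n)}$. Exploration ends in the first iteration $n=n_\epsilon$ in which the second case occurs and $\mathtt U^{(n)}(\pi^{(n)})\le\mathtt T$. In the planning phase, for given utilities $r^*,c^*$ and $\tau^*\in(0,1]$, the output $\bar\pi$ is any maximiser of $V^\pi_{\hat P^{(n_\epsilon)},r^*}$ subject to $V^\pi_{\hat P^{(n_\epsilon)},c^*}+\mathtt U^{(n_\epsilon)}(\pi)\le\tau^*$. All maximisers are assumed to exist and are selected as measurable functions of the data observed so far. **Theorem.** There are universal constants $\beta,C>0$ such that in every such instance, with probability at least $1-\delta$, the exploration phase ends in some iteration $n_\epsilon\le N$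 and the following hold. 1. Every policy $\pi$ executed in an episode of the exploration phase satisfies $V^\pi_{P^*,c}\le\tau$. 2. For all utilities $r^*,c^*$ and all $\tau^*\in(0,1]$ with $\Delta(c^*,\tau^*)\ge\Delta_{\min}$, the planning problem is feasible and every output $\bar\pi$ is an $\epsilon$-optimal $(c^*,\tau^*)$-safe policy: $V^{\bar\pi}_{P^*,c^*}\le\tau^*$, and $V^{\pi}_{P^*,r^*}-V^{\bar\pi}_{P^*,r^*}\le\epsilon$ for every $\pi$ with $V^\pi_{P^*,c^*}\le\tau^*$. 3. Write $X=\frac{H^2d^4A^2}{\kappa^2\Delta(c,\tau)^2\mathfrak U^2}+\frac{H^2d^4A^2}{\kappa^4}$. The number $Hn_\epsilon$ of exploration trajectories is at most $$C\Big(\frac{H^3d^4A^2\iota}{\kappa^2\Delta(c,\tau)^2\mathfrak U^2}+\frac{H^3d^4A^2\iota}{\kappa^4}\Big),\qquad\iota=\log^2\!\big(X|\Phi||\Psi|H/\delta\big),$$ and also at most $$C\log^2\!\big(X|\Phi||\Psi|H\big)\Big(\frac{H^3d^4A^2(1+\log(1/\delta))}{\kappa^2\Delta(c,\tau)^2\mathfrak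 U^2}+\frac{H^3d^4A^2(1+\log(1/\delta))}{\kappa^4}\Big).$$ 4. In the constraint-free case $c=0$, $\tau=\kappa=\Delta_{\min}=1$, this number is at most $C\log^2(X|\Phi||\Psi|H)\,(1+\log(1/\delta))\,H^3d^4A^2/\epsilon^2$. -/

import Mathlib

open MeasureTheory

noncomputable section

namespace SafeRewardFree

/-! Time steps are numbered `0, …, H - 1`; step `h` here is step `h + 1` in one-based numbering.
Families indexed by time are indexed by `ℕ`, and only their entries at `h < H` are ever used. -/

/-- A Markov policy: `prob h s a` is the probability of action `a` in state `s` at step `h`. -/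
structure MarkovPolicy (S : Type*) (A : Type*) [MeasurableSpace S] [Fintype A] where
  prob : ℕ → S → A → ℝ
  nonneg : ∀ h s a, 0 ≤ prob h s a
  sum_eq_one : ∀ h s, ∑ a, prob h s a = 1
  measurable_prob : ∀ h a, Measurable fun s => prob h s a

/-- The value `V_h(s)` of the policy `π` for the utility `u` when `k` steps remain from step `h`;
`p h s a` is the density, with respect to `ν`, of the next state given `(s, a)` at step `h`. -/
def value {S A : Type*} [MeasurableSpace S] [Fintype A] (ν : Measure S)
    (p : ℕ → S → A → S → ℝ) (u : ℕ → S → A → ℝ) (π : ℕ → S → A → ℝ) : ℕ → ℕ → S → ℝ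
  | 0, _, _ => 0
  | k + 1, h, s =>
      ∑ a, π h s a * (u h s a + ∫ s', p h s a s' * value ν p u π k (h + 1) s' ∂ν)

/-- The truncated value function (with factor `1`): as `value`, but the state value is cut at `1`
in every step. -/
def truncValue {S A : Type*} [MeasurableSpace S] [Fintype A] (ν : Measure S)
    (p : ℕ → S → A → S → ℝ) (u : ℕ → S → A → ℝ) (π : ℕ → S → A → ℝ) : ℕ → ℕ → S → ℝ
  | 0, _, _ => 0
  | k + 1, h, s =>
      min 1 (∑ a, π h s a * (u h s a + ∫ s', p h s a s' * truncValue ν p u π k (h + 1) s' ∂ν))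

/-- The policy that follows `π`, except that at the steps in `I` it plays a uniformly random
action with probability `ε₀`. -/
def greedy {S A : Type*} [Fintype A] (ε₀ : ℝ) (I : Set ℕ) (π : ℕ → S → A → ℝ) :
    ℕ → S → A → ℝ :=
  open Classical in
  fun h s a => if h ∈ I then ε₀ / (Fintype.card A : ℝ) + (1 - ε₀) * π h s a else π h s a

/-- `(φ, μ)` is a `d`-dimensional low-rank decomposition of a transition kernel whose density with
respect to `ν` is `⟨φ s a, μ s'⟩`, with the usual normalisation. -/
structure IsLowRankStep {S A : Type*} [MeasurableSpace S] {d : ℕ} (ν : Measure S)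
    (φ : S → A → EuclideanSpace ℝ (Fin d)) (μ : S → EuclideanSpace ℝ (Fin d)) : Prop where
  measurable_feature : ∀ a, Measurable fun s => φ s a
  measurable_mu : Measurable μ
  integrable_mu : Integrable μ ν
  norm_feature_le : ∀ s a, ‖φ s a‖ ≤ 1
  norm_integral_mu_le : ∀ g : S → ℝ, Measurable g → (∀ s, g s ∈ Set.Icc (0 : ℝ) 1) →
    ‖∫ s, g s • μ s ∂ν‖ ≤ √(d : ℝ)
  density_nonneg : ∀ s a s', 0 ≤ inner ℝ (φ s a) (μ s')
  integral_density : ∀ s a, ∫ s', inner ℝ (φ s a) (μ s') ∂ν = 1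

/-- A low-rank episodic MDP with horizon `H`, rank `d` and fixed initial state. -/
structure LowRankMDP (S : Type*) (A : Type*) [MeasurableSpace S] [Fintype A] where
  H : ℕ
  H_pos : 0 < H
  d : ℕ
  base : Measure S
  sigmaFinite_base : SigmaFinite base
  init : S
  feature : ℕ → S → A → EuclideanSpace ℝ (Fin d)
  mu : ℕ → S → EuclideanSpace ℝ (Fin d)
  isLowRankStep : ∀ h < H, IsLowRankStep base (feature h) (mu h)

namespace LowRankMDP

/-- The true transition density. -/
def density {S A : Type*} [MeasurableSpace S] [Fintype A] (M : LowRankMDP S A) :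
    ℕ → S → A → S → ℝ :=
  fun h s a s' => inner ℝ (M.feature h s a) (M.mu h s')

/-- The value of the policy `π` from the initial state, in the true MDP. -/
def V {S A : Type*} [MeasurableSpace S] [Fintype A] (M : LowRankMDP S A)
    (u : ℕ → S → A → ℝ) (π : ℕ → S → A → ℝ) : ℝ :=
  value M.base M.density u π M.H 0 M.init

/-- Utilities (rewards, costs): values in `[0, 1]`, and total at most `1` along each trajectory. -/
structure IsUtility {S A : Type*} [MeasurableSpace S] [Fintype A] (M : LowRankMDP S A)
    (u : ℕ → S → A → ℝ) : Prop where
  measurable : ∀ h < M.H, ∀ a, Measurable fun s => u h s a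
  mem_Icc : ∀ h < M.H, ∀ s a, u h s a ∈ Set.Icc (0 : ℝ) 1
  sum_le_one : ∀ (s : ℕ → S) (a : ℕ → A), s 0 = M.init →
    ∑ h ∈ Finset.range M.H, u h (s h) (a h) ≤ 1

/-- The safety margin `Δ(c, τ) = τ - inf_π V^π_c`. -/
def margin {S A : Type*} [MeasurableSpace S] [Fintype A] (M : LowRankMDP S A)
    (c : ℕ → S → A → ℝ) (τ : ℝ) : ℝ :=
  τ - ⨅ π : MarkovPolicy S A, M.V c π.prob

/-- `π` is an `ε`-optimal `(c, τ)`-safe policy for the reward `r`. -/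
def IsEpsOptimalSafe {S A : Type*} [MeasurableSpace S] [Fintype A] (M : LowRankMDP S A)
    (ε : ℝ) (r c : ℕ → S → A → ℝ) (τ : ℝ) (π : MarkovPolicy S A) : Prop :=
  (∀ π' : MarkovPolicy S A, M.V c π'.prob ≤ τ → M.V r π'.prob - M.V r π.prob ≤ ε) ∧
    M.V c π.prob ≤ τ

end LowRankMDP

/-- A finite realizable class of low-rank models. -/
structure ModelClass {S A : Type*} [MeasurableSpace S] [Fintype A] (M : LowRankMDP S A) where
  Φ : Finset (S → A → EuclideanSpace ℝ (Fin M.d))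
  Ψ : Finset (S → EuclideanSpace ℝ (Fin M.d))
  isLowRankStep : ∀ φ ∈ Φ, ∀ μ ∈ Ψ, IsLowRankStep M.base φ μ
  feature_mem : ∀ h < M.H, M.feature h ∈ Φ
  mu_mem : ∀ h < M.H, M.mu h ∈ Ψ

/-- The safety constraint of the exploration phase, with the feasibility assumption. -/
structure SafeTask {S A : Type*} [MeasurableSpace S] [Fintype A] (M : LowRankMDP S A) where
  c : ℕ → S → A → ℝ
  isUtility_c : M.IsUtility c
  τ : ℝ
  τ_pos : 0 < τ
  τ_le_one : τ ≤ 1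
  baseline : MarkovPolicy S A
  κ : ℝ
  κ_pos : 0 < κ
  κ_le : κ ≤ τ
  baseline_safe : M.V c baseline.prob ≤ τ - κ
  Δmin : ℝ
  Δmin_pos : 0 < Δmin
  Δmin_le : Δmin ≤ M.margin c τ

/-- An instance of safe reward-free exploration in a low-rank MDP, with accuracy `ε` and
confidence `δ`. -/
structure Config (S : Type*) (A : Type*) [MeasurableSpace S] [Fintype A] where
  M : LowRankMDP S A
  models : ModelClass M
  task : SafeTask M
  ε : ℝ
  ε_mem : ε ∈ Set.Ioo (0 : ℝ) 1
  δ : ℝ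
  δ_mem : δ ∈ Set.Ioo (0 : ℝ) 1

namespace Config

section Parameters

variable {S A : Type*} [MeasurableSpace S] [Fintype A] (P : Config S A)

/-- `Δ(c, τ)` for the constraint of the exploration phase. -/
def Δ : ℝ := P.M.margin P.task.c P.task.τ

/-- The accuracy level `𝔘`. -/
def acc : ℝ :=
  min (P.ε / 2) (min (P.task.Δmin / 2) (min (P.ε * P.task.Δmin / 5)
    (min (P.task.τ / 6) (P.task.κ / 24))))

/-- The termination threshold `T = Δ(c, τ) 𝔘 / 3`. -/
def threshold : ℝ := P.Δ * P.acc / 3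

/-- The probability `ε₀ = κ / 6` of a uniformly random action. -/
def ε₀ : ℝ := P.task.κ / 6

/-- `Ã = A / ε₀`. -/
def Atilde : ℝ := (Fintype.card A : ℝ) / P.ε₀

/-- `log (2 |Φ| |Ψ| n H / δ)`. -/
def logTerm (n : ℕ) : ℝ :=
  Real.log (2 * (P.models.Φ.card : ℝ) * (P.models.Ψ.card : ℝ) * (n : ℝ) * (P.M.H : ℝ) / P.δ)

/-- The maximal number `N` of iterations: the least positive integer with
`N ≥ (2¹⁰ β H² d⁴ Ã² / T² + 2¹² 3² β H² d⁴ Ã² / κ²) ζ²`, where `ζ = log (2 |Φ| |Ψ| N H / δ)`. -/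
def N (β : ℝ) : ℕ :=
  sInf {n : ℕ | 1 ≤ n ∧
    (2 ^ 10 * β * (P.M.H : ℝ) ^ 2 * (P.M.d : ℝ) ^ 4 * P.Atilde ^ 2 / P.threshold ^ 2 +
      2 ^ 12 * 3 ^ 2 * β * (P.M.H : ℝ) ^ 2 * (P.M.d : ℝ) ^ 4 * P.Atilde ^ 2 / P.task.κ ^ 2) *
        P.logTerm n ^ 2 ≤ (n : ℝ)}

/-- `ζ = log (2 |Φ| |Ψ| N H / δ)`. -/
def ζ (β : ℝ) : ℝ := P.logTerm (P.N β)

/-- `λ = β d log (2 N H |Φ| / δ)`. -/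
def lam (β : ℝ) : ℝ :=
  β * (P.M.d : ℝ) *
    Real.log (2 * (P.N β : ℝ) * (P.M.H : ℝ) * (P.models.Φ.card : ℝ) / P.δ)

/-- `α̂ = 5 √(β ζ (Ã + d²))`. -/
def αhat (β : ℝ) : ℝ := 5 * √(β * P.ζ β * (P.Atilde + (P.M.d : ℝ) ^ 2))

/-- Everything observed: iteration, episode in the iteration, step ↦ (action, next state). -/
abbrev Data (β : ℝ) : Type _ := Fin (P.N β) → Fin P.M.H → Fin P.M.H → A × S

/-- The state at step `j` of an episode. -/
def stateAt (e : Fin P.M.H → A × S) (j : Fin P.M.H) : S :=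
  if (j : ℕ) = 0 then P.M.init else (e ⟨(j : ℕ) - 1, lt_of_le_of_lt (Nat.sub_le _ _) j.2⟩).2

/-- The episode of an iteration used for the covariance at step `h`: episode `h + 1`, in which
the random action is played at steps `h` and `h + 1`; at the last step, the last episode. -/
def covEpisode (h : Fin P.M.H) : Fin P.M.H :=
  ⟨min ((h : ℕ) + 1) (P.M.H - 1), lt_of_le_of_lt (min_le_right _ _) (Nat.sub_lt P.M.H_pos one_pos)⟩

/-- The log-likelihood of `(φ, μ)` on the data set for step `h` after `n` iterations, which
consists of the transition at step `h` in the episode `h` of each of them (`log 0 = -∞`). -/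
def logLik {β : ℝ} (n : ℕ) (h : Fin P.M.H) (ω : P.Data β)
    (φ : S → A → EuclideanSpace ℝ (Fin P.M.d)) (μ : S → EuclideanSpace ℝ (Fin P.M.d)) : EReal :=
  ∑ m : Fin (P.N β) with m.val < n,
    ENNReal.log (ENNReal.ofReal
      (inner ℝ (φ (P.stateAt (ω m h) h) (ω m h h).1) (μ (ω m h h).2)))

/-- The scale `H² d⁴ A² / (κ² Δ(c,τ)² 𝔘²) + H² d⁴ A² / κ⁴`. -/
def scale : ℝ :=
  (P.M.H : ℝ) ^ 2 * (P.M.d : ℝ) ^ 4 * (Fintype.card A : ℝ) ^ 2 /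
      (P.task.κ ^ 2 * P.Δ ^ 2 * P.acc ^ 2) +
    (P.M.H : ℝ) ^ 2 * (P.M.d : ℝ) ^ 4 * (Fintype.card A : ℝ) ^ 2 / P.task.κ ^ 4

/-- `ι = log² (scale · |Φ| |Ψ| H / δ)`. -/
def iota : ℝ :=
  Real.log (P.scale * (P.models.Φ.card : ℝ) * (P.models.Ψ.card : ℝ) * (P.M.H : ℝ) / P.δ) ^ 2

/-- A logarithmic factor that does not depend on `δ`. -/
def logFactor : ℝ :=
  Real.log (P.scale * (P.models.Φ.card : ℝ) * (P.models.Ψ.card : ℝ) * (P.M.H : ℝ)) ^ 2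

end Parameters

end Config

/-- The outputs of the oracles, as functions of the data: the estimates after iteration `n` for
step `h`, and the reference policy `π⁽ⁿ⁾` computed in iteration `n` (`π⁽⁰⁾` is the baseline). -/
structure Choices {S A : Type*} [MeasurableSpace S] [Fintype A] (P : Config S A) (β : ℝ) where
  φhat : ℕ → ℕ → P.Data β → S → A → EuclideanSpace ℝ (Fin P.M.d)
  μhat : ℕ → ℕ → P.Data β → S → EuclideanSpace ℝ (Fin P.M.d)
  pol : ℕ → P.Data β → MarkovPolicy S A

namespace Choices

section Algorithm

variable {S A : Type*} [MeasurableSpace S] [Fintype A] {P : Config S A} {β : ℝ}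
  (R : Choices P β)

/-- The density of the estimated model `P̂⁽ⁿ⁾`. -/
def phat (n : ℕ) (ω : P.Data β) : ℕ → S → A → S → ℝ :=
  fun h s a s' => inner ℝ (R.φhat n h ω s a) (R.μhat n h ω s')

/-- The value of a policy under the estimated model. -/
def Vhat (n : ℕ) (ω : P.Data β) (u : ℕ → S → A → ℝ) (π : MarkovPolicy S A) : ℝ :=
  value P.M.base (R.phat n ω) u π.prob P.M.H 0 P.M.init

/-- The empirical covariance matrix `Û⁽ⁿ⁾` at step `h`. -/
def cov (n : ℕ) (ω : P.Data β) (h : Fin P.M.H) : Matrix (Fin P.M.d) (Fin P.M.d) ℝ :=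
  (∑ m : Fin (P.N β) with m.val < n,
    Matrix.vecMulVec
      (WithLp.ofLp (R.φhat n h ω (P.stateAt (ω m (P.covEpisode h)) h)
        (ω m (P.covEpisode h) h).1))
      (WithLp.ofLp (R.φhat n h ω (P.stateAt (ω m (P.covEpisode h)) h)
        (ω m (P.covEpisode h) h).1))) +
    P.lam β • (1 : Matrix (Fin P.M.d) (Fin P.M.d) ℝ)

/-- The exploration-driven reward `b̂⁽ⁿ⁾ = min {α̂ ‖φ̂‖_{Û⁻¹}, 1}`. -/
def bonus (n : ℕ) (ω : P.Data β) : ℕ → S → A → ℝ :=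
  fun h s a =>
    if hh : h < P.M.H then
      min (P.αhat β * √(WithLp.ofLp (R.φhat n h ω s a) ⬝ᵥ
        Matrix.mulVec (R.cov n ω ⟨h, hh⟩)⁻¹ (WithLp.ofLp (R.φhat n h ω s a)))) 1
    else 0

/-- The approximation error function `U⁽ⁿ⁾(π)`. -/
def U (n : ℕ) (ω : P.Data β) (π : MarkovPolicy S A) : ℝ :=
  truncValue P.M.base (R.phat n ω) (R.bonus n ω) π.prob P.M.H 0 P.M.init +
    √(P.Atilde * P.ζ β / (n : ℝ))

/-- The estimated model is accurate enough on the baseline policy. -/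
def BaselineAccurate (n : ℕ) (ω : P.Data β) : Prop :=
  R.Vhat n ω P.task.c P.task.baseline + R.U n ω P.task.baseline <
    P.task.τ - 2 * P.task.κ / 3

/-- The empirical safe policy set. -/
def safeSet (n : ℕ) (ω : P.Data β) : Set (MarkovPolicy S A) :=
  open Classical in
  if R.BaselineAccurate n ω then
    {π | R.Vhat n ω P.task.c π + R.U n ω π ≤ P.task.τ - P.task.κ / 3}
  else {P.task.baseline}

/-- The termination test in iteration `n`. -/
def Terminates (n : ℕ) (ω : P.Data β) : Prop :=
  R.BaselineAccurate n ω ∧ R.U n ω (R.pol n ω) ≤ P.threshold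

/-- The exploration phase ends in iteration `n`. -/
def StopsAt (n : ℕ) (ω : P.Data β) : Prop :=
  1 ≤ n ∧ n ≤ P.N β ∧ R.Terminates n ω ∧ ∀ m, 1 ≤ m → m < n → ¬ R.Terminates m ω

/-- The behavior policy of episode `k` in the iteration that follows the computation of
`π⁽ⁱ⁾`: random actions at steps `k - 1` and `k`. -/
def behavior (i : ℕ) (ω : P.Data β) (k : ℕ) : ℕ → S → A → ℝ :=
  greedy P.ε₀ {j | j = k ∨ j + 1 = k} (R.pol i ω).prob

/-- The law of the data. Its density with respect to the product of the counting measure on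
actions and the base measure on states is the product, over all iterations, episodes and steps,
of the probability of the action under the behavior policy and the true transition density. -/
def law [MeasurableSpace A] : Measure (P.Data β) :=
  (Measure.pi fun _ : Fin (P.N β) => Measure.pi fun _ : Fin P.M.H =>
      Measure.pi fun _ : Fin P.M.H => (Measure.count : Measure A).prod P.M.base).withDensity
    fun ω => ENNReal.ofReal (∏ i : Fin (P.N β), ∏ k : Fin P.M.H, ∏ j : Fin P.M.H,
      R.behavior i.val ω k.val j.val (P.stateAt (ω i k) j) (ω i k j).1 *
        P.M.density j.val (P.stateAt (ω i k) j) (ω i k j).1 (ω i k j).2)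

/-- The choices follow the algorithm: the estimates are maximum-likelihood estimates, the reference
policy maximises `U⁽ⁿ⁾` over the empirical safe policy set as long as exploration has not ended,
and everything is a measurable function of the data observed so far. -/
structure IsRun [MeasurableSpace A] : Prop where
  φhat_mem : ∀ n, 1 ≤ n → n ≤ P.N β → ∀ (h : Fin P.M.H) ω, R.φhat n h ω ∈ P.models.Φ
  μhat_mem : ∀ n, 1 ≤ n → n ≤ P.N β → ∀ (h : Fin P.M.H) ω, R.μhat n h ω ∈ P.models.Ψ
  mle : ∀ n, 1 ≤ n → n ≤ P.N β → ∀ (h : Fin P.M.H) ω, ∀ φ ∈ P.models.Φ, ∀ μ ∈ P.models.Ψ,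
    P.logLik n h ω φ μ ≤ P.logLik n h ω (R.φhat n h ω) (R.μhat n h ω)
  pol_zero : ∀ ω, R.pol 0 ω = P.task.baseline
  pol_mem : ∀ n, 1 ≤ n → n ≤ P.N β → ∀ ω, (∀ m, 1 ≤ m → m < n → ¬ R.Terminates m ω) →
    R.pol n ω ∈ R.safeSet n ω
  pol_max : ∀ n, 1 ≤ n → n ≤ P.N β → ∀ ω, (∀ m, 1 ≤ m → m < n → ¬ R.Terminates m ω) →
    ∀ π ∈ R.safeSet n ω, R.U n ω π ≤ R.U n ω (R.pol n ω)
  φhat_adapted : ∀ n, n ≤ P.N β → ∀ (h : Fin P.M.H) (ω ω' : P.Data β),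
    (∀ m : Fin (P.N β), m.val < n → ω m = ω' m) → R.φhat n h ω = R.φhat n h ω'
  μhat_adapted : ∀ n, n ≤ P.N β → ∀ (h : Fin P.M.H) (ω ω' : P.Data β),
    (∀ m : Fin (P.N β), m.val < n → ω m = ω' m) → R.μhat n h ω = R.μhat n h ω'
  pol_adapted : ∀ n, n ≤ P.N β → ∀ ω ω' : P.Data β,
    (∀ m : Fin (P.N β), m.val < n → ω m = ω' m) → R.pol n ω = R.pol n ω'
  φhat_measurable : ∀ n, 1 ≤ n → n ≤ P.N β → ∀ (h : Fin P.M.H), ∀ φ ∈ P.models.Φ,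
    MeasurableSet {ω | R.φhat n h ω = φ}
  μhat_measurable : ∀ n, 1 ≤ n → n ≤ P.N β → ∀ (h : Fin P.M.H), ∀ μ ∈ P.models.Ψ,
    MeasurableSet {ω | R.μhat n h ω = μ}
  pol_measurable : ∀ n, n ≤ P.N β → ∀ (h : Fin P.M.H) a,
    Measurable fun x : P.Data β × S => (R.pol n x.1).prob h x.2 a

/-- `π` satisfies the empirical constraint of the planning phase. -/
def PlanFeasible (n : ℕ) (ω : P.Data β) (c : ℕ → S → A → ℝ) (τ : ℝ)
    (π : MarkovPolicy S A) : Prop :=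
  R.Vhat n ω c π + R.U n ω π ≤ τ

/-- `π` is an output of the planning phase for the reward `r` and the constraint `(c, τ)`, with
the model obtained in iteration `n`. -/
def IsPlan (n : ℕ) (ω : P.Data β) (r c : ℕ → S → A → ℝ) (τ : ℝ) (π : MarkovPolicy S A) : Prop :=
  R.PlanFeasible n ω c τ π ∧
    ∀ π' : MarkovPolicy S A, R.PlanFeasible n ω c τ π' → R.Vhat n ω r π' ≤ R.Vhat n ω r π

end Algorithm

end Choices

end SafeRewardFree

end

/-! All randomness is confined to one event of probability at least 1 - δ (`Choices.Good`). On that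
event every claim is deterministic.

Good event. The law of the data has a density that is a product of conditional densities, so
exponential moments of adaptively collected data can be integrated out from the last iteration to
the first. This gives a Chernoff bound without conditional expectations (`IsRun.law_ge_le`). Applied
to root likelihood ratios, with a union bound over Φ × Ψ, it bounds the squared total variation
errors of the maximum-likelihood model, summed over the data-collecting policies, by 2ζ. Applied to
squared projections of features onto a net of the unit ball, it makes empirical and expected
covariances comparable up to factors 2 and λ.

Validity of the bonus. The estimated density at step h is linear in its feature, so the estimated
mean of the model error at step h + 1 is an inner product ⟨φ̂, w⟩. Cauchy–Schwarz for the empirical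
covariance bounds it by the elliptical norm of φ̂ times the in-sample size of w. That size is
controlled by the likelihood bound, after a change of policy that costs a factor Ã thanks to the
random actions. Thus the bonus at each step pays for the model error one step later, and its
truncated value dominates the error of every utility under every policy (`Good.abs_Vhat_sub_V_le`).
The first step has no predecessor; its bonus is shown to be large enough to pay for its own error
too (`Good.err_zero_add_le`).

Termination. Conversely, `U` is at most an expected sum of bonuses and errors in the true model. The
true low-rank features and the elliptical potential lemma bound its sum over n iterations by order H
√n, up to the factor `potScale` and a logarithm (`Good.sum_U_le`). Before termination each summand
exceeds the threshold T, which bounds n.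

From safe policies to all policies. At termination `U` ≤ T is known only on the empirically safe
policies. Truncated values are not linear in occupancy measures, and statewise mixtures of Markov
policies do not average values, so convexity is replaced by a Lagrangian homotopy
(`exists_lagrangian_path`). Dynamic programming optimises a truncated value of θ b - c. Optimisers
for neighbouring θ are joined by statewise mixtures, which stay nearly optimal, and the intermediate
value theorem finds such a policy exactly on the boundary of the constraint. It remains safe along
the way because for small cost `U` ≤ 2T already implies `U` ≤ T (`le_of_gap`). Comparing its
Lagrangian with that of a supposed policy with large `U` and that of the cheapest policy yields a
contradiction (`bonus_value_le_of_safe`). The same device, with the reward in place of the bonus,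
gives near-optimality of planning (`planning_succeeds`).

Counting. The inequality for n contains logarithms of n and is solved by elementary inversion. The
potential is regularised by βζ, so that ζ cancels from its logarithm; only one factor log(1/δ) then
survives (`logPot_le`). -/

set_option linter.unusedSectionVars false

/-! ### Integration against transition densities, total variation and Bhattacharyya coefficient. -/

noncomputable section

namespace SafeRewardFree

/-- Bounded measurable real functions. -/
structure BddMeas {S : Type*} [MeasurableSpace S] (V : S → ℝ) : Prop where
  meas : Measurable V
  bdd : ∃ C, ∀ s, |V s| ≤ C

namespace BddMeas

variable {S : Type*} [MeasurableSpace S] {V W : S → ℝ}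

theorem const (c : ℝ) : BddMeas (fun _ : S => c) := ⟨measurable_const, |c|, fun _ => le_rfl⟩

theorem of_mem_Icc {a b : ℝ} (h : Measurable V) (hV : ∀ s, V s ∈ Set.Icc a b) : BddMeas V :=
  ⟨h, max |a| |b|, fun s => abs_le_max_abs_abs (hV s).1 (hV s).2⟩

theorem add (hV : BddMeas V) (hW : BddMeas W) : BddMeas (fun s => V s + W s) := by
  obtain ⟨C, hC⟩ := hV.bdd
  obtain ⟨D, hD⟩ := hW.bdd
  exact ⟨hV.meas.add hW.meas, C + D, fun s => (abs_add_le _ _).trans (add_le_add (hC s) (hD s))⟩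

theorem mul (hV : BddMeas V) (hW : BddMeas W) : BddMeas (fun s => V s * W s) := by
  obtain ⟨C, hC⟩ := hV.bdd
  obtain ⟨D, hD⟩ := hW.bdd
  refine ⟨hV.meas.mul hW.meas, C * D, fun s => ?_⟩
  rw [abs_mul]
  exact mul_le_mul (hC s) (hD s) (abs_nonneg _) ((abs_nonneg _).trans (hC s))

theorem const_mul (c : ℝ) (hV : BddMeas V) : BddMeas (fun s => c * V s) := (const c).mul hV

theorem neg (hV : BddMeas V) : BddMeas (fun s => - V s) := by
  simpa using hV.const_mul (-1)

theorem sub (hV : BddMeas V) (hW : BddMeas W) : BddMeas (fun s => V s - W s) := by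
  simpa [sub_eq_add_neg] using hV.add hW.neg

theorem pow (hV : BddMeas V) (n : ℕ) : BddMeas (fun s => V s ^ n) := by
  induction n with
  | zero => simpa using const (S := S) 1
  | succ n ih => simpa [pow_succ] using ih.mul hV

theorem abs (hV : BddMeas V) : BddMeas (fun s => |V s|) := by
  obtain ⟨C, hC⟩ := hV.bdd
  exact ⟨hV.meas.abs, C, fun s => by simpa using hC s⟩

theorem sum {ι : Type*} (t : Finset ι) {F : ι → S → ℝ} (h : ∀ i ∈ t, BddMeas (F i)) :
    BddMeas (fun s => ∑ i ∈ t, F i s) := by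
  classical
  induction t using Finset.induction_on with
  | empty => simpa using const (S := S) 0
  | insert i t hi ih =>
    simp only [Finset.sum_insert hi]
    exact (h i (by simp)).add (ih fun j hj => h j (by simp [hj]))

theorem comp_of_continuous (hV : BddMeas V) {f : ℝ → ℝ} (hf : Continuous f) :
    BddMeas (fun s => f (V s)) := by
  obtain ⟨C, hC⟩ := hV.bdd
  obtain ⟨D, hD⟩ := (isCompact_Icc (a := -C) (b := C)).exists_bound_of_continuousOn hf.continuousOn
  exact ⟨hf.measurable.comp hV.meas, D, fun s => hD _ (abs_le.mp (hC s))⟩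

theorem integrable_mul {ν : Measure S} {f : S → ℝ} (hf : Integrable f ν) (hV : BddMeas V) :
    Integrable (fun s => f s * V s) ν := by
  obtain ⟨C, hC⟩ := hV.bdd
  exact hf.mul_bdd (c := C) hV.meas.aestronglyMeasurable (by simpa using Filter.Eventually.of_forall hC)

end BddMeas

/-- `p` is a family of probability densities with respect to `ν`. -/
structure IsDensity {S A : Type*} [MeasurableSpace S] (ν : Measure S) (p : S → A → S → ℝ) :
    Prop where
  meas : ∀ a, Measurable fun x : S × S => p x.1 a x.2
  nonneg : ∀ s a s', 0 ≤ p s a s'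
  integrable : ∀ s a, Integrable (p s a) ν
  integral : ∀ s a, ∫ s', p s a s' ∂ν = 1

/-- The expectation of `V` at the next state. -/
def kint {S A : Type*} [MeasurableSpace S] (ν : Measure S) (p : S → A → S → ℝ) (V : S → ℝ)
    (s : S) (a : A) : ℝ := ∫ s', p s a s' * V s' ∂ν

theorem IsLowRankStep.isDensity {S A : Type*} [MeasurableSpace S] {d : ℕ} {ν : Measure S}
    {φ : S → A → EuclideanSpace ℝ (Fin d)} {μ : S → EuclideanSpace ℝ (Fin d)}
    (h : IsLowRankStep ν φ μ) : IsDensity ν (fun s a s' => inner ℝ (φ s a) (μ s')) where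
  meas a := ((h.measurable_feature a).comp measurable_fst).inner (h.measurable_mu.comp measurable_snd)
  nonneg := h.density_nonneg
  integrable s a := h.integrable_mu.const_inner (φ s a)
  integral := h.integral_density

section Kernel

variable {S A : Type*} [MeasurableSpace S] {ν : Measure S} {p q : S → A → S → ℝ} {V W : S → ℝ}

namespace IsDensity

theorem integrable_mul (hp : IsDensity ν p) (hV : BddMeas V) (s : S) (a : A) :
    Integrable (fun s' => p s a s' * V s') ν := hV.integrable_mul (hp.integrable s a)

theorem kint_mono (hp : IsDensity ν p) (hV : BddMeas V) (hW : BddMeas W) (h : ∀ s, V s ≤ W s)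
    (s : S) (a : A) : kint ν p V s a ≤ kint ν p W s a :=
  integral_mono (hp.integrable_mul hV s a) (hp.integrable_mul hW s a)
    fun s' => mul_le_mul_of_nonneg_left (h s') (hp.nonneg s a s')

theorem kint_const (hp : IsDensity ν p) (c : ℝ) (s : S) (a : A) :
    kint ν p (fun _ => c) s a = c := by
  simp [kint, integral_mul_const, hp.integral]

theorem kint_add (hp : IsDensity ν p) (hV : BddMeas V) (hW : BddMeas W) (s : S) (a : A) :
    kint ν p (fun s => V s + W s) s a = kint ν p V s a + kint ν p W s a := by
  simp only [kint, mul_add]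
  exact integral_add (hp.integrable_mul hV s a) (hp.integrable_mul hW s a)

theorem kint_sub (hp : IsDensity ν p) (hV : BddMeas V) (hW : BddMeas W) (s : S) (a : A) :
    kint ν p (fun s => V s - W s) s a = kint ν p V s a - kint ν p W s a := by
  simp only [kint, mul_sub]
  exact integral_sub (hp.integrable_mul hV s a) (hp.integrable_mul hW s a)

theorem kint_const_mul (c : ℝ) (V : S → ℝ) (s : S) (a : A) :
    kint ν p (fun s => c * V s) s a = c * kint ν p V s a := by
  simp only [kint]
  rw [← integral_const_mul]
  exact integral_congr_ae (Filter.Eventually.of_forall fun _ => by simp only; ring)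

theorem kint_le (hp : IsDensity ν p) (hV : BddMeas V) {C : ℝ} (h : ∀ s, V s ≤ C)
    (s : S) (a : A) : kint ν p V s a ≤ C :=
  (hp.kint_mono hV (BddMeas.const C) h s a).trans_eq (hp.kint_const C s a)

theorem le_kint (hp : IsDensity ν p) (hV : BddMeas V) {C : ℝ} (h : ∀ s, C ≤ V s)
    (s : S) (a : A) : C ≤ kint ν p V s a :=
  (hp.kint_const C s a).symm.trans_le (hp.kint_mono (BddMeas.const C) hV h s a)

theorem abs_kint_le (hp : IsDensity ν p) (hV : BddMeas V) {C : ℝ} (h : ∀ s, |V s| ≤ C)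
    (s : S) (a : A) : |kint ν p V s a| ≤ C :=
  abs_le.mpr ⟨hp.le_kint hV (fun s => (abs_le.mp (h s)).1) s a,
    hp.kint_le hV (fun s => (abs_le.mp (h s)).2) s a⟩

theorem abs_kint_sub_le (hp : IsDensity ν p) (hV : BddMeas V) (hW : BddMeas W) (s : S) (a : A) :
    |kint ν p V s a - kint ν p W s a| ≤ kint ν p (fun s => |V s - W s|) s a := by
  rw [← hp.kint_sub hV hW]
  simp only [kint]
  refine (abs_integral_le_integral_abs).trans_eq ?_
  refine integral_congr_ae (Filter.Eventually.of_forall fun s' => ?_)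
  simp only [abs_mul, abs_of_nonneg (hp.nonneg s a s')]

theorem kint_bddMeas [SigmaFinite ν] (hp : IsDensity ν p) (hV : BddMeas V) (a : A) :
    BddMeas (fun s => kint ν p V s a) := by
  obtain ⟨C, hC⟩ := hV.bdd
  refine ⟨?_, C, fun s => hp.abs_kint_le hV hC s a⟩
  have : StronglyMeasurable (Function.uncurry fun s s' => p s a s' * V s') :=
    ((hp.meas a).mul (hV.meas.comp measurable_snd)).stronglyMeasurable
  exact this.integral_prod_right.measurable

/-- Jensen's inequality for the square. -/
theorem sq_kint_le (hp : IsDensity ν p) (hV : BddMeas V) (s : S) (a : A) :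
    kint ν p V s a ^ 2 ≤ kint ν p (fun s => V s ^ 2) s a := by
  set m := kint ν p V s a
  have h0 : 0 ≤ kint ν p (fun s => (V s - m) ^ 2) s a :=
    hp.le_kint ((hV.sub (BddMeas.const m)).pow 2) (fun _ => sq_nonneg _) s a
  have h1 : (fun s => (V s - m) ^ 2) = fun s => (V s ^ 2 - (2 * m) * V s) + m ^ 2 := by
    ext s; ring
  rw [h1, hp.kint_add ((hV.pow 2).sub (hV.const_mul _)) (BddMeas.const _), hp.kint_sub (hV.pow 2)
    (hV.const_mul _), hp.kint_const, kint_const_mul] at h0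
  have : kint ν p V s a = m := rfl
  rw [this] at h0
  nlinarith

end IsDensity

/-- The total variation distance between two transition densities. -/
def tvDist (ν : Measure S) (p q : S → A → S → ℝ) (s : S) (a : A) : ℝ :=
  (∫ s', |p s a s' - q s a s'| ∂ν) / 2

/-- The Bhattacharyya coefficient of two transition densities. -/
def bhatta (ν : Measure S) (p q : S → A → S → ℝ) (s : S) (a : A) : ℝ :=
  ∫ s', √(p s a s' * q s a s') ∂ν

theorem tvDist_nonneg (s : S) (a : A) : 0 ≤ tvDist ν p q s a :=
  div_nonneg (integral_nonneg fun _ => abs_nonneg _) (by norm_num)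

theorem tvDist_le_one (hp : IsDensity ν p) (hq : IsDensity ν q) (s : S) (a : A) :
    tvDist ν p q s a ≤ 1 := by
  have : ∫ s', |p s a s' - q s a s'| ∂ν ≤ ∫ s', p s a s' + q s a s' ∂ν := by
    refine integral_mono ((hp.integrable s a).sub (hq.integrable s a)).abs
      ((hp.integrable s a).add (hq.integrable s a)) fun s' => ?_
    have := hp.nonneg s a s'
    have := hq.nonneg s a s'
    exact abs_le.mpr ⟨by linarith, by linarith⟩
  rw [integral_add (hp.integrable s a) (hq.integrable s a), hp.integral, hq.integral] at this
  unfold tvDist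
  linarith

theorem tvDist_bddMeas [SigmaFinite ν] (hp : IsDensity ν p) (hq : IsDensity ν q) (a : A) :
    BddMeas fun s => tvDist ν p q s a := by
  refine BddMeas.of_mem_Icc (a := 0) (b := 1) ?_
    fun s => ⟨tvDist_nonneg s a, tvDist_le_one hp hq s a⟩
  have : StronglyMeasurable (Function.uncurry fun s s' => |p s a s' - q s a s'|) :=
    ((hp.meas a).sub (hq.meas a)).abs.stronglyMeasurable
  exact this.integral_prod_right.measurable.div_const 2

/-- Both densities have mass one, so `V` may be centred at 1/2; its modulus is then at most 1/2,
which is the factor in `tvDist`. -/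
theorem abs_kint_sub_kint_le (hp : IsDensity ν p) (hq : IsDensity ν q) (hV : BddMeas V)
    (h : ∀ s, V s ∈ Set.Icc (0 : ℝ) 1) (s : S) (a : A) :
    |kint ν p V s a - kint ν q V s a| ≤ tvDist ν p q s a := by
  have hW : BddMeas fun s => V s - 1 / 2 := hV.sub (BddMeas.const _)
  have h1 : ∀ r : S → A → S → ℝ, IsDensity ν r →
      kint ν r V s a = kint ν r (fun s => V s - 1 / 2) s a + 1 / 2 := fun r hr => by
    rw [hr.kint_sub hV (BddMeas.const _), hr.kint_const]; ring
  rw [h1 p hp, h1 q hq, add_sub_add_right_eq_sub]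
  simp only [kint]
  rw [← integral_sub (hp.integrable_mul hW s a) (hq.integrable_mul hW s a)]
  refine (abs_integral_le_integral_abs).trans ?_
  rw [tvDist, ← integral_div]
  refine integral_mono_of_nonneg (Filter.Eventually.of_forall fun _ => abs_nonneg _)
    (((hp.integrable s a).sub (hq.integrable s a)).abs.div_const 2)
    (Filter.Eventually.of_forall fun s' => ?_)
  simp only [← sub_mul, abs_mul]
  rw [div_eq_mul_one_div]
  refine mul_le_mul_of_nonneg_left ?_ (abs_nonneg _)
  have := h s'
  exact abs_le.mpr ⟨by linarith [this.1], by linarith [this.2]⟩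

theorem integrable_sqrt_mul (hp : IsDensity ν p) (hq : IsDensity ν q) (s : S) (a : A) :
    Integrable (fun s' => √(p s a s' * q s a s')) ν := by
  refine Integrable.mono' ((hp.integrable s a).add (hq.integrable s a)) ?_
    (Filter.Eventually.of_forall fun s' => ?_)
  · exact Real.continuous_sqrt.comp_aestronglyMeasurable
      ((hp.integrable s a).aestronglyMeasurable.mul (hq.integrable s a).aestronglyMeasurable)
  · have h1 := hp.nonneg s a s'
    have h2 := hq.nonneg s a s'
    rw [Real.norm_of_nonneg (Real.sqrt_nonneg _)]
    refine Real.sqrt_le_iff.mpr ⟨add_nonneg h1 h2, ?_⟩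
    simp only [Pi.add_apply]
    nlinarith [mul_nonneg h1 h2]

theorem bhatta_nonneg (s : S) (a : A) : 0 ≤ bhatta ν p q s a :=
  integral_nonneg fun _ => Real.sqrt_nonneg _

theorem bhatta_le_one (hp : IsDensity ν p) (hq : IsDensity ν q) (s : S) (a : A) :
    bhatta ν p q s a ≤ 1 := by
  have : bhatta ν p q s a ≤ ∫ s', (p s a s' + q s a s') / 2 ∂ν := by
    refine integral_mono (integrable_sqrt_mul hp hq s a)
      (((hp.integrable s a).add (hq.integrable s a)).div_const 2) fun s' => ?_
    have h1 := hp.nonneg s a s'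
    have h2 := hq.nonneg s a s'
    refine Real.sqrt_le_iff.mpr ⟨by positivity, ?_⟩
    nlinarith [sq_nonneg (p s a s' - q s a s')]
  rw [integral_div, integral_add (hp.integrable s a) (hq.integrable s a), hp.integral,
    hq.integral] at this
  linarith

theorem bhatta_bddMeas [SigmaFinite ν] (hp : IsDensity ν p) (hq : IsDensity ν q) (a : A) :
    BddMeas fun s => bhatta ν p q s a := by
  refine BddMeas.of_mem_Icc (a := 0) (b := 1) ?_
    fun s => ⟨bhatta_nonneg s a, bhatta_le_one hp hq s a⟩
  have : StronglyMeasurable (Function.uncurry fun s s' => √(p s a s' * q s a s')) :=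
    ((hp.meas a).mul (hq.meas a)).sqrt.stronglyMeasurable
  exact this.integral_prod_right.measurable

/-- Write |p - q| = |√p - √q| (√p + √q) and split the product by Young's inequality with parameter
`t`. The squares integrate to 2(1 - b) and 2(1 + b), where b ≤ 1 is the Bhattacharyya coefficient.
Optimising over `t` afterwards replaces Cauchy–Schwarz for the integral. -/
theorem tvDist_le_of_pos (hp : IsDensity ν p) (hq : IsDensity ν q) (s : S) (a : A) {t : ℝ}
    (ht : 0 < t) : 2 * tvDist ν p q s a ≤ t * (1 - bhatta ν p q s a) + 2 / t := by
  have hI := integrable_sqrt_mul hp hq s a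
  have hpq := (hp.integrable s a).add (hq.integrable s a)
  have h1 : 2 * tvDist ν p q s a ≤ ∫ s', (t / 2 * ((p s a s' + q s a s') - 2 * √(p s a s' * q s a s'))
      + 1 / (2 * t) * ((p s a s' + q s a s') + 2 * √(p s a s' * q s a s'))) ∂ν := by
    rw [tvDist, mul_div_cancel₀ _ (two_ne_zero)]
    refine integral_mono ((hp.integrable s a).sub (hq.integrable s a)).abs
      (((hpq.sub (hI.const_mul 2)).const_mul _).add ((hpq.add (hI.const_mul 2)).const_mul _))
      fun s' => ?_
    have h1 := hp.nonneg s a s'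
    have h2 := hq.nonneg s a s'
    simp only [Real.sqrt_mul h1]
    set x := √(p s a s') with hx
    set y := √(q s a s') with hy
    have hxx : p s a s' = x ^ 2 := (Real.sq_sqrt h1).symm
    have hyy : q s a s' = y ^ 2 := (Real.sq_sqrt h2).symm
    have hx0 : 0 ≤ x := Real.sqrt_nonneg _
    have hy0 : 0 ≤ y := Real.sqrt_nonneg _
    rw [hxx, hyy, show x ^ 2 - y ^ 2 = (x - y) * (x + y) by ring, abs_mul,
      abs_of_nonneg (add_nonneg hx0 hy0)]
    have key : 0 ≤ (t * |x - y| - (x + y)) ^ 2 / (2 * t) := by positivity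
    have hsq : |x - y| ^ 2 = x ^ 2 + y ^ 2 - 2 * (x * y) := by rw [sq_abs]; ring
    have e : (t * |x - y| - (x + y)) ^ 2 / (2 * t) =
        t / 2 * |x - y| ^ 2 + 1 / (2 * t) * (x + y) ^ 2 - |x - y| * (x + y) := by
      field_simp; ring
    rw [e, hsq] at key
    nlinarith [key]
  refine h1.trans ?_
  have e : ∀ s', t / 2 * ((p s a s' + q s a s') - 2 * √(p s a s' * q s a s'))
      + 1 / (2 * t) * ((p s a s' + q s a s') + 2 * √(p s a s' * q s a s')) =
      (t / 2 + 1 / (2 * t)) * (p s a + q s a) s' + (1 / t - t) * √(p s a s' * q s a s') := by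
    intro s'
    simp only [Pi.add_apply]
    field_simp
    ring
  simp only [e]
  rw [integral_add (hpq.const_mul _) (hI.const_mul _), integral_const_mul, integral_const_mul,
    integral_add' (hp.integrable s a) (hq.integrable s a), hp.integral, hq.integral]
  change _ * (1 + 1) + (1 / t - t) * bhatta ν p q s a ≤ _
  have hb := bhatta_le_one hp hq s a
  have : 1 / t * bhatta ν p q s a ≤ 1 / t * 1 := mul_le_mul_of_nonneg_left hb (by positivity)
  have e2 : (t / 2 + 1 / (2 * t)) * (1 + 1) = t + 1 / t := by field_simp; ring
  have e3 : 2 / t = 2 * (1 / t) := by ring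
  rw [e2, e3]
  linarith

theorem sq_tvDist_le (hp : IsDensity ν p) (hq : IsDensity ν q) (s : S) (a : A) :
    tvDist ν p q s a ^ 2 ≤ 2 * (1 - bhatta ν p q s a) := by
  rcases (tvDist_nonneg (ν := ν) (p := p) (q := q) s a).eq_or_lt with h | h
  · rw [← h]
    have := bhatta_le_one hp hq s a
    nlinarith
  -- With this `t` the remainder 2/t is one copy of the distance and is absorbed on the left.
  · have := tvDist_le_of_pos hp hq s a (t := 2 / tvDist ν p q s a) (by positivity)
    rw [div_div_cancel₀ two_ne_zero, div_mul_eq_mul_div] at this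
    have h2 : tvDist ν p q s a ≤ 2 * (1 - bhatta ν p q s a) / tvDist ν p q s a := by linarith
    rw [le_div_iff₀ h] at h2
    nlinarith

end Kernel

end SafeRewardFree

/-! ### Value recursions, continuity in the policy, dynamic programming and expectations along an
episode. -/

noncomputable section

namespace SafeRewardFree

section PolicyCalculus

variable {S A : Type*} [MeasurableSpace S] [Fintype A]

/-- The average of `g` over the action played by `π` in state `s` at step `h`. -/
def MarkovPolicy.avg (π : MarkovPolicy S A) (h : ℕ) (s : S) (g : A → ℝ) : ℝ :=
  ∑ a, π.prob h s a * g a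

namespace MarkovPolicy

variable (π : MarkovPolicy S A) (h : ℕ) (s : S) {f g : A → ℝ}

theorem avg_mono (hfg : ∀ a, f a ≤ g a) : π.avg h s f ≤ π.avg h s g :=
  Finset.sum_le_sum fun a _ => mul_le_mul_of_nonneg_left (hfg a) (π.nonneg h s a)

theorem avg_const (c : ℝ) : π.avg h s (fun _ => c) = c := by
  simp [avg, ← Finset.sum_mul, π.sum_eq_one]

theorem avg_add : π.avg h s (fun a => f a + g a) = π.avg h s f + π.avg h s g := by
  simp [avg, mul_add, Finset.sum_add_distrib]

theorem avg_sub : π.avg h s (fun a => f a - g a) = π.avg h s f - π.avg h s g := by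
  simp [avg, mul_sub, Finset.sum_sub_distrib]

theorem avg_const_mul (c : ℝ) : π.avg h s (fun a => c * f a) = c * π.avg h s f := by
  simp only [avg, Finset.mul_sum]
  exact Finset.sum_congr rfl fun _ _ => by ring

theorem avg_le {c : ℝ} (hf : ∀ a, f a ≤ c) : π.avg h s f ≤ c :=
  (π.avg_mono h s hf).trans_eq (π.avg_const h s c)

theorem le_avg {c : ℝ} (hf : ∀ a, c ≤ f a) : c ≤ π.avg h s f :=
  (π.avg_const h s c).symm.trans_le (π.avg_mono h s hf)

theorem abs_avg_le : |π.avg h s f| ≤ π.avg h s (fun a => |f a|) :=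
  (Finset.abs_sum_le_sum_abs _ _).trans_eq <| Finset.sum_congr rfl fun a _ => by
    rw [abs_mul, abs_of_nonneg (π.nonneg h s a)]

theorem sq_avg_le : π.avg h s f ^ 2 ≤ π.avg h s (fun a => f a ^ 2) := by
  set m := π.avg h s f with hm
  have h0 : 0 ≤ π.avg h s (fun a => (f a - m) ^ 2) := π.le_avg h s fun _ => sq_nonneg _
  have h1 : (fun a => (f a - m) ^ 2) = fun a => (f a ^ 2 - (2 * m) * f a) + m ^ 2 := by
    ext; ring
  rw [h1, avg_add, avg_sub, avg_const_mul, avg_const, ← hm] at h0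
  nlinarith

theorem prob_bddMeas (a : A) : BddMeas fun s => π.prob h s a :=
  BddMeas.of_mem_Icc (a := 0) (b := 1) (π.measurable_prob h a) fun s => ⟨π.nonneg h s a,
    (Finset.single_le_sum (f := fun a => π.prob h s a) (fun a _ => π.nonneg h s a)
      (Finset.mem_univ a)).trans_eq (π.sum_eq_one h s)⟩

theorem prob_le_one (a : A) : π.prob h s a ≤ 1 :=
  (Finset.single_le_sum (f := fun a => π.prob h s a) (fun a _ => π.nonneg h s a)
      (Finset.mem_univ a)).trans_eq (π.sum_eq_one h s)

theorem avg_bddMeas {F : S → A → ℝ} (hF : ∀ a, BddMeas fun s => F s a) :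
    BddMeas fun s => π.avg h s (F s) :=
  BddMeas.sum _ fun a _ => (π.prob_bddMeas h a).mul (hF a)

end MarkovPolicy

/-- The value recursion in which `post` is applied to the state value in every step. -/
def bval (ν : Measure S) (post : ℝ → ℝ) (p : ℕ → S → A → S → ℝ) (u : ℕ → S → A → ℝ)
    (π : ℕ → S → A → ℝ) : ℕ → ℕ → S → ℝ
  | 0, _, _ => 0
  | k + 1, h, s => post (∑ a, π h s a * (u h s a + kint ν (p h) (bval ν post p u π k (h + 1)) s a))

theorem value_eq_bval (ν : Measure S) (p : ℕ → S → A → S → ℝ) (u : ℕ → S → A → ℝ)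
    (π : ℕ → S → A → ℝ) : value ν p u π = bval ν id p u π := by
  funext k
  induction k with
  | zero => rfl
  | succ k ih =>
    funext h s
    simp only [value, bval, kint, id, ih]

theorem truncValue_eq_bval (ν : Measure S) (p : ℕ → S → A → S → ℝ) (u : ℕ → S → A → ℝ)
    (π : ℕ → S → A → ℝ) : truncValue ν p u π = bval ν (min 1) p u π := by
  funext k
  induction k with
  | zero => rfl
  | succ k ih =>
    funext h s
    simp only [truncValue, bval, kint, ih]

theorem bval_congr {ν : Measure S} {post : ℝ → ℝ} {p q : ℕ → S → A → S → ℝ} {u v : ℕ → S → A → ℝ}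
    {π ρ : ℕ → S → A → ℝ} (k h : ℕ) (hp : ∀ j, h ≤ j → j < h + k → p j = q j)
    (hu : ∀ j, h ≤ j → j < h + k → u j = v j) (hπ : ∀ j, h ≤ j → j < h + k → π j = ρ j) :
    bval ν post p u π k h = bval ν post q v ρ k h := by
  induction k generalizing h with
  | zero => rfl
  | succ k ih =>
    ext s
    have := ih (h + 1) (fun j hj hj' => hp j (by omega) (by omega))
      (fun j hj hj' => hu j (by omega) (by omega)) (fun j hj hj' => hπ j (by omega) (by omega))
    simp only [bval, this, hp h le_rfl (by omega), hu h le_rfl (by omega), hπ h le_rfl (by omega)]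

theorem bval_succ (ν : Measure S) (post : ℝ → ℝ) (p : ℕ → S → A → S → ℝ) (u : ℕ → S → A → ℝ)
    (π : MarkovPolicy S A) (k h : ℕ) (s : S) : bval ν post p u π.prob (k + 1) h s =
      post (π.avg h s fun a => u h s a + kint ν (p h) (bval ν post p u π.prob k (h + 1)) s a) := rfl

section Bval

variable {ν : Measure S} [SigmaFinite ν] {post : ℝ → ℝ} {p : ℕ → S → A → S → ℝ} {u : ℕ → S → A → ℝ}

theorem bval_bddMeas (hpost : Continuous post) (hp : ∀ h, IsDensity ν (p h))
    (hu : ∀ h a, BddMeas fun s => u h s a) (π : MarkovPolicy S A) (k h : ℕ) :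
    BddMeas (bval ν post p u π.prob k h) := by
  induction k generalizing h with
  | zero => exact BddMeas.const 0
  | succ k ih =>
    exact (π.avg_bddMeas h fun a => (hu h a).add ((hp h).kint_bddMeas (ih (h + 1)) a)
      ).comp_of_continuous hpost

theorem exists_bval_bound (hpost : LipschitzWith 1 post) (hp : ∀ h, IsDensity ν (p h))
    (hu : ∀ h a, BddMeas fun s => u h s a) (k h : ℕ) :
    ∃ C, 0 ≤ C ∧ ∀ (π : MarkovPolicy S A) s, |bval ν post p u π.prob k h s| ≤ C := by
  induction k generalizing h with
  | zero => exact ⟨0, le_rfl, fun π s => by simp [bval]⟩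
  | succ k ih =>
    obtain ⟨C, hC0, hC⟩ := ih (h + 1)
    choose D hD using fun a => (hu h a).bdd
    refine ⟨|post 0| + (∑ a, |D a| + C), by positivity, fun π s => ?_⟩
    set x := π.avg h s fun a => u h s a + kint ν (p h) (bval ν post p u π.prob k (h + 1)) s a
    have hx : |x| ≤ ∑ a, |D a| + C := by
      refine (π.abs_avg_le h s).trans (π.avg_le h s fun a => (abs_add_le _ _).trans (add_le_add ?_ ?_))
      · refine ((hD a s).trans (le_abs_self _)).trans ?_
        exact Finset.single_le_sum (f := fun a => |D a|) (fun _ _ => abs_nonneg _) (Finset.mem_univ a)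
      · exact (hp h).abs_kint_le (bval_bddMeas hpost.continuous hp hu π k (h + 1)) (hC π) s a
    have h1 := hpost.dist_le_mul x 0
    rw [Real.dist_eq, Real.dist_eq, NNReal.coe_one, one_mul, sub_zero] at h1
    have h2 : |post x| ≤ |post x - post 0| + |post 0| := by
      simpa using abs_add_le (post x - post 0) (post 0)
    rw [bval_succ]
    linarith

/-- Continuity of a family of policies, uniformly in the state. -/
def UnifContPolicy {X : Type*} [TopologicalSpace X] (π : X → MarkovPolicy S A) : Prop :=
  ∀ h t₀, ∀ ε > 0, ∀ᶠ t in nhds t₀, ∀ s a, |(π t).prob h s a - (π t₀).prob h s a| ≤ ε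

/-- Uniformity in the state is what lets the induction pass under the transition integral. The
change splits into the change of the current action probabilities, times a bound that is uniform
over policies, and the change of the continuation. -/
theorem eventually_abs_bval_sub_le {X : Type*} [TopologicalSpace X] {π : X → MarkovPolicy S A}
    (hπ : UnifContPolicy π) (hpost : LipschitzWith 1 post) (hp : ∀ h, IsDensity ν (p h))
    (hu : ∀ h a, BddMeas fun s => u h s a) (k h : ℕ) (t₀ : X) {ε : ℝ} (hε : 0 < ε) :
    ∀ᶠ t in nhds t₀, ∀ s,
      |bval ν post p u (π t).prob k h s - bval ν post p u (π t₀).prob k h s| ≤ ε := by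
  induction k generalizing h ε with
  | zero => simp [bval, hε.le]
  | succ k ih =>
    obtain ⟨C, hC0, hC⟩ := exists_bval_bound hpost hp hu k (h + 1)
    choose D hD using fun a => (hu h a).bdd
    set E : ℝ := ∑ a, (|D a| + C) + 1 with hE
    have hE0 : 0 < E := by positivity
    filter_upwards [ih (h + 1) (half_pos hε), hπ h t₀ (ε / 2 / E) (by positivity)] with t h1 h2 s
    set V := bval ν post p u (π t).prob k (h + 1)
    set V₀ := bval ν post p u (π t₀).prob k (h + 1)
    have hV : BddMeas V := bval_bddMeas hpost.continuous hp hu (π t) k (h + 1)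
    have hV₀ : BddMeas V₀ := bval_bddMeas hpost.continuous hp hu (π t₀) k (h + 1)
    have hlip : ∀ x y, |post x - post y| ≤ |x - y| := fun x y => by
      simpa [Real.dist_eq] using hpost.dist_le_mul x y
    rw [bval_succ, bval_succ]
    refine (hlip _ _).trans ?_
    have e : ((π t).avg h s fun a => u h s a + kint ν (p h) V s a) -
        ((π t₀).avg h s fun a => u h s a + kint ν (p h) V₀ s a) =
        ∑ a, ((π t).prob h s a - (π t₀).prob h s a) * (u h s a + kint ν (p h) V s a) +
        (π t₀).avg h s fun a => kint ν (p h) V s a - kint ν (p h) V₀ s a := by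
      simp only [MarkovPolicy.avg]
      rw [← Finset.sum_sub_distrib, ← Finset.sum_add_distrib]
      exact Finset.sum_congr rfl fun a _ => by ring
    rw [e]
    have h3 : |∑ a, ((π t).prob h s a - (π t₀).prob h s a) * (u h s a + kint ν (p h) V s a)|
        ≤ ε / 2 := by
      refine (Finset.abs_sum_le_sum_abs _ _).trans ?_
      have : ∀ a ∈ Finset.univ, |((π t).prob h s a - (π t₀).prob h s a) *
          (u h s a + kint ν (p h) V s a)| ≤ (ε / 2 / E) * (|D a| + C) := fun a _ => by
        rw [abs_mul]
        refine mul_le_mul (h2 s a) ((abs_add_le _ _).trans (add_le_add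
          ((hD a s).trans (le_abs_self _)) ((hp h).abs_kint_le hV (hC (π t)) s a)))
          (abs_nonneg _) (by positivity)
      refine (Finset.sum_le_sum this).trans ?_
      rw [← Finset.mul_sum, div_mul_eq_mul_div, div_le_iff₀ hE0]
      exact mul_le_mul_of_nonneg_left (by linarith) (half_pos hε).le
    have h4 : |(π t₀).avg h s fun a => kint ν (p h) V s a - kint ν (p h) V₀ s a| ≤ ε / 2 :=
      ((π t₀).abs_avg_le h s).trans ((π t₀).avg_le h s fun a =>
        ((hp h).abs_kint_sub_le hV hV₀ s a).trans ((hp h).kint_le (hV.sub hV₀).abs h1 s a))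
    exact (abs_add_le _ _).trans (by linarith)

theorem continuous_bval {X : Type*} [TopologicalSpace X] {π : X → MarkovPolicy S A}
    (hπ : UnifContPolicy π) (hpost : LipschitzWith 1 post) (hp : ∀ h, IsDensity ν (p h))
    (hu : ∀ h a, BddMeas fun s => u h s a) (k h : ℕ) (s : S) :
    Continuous fun t => bval ν post p u (π t).prob k h s := by
  rw [continuous_iff_continuousAt]
  intro t₀
  rw [ContinuousAt, Metric.tendsto_nhds]
  intro ε hε
  filter_upwards [eventually_abs_bval_sub_le hπ hpost hp hu k h t₀ (half_pos hε)] with t ht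
  exact (ht s).trans_lt (half_lt_self hε)

/-- The policy that follows `π'` with probability `w h` and `π` otherwise, at each step `h`. -/
def MarkovPolicy.mix (w : ℕ → unitInterval) (π π' : MarkovPolicy S A) : MarkovPolicy S A where
  prob h s a := (1 - (w h : ℝ)) * π.prob h s a + w h * π'.prob h s a
  nonneg h s a := add_nonneg (mul_nonneg (sub_nonneg.mpr (w h).2.2) (π.nonneg h s a))
    (mul_nonneg (w h).2.1 (π'.nonneg h s a))
  sum_eq_one h s := by
    rw [Finset.sum_add_distrib, ← Finset.mul_sum, ← Finset.mul_sum, π.sum_eq_one, π'.sum_eq_one]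
    ring
  measurable_prob h a := ((π.measurable_prob h a).const_mul _).add
    ((π'.measurable_prob h a).const_mul _)

theorem MarkovPolicy.avg_mix (w : ℕ → unitInterval) (π π' : MarkovPolicy S A) (h : ℕ) (s : S)
    (g : A → ℝ) : (MarkovPolicy.mix w π π').avg h s g =
      (1 - (w h : ℝ)) * π.avg h s g + w h * π'.avg h s g := by
  simp only [avg, mix, Finset.mul_sum, ← Finset.sum_add_distrib]
  exact Finset.sum_congr rfl fun _ _ => by ring

theorem unifContPolicy_mix {X : Type*} [TopologicalSpace X] {w : X → ℕ → unitInterval}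
    (hw : ∀ h, Continuous fun t => w t h) (π π' : MarkovPolicy S A) :
    UnifContPolicy fun t => MarkovPolicy.mix (w t) π π' := by
  intro h t₀ ε hε
  have : ContinuousAt (fun t => ((w t h : unitInterval) : ℝ)) t₀ :=
    (continuous_subtype_val.comp (hw h)).continuousAt
  filter_upwards [(Metric.tendsto_nhds.mp this) ε hε] with t ht s a
  rw [Real.dist_eq] at ht
  have e : (MarkovPolicy.mix (w t) π π').prob h s a - (MarkovPolicy.mix (w t₀) π π').prob h s a =
      ((w t h : ℝ) - w t₀ h) * (π'.prob h s a - π.prob h s a) := by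
    simp only [MarkovPolicy.mix]; ring
  rw [e, abs_mul]
  have h1 : |π'.prob h s a - π.prob h s a| ≤ 1 := by
    have := π.nonneg h s a
    have := π'.nonneg h s a
    have := π.prob_le_one h s a
    have := π'.prob_le_one h s a
    exact abs_le.mpr ⟨by linarith, by linarith⟩
  calc _ ≤ |(w t h : ℝ) - w t₀ h| * 1 := mul_le_mul_of_nonneg_left h1 (abs_nonneg _)
    _ ≤ ε := by rw [mul_one]; exact ht.le

/-- The uniform distribution on the set of maximising actions is measurable in the state, so no
selection among ties is needed. -/
theorem exists_argmax_policy [Nonempty A] {Q : ℕ → S → A → ℝ}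
    (hQ : ∀ h a, Measurable fun s => Q h s a) :
    ∃ π : MarkovPolicy S A, ∀ h s b, Q h s b ≤ π.avg h s (Q h s) := by
  classical
  let I : ℕ → S → A → ℝ := fun h s a => if ∀ b, Q h s b ≤ Q h s a then 1 else 0
  have hI0 : ∀ h s a, 0 ≤ I h s a := fun h s a => by simp only [I]; split_ifs <;> norm_num
  have hpos : ∀ h s, 0 < ∑ a, I h s a := fun h s => by
    obtain ⟨a, ha⟩ := Finite.exists_max (Q h s)
    refine Finset.sum_pos' (fun a _ => hI0 h s a) ⟨a, Finset.mem_univ a, ?_⟩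
    simp [I, ha]
  have hIm : ∀ h a, Measurable fun s => I h s a := fun h a => by
    refine Measurable.ite ?_ measurable_const measurable_const
    simp only [Set.ofPred_forall]
    exact MeasurableSet.iInter fun b => measurableSet_le (hQ h b) (hQ h a)
  let π : MarkovPolicy S A :=
    { prob := fun h s a => I h s a / ∑ b, I h s b
      nonneg := fun h s a => div_nonneg (hI0 h s a) (hpos h s).le
      sum_eq_one := fun h s => by rw [← Finset.sum_div, div_self (hpos h s).ne']
      measurable_prob := fun h a => (hIm h a).div (Finset.measurable_sum _ fun b _ => hIm h b) }
  refine ⟨π, fun h s b => ?_⟩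
  refine (π.avg_const h s (Q h s b)).symm.trans_le (Finset.sum_le_sum fun a _ => ?_)
  by_cases h1 : ∀ b, Q h s b ≤ Q h s a
  · exact mul_le_mul_of_nonneg_left (h1 b) (π.nonneg h s a)
  · have : π.prob h s a = 0 := by simp [π, I, h1]
    simp [this]

/-- Dynamic programming: some policy is optimal in every state, at every step. -/
theorem exists_optimal_policy [Nonempty A] (hpost : Continuous post) (hmono : Monotone post)
    (hp : ∀ h, IsDensity ν (p h)) (hu : ∀ h a, BddMeas fun s => u h s a) (H : ℕ) :
    ∃ π : MarkovPolicy S A, ∀ (π' : MarkovPolicy S A) k h, k + h = H → ∀ s,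
      bval ν post p u π'.prob k h s ≤ bval ν post p u π.prob k h s := by
  -- The optimal value function, by Bellman recursion on the number of remaining steps.
  let O : ℕ → ℕ → S → ℝ := fun k => Nat.rec (motive := fun _ => ℕ → S → ℝ) (fun _ _ => 0)
    (fun _ V h s => post (Finset.univ.sup' Finset.univ_nonempty
      fun a => u h s a + kint ν (p h) (V (h + 1)) s a)) k
  have hO : ∀ k h s, O (k + 1) h s = post (Finset.univ.sup' Finset.univ_nonempty
      fun a => u h s a + kint ν (p h) (O k (h + 1)) s a) := fun _ _ _ => rfl
  have hB : ∀ k h, BddMeas (O k h) := by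
    intro k
    induction k with
    | zero => exact fun h => BddMeas.const 0
    | succ k ih =>
      intro h
      have hq : ∀ a, BddMeas fun s => u h s a + kint ν (p h) (O k (h + 1)) s a := fun a =>
        (hu h a).add ((hp h).kint_bddMeas (ih (h + 1)) a)
      refine BddMeas.comp_of_continuous ?_ hpost
      choose D hD using fun a => (hq a).bdd
      refine ⟨?_, ∑ a, |D a|, fun s => ?_⟩
      · have := Finset.measurable_sup' (f := fun a s => u h s a + kint ν (p h) (O k (h + 1)) s a)
          (Finset.univ_nonempty (α := A)) fun a _ => (hq a).meas
        have e : (fun s => Finset.univ.sup' Finset.univ_nonempty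
            fun a => u h s a + kint ν (p h) (O k (h + 1)) s a) = Finset.univ.sup'
            Finset.univ_nonempty fun a s => u h s a + kint ν (p h) (O k (h + 1)) s a := by
          ext s
          rw [Finset.sup'_apply]
        exact e ▸ this
      · obtain ⟨a, -, ha⟩ := Finset.exists_mem_eq_sup' (Finset.univ_nonempty (α := A))
          fun a => u h s a + kint ν (p h) (O k (h + 1)) s a
        rw [ha]
        exact ((hD a s).trans (le_abs_self _)).trans (Finset.single_le_sum (f := fun a => |D a|)
          (fun _ _ => abs_nonneg _) (Finset.mem_univ a))
  -- The step `h` determines the number `H - h - 1` of steps that remain after it, so one Markov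
  -- policy serves all `k` with `k + h = H`.
  obtain ⟨π, hπ⟩ := exists_argmax_policy
    (Q := fun h s a => u h s a + kint ν (p h) (O (H - h - 1) (h + 1)) s a)
    fun h a => ((hu h a).add ((hp h).kint_bddMeas (hB _ _) a)).meas
  have h1 : ∀ k h, k + h = H → ∀ s, O k h s ≤ bval ν post p u π.prob k h s := by
    intro k
    induction k with
    | zero => intros; exact le_rfl
    | succ k ih =>
      intro h hk s
      rw [hO, bval_succ]
      have hk' : H - h - 1 = k := by omega
      have hπ' := hπ h s
      rw [hk'] at hπ'
      exact hmono ((Finset.sup'_le _ _ fun b _ => hπ' b).trans (π.avg_mono h s fun a =>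
        add_le_add_right ((hp h).kint_mono (hB k (h + 1)) (bval_bddMeas hpost hp hu π k (h + 1))
          (ih (h + 1) (by omega)) s a) _))
  have h2 : ∀ (π' : MarkovPolicy S A) k h s, bval ν post p u π'.prob k h s ≤ O k h s := by
    intro π' k
    induction k with
    | zero => intros; exact le_rfl
    | succ k ih =>
      intro h s
      rw [hO, bval_succ]
      refine hmono (π'.avg_le h s fun a => ?_)
      refine le_trans (add_le_add_right ((hp h).kint_mono (bval_bddMeas hpost hp hu π' k (h + 1))
        (hB k (h + 1)) (ih (h + 1)) s a) _) ?_
      exact Finset.le_sup' (fun a => u h s a + kint ν (p h) (O k (h + 1)) s a) (Finset.mem_univ a)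
  exact ⟨π, fun π' k h hk s => (h2 π' k h s).trans (h1 k h hk s)⟩

/-- The expectation of `g` at the state-action pair reached after `k` steps from step `h`. -/
def occ (ν : Measure S) (p : ℕ → S → A → S → ℝ) (π : ℕ → S → A → ℝ) (g : S → A → ℝ) :
    ℕ → ℕ → S → ℝ
  | 0, h, s => ∑ a, π h s a * g s a
  | k + 1, h, s => ∑ a, π h s a * kint ν (p h) (occ ν p π g k (h + 1)) s a

variable {g g' : S → A → ℝ}

theorem occ_zero (π : MarkovPolicy S A) (g : S → A → ℝ) (h : ℕ) (s : S) :
    occ ν p π.prob g 0 h s = π.avg h s (g s) := rfl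

theorem occ_succ (π : MarkovPolicy S A) (g : S → A → ℝ) (k h : ℕ) (s : S) :
    occ ν p π.prob g (k + 1) h s =
      π.avg h s fun a => kint ν (p h) (occ ν p π.prob g k (h + 1)) s a := rfl

theorem occ_bddMeas (hp : ∀ h, IsDensity ν (p h)) (hg : ∀ a, BddMeas fun s => g s a)
    (π : MarkovPolicy S A) (k h : ℕ) : BddMeas (occ ν p π.prob g k h) := by
  induction k generalizing h with
  | zero => exact π.avg_bddMeas h hg
  | succ k ih => exact π.avg_bddMeas h fun a => (hp h).kint_bddMeas (ih (h + 1)) a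

theorem occ_mono (hp : ∀ h, IsDensity ν (p h)) (hg : ∀ a, BddMeas fun s => g s a)
    (hg' : ∀ a, BddMeas fun s => g' s a) (hgg : ∀ s a, g s a ≤ g' s a)
    (π : MarkovPolicy S A) (k h : ℕ) (s : S) :
    occ ν p π.prob g k h s ≤ occ ν p π.prob g' k h s := by
  induction k generalizing h s with
  | zero => exact π.avg_mono h s (hgg s)
  | succ k ih =>
    exact π.avg_mono h s fun a => (hp h).kint_mono (occ_bddMeas hp hg π k _)
      (occ_bddMeas hp hg' π k _) (ih (h + 1)) s a

theorem occ_const (hp : ∀ h, IsDensity ν (p h)) (c : ℝ) (π : MarkovPolicy S A) (k h : ℕ) (s : S) :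
    occ ν p π.prob (fun _ _ => c) k h s = c := by
  induction k generalizing h s with
  | zero => exact π.avg_const h s c
  | succ k ih =>
    have : occ ν p π.prob (fun _ _ => c) k (h + 1) = fun _ => c := by ext s; exact ih (h + 1) s
    rw [occ_succ, this]
    simp only [(hp h).kint_const, π.avg_const]

theorem occ_add (hp : ∀ h, IsDensity ν (p h)) (hg : ∀ a, BddMeas fun s => g s a)
    (hg' : ∀ a, BddMeas fun s => g' s a) (π : MarkovPolicy S A) (k h : ℕ) (s : S) :
    occ ν p π.prob (fun s a => g s a + g' s a) k h s =
      occ ν p π.prob g k h s + occ ν p π.prob g' k h s := by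
  induction k generalizing h s with
  | zero => exact π.avg_add h s
  | succ k ih =>
    have : occ ν p π.prob (fun s a => g s a + g' s a) k (h + 1) = fun s =>
      occ ν p π.prob g k (h + 1) s + occ ν p π.prob g' k (h + 1) s := by ext s; exact ih (h + 1) s
    simp only [occ_succ, this, (hp h).kint_add (occ_bddMeas hp hg π k _) (occ_bddMeas hp hg' π k _),
      π.avg_add]

theorem occ_const_mul (c : ℝ) (g : S → A → ℝ) (π : MarkovPolicy S A) (k h : ℕ) (s : S) :
    occ ν p π.prob (fun s a => c * g s a) k h s = c * occ ν p π.prob g k h s := by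
  induction k generalizing h s with
  | zero => exact π.avg_const_mul h s c
  | succ k ih =>
    have : occ ν p π.prob (fun s a => c * g s a) k (h + 1) = fun s =>
      c * occ ν p π.prob g k (h + 1) s := by ext s; exact ih (h + 1) s
    simp only [occ_succ, this, IsDensity.kint_const_mul, π.avg_const_mul]

theorem occ_sub (hp : ∀ h, IsDensity ν (p h)) (hg : ∀ a, BddMeas fun s => g s a)
    (hg' : ∀ a, BddMeas fun s => g' s a) (π : MarkovPolicy S A) (k h : ℕ) (s : S) :
    occ ν p π.prob (fun s a => g s a - g' s a) k h s =
      occ ν p π.prob g k h s - occ ν p π.prob g' k h s := by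
  have h1 : (fun s a => g s a - g' s a) = fun s a => g s a + (-1) * g' s a := by ext; ring
  rw [h1, occ_add hp hg fun a => (hg' a).const_mul _, occ_const_mul]
  ring

theorem occ_sum (hp : ∀ h, IsDensity ν (p h)) {ι : Type*} (t : Finset ι) {F : ι → S → A → ℝ}
    (hF : ∀ i ∈ t, ∀ a, BddMeas fun s => F i s a) (π : MarkovPolicy S A) (k h : ℕ) (s : S) :
    occ ν p π.prob (fun s a => ∑ i ∈ t, F i s a) k h s = ∑ i ∈ t, occ ν p π.prob (F i) k h s := by
  classical
  induction t using Finset.induction_on with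
  | empty => simpa using occ_const hp 0 π k h s
  | insert i t hi ih =>
    simp only [Finset.sum_insert hi]
    rw [occ_add hp (hF i (by simp)) fun a => BddMeas.sum t fun j hj => hF j (by simp [hj]) a,
      ih fun j hj => hF j (by simp [hj])]

theorem occ_nonneg (hp : ∀ h, IsDensity ν (p h)) (hg : ∀ a, BddMeas fun s => g s a)
    (h0 : ∀ s a, 0 ≤ g s a) (π : MarkovPolicy S A) (k h : ℕ) (s : S) :
    0 ≤ occ ν p π.prob g k h s :=
  (occ_const hp 0 π k h s).symm.trans_le (occ_mono hp (fun _ => BddMeas.const 0) hg h0 π k h s)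

theorem occ_le (hp : ∀ h, IsDensity ν (p h)) (hg : ∀ a, BddMeas fun s => g s a) {c : ℝ}
    (h0 : ∀ s a, g s a ≤ c) (π : MarkovPolicy S A) (k h : ℕ) (s : S) :
    occ ν p π.prob g k h s ≤ c :=
  (occ_mono hp hg (fun _ => BddMeas.const c) h0 π k h s).trans_eq (occ_const hp c π k h s)

/-- Jensen's inequality for the square. -/
theorem sq_occ_le (hp : ∀ h, IsDensity ν (p h)) (hg : ∀ a, BddMeas fun s => g s a)
    (π : MarkovPolicy S A) (k h : ℕ) (s : S) :
    occ ν p π.prob g k h s ^ 2 ≤ occ ν p π.prob (fun s a => g s a ^ 2) k h s := by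
  set m := occ ν p π.prob g k h s with hm
  have h0 : 0 ≤ occ ν p π.prob (fun s a => (g s a - m) ^ 2) k h s :=
    occ_nonneg hp (fun a => ((hg a).sub (BddMeas.const m)).pow 2) (fun _ _ => sq_nonneg _) π k h s
  have h1 : (fun s a => (g s a - m) ^ 2) = fun s a => (g s a ^ 2 - (2 * m) * g s a) + m ^ 2 := by
    ext; ring
  rw [h1, occ_add hp (fun a => ((hg a).pow 2).sub ((hg a).const_mul _)) fun _ => BddMeas.const _,
    occ_sub hp (fun a => (hg a).pow 2) fun a => (hg a).const_mul _, occ_const_mul, occ_const hp,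
    ← hm] at h0
  nlinarith

/-- The recursion of `occ` peels off the first step. Exposing the last transition instead lets its
low-rank structure be used and the final action be changed. -/
theorem occ_succ_right (π : ℕ → S → A → ℝ) (g : S → A → ℝ) (k h : ℕ) :
    occ ν p π g (k + 1) h = occ ν p π
      (fun s a => kint ν (p (h + k)) (fun s' => ∑ a', π (h + k + 1) s' a' * g s' a') s a) k h := by
  induction k generalizing h with
  | zero => rfl
  | succ k ih =>
    have := ih (h + 1)
    ext s
    rw [occ, this, occ]
    simp only [show h + 1 + k = h + (k + 1) by ring]

/-- Change of policy: if `π` is dominated by `ρ` step by step then so are expectations. -/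
theorem occ_le_prod_mul (hp : ∀ h, IsDensity ν (p h)) (hg : ∀ a, BddMeas fun s => g s a)
    (h0 : ∀ s a, 0 ≤ g s a) (π ρ : MarkovPolicy S A) {K : ℕ → ℝ} (hK : ∀ j, 0 ≤ K j) (k h : ℕ)
    (hπ : ∀ j, h ≤ j → j ≤ h + k → ∀ s a, π.prob j s a ≤ K j * ρ.prob j s a) (s : S) :
    occ ν p π.prob g k h s ≤ (∏ j ∈ Finset.range (k + 1), K (h + j)) * occ ν p ρ.prob g k h s := by
  induction k generalizing h s with
  | zero =>
    rw [zero_add, Finset.prod_range_one, add_zero, occ, occ, Finset.mul_sum]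
    simp only [← mul_assoc]
    exact Finset.sum_le_sum fun a _ => mul_le_mul_of_nonneg_right (hπ h le_rfl le_rfl s a) (h0 s a)
  | succ k ih =>
    set C := ∏ j ∈ Finset.range (k + 1), K (h + 1 + j) with hC
    have e : ∏ j ∈ Finset.range (k + 1 + 1), K (h + j) = K h * C := by
      rw [Finset.prod_range_succ', mul_comm, add_zero, hC]
      exact congrArg _ (Finset.prod_congr rfl fun j _ => congrArg K (by ring))
    have hV := occ_bddMeas hp hg π k (h + 1)
    have hW := occ_bddMeas hp hg ρ k (h + 1)
    have h1 : ∀ a, kint ν (p h) (occ ν p π.prob g k (h + 1)) s a ≤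
        C * kint ν (p h) (occ ν p ρ.prob g k (h + 1)) s a := fun a => by
      rw [← IsDensity.kint_const_mul]
      exact (hp h).kint_mono hV (hW.const_mul C)
        (ih (h + 1) fun j hj hj' => hπ j (by omega) (by omega)) s a
    have h2 : ∀ a, 0 ≤ kint ν (p h) (occ ν p π.prob g k (h + 1)) s a := fun a =>
      (hp h).le_kint hV (occ_nonneg hp hg h0 π k (h + 1)) s a
    rw [e]
    simp only [occ, Finset.mul_sum]
    refine Finset.sum_le_sum fun a _ => ?_
    calc _ ≤ (K h * ρ.prob h s a) * (C * kint ν (p h) (occ ν p ρ.prob g k (h + 1)) s a) :=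
          mul_le_mul (hπ h le_rfl (by omega) s a) (h1 a) (h2 a)
            (mul_nonneg (hK h) (ρ.nonneg h s a))
      _ = _ := by ring

/-- The value is the sum of the expected utilities of the steps. -/
theorem bval_id_eq_sum_occ (hp : ∀ h, IsDensity ν (p h)) (hu : ∀ h a, BddMeas fun s => u h s a)
    (π : MarkovPolicy S A) (k h : ℕ) (s : S) :
    bval ν id p u π.prob k h s = ∑ j ∈ Finset.range k, occ ν p π.prob (u (h + j)) j h s := by
  induction k generalizing h s with
  | zero => rfl
  | succ k ih =>
    have h1 : bval ν id p u π.prob k (h + 1) = fun s =>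
        ∑ j ∈ Finset.range k, occ ν p π.prob (u (h + 1 + j)) j (h + 1) s := by
      ext s; exact ih (h + 1) s
    have h2 : ∀ a, kint ν (p h) (bval ν id p u π.prob k (h + 1)) s a =
        ∑ j ∈ Finset.range k, kint ν (p h) (occ ν p π.prob (u (h + 1 + j)) j (h + 1)) s a := by
      intro a
      rw [h1]
      simp only [kint, Finset.mul_sum]
      exact integral_finsetSum _ fun j _ => (hp h).integrable_mul (occ_bddMeas hp (hu _) π _ _) s a
    rw [bval_succ, Finset.sum_range_succ']
    simp only [h2, id, occ_zero, add_zero, occ_succ, π.avg_add]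
    rw [add_comm]
    congr 1
    simp only [MarkovPolicy.avg, Finset.mul_sum]
    rw [Finset.sum_comm]
    simp only [show ∀ j, h + 1 + j = h + (j + 1) by intro j; ring]

end Bval

end PolicyCalculus

end SafeRewardFree

/-! ### Utilities, truncated Lagrangian values and paths of policies. -/

noncomputable section

namespace SafeRewardFree

section Planning

variable {S A : Type*} [MeasurableSpace S] [Fintype A] {ν : Measure S} [SigmaFinite ν]
  {p q : ℕ → S → A → S → ℝ} {b c r : ℕ → S → A → ℝ} {H : ℕ} {s₀ : S}

/-- Utilities indexed by all natural numbers, with total at most `1` over the first `H` steps of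
each trajectory from `s₀`. -/
structure IsUtil (H : ℕ) (s₀ : S) (u : ℕ → S → A → ℝ) : Prop where
  measurable : ∀ h a, Measurable fun s => u h s a
  mem_Icc : ∀ h s a, u h s a ∈ Set.Icc (0 : ℝ) 1
  sum_le_one : ∀ (s : ℕ → S) (a : ℕ → A), s 0 = s₀ → ∑ h ∈ Finset.range H, u h (s h) (a h) ≤ 1

theorem IsUtil.bddMeas {u : ℕ → S → A → ℝ} (hu : IsUtil H s₀ u) (h : ℕ) (a : A) :
    BddMeas fun s => u h s a := BddMeas.of_mem_Icc (hu.measurable h a) fun s => hu.mem_Icc h s a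

theorem bval_id_nonneg {u : ℕ → S → A → ℝ} (hp : ∀ h, IsDensity ν (p h))
    (hu : ∀ h a, BddMeas fun s => u h s a) (h0 : ∀ h s a, 0 ≤ u h s a) (π : MarkovPolicy S A)
    (k h : ℕ) (s : S) : 0 ≤ bval ν id p u π.prob k h s := by
  induction k generalizing h s with
  | zero => exact le_rfl
  | succ k ih =>
    exact π.le_avg h s fun a => add_nonneg (h0 h s a) ((hp h).le_kint
      (bval_bddMeas continuous_id hp hu π k (h + 1)) (ih (h + 1)) s a)

namespace IsUtil

variable {u : ℕ → S → A → ℝ}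

theorem bval_nonneg (hu : IsUtil H s₀ u) (hp : ∀ h, IsDensity ν (p h)) (π : MarkovPolicy S A)
    (k h : ℕ) (s : S) : 0 ≤ bval ν id p u π.prob k h s :=
  bval_id_nonneg hp hu.bddMeas (fun h s a => (hu.mem_Icc h s a).1) π k h s

/-- Averaging the pathwise constraint over the future one step at a time: the utility collected on a
fixed prefix plus the value to go is at most one. The prefix is arbitrary, so no reachability
enters. -/
theorem sum_add_bval_le (hu : IsUtil H s₀ u) (hp : ∀ h, IsDensity ν (p h)) (π : MarkovPolicy S A)
    (k h : ℕ) (hk : k + h = H) (σ : ℕ → S) (α : ℕ → A) (hσ : σ 0 = s₀) :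
    ∑ j ∈ Finset.range h, u j (σ j) (α j) + bval ν id p u π.prob k h (σ h) ≤ 1 := by
  induction k generalizing h σ α with
  | zero =>
    obtain rfl : h = H := by omega
    simpa [bval] using hu.sum_le_one σ α hσ
  | succ k ih =>
    rw [bval_succ, ← le_sub_iff_add_le']
    refine π.avg_le h (σ h) fun a => ?_
    rw [← le_sub_iff_add_le']
    refine (hp h).kint_le (bval_bddMeas continuous_id hp hu.bddMeas π k (h + 1)) (fun s' => ?_) _ a
    have := ih (h + 1) (by omega) (Function.update σ (h + 1) s') (Function.update α h a)
      (by simpa using hσ)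
    rw [Finset.sum_range_succ, Function.update_self, Function.update_of_ne (by omega),
      Function.update_self] at this
    have e : ∑ j ∈ Finset.range h, u j (Function.update σ (h + 1) s' j) (Function.update α h a j) =
        ∑ j ∈ Finset.range h, u j (σ j) (α j) := Finset.sum_congr rfl fun j hj => by
      have := Finset.mem_range.mp hj
      rw [Function.update_of_ne (by omega), Function.update_of_ne (by omega)]
    rw [e] at this
    linarith

theorem add_kint_bval_le_one (hu : IsUtil H s₀ u) (hp : ∀ h, IsDensity ν (p h))
    (π : MarkovPolicy S A) (k h : ℕ) (hk : k + 1 + h = H) (s : S) (hs : h = 0 → s = s₀) (a : A) :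
    u h s a + kint ν (p h) (bval ν id p u π.prob k (h + 1)) s a ≤ 1 := by
  rw [← le_sub_iff_add_le']
  refine (hp h).kint_le (bval_bddMeas continuous_id hp hu.bddMeas π k (h + 1)) (fun s' => ?_) _ a
  -- For `h > 0` every state lies on some trajectory from `s₀`; only at `h = 0` must the state be
  -- `s₀` itself.
  let σ : ℕ → S := fun j => if j = h + 1 then s' else if j = h then s else s₀
  have h0 : σ 0 = s₀ := by
    by_cases hh : h = 0
    · simp [σ, hh, hs hh]
    · simp [σ, Ne.symm hh]
  have := hu.sum_add_bval_le hp π k (h + 1) (by omega) σ (fun _ => a) h0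
  rw [Finset.sum_range_succ] at this
  have h1 : σ (h + 1) = s' := by simp [σ]
  have h2 : σ h = s := by simp [σ]
  have h3 : 0 ≤ ∑ j ∈ Finset.range h, u j (σ j) a :=
    Finset.sum_nonneg fun j _ => (hu.mem_Icc j _ _).1
  rw [h1, h2] at this
  linarith

theorem bval_le_one (hu : IsUtil H s₀ u) (hp : ∀ h, IsDensity ν (p h)) (π : MarkovPolicy S A)
    (k h : ℕ) (hk : k + h = H) (s : S) (hs : h = 0 → s = s₀) :
    bval ν id p u π.prob k h s ≤ 1 := by
  cases k with
  | zero => simp [bval]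
  | succ k => exact π.avg_le h s fun a => hu.add_kint_bval_le_one hp π k h hk s hs a

/-- A cap of at least `1` has no effect on the value of a utility. -/
theorem bval_min_eq (hu : IsUtil H s₀ u) (hp : ∀ h, IsDensity ν (p h)) {K : ℝ} (hK : 1 ≤ K)
    (π : MarkovPolicy S A) (k h : ℕ) (hk : k + h = H) (s : S) (hs : h = 0 → s = s₀) :
    bval ν (min K) p u π.prob k h s = bval ν id p u π.prob k h s := by
  induction k generalizing h s with
  | zero => rfl
  | succ k ih =>
    have e : bval ν (min K) p u π.prob k (h + 1) = bval ν id p u π.prob k (h + 1) := by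
      ext s'
      exact ih (h + 1) (by omega) s' (by omega)
    have h1 := hu.bval_le_one hp π (k + 1) h hk s hs
    rw [bval_succ] at h1
    rw [bval_succ, bval_succ, e]
    exact min_eq_right (h1.trans hK)

end IsUtil

theorem lipschitzWith_min (K : ℝ) : LipschitzWith 1 (fun x : ℝ => min K x) :=
  LipschitzWith.of_dist_le_mul fun x y => by
    rw [Real.dist_eq, Real.dist_eq, NNReal.coe_one, one_mul]
    simpa using abs_min_sub_min_le_max K x K y

theorem monotone_min (K : ℝ) : Monotone (fun x : ℝ => min K x) := fun _ _ h => min_le_min le_rfl h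

/-- The truncated value of the Lagrangian utility `θ b - c`, with cap `θ K`. -/
def lagVal (ν : Measure S) (p : ℕ → S → A → S → ℝ) (b c : ℕ → S → A → ℝ) (K θ : ℝ) :
    (ℕ → S → A → ℝ) → ℕ → ℕ → S → ℝ :=
  bval ν (min (θ * K)) p fun h s a => θ * b h s a - c h s a

section Lagrangian

variable (hp : ∀ h, IsDensity ν (p h)) (hb : ∀ h a, BddMeas fun s => b h s a)
  (hb1 : ∀ h s a, b h s a ∈ Set.Icc (0 : ℝ) 1) {K : ℝ}

include hp hb

theorem lagVal_bddMeas (hc : IsUtil H s₀ c) (θ : ℝ) (π : MarkovPolicy S A) (k h : ℕ) :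
    BddMeas (lagVal ν p b c K θ π.prob k h) :=
  bval_bddMeas (lipschitzWith_min _).continuous hp
    (fun h a => ((hb h a).const_mul θ).sub (hc.bddMeas h a)) π k h

/-- Lower half of a sandwich: subtracting a nonnegative cost keeps the truncated value below the cap
θK. The Lagrangian value, unlike its two ingredients separately, can be optimised by dynamic
programming. -/
theorem le_lagVal (hc : IsUtil H s₀ c) {θ : ℝ} (hθ : 0 ≤ θ) (π : MarkovPolicy S A) (k h : ℕ)
    (s : S) : θ * bval ν (min K) p b π.prob k h s - bval ν id p c π.prob k h s ≤
      lagVal ν p b c K θ π.prob k h s := by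
  induction k generalizing h s with
  | zero => simp [bval, lagVal]
  | succ k ih =>
    have hB := bval_bddMeas (lipschitzWith_min K).continuous hp hb π k (h + 1)
    have hV := bval_bddMeas continuous_id hp hc.bddMeas π k (h + 1)
    have hG := lagVal_bddMeas (K := K) hp hb hc θ π k (h + 1)
    set x := π.avg h s fun a => b h s a + kint ν (p h) (bval ν (min K) p b π.prob k (h + 1)) s a
    have hx : θ * x - bval ν id p c π.prob (k + 1) h s ≤ π.avg h s fun a =>
        (θ * b h s a - c h s a) + kint ν (p h) (lagVal ν p b c K θ π.prob k (h + 1)) s a := by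
      rw [bval_succ, id, ← π.avg_const_mul, ← π.avg_sub]
      refine π.avg_mono h s fun a => ?_
      have := (hp h).kint_mono ((hB.const_mul θ).sub hV) hG (ih (h + 1)) s a
      rw [(hp h).kint_sub (hB.const_mul θ) hV, IsDensity.kint_const_mul] at this
      linarith
    have h0 := hc.bval_nonneg hp π (k + 1) h s
    refine le_min ?_ (le_trans (sub_le_sub_right (mul_le_mul_of_nonneg_left (min_le_right K x) hθ) _) hx)
    have := mul_le_mul_of_nonneg_left (min_le_left K x) hθ
    change θ * min K x - _ ≤ θ * K
    linarith

theorem lagVal_zero_le (hc : IsUtil H s₀ c) (π : MarkovPolicy S A) (k h : ℕ) (s : S) :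
    lagVal ν p b c K 0 π.prob k h s ≤ - bval ν id p c π.prob k h s := by
  induction k generalizing h s with
  | zero => simp [bval, lagVal]
  | succ k ih =>
    have hV := bval_bddMeas continuous_id hp hc.bddMeas π k (h + 1)
    refine (min_le_right _ _).trans ?_
    rw [bval_succ, id, neg_eq_neg_one_mul, ← π.avg_const_mul]
    refine π.avg_mono h s fun a => ?_
    have := (hp h).kint_mono (lagVal_bddMeas (K := K) hp hb hc 0 π k (h + 1)) (hV.const_mul (-1))
      (fun s => (ih (h + 1) s).trans_eq (by ring)) s a
    rw [IsDensity.kint_const_mul] at this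
    change 0 * _ - _ + kint ν (p h) (lagVal ν p b c K 0 π.prob k (h + 1)) s a ≤ _
    linarith

include hb1

theorem bval_min_nonneg (hK : 0 ≤ K) (π : MarkovPolicy S A) (k h : ℕ) (s : S) :
    0 ≤ bval ν (min K) p b π.prob k h s := by
  induction k generalizing h s with
  | zero => exact le_rfl
  | succ k ih =>
    refine le_min hK (π.le_avg h s fun a => add_nonneg (hb1 h s a).1 ?_)
    exact (hp h).le_kint (bval_bddMeas (lipschitzWith_min K).continuous hp hb π k (h + 1))
      (ih (h + 1)) s a

/-- Upper half of the sandwich. Where the cap is active the bonus value equals `K`, and the extra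
multiplier 1/K then contributes one unit, enough to cover the cost, which is at most one. -/
theorem lagVal_le (hc : IsUtil H s₀ c) (hK : 0 < K) {θ : ℝ} (hθ : 0 ≤ θ) (π : MarkovPolicy S A)
    (k h : ℕ) (hk : k + h = H) (s : S) (hs : h = 0 → s = s₀) :
    lagVal ν p b c K θ π.prob k h s ≤
      (θ + 1 / K) * bval ν (min K) p b π.prob k h s - bval ν id p c π.prob k h s := by
  induction k generalizing h s with
  | zero => simp [bval, lagVal]
  | succ k ih =>
    have hB := bval_bddMeas (lipschitzWith_min K).continuous hp hb π k (h + 1)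
    have hV := bval_bddMeas continuous_id hp hc.bddMeas π k (h + 1)
    have hG := lagVal_bddMeas (K := K) hp hb hc θ π k (h + 1)
    have hK' : 0 < 1 / K := by positivity
    set x := π.avg h s fun a => b h s a + kint ν (p h) (bval ν (min K) p b π.prob k (h + 1)) s a
      with hxdef
    have hBs : bval ν (min K) p b π.prob (k + 1) h s = min K x := rfl
    rw [hBs]
    rcases le_total K x with hx | hx
    · rw [min_eq_left hx]
      have := hc.bval_le_one hp π (k + 1) h hk s hs
      have e : (θ + 1 / K) * K = θ * K + 1 := by field_simp
      exact (min_le_left _ _).trans (by linarith)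
    · rw [min_eq_right hx]
      refine (min_le_right _ _).trans ?_
      rw [bval_succ, id, hxdef, ← π.avg_const_mul, ← π.avg_sub]
      refine π.avg_mono h s fun a => ?_
      have := (hp h).kint_mono hG ((hB.const_mul (θ + 1 / K)).sub hV)
        (fun s => ih (h + 1) (by omega) s (by omega)) s a
      rw [(hp h).kint_sub (hB.const_mul _) hV, IsDensity.kint_const_mul] at this
      have h2 := mul_nonneg hK'.le (hb1 h s a).1
      change θ * _ - _ + kint ν (p h) (lagVal ν p b c K θ π.prob k (h + 1)) s a ≤ _
      linarith

theorem abs_lagVal_sub_le (hc : IsUtil H s₀ c) (hK : 0 ≤ K) (θ θ' : ℝ) (π : MarkovPolicy S A)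
    (k h : ℕ) (s : S) :
    |lagVal ν p b c K θ π.prob k h s - lagVal ν p b c K θ' π.prob k h s| ≤ |θ - θ'| * (K + k) := by
  induction k generalizing h s with
  | zero =>
    simp only [bval, lagVal, sub_self, abs_zero]
    positivity
  | succ k ih =>
    have hG := lagVal_bddMeas (K := K) hp hb hc θ π k (h + 1)
    have hG' := lagVal_bddMeas (K := K) hp hb hc θ' π k (h + 1)
    refine (abs_min_sub_min_le_max _ _ _ _).trans (max_le ?_ ?_)
    · rw [← sub_mul, abs_mul, abs_of_nonneg hK]
      exact mul_le_mul_of_nonneg_left (by simp only [le_add_iff_nonneg_right]; positivity)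
        (abs_nonneg _)
    · change |π.avg h s (fun a => (θ * b h s a - c h s a) +
          kint ν (p h) (lagVal ν p b c K θ π.prob k (h + 1)) s a) -
        π.avg h s (fun a => (θ' * b h s a - c h s a) +
          kint ν (p h) (lagVal ν p b c K θ' π.prob k (h + 1)) s a)| ≤ _
      rw [← π.avg_sub]
      refine (π.abs_avg_le h s).trans (π.avg_le h s fun a => ?_)
      have h1 := (hp h).abs_kint_sub_le hG hG' s a
      have h2 := (hp h).kint_le (hG.sub hG').abs (ih (h + 1)) s a
      have h3 : |(θ - θ') * b h s a| ≤ |θ - θ'| := by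
        rw [abs_mul, abs_of_nonneg (hb1 h s a).1]
        exact mul_le_of_le_one_right (abs_nonneg _) (hb1 h s a).2
      have h4 : θ * b h s a - c h s a + kint ν (p h) (lagVal ν p b c K θ π.prob k (h + 1)) s a -
          (θ' * b h s a - c h s a + kint ν (p h) (lagVal ν p b c K θ' π.prob k (h + 1)) s a) =
          (θ - θ') * b h s a + (kint ν (p h) (lagVal ν p b c K θ π.prob k (h + 1)) s a -
            kint ν (p h) (lagVal ν p b c K θ' π.prob k (h + 1)) s a) := by ring
      rw [h4]
      refine (abs_add_le _ _).trans ?_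
      push_cast
      linarith

/-- A statewise mixture of two nearly optimal policies is nearly optimal. -/
theorem lagVal_mix_ge (hc : IsUtil H s₀ c) {θ e : ℝ} (he : 0 ≤ e)
    (π π' : MarkovPolicy S A)
    (hopt : ∀ (ρ : MarkovPolicy S A) k h, k + h = H → ∀ s,
      lagVal ν p b c K θ ρ.prob k h s ≤ lagVal ν p b c K θ π'.prob k h s)
    (hnear : ∀ k h, k + h = H → ∀ s,
      lagVal ν p b c K θ π'.prob k h s - e ≤ lagVal ν p b c K θ π.prob k h s)
    (w : ℕ → unitInterval) (k h : ℕ) (hk : k + h = H) (s : S) :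
    lagVal ν p b c K θ π'.prob k h s - e * k ≤
      lagVal ν p b c K θ (MarkovPolicy.mix w π π').prob k h s := by
  induction k generalizing h s with
  | zero => simp [bval, lagVal]
  | succ k ih =>
    set ρ := MarkovPolicy.mix w π π'
    have hG := fun ρ : MarkovPolicy S A => lagVal_bddMeas (K := K) hp hb hc θ ρ k (h + 1)
    set Q : MarkovPolicy S A → A → ℝ := fun ρ a =>
      (θ * b h s a - c h s a) + kint ν (p h) (lagVal ν p b c K θ ρ.prob k (h + 1)) s a with hQ
    have hL : ∀ ρ : MarkovPolicy S A, lagVal ν p b c K θ ρ.prob (k + 1) h s =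
      min (θ * K) (ρ.avg h s (Q ρ)) := fun ρ => rfl
    have h1 : ∀ a, Q π a ≤ Q π' a := fun a => add_le_add_right
      ((hp h).kint_mono (hG π) (hG π') (hopt π k (h + 1) (by omega)) s a) _
    have h2 : ∀ a, Q π' a - e * k ≤ Q ρ a := fun a => by
      have := (hp h).kint_mono ((hG π').sub (BddMeas.const (e * k))) (hG ρ)
        (ih (h + 1) (by omega)) s a
      rw [(hp h).kint_sub (hG π') (BddMeas.const _), (hp h).kint_const] at this
      simp only [hQ]
      linarith
    -- Optimality of `π'` gives `Q π ≤ Q π'`, so near-optimality of `π` survives when its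
    -- continuation is replaced by that of `π'`. For this common continuation both policies choose
    -- actions within `e` of the optimum, hence so does any mixture of them; the errors add up over
    -- the steps.
    have h3 : lagVal ν p b c K θ π'.prob (k + 1) h s - e ≤ min (θ * K) (π.avg h s (Q π')) :=
      (hnear (k + 1) h hk s).trans (min_le_min le_rfl (π.avg_mono h s h1))
    have h4 : ρ.avg h s (Q π') - e * k ≤ ρ.avg h s (Q ρ) := by
      rw [← ρ.avg_const h s (e * k), ← ρ.avg_sub]
      exact ρ.avg_mono h s h2
    have h5 : ρ.avg h s (Q π') = (1 - (w h : ℝ)) * π.avg h s (Q π') + w h * π'.avg h s (Q π') :=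
      MarkovPolicy.avg_mix w π π' h s _
    have hw0 := (w h).2.1
    have hw1 := (w h).2.2
    have hek : 0 ≤ e * k := by positivity
    have h6 := hL π'
    set g := lagVal ν p b c K θ π'.prob (k + 1) h s
    have h7 : g - e ≤ π'.avg h s (Q π') := (by linarith : g - e ≤ g).trans
      (h6.trans_le (min_le_right _ _))
    have h8 : g - e ≤ π.avg h s (Q π') := h3.trans (min_le_right _ _)
    have h9 : g ≤ θ * K := h6.trans_le (min_le_left _ _)
    have h10 : g - e ≤ ρ.avg h s (Q π') := by
      rw [h5]
      nlinarith
    rw [hL]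
    push_cast
    exact le_min (by nlinarith) (by linarith)

/-- Along the Lagrangian trade-off between a reward and a cost, either the policy that (nearly)
ignores the cost is good, or there is a path of nearly optimal policies along which a good policy
turns bad. -/
theorem exists_lagrangian_path [Nonempty A] (hc : IsUtil H s₀ c) (hK : 0 < K)
    (good : MarkovPolicy S A → Prop)
    (hgood : ∀ π : MarkovPolicy S A, (∀ (π' : MarkovPolicy S A) k h, k + h = H → ∀ s,
      bval ν id p c π.prob k h s ≤ bval ν id p c π'.prob k h s) → good π)
    {Θ η : ℝ} (hΘ : 0 < Θ) (hη : 0 < η) :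
    (∃ π, good π ∧ ∀ π' : MarkovPolicy S A,
      Θ * bval ν (min K) p b π'.prob H 0 s₀ - bval ν id p c π'.prob H 0 s₀ ≤
        (Θ + 1 / K) * bval ν (min K) p b π.prob H 0 s₀ - bval ν id p c π.prob H 0 s₀) ∨
    ∃ θ, 0 < θ ∧ θ ≤ Θ ∧ ∃ π : unitInterval → MarkovPolicy S A, UnifContPolicy π ∧ good (π 0) ∧
      ¬ good (π 1) ∧ ∀ t, ∀ π' : MarkovPolicy S A,
      θ * bval ν (min K) p b π'.prob H 0 s₀ - bval ν id p c π'.prob H 0 s₀ - η ≤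
        (θ + 1 / K) * bval ν (min K) p b (π t).prob H 0 s₀ - bval ν id p c (π t).prob H 0 s₀ := by
  classical
  -- The multipliers run through a grid of mesh Θ/m. By the Lipschitz bound in θ, optimisers for
  -- neighbours are within 2(Θ/m)(K + H) of optimal for one another at every state, and mixing
  -- multiplies this by at most H.
  obtain ⟨m, hm0, hm⟩ : ∃ m : ℕ, 0 < m ∧ 2 * (Θ / m) * (K + H) * H ≤ η := by
    obtain ⟨m, hm⟩ := exists_nat_gt (2 * Θ * (K + H) * H / η)
    have hm' : 0 < (m : ℝ) := lt_of_le_of_lt (by positivity) hm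
    refine ⟨m, by exact_mod_cast hm', ?_⟩
    rw [div_lt_iff₀ hη] at hm
    rw [show 2 * (Θ / m) * (K + H) * H = 2 * Θ * (K + H) * H / m by ring, div_le_iff₀ hm']
    linarith
  have hm' : 0 < (m : ℝ) := by exact_mod_cast hm0
  have hopt : ∀ j : ℕ, ∃ π : MarkovPolicy S A, ∀ (π' : MarkovPolicy S A) k h, k + h = H → ∀ s,
      lagVal ν p b c K (j * (Θ / m)) π'.prob k h s ≤ lagVal ν p b c K (j * (Θ / m)) π.prob k h s :=
    fun j => exists_optimal_policy (lipschitzWith_min _).continuous (monotone_min _) hp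
      (fun h a => ((hb h a).const_mul _).sub (hc.bddMeas h a)) H
  choose P hP using hopt
  -- At θ = 0 the Lagrangian value lies between -C and -C, where C is the cost, so its optimiser has
  -- minimal cost in every state.
  have hP0 : good (P 0) := hgood _ fun π' k h hk s => by
    have h1 := hP 0 π' k h hk s
    have h2 := le_lagVal (K := K) hp hb hc le_rfl π' k h s
    have h3 := lagVal_zero_le (K := K) hp hb hc (P 0) k h s
    simp only [Nat.cast_zero, zero_mul] at h1 h2
    linarith
  have hend : (m : ℝ) * (Θ / m) = Θ := by field_simp
  by_cases hall : ∀ j ≤ m, good (P j)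
  · left
    refine ⟨P m, hall m le_rfl, fun π' => ?_⟩
    have h1 := hP m π' H 0 rfl s₀
    rw [hend] at h1
    exact (le_lagVal hp hb hc hΘ.le π' H 0 s₀).trans (h1.trans
      (lagVal_le hp hb hb1 hc hK hΘ.le (P m) H 0 rfl s₀ fun _ => rfl))
  · right
    push Not at hall
    have hex : ∃ j, ¬ good (P j) := hall.imp fun j h => h.2
    -- The first bad optimiser and its good predecessor on the grid are the ends of the path.
    set j := Nat.find hex
    have hj : ¬ good (P j) := Nat.find_spec hex
    have hjm : j ≤ m := by
      obtain ⟨i, hi, hi'⟩ := hall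
      exact (Nat.find_min' hex hi').trans hi
    have hj0 : j ≠ 0 := fun h => hj (h ▸ hP0)
    obtain ⟨i, hi⟩ := Nat.exists_eq_succ_of_ne_zero hj0
    have hi' : good (P i) := not_not.mp (Nat.find_min hex (show i < j by omega))
    have hj' : 0 < (j : ℝ) := by exact_mod_cast Nat.pos_of_ne_zero hj0
    have hstep : 0 < Θ / m := by positivity
    set θ := (j : ℝ) * (Θ / m) with hθ
    set θ' := (i : ℝ) * (Θ / m) with hθ'
    have hdiff : |θ - θ'| = Θ / m := by
      have : (j : ℝ) = i + 1 := by rw [hi]; push_cast; ring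
      rw [hθ, hθ', this, show (i + 1 : ℝ) * (Θ / m) - i * (Θ / m) = Θ / m by ring,
        abs_of_pos hstep]
    have hθ0 : 0 < θ := by positivity
    refine ⟨θ, hθ0, ?_, fun t => MarkovPolicy.mix (fun _ => t) (P i) (P j), ?_, ?_, ?_, ?_⟩
    · rw [← hend]
      exact mul_le_mul_of_nonneg_right (by exact_mod_cast hjm) hstep.le
    · exact unifContPolicy_mix (fun _ => continuous_id) _ _
    · convert hi'
      simp [MarkovPolicy.mix]
    · convert hj
      simp [MarkovPolicy.mix]
    · intro t π'
      have h1 := le_lagVal (K := K) hp hb hc hθ0.le π' H 0 s₀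
      have h2 := hP j π' H 0 rfl s₀
      have hnear : ∀ k h, k + h = H → ∀ s, lagVal ν p b c K θ (P j).prob k h s -
          2 * (Θ / m) * (K + H) ≤ lagVal ν p b c K θ (P i).prob k h s := fun k h hk s => by
        have e1 := abs_le.mp (abs_lagVal_sub_le hp hb hb1 hc hK.le θ θ' (P j) k h s)
        have e2 := abs_le.mp (abs_lagVal_sub_le hp hb hb1 hc hK.le θ θ' (P i) k h s)
        have e3 := hP i (P j) k h hk s
        have hkH : (k : ℝ) ≤ H := by exact_mod_cast (by omega : k ≤ H)
        have e4 : |θ - θ'| * (K + k) ≤ Θ / m * (K + H) := by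
          rw [hdiff]; exact mul_le_mul_of_nonneg_left (by linarith) hstep.le
        linarith
      have h3 := lagVal_mix_ge hp hb hb1 hc (by positivity) (P i) (P j) (hP j) hnear
        (fun _ => t) H 0 rfl s₀
      have h4 := lagVal_le hp hb hb1 hc hK hθ0.le (MarkovPolicy.mix (fun _ => t) (P i) (P j))
        H 0 rfl s₀ fun _ => rfl
      linarith

end Lagrangian

/-- A path of policies from `π` to an optimal policy `m`, along which the cost does not exceed
that of `π`. -/
theorem exists_switching_path (hp : ∀ h, IsDensity ν (p h)) (hc : ∀ h a, BddMeas fun s => c h s a)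
    (π m : MarkovPolicy S A) (hm : ∀ (π' : MarkovPolicy S A) k h, k + h = H → ∀ s,
      bval ν id p c m.prob k h s ≤ bval ν id p c π'.prob k h s) :
    ∃ P : unitInterval → MarkovPolicy S A, UnifContPolicy P ∧
      (∀ h < H, (P 0).prob h = π.prob h) ∧ P 1 = m ∧
      ∀ t k h, k + h = H → ∀ s, bval ν id p c (P t).prob k h s ≤ bval ν id p c π.prob k h s := by
  -- Steps are switched from `π` to `m` one after another, the last one first. Whenever step `h` is
  -- at least partly switched, all later steps are switched completely, so from `h` on the switched
  -- part of the policy is optimal and the cost cannot rise.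
  let w : unitInterval → ℕ → unitInterval := fun t h =>
    Set.projIcc 0 1 zero_le_one ((H : ℝ) * t + h + 1 - H)
  refine ⟨fun t => MarkovPolicy.mix (w t) π m, unifContPolicy_mix (fun h => ?_) π m, ?_, ?_, ?_⟩
  · exact continuous_projIcc.comp (by fun_prop)
  · intro h hh
    have : w 0 h = 0 := by
      have hh' : (h : ℝ) + 1 ≤ H := by exact_mod_cast hh
      exact Set.projIcc_of_le_left _ (by simp; linarith)
    ext s a
    simp [MarkovPolicy.mix, this]
  · have : ∀ h, w 1 h = 1 := fun h => Set.projIcc_of_right_le _ (by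
      simp only [Set.Icc.coe_one]; linarith [(Nat.cast_nonneg h : (0 : ℝ) ≤ h)])
    simp [MarkovPolicy.mix, this]
  · intro t k
    induction k with
    | zero => intros; exact le_rfl
    | succ k ih =>
      intro h hk s
      set ρ := MarkovPolicy.mix (w t) π m with hρ
      have hV := fun ρ : MarkovPolicy S A => bval_bddMeas continuous_id hp hc ρ k (h + 1)
      have hmix := MarkovPolicy.avg_mix (w t) π m h s
      by_cases hw : w t h = 0
      · rw [bval_succ, bval_succ, hmix, hw]
        simp only [Set.Icc.coe_zero, sub_zero, one_mul, zero_mul, add_zero, id]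
        exact π.avg_mono h s fun a => add_le_add_right ((hp h).kint_mono (hV ρ) (hV π)
          (ih (h + 1) (by omega)) s a) _
      · have hpos : 0 < (H : ℝ) * t + h + 1 - H := by
          by_contra hcon
          exact hw (Set.projIcc_of_le_left _ (not_lt.mp hcon))
        have h1 : bval ν id p c ρ.prob k (h + 1) = bval ν id p c m.prob k (h + 1) := by
          refine bval_congr k (h + 1) (fun _ _ _ => rfl) (fun _ _ _ => rfl) fun j hj _ => ?_
          have : w t j = 1 := by
            have hj' : (h : ℝ) + 1 ≤ j := by exact_mod_cast hj
            exact Set.projIcc_of_right_le _ (by linarith)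
          ext s a
          simp [hρ, MarkovPolicy.mix, this]
        have h2 := hm π (k + 1) h hk s
        rw [bval_succ, bval_succ, id, id] at h2
        rw [bval_succ, bval_succ, hmix, h1, id, id]
        have h3 : (π.avg h s fun a => c h s a + kint ν (p h) (bval ν id p c m.prob k (h + 1)) s a) ≤
            π.avg h s fun a => c h s a + kint ν (p h) (bval ν id p c π.prob k (h + 1)) s a :=
          π.avg_mono h s fun a => add_le_add_right ((hp h).kint_mono (hV m) (hV π)
            (hm π k (h + 1) (by omega)) s a) _
        have h4 := (w t h).2.1
        have h5 := (w t h).2.2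
        nlinarith

end Planning

end SafeRewardFree

/-! ### From empirically safe policies to all policies, success of planning, and the cost of random
actions. -/

noncomputable section

namespace SafeRewardFree

section Safety

variable {S A : Type*} [MeasurableSpace S] [Fintype A] {ν : Measure S} [SigmaFinite ν]
  {p q : ℕ → S → A → S → ℝ} {b c r : ℕ → S → A → ℝ} {H : ℕ} {s₀ : S}

/-- A continuous function that never takes a value in (T, 2T] cannot cross this gap. -/
theorem le_of_gap {f : unitInterval → ℝ} (hf : Continuous f) {T : ℝ} (hT : 0 < T) (h0 : f 0 ≤ T)
    (hgap : ∀ t, f t ≤ 2 * T → f t ≤ T) (t : unitInterval) : f t ≤ T := by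
  by_contra hcon
  have h2 : 2 * T ≤ f t := by
    by_contra h
    exact hcon (hgap t (not_le.mp h).le)
  obtain ⟨t', ht'⟩ := mem_range_of_exists_le_of_exists_ge hf ⟨0, by linarith⟩ ⟨t, h2⟩
  have := hgap t' ht'.le
  linarith

/-- Two Lagrangian comparisons against the same policy are averaged. This stands in for a policy
with averaged values, which need not be at hand. -/
theorem convex_comb_le {γ x y cx cy η L : ℝ} (h0 : 0 ≤ γ) (h1 : γ ≤ 1) (hx : x - cx - η ≤ L)
    (hy : y - cy - η ≤ L) : γ * x + (1 - γ) * y - (γ * cx + (1 - γ) * cy) - η ≤ L := by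
  have m1 := mul_le_mul_of_nonneg_left hx h0
  have m2 := mul_le_mul_of_nonneg_left hy (sub_nonneg.mpr h1)
  linarith

/-- If the truncated value of the bonus dominates the model error and is small for all policies
that look safe, then it is small for all policies. -/
theorem bonus_value_le_of_safe (hp : ∀ h, IsDensity ν (p h)) (hq : ∀ h, IsDensity ν (q h))
    (hb : ∀ h a, BddMeas fun s => b h s a) (hb1 : ∀ h s a, b h s a ∈ Set.Icc (0 : ℝ) 1)
    (hc : IsUtil H s₀ c) [Nonempty A] {ρ τ κ Δ acc : ℝ} (hρ : 0 ≤ ρ) (hκ : 0 < κ) (hκΔ : κ ≤ Δ)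
    (hΔτ : Δ ≤ τ) (hτ : τ ≤ 1) (hacc : 0 < acc) (haccκ : acc ≤ κ / 24)
    (hval : ∀ π : MarkovPolicy S A, |bval ν id p c π.prob H 0 s₀ - bval ν id q c π.prob H 0 s₀| ≤
      bval ν (min 1) p b π.prob H 0 s₀)
    (π₀ : MarkovPolicy S A) (hπ₀ : bval ν id q c π₀.prob H 0 s₀ ≤ τ - κ)
    (hπ₀' : bval ν id p c π₀.prob H 0 s₀ + (bval ν (min 1) p b π₀.prob H 0 s₀ + ρ) < τ - 2 * κ / 3)
    (hΔ : ∀ m : MarkovPolicy S A, (∀ π : MarkovPolicy S A,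
      bval ν id q c m.prob H 0 s₀ ≤ bval ν id q c π.prob H 0 s₀) →
        bval ν id q c m.prob H 0 s₀ ≤ τ - Δ)
    (hsafe : ∀ π : MarkovPolicy S A,
      bval ν id p c π.prob H 0 s₀ + (bval ν (min 1) p b π.prob H 0 s₀ + ρ) ≤ τ - κ / 3 →
        bval ν (min 1) p b π.prob H 0 s₀ + ρ ≤ Δ * acc / 3)
    (π : MarkovPolicy S A) : bval ν (min 1) p b π.prob H 0 s₀ + ρ ≤ acc := by
  have hcb := hc.bddMeas
  set B := fun π : MarkovPolicy S A => bval ν (min 1) p b π.prob H 0 s₀ with hB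
  set C := fun π : MarkovPolicy S A => bval ν id p c π.prob H 0 s₀ with hC
  set C' := fun π : MarkovPolicy S A => bval ν id q c π.prob H 0 s₀ with hC'
  set T := Δ * acc / 3 with hTdef
  have hΔ0 : 0 < Δ := hκ.trans_le hκΔ
  have hΔ1 : Δ ≤ 1 := hΔτ.trans hτ
  have hT : 0 < T := by positivity
  have hTκ : T ≤ κ / 72 := by
    rw [hTdef]; nlinarith
  have hTΔ : T ≤ Δ / 72 := by
    rw [hTdef]; nlinarith
  have hB0 : ∀ π, 0 ≤ B π := fun π => bval_min_nonneg hp hb hb1 zero_le_one π H 0 s₀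
  have hval' : ∀ π, C π ≤ C' π + B π ∧ C' π ≤ C π + B π := fun π => by
    have h := abs_le.mp (hval π)
    exact ⟨by linarith [h.2], by linarith [h.1]⟩
  have hsafe' : ∀ π, C π + (B π + ρ) ≤ τ - κ / 3 → B π + ρ ≤ T := hsafe
  have hcontB : ∀ P : unitInterval → MarkovPolicy S A, UnifContPolicy P →
      Continuous fun t => B (P t) + ρ := fun P hP =>
    (continuous_bval hP (lipschitzWith_min 1) hp hb H 0 s₀).add continuous_const
  have hcontC : ∀ P : unitInterval → MarkovPolicy S A, UnifContPolicy P →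
      Continuous fun t => C (P t) := fun P hP =>
    continuous_bval hP LipschitzWith.id hp hcb H 0 s₀
  have hB₀ : ∀ π : MarkovPolicy S A, (∀ h < H, π.prob h = π₀.prob h) → B π + ρ ≤ T := fun π h => by
    have : B π = B π₀ := congrFun (bval_congr H 0 (fun _ _ _ => rfl) (fun _ _ _ => rfl)
      fun j _ hj => h j (by omega)) s₀
    rw [this]
    exact hsafe' π₀ (by linarith)
  obtain ⟨mq, hmq⟩ := exists_optimal_policy (post := id) (u := fun h s a => -1 * c h s a)
    continuous_id monotone_id hq (fun h a => (hcb h a).const_mul (-1)) H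
  have hneg : ∀ (p : ℕ → S → A → S → ℝ), (∀ h, IsDensity ν (p h)) → ∀ (π : MarkovPolicy S A) k h s,
      bval ν id p (fun h s a => -1 * c h s a) π.prob k h s = - bval ν id p c π.prob k h s := by
    intro p hp π k h s
    rw [bval_id_eq_sum_occ hp hcb, bval_id_eq_sum_occ hp fun h a => (hcb h a).const_mul (-1),
      ← Finset.sum_neg_distrib]
    exact Finset.sum_congr rfl fun j _ => by rw [occ_const_mul]; ring
  have hmq' : ∀ (π' : MarkovPolicy S A) k h, k + h = H → ∀ s,
      bval ν id q c mq.prob k h s ≤ bval ν id q c π'.prob k h s := fun π' k h hk s => by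
    have := hmq π' k h hk s
    rw [hneg q hq, hneg q hq] at this
    linarith
  -- On the switching path to the truly cheapest policy the true cost stays at most τ - κ. While `B
  -- + ρ ≤ 2T`, the estimated cost is close to it and the policy is empirically safe, so `B + ρ ≤
  -- T`; the gap carries this to the end of the path.
  have hmqB : B mq + ρ ≤ T := by
    obtain ⟨P, hP, hP0, hP1, hPC⟩ := exists_switching_path hq hcb π₀ mq hmq'
    rw [← hP1]
    refine le_of_gap (hcontB P hP) hT (hB₀ _ hP0) (fun t ht => hsafe' _ ?_) 1
    have h1 : C' (P t) ≤ C' π₀ := hPC t H 0 rfl s₀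
    have h2 := (hval' (P t)).1
    have h3 : C' π₀ ≤ τ - κ := hπ₀
    have ht' : B (P t) + ρ ≤ 2 * T := ht
    linarith
  have hmqC : C mq ≤ τ - Δ + T := by
    have h1 : C' mq ≤ τ - Δ := hΔ mq fun π => hmq' π H 0 rfl s₀
    have h2 := (hval' mq).1
    linarith
  -- Chosen so that estimated cost at most `X` together with `B + ρ ≤ 2T` implies empirical safety.
  -- The cheapest policy lies below `X` by Δ - κ/3 - 3T, which is at least 3Δ/5.
  set X := τ - κ / 3 - 2 * T with hX
  have hXm : ∀ m : MarkovPolicy S A, C m ≤ τ - Δ + T → 3 / 5 * Δ ≤ X - C m := fun m hm => by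
    linarith
  by_contra hcon
  have hW : acc < B π + ρ := not_le.mp hcon
  have hρT : ρ ≤ T := by linarith [hB0 mq]
  -- With Θ = 2 + 2/T, a bonus value of 2T contributes 4T + 4, whereas (Θ + 1)T is only 3T + 2. The
  -- difference exceeds the range 1 of the costs, so the optimiser at the largest multiplier cannot
  -- have bonus value at most T.
  have hΘ : 0 < 2 + 2 / T := by positivity
  rcases exists_lagrangian_path (K := 1) hp hb hb1 hc one_pos (fun π => C π ≤ X ∧ B π + ρ ≤ T)
    (fun m hm => by
      obtain ⟨P, hP, hP0, hP1, hPC⟩ := exists_switching_path hp hcb π₀ m hm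
      refine ⟨?_, ?_⟩
      · have h1 : C m ≤ C mq := hm mq H 0 rfl s₀
        linarith [hXm m (h1.trans hmqC)]
      · rw [← hP1]
        refine le_of_gap (hcontB P hP) hT (hB₀ _ hP0) (fun t ht => hsafe' _ ?_) 1
        have h1 : C (P t) ≤ C π₀ := hPC t H 0 rfl s₀
        have ht' : B (P t) + ρ ≤ 2 * T := ht
        have h2 : C π₀ + (B π₀ + ρ) < τ - 2 * κ / 3 := hπ₀'
        linarith [hB0 π₀])
    hΘ (show 0 < Δ * acc / 20 by positivity) with ⟨m, ⟨-, hmB⟩, hm⟩ | ⟨θ, hθ, -, P, hP, h0, h1, hopt⟩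
  · have h1 : (2 + 2 / T) * B π - C π ≤ (2 + 2 / T + 1 / 1) * B m - C m := hm π
    have h2 : C π ≤ 1 := hc.bval_le_one hp π H 0 rfl s₀ fun _ => rfl
    have h3 : 0 ≤ C m := hc.bval_nonneg hp m H 0 s₀
    have h4 : 3 * T ≤ acc := by rw [hTdef]; nlinarith
    have h5 : 2 * T ≤ B π := by linarith
    have h6 : (2 + 2 / T) * (2 * T) ≤ (2 + 2 / T) * B π := mul_le_mul_of_nonneg_left h5 hΘ.le
    have h7 : (2 + 2 / T + 1 / 1) * B m ≤ (2 + 2 / T + 1 / 1) * T :=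
      mul_le_mul_of_nonneg_left (by linarith) (by linarith)
    have h8 : (2 + 2 / T) * (2 * T) = 4 * T + 4 := by field_simp; ring
    have h9 : (2 + 2 / T + 1 / 1) * T = 3 * T + 2 := by field_simp; ring
    linarith
  -- A first contact with the boundary of both constraints. The policy there is empirically safe, so
  -- in fact `B + ρ ≤ T` and the second constraint is slack; hence the cost equals `X`.
  · obtain ⟨t, ht⟩ : ∃ t, max (C (P t) - X) (B (P t) + ρ - 2 * T) = 0 := by
      refine mem_range_of_exists_le_of_exists_ge
        (((hcontC P hP).sub continuous_const).max ((hcontB P hP).sub continuous_const))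
        ⟨0, max_le (by linarith [h0.1]) (by linarith [h0.2])⟩ ⟨1, ?_⟩
      by_contra hneg
      have hneg' := max_lt_iff.mp (not_le.mp hneg)
      refine h1 ⟨by linarith [hneg'.1], hsafe' _ ?_⟩
      linarith [hneg'.1, hneg'.2]
    have ht1 : C (P t) ≤ X := by linarith [le_max_left (C (P t) - X) (B (P t) + ρ - 2 * T)]
    have ht2 : B (P t) + ρ ≤ 2 * T := by linarith [le_max_right (C (P t) - X) (B (P t) + ρ - 2 * T)]
    have ht3 : B (P t) + ρ ≤ T := hsafe' _ (by linarith)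
    have ht4 : C (P t) = X := by
      rcases max_choice (C (P t) - X) (B (P t) + ρ - 2 * T) with h | h
      · linarith
      · linarith
    have e1 : θ * B π - C π - Δ * acc / 20 ≤ (θ + 1 / 1) * B (P t) - C (P t) := hopt t π
    have e2 : θ * B mq - C mq - Δ * acc / 20 ≤ (θ + 1 / 1) * B (P t) - C (P t) := hopt t mq
    rw [ht4, div_one] at e1 e2
    have e3 : C π ≤ 1 := hc.bval_le_one hp π H 0 rfl s₀ fun _ => rfl
    have e4 : 3 / 5 * Δ ≤ X - C mq := hXm mq hmqC
    have e5 : 0 ≤ θ * B mq := mul_nonneg hθ.le (hB0 mq)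
    have e6 : (θ + 1) * B (P t) ≤ (θ + 1) * (T - ρ) :=
      mul_le_mul_of_nonneg_left (by linarith) (by linarith)
    have hacc' : acc ≤ 1 / 24 := by linarith
    -- the multiplier is large
    have e7 : 35 ≤ θ := by
      have h1 : 3 / 5 * Δ - Δ * acc / 20 ≤ (θ + 1) * T := by
        nlinarith [mul_nonneg (by linarith : (0 : ℝ) ≤ θ + 1) hρ]
      have h2 : (θ + 1) * T ≤ (θ + 1) * (Δ / 72) := mul_le_mul_of_nonneg_left hTΔ (by linarith)
      have h3 : Δ * acc ≤ Δ * (1 / 24) := mul_le_mul_of_nonneg_left hacc' hΔ0.le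
      have h4 : Δ * (1 / 2) ≤ Δ * ((θ + 1) / 72) := by nlinarith
      have h5 := le_of_mul_le_mul_left h4 hΔ0
      linarith
    -- the mixture of the two comparisons
    set γ := 3 / 5 * Δ with hγ
    have hγ0 : 0 ≤ γ := by positivity
    have hγ1 : γ ≤ 1 := by linarith
    have hCmq : 0 ≤ C mq := hc.bval_nonneg hp mq H 0 s₀
    have e8 : γ * (θ * B π) - X - Δ * acc / 20 ≤ (θ + 1) * B (P t) - X := by
      have m1 := convex_comb_le hγ0 hγ1 e1 e2
      have m3 : γ * C π ≤ γ * 1 := mul_le_mul_of_nonneg_left e3 hγ0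
      have m4 := mul_nonneg (sub_nonneg.mpr hγ1) e5
      have m5 : (1 - γ) * C mq ≤ 1 * C mq := mul_le_mul_of_nonneg_right (by linarith) hCmq
      linarith
    have e9 : γ * (θ * (acc - ρ)) ≤ γ * (θ * B π) :=
      mul_le_mul_of_nonneg_left (mul_le_mul_of_nonneg_left (by linarith) hθ.le) hγ0
    have e10 : γ * (θ * (acc - ρ)) - Δ * acc / 20 ≤ (θ + 1) * (T - ρ) := by linarith
    have e11 : γ * θ * ρ ≤ (θ + 1) * ρ := by
      refine mul_le_mul_of_nonneg_right ?_ hρ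
      exact (mul_le_of_le_one_left hθ.le hγ1).trans (by linarith)
    have e12 : 3 / 5 * θ * (Δ * acc) ≤ (1 / 20 + (θ + 1) / 3) * (Δ * acc) := by
      have a := e10
      have b := e11
      rw [hTdef, hγ] at a
      rw [hγ] at b
      linarith
    have e13 := le_of_mul_le_mul_right e12 (by positivity)
    linarith

/-- With uniformly accurate values, planning in the estimated model succeeds. -/
theorem planning_succeeds (hp : ∀ h, IsDensity ν (p h)) (hq : ∀ h, IsDensity ν (q h))
    (hc : IsUtil H s₀ c) (hr : IsUtil H s₀ r) [Nonempty A] {U : MarkovPolicy S A → ℝ}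
    {τ ε Δmin acc : ℝ} (hε : 0 < ε) (hε1 : ε < 1) (hΔ0 : 0 < Δmin) (hΔ1 : Δmin ≤ 1)
    (hacc1 : acc ≤ Δmin / 2) (hacc2 : acc ≤ ε * Δmin / 5) (hU : ∀ π, U π ≤ acc)
    (hvalc : ∀ π : MarkovPolicy S A,
      |bval ν id p c π.prob H 0 s₀ - bval ν id q c π.prob H 0 s₀| ≤ U π)
    (hvalr : ∀ π : MarkovPolicy S A,
      |bval ν id p r π.prob H 0 s₀ - bval ν id q r π.prob H 0 s₀| ≤ U π)
    (hΔ : ∀ m : MarkovPolicy S A, (∀ π : MarkovPolicy S A,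
      bval ν id q c m.prob H 0 s₀ ≤ bval ν id q c π.prob H 0 s₀) →
        bval ν id q c m.prob H 0 s₀ ≤ τ - Δmin) :
    (∃ π : MarkovPolicy S A, bval ν id p c π.prob H 0 s₀ + U π ≤ τ) ∧
    ∀ π : MarkovPolicy S A, bval ν id p c π.prob H 0 s₀ + U π ≤ τ →
      (∀ π' : MarkovPolicy S A, bval ν id p c π'.prob H 0 s₀ + U π' ≤ τ →
        bval ν id p r π'.prob H 0 s₀ ≤ bval ν id p r π.prob H 0 s₀) →
      (∀ π' : MarkovPolicy S A, bval ν id q c π'.prob H 0 s₀ ≤ τ →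
        bval ν id q r π'.prob H 0 s₀ - bval ν id q r π.prob H 0 s₀ ≤ ε) ∧
      bval ν id q c π.prob H 0 s₀ ≤ τ := by
  have hcb := hc.bddMeas
  set C := fun π : MarkovPolicy S A => bval ν id p c π.prob H 0 s₀ with hC
  set C' := fun π : MarkovPolicy S A => bval ν id q c π.prob H 0 s₀ with hC'
  set R := fun π : MarkovPolicy S A => bval ν id p r π.prob H 0 s₀ with hR
  set R' := fun π : MarkovPolicy S A => bval ν id q r π.prob H 0 s₀ with hR'
  have hvc : ∀ π, C π ≤ C' π + U π ∧ C' π ≤ C π + U π := fun π => by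
    have h := abs_le.mp (hvalc π)
    exact ⟨by linarith [h.2], by linarith [h.1]⟩
  have hvr : ∀ π, R π ≤ R' π + U π ∧ R' π ≤ R π + U π := fun π => by
    have h := abs_le.mp (hvalr π)
    exact ⟨by linarith [h.2], by linarith [h.1]⟩
  obtain ⟨m, hm⟩ : ∃ m : MarkovPolicy S A, ∀ π : MarkovPolicy S A, C' m ≤ C' π := by
    obtain ⟨m, hm⟩ := exists_optimal_policy (post := id) (u := fun h s a => -1 * c h s a)
      continuous_id monotone_id hq (fun h a => (hcb h a).const_mul (-1)) H
    refine ⟨m, fun π => ?_⟩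
    have := hm π H 0 rfl s₀
    rw [bval_id_eq_sum_occ hq fun h a => (hcb h a).const_mul (-1),
      bval_id_eq_sum_occ hq fun h a => (hcb h a).const_mul (-1)] at this
    simp only [occ_const_mul, ← Finset.mul_sum, ← bval_id_eq_sum_occ hq hcb] at this
    have h2 : -1 * C' π ≤ -1 * C' m := this
    linarith
  have hmC' : C' m ≤ τ - Δmin := hΔ m hm
  have hmC : C m ≤ τ - Δmin + acc := by linarith [(hvc m).1, hU m]
  refine ⟨⟨m, ?_⟩, fun π hπ hmax => ⟨fun π' hπ' => ?_, ?_⟩⟩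
  · change C m + U m ≤ τ
    linarith [hU m]
  swap
  · have := (hvc π).2
    change C' π ≤ τ
    have h2 : C π + U π ≤ τ := hπ
    linarith
  have hmax' : ∀ ρ, C ρ ≤ τ - acc → R ρ ≤ R π := fun ρ h => hmax ρ (by
    change C ρ + U ρ ≤ τ
    linarith [hU ρ])
  change R' π' - R' π ≤ ε
  by_contra hcon
  have hgap : ε - 2 * acc < R π' - R π := by
    linarith [(hvr π').2, (hvr π).1, hU π, hU π']
  have hεΔ : ε * Δmin ≤ ε * 1 := mul_le_mul_of_nonneg_left hΔ1 hε.le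
  have h01 : ∀ ρ, 0 ≤ R ρ ∧ R ρ ≤ 1 ∧ 0 ≤ C ρ ∧ C ρ ≤ 1 := fun ρ =>
    ⟨hr.bval_nonneg hp ρ H 0 s₀, hr.bval_le_one hp ρ H 0 rfl s₀ fun _ => rfl,
      hc.bval_nonneg hp ρ H 0 s₀, hc.bval_le_one hp ρ H 0 rfl s₀ fun _ => rfl⟩
  have hεΔ0 : 0 < ε * Δmin := mul_pos hε hΔ0
  -- A cap of at least one does not affect the value of the utility `r`, while the loss 1/K in the
  -- upper half of the Lagrangian sandwich becomes negligible.
  set K := 100 / (ε * Δmin) with hK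
  have hK1 : 1 ≤ K := by
    rw [hK, le_div_iff₀ hεΔ0]; nlinarith
  have hKinv : 1 / K = ε * Δmin / 100 := by rw [hK]; field_simp
  have hB : ∀ ρ : MarkovPolicy S A, bval ν (min K) p r ρ.prob H 0 s₀ = R ρ := fun ρ =>
    hr.bval_min_eq hp hK1 ρ H 0 rfl s₀ fun _ => rfl
  -- At this multiplier a cost difference of at most one is worth at most ε/20 of reward, so a good
  -- optimiser there already has nearly maximal reward.
  have hΘ : 0 < 20 / ε := by positivity
  have hπ'C : C π' ≤ τ + acc := by linarith [(hvc π').1, hU π', (show C' π' ≤ τ from hπ')]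
  rcases exists_lagrangian_path (K := K) hp hr.bddMeas hr.mem_Icc hc (zero_lt_one.trans_le hK1)
    (fun π => C π ≤ τ - acc) (fun m' hm' => by
      have : C m' ≤ C m := hm' m H 0 rfl s₀
      linarith)
    hΘ (show 0 < ε * Δmin / 100 by positivity) with ⟨ρ, hρ, hopt⟩ | ⟨θ, hθ, -, P, hP, h0, h1, hopt⟩
  · have e1 := hopt π'
    rw [hB, hB, hKinv] at e1
    have e1' : 20 / ε * R π' - C π' ≤ (20 / ε + ε * Δmin / 100) * R ρ - C ρ := e1
    have e2 := hmax' ρ hρ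
    have e3 := h01 ρ
    have e4 := h01 π'
    have e5 : 20 / ε * (R π' - R ρ) ≤ 2 := by nlinarith
    have e6 : R π' - R ρ ≤ ε / 10 := by
      rw [div_mul_eq_mul_div, div_le_iff₀ hε] at e5
      linarith
    linarith
  · obtain ⟨t, ht⟩ : ∃ t, C (P t) = τ - acc :=
      mem_range_of_exists_le_of_exists_ge
        (continuous_bval hP LipschitzWith.id hp hcb H 0 s₀) ⟨0, h0⟩ ⟨1, (not_le.mp h1).le⟩
    have e1 := hopt t π'
    have e2 := hopt t m
    rw [hB, hB, hKinv] at e1 e2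
    have e1' : θ * R π' - C π' - ε * Δmin / 100 ≤ (θ + ε * Δmin / 100) * R (P t) - C (P t) := e1
    have e2' : θ * R m - C m - ε * Δmin / 100 ≤ (θ + ε * Δmin / 100) * R (P t) - C (P t) := e2
    rw [ht] at e1' e2'
    have e3 := hmax' (P t) ht.le
    obtain ⟨t1, t2, -, -⟩ := h01 (P t)
    obtain ⟨m1, -, -, -⟩ := h01 m
    obtain ⟨p1, p2, -, -⟩ := h01 π'
    have e4 : 0 ≤ θ * R m := mul_nonneg hθ.le m1
    have e5 : θ * R (P t) ≤ θ * 1 := mul_le_mul_of_nonneg_left t2 hθ.le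
    have e5' : ε * Δmin / 100 * R (P t) ≤ ε * Δmin / 100 * 1 :=
      mul_le_mul_of_nonneg_left t2 (by positivity)
    have hεΔ' : ε * Δmin ≤ 1 * Δmin := mul_le_mul_of_nonneg_right hε1.le hΔ0.le
    -- The policy `m` is cheaper than the boundary policy by more than Δmin/2, and a difference of
    -- rewards is at most one; near-optimality of the boundary policy then forces a multiplier of
    -- this size.
    have hθΔ : Δmin / 2 ≤ θ := by linarith
    -- Moving weight 2ε/5 to `m` lowers the averaged cost by 2εΔmin/5 ≥ 2 `acc`, from at most τ +
    -- `acc` to at most τ - `acc`. The reward loss is 2ε/5, plus ε/25 of slack, and stays below ε -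
    -- 2 `acc` ≥ 3ε/5.
    set γ := 1 - 2 * ε / 5 with hγ
    have hγ0 : 0 ≤ γ := by rw [hγ]; linarith
    have e6 : γ * (θ * R π') - ε * Δmin / 100 ≤ θ * R (P t) + ε * Δmin / 100 := by
      have m1 := convex_comb_le hγ0 (by rw [hγ]; linarith) e1' e2'
      have m3 := mul_le_mul_of_nonneg_left hπ'C hγ0
      have m4 := mul_le_mul_of_nonneg_left hmC (show 0 ≤ 1 - γ by rw [hγ]; linarith)
      have m5 := mul_nonneg (show 0 ≤ 1 - γ by rw [hγ]; linarith) e4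
      have m6 : γ * (τ + acc) + (1 - γ) * (τ - Δmin + acc) ≤ τ - acc := by
        rw [hγ]; linarith
      linarith
    have e7 : θ * (R π' - R (P t) - 2 * ε / 5 * R π') ≤ ε * Δmin / 50 := by
      rw [hγ] at e6
      linarith
    have e8 : R π' - R (P t) - 2 * ε / 5 * R π' ≤ ε / 25 := by
      by_contra h
      have h' := not_le.mp h
      have : Δmin / 2 * (ε / 25) < θ * (R π' - R (P t) - 2 * ε / 5 * R π') :=
        mul_lt_mul' hθΔ h' (by positivity) hθ
      nlinarith
    have e9 : 2 * ε / 5 * R π' ≤ 2 * ε / 5 * 1 := mul_le_mul_of_nonneg_left p2 (by positivity)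
    linarith

/-- The policy that follows `π`, but plays a uniformly random action with probability `ε₀` at the
steps in `I`. -/
def MarkovPolicy.greedy [Nonempty A] (π : MarkovPolicy S A) (ε₀ : unitInterval) (I : Set ℕ) :
    MarkovPolicy S A where
  prob := SafeRewardFree.greedy (ε₀ : ℝ) I π.prob
  nonneg h s a := by
    unfold SafeRewardFree.greedy
    split_ifs
    · exact add_nonneg (div_nonneg ε₀.2.1 (Nat.cast_nonneg _))
        (mul_nonneg (sub_nonneg.mpr ε₀.2.2) (π.nonneg h s a))
    · exact π.nonneg h s a
  sum_eq_one h s := by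
    unfold SafeRewardFree.greedy
    split_ifs
    · rw [Finset.sum_add_distrib, ← Finset.mul_sum, π.sum_eq_one, Finset.sum_const,
        Finset.card_univ, nsmul_eq_mul, mul_div_cancel₀ _ (by simp)]
      ring
    · exact π.sum_eq_one h s
  measurable_prob h a := by
    unfold SafeRewardFree.greedy
    by_cases hh : h ∈ I
    · simp only [hh, if_true]
      exact ((π.measurable_prob h a).const_mul _).const_add _
    · simp only [hh, if_false]
      exact π.measurable_prob h a

/-- The cost to go of any action lies between zero and one, so a random action with probability `ε₀`
adds at most `ε₀` for each randomised step that remains. -/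
theorem bval_greedy_le [Nonempty A] (hp : ∀ h, IsDensity ν (p h)) (hc : IsUtil H s₀ c)
    (π : MarkovPolicy S A) (ε₀ : unitInterval) (I : Finset ℕ) (k h : ℕ) (hk : k + h = H) (s : S)
    (hs : h = 0 → s = s₀) :
    bval ν id p c (π.greedy ε₀ I).prob k h s ≤
      bval ν id p c π.prob k h s + ε₀ * (I.filter fun j => h ≤ j).card := by
  induction k generalizing h s with
  | zero =>
    simp only [bval, zero_add]
    exact mul_nonneg ε₀.2.1 (Nat.cast_nonneg _)
  | succ k ih =>
    set ρ := π.greedy ε₀ I with hρ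
    set n : ℝ := ((I.filter fun j => h + 1 ≤ j).card : ℝ) with hn
    have hV := fun π : MarkovPolicy S A => bval_bddMeas continuous_id hp hc.bddMeas π k (h + 1)
    have h1 : ∀ a, c h s a + kint ν (p h) (bval ν id p c ρ.prob k (h + 1)) s a ≤
        (c h s a + kint ν (p h) (bval ν id p c π.prob k (h + 1)) s a) + ε₀ * n := fun a => by
      have := (hp h).kint_mono (hV ρ) ((hV π).add (BddMeas.const (ε₀ * n)))
        (fun s' => ih (h + 1) (by omega) s' (by omega)) s a
      rw [(hp h).kint_add (hV π) (BddMeas.const _), (hp h).kint_const] at this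
      linarith
    have h2 : (π.avg h s fun a => c h s a + kint ν (p h) (bval ν id p c ρ.prob k (h + 1)) s a) ≤
        bval ν id p c π.prob (k + 1) h s + ε₀ * n := by
      refine (π.avg_mono h s h1).trans_eq ?_
      rw [π.avg_add, π.avg_const]
      rfl
    rw [bval_succ, id]
    by_cases hh : h ∈ I
    · have hcard : ((I.filter fun j => h ≤ j).card : ℝ) = n + 1 := by
        have e : I.filter (fun j => h ≤ j) = insert h (I.filter fun j => h + 1 ≤ j) := by
          ext j
          simp only [Finset.mem_filter, Finset.mem_insert]
          constructor
          · rintro ⟨h1, h2⟩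
            rcases h2.eq_or_lt with h3 | h3
            · exact Or.inl h3.symm
            · exact Or.inr ⟨h1, h3⟩
          · rintro (rfl | ⟨h1, h2⟩)
            · exact ⟨hh, le_rfl⟩
            · exact ⟨h1, by omega⟩
        rw [e, Finset.card_insert_of_notMem (by simp)]
        push_cast
        rw [hn]
      set Q := fun a => c h s a + kint ν (p h) (bval ν id p c ρ.prob k (h + 1)) s a with hQ
      have hQ0 : ∀ a, 0 ≤ Q a := fun a => add_nonneg (hc.mem_Icc h s a).1
        ((hp h).le_kint (hV ρ) (hc.bval_nonneg hp ρ k (h + 1)) s a)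
      have hQ1 : ∀ a, Q a ≤ 1 := fun a => hc.add_kint_bval_le_one hp ρ k h hk s hs a
      have e : ρ.avg h s Q = ε₀ * ((∑ a, Q a) / Fintype.card A) + (1 - ε₀) * π.avg h s Q := by
        simp only [MarkovPolicy.avg, hρ, MarkovPolicy.greedy, SafeRewardFree.greedy,
          Finset.mem_coe, hh, if_true, Finset.mul_sum, Finset.sum_div, ← Finset.sum_add_distrib]
        exact Finset.sum_congr rfl fun a _ => by ring
      have hmean : (∑ a, Q a) / Fintype.card A ≤ 1 := by
        have hA : 0 < (Fintype.card A : ℝ) := by exact_mod_cast Fintype.card_pos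
        rw [div_le_one hA]
        refine (Finset.sum_le_sum fun a _ => hQ1 a).trans_eq ?_
        simp
      have h3 : 0 ≤ π.avg h s Q := π.le_avg h s hQ0
      have h4 := ε₀.2.1
      rw [e, hcard]
      nlinarith [mul_le_mul_of_nonneg_left hmean h4, mul_nonneg h4 h3]
    · have hcard : n ≤ ((I.filter fun j => h ≤ j).card : ℝ) := by
        rw [hn]
        exact_mod_cast Finset.card_le_card fun j => by
          simp only [Finset.mem_filter]
          exact fun ⟨h1, h2⟩ => ⟨h1, by omega⟩
      have e : ρ.avg h s = π.avg h s := by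
        ext g
        simp [MarkovPolicy.avg, hρ, MarkovPolicy.greedy, SafeRewardFree.greedy, hh]
      rw [e]
      exact h2.trans (by nlinarith [mul_le_mul_of_nonneg_left hcard ε₀.2.1])

end Safety

end SafeRewardFree

/-! ### Positive definite matrices and the elliptical potential. -/

noncomputable section
namespace Matrix

lemma exists_eq_transpose_mul_self {d : ℕ} {M : Matrix (Fin d) (Fin d) ℝ} (hM : M.PosSemidef) :
    ∃ B : Matrix (Fin d) (Fin d) ℝ, M = Bᵀ * B := by
  open scoped MatrixOrder in
  obtain ⟨B, hB⟩ := CStarAlgebra.nonneg_iff_eq_star_mul_self.mp hM.nonneg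
  exact ⟨B, by rw [hB, star_eq_conjTranspose, conjTranspose_eq_transpose_of_trivial]⟩

namespace PosSemidef

variable {d : ℕ} {U : Matrix (Fin d) (Fin d) ℝ}

lemma quad_nonneg (hU : U.PosSemidef) (x : Fin d → ℝ) : 0 ≤ x ⬝ᵥ U *ᵥ x := by
  simpa using hU.dotProduct_mulVec_nonneg x

lemma dotProduct_mulVec_symm (hU : U.PosSemidef) (x y : Fin d → ℝ) :
    x ⬝ᵥ U *ᵥ y = y ⬝ᵥ U *ᵥ x := by
  have h : Uᵀ = U := by
    have := hU.isHermitian.eq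
    rwa [conjTranspose_eq_transpose_of_trivial] at this
  rw [dotProduct_mulVec, ← mulVec_transpose, h, dotProduct_comm]

end PosSemidef

namespace PosDef

variable {d : ℕ} {U V : Matrix (Fin d) (Fin d) ℝ}

lemma mulVec_inv_mulVec (hU : U.PosDef) (x : Fin d → ℝ) : U *ᵥ (U⁻¹ *ᵥ x) = x := by
  rw [mulVec_mulVec, mul_nonsing_inv _ ((isUnit_iff_isUnit_det _).1 hU.isUnit), one_mulVec]

lemma quad_inv_nonneg (hU : U.PosDef) (x : Fin d → ℝ) : 0 ≤ x ⬝ᵥ U⁻¹ *ᵥ x :=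
  hU.inv.posSemidef.quad_nonneg x

/-- The Cauchy–Schwarz inequality for the norm of a positive definite matrix and its dual. -/
lemma sq_dotProduct_le (hU : U.PosDef) (x w : Fin d → ℝ) :
    (x ⬝ᵥ w) ^ 2 ≤ (x ⬝ᵥ U⁻¹ *ᵥ x) * (w ⬝ᵥ U *ᵥ w) := by
  have key : ∀ t : ℝ, 0 ≤ (w ⬝ᵥ U *ᵥ w) * (t * t) + (-2 * (x ⬝ᵥ w)) * t + x ⬝ᵥ U⁻¹ *ᵥ x := by
    intro t
    have h := hU.posSemidef.quad_nonneg (U⁻¹ *ᵥ x - t • w)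
    have e : U *ᵥ (U⁻¹ *ᵥ x - t • w) = x - t • (U *ᵥ w) := by
      rw [mulVec_sub, hU.mulVec_inv_mulVec, mulVec_smul]
    have e1 : (U⁻¹ *ᵥ x) ⬝ᵥ (U *ᵥ w) = x ⬝ᵥ w := by
      rw [hU.posSemidef.dotProduct_mulVec_symm, hU.mulVec_inv_mulVec, dotProduct_comm]
    rw [e, sub_dotProduct, dotProduct_sub, dotProduct_sub, smul_dotProduct, smul_dotProduct,
      dotProduct_smul, dotProduct_smul, e1, dotProduct_comm _ x, dotProduct_comm w x] at h
    simp only [smul_eq_mul] at h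
    linarith
  have := discrim_le_zero key
  unfold discrim at this
  nlinarith

/-- Put y = U⁻¹x. The hypothesis gives l|y|² ≤ x·y, and (x·y)² ≤ |x|²|y|²; dividing by x·y gives the
bound without diagonalising `U`. -/
lemma quad_inv_le_of_le (hU : U.PosDef) {l : ℝ} (hl : 0 < l)
    (h : ∀ w, l * (w ⬝ᵥ w) ≤ w ⬝ᵥ U *ᵥ w) (x : Fin d → ℝ) :
    x ⬝ᵥ U⁻¹ *ᵥ x ≤ (x ⬝ᵥ x) / l := by
  have h1 := h (U⁻¹ *ᵥ x)
  rw [hU.mulVec_inv_mulVec, dotProduct_comm _ x] at h1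
  have h2 := sq_dotProduct_le (PosDef.one (n := Fin d) (R := ℝ)) x (U⁻¹ *ᵥ x)
  simp only [inv_one, one_mulVec] at h2
  have h3 := hU.quad_inv_nonneg x
  have h4 : 0 ≤ x ⬝ᵥ x := by simpa using dotProduct_star_self_nonneg x
  rw [le_div_iff₀ hl]
  by_contra hc
  push Not at hc
  have h5 : 0 < x ⬝ᵥ U⁻¹ *ᵥ x := by
    rcases h3.lt_or_eq with h3 | h3
    · exact h3
    · rw [← h3] at hc; linarith
  have := mul_lt_mul_of_pos_left hc h5
  have := mul_le_mul_of_nonneg_left h1 h4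
  nlinarith

/-- Comparison of traces from a comparison of quadratic forms. -/
lemma trace_inv_mul_le (hV : V.PosDef) {c : ℝ}
    (h : ∀ x, x ⬝ᵥ U *ᵥ x ≤ c * (x ⬝ᵥ V *ᵥ x)) : (V⁻¹ * U).trace ≤ c * d := by
  obtain ⟨B, hB⟩ := exists_eq_transpose_mul_self hV.inv.posSemidef
  have e : ∀ W : Matrix (Fin d) (Fin d) ℝ, (V⁻¹ * W).trace = ∑ i, B i ⬝ᵥ W *ᵥ B i := by
    intro W
    rw [hB, Matrix.mul_assoc, trace_mul_comm, Matrix.trace]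
    refine Finset.sum_congr rfl fun i _ => ?_
    rw [diag_apply, Matrix.mul_assoc, Matrix.mul_apply, dotProduct]
    refine Finset.sum_congr rfl fun j _ => ?_
    rw [Matrix.mul_apply, mulVec, dotProduct]
    rfl
  have e1 : (V⁻¹ * V).trace = d := by
    rw [nonsing_inv_mul _ ((isUnit_iff_isUnit_det _).1 hV.isUnit), trace_one, Fintype.card_fin]
  rw [← e1, e, e, Finset.mul_sum]
  exact Finset.sum_le_sum fun i _ => h _

end PosDef

lemma one_add_sum_le_prod_one_add {ι : Type*} (s : Finset ι) {f : ι → ℝ} (hf : ∀ i ∈ s, 0 ≤ f i) :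
    1 + ∑ i ∈ s, f i ≤ ∏ i ∈ s, (1 + f i) := by
  classical
  induction s using Finset.induction_on with
  | empty => simp
  | insert a s ha ih =>
    rw [Finset.sum_insert ha, Finset.prod_insert ha]
    have h1 := ih fun i hi => hf i (Finset.mem_insert_of_mem hi)
    have h2 := hf a (Finset.mem_insert_self _ _)
    have h3 : 0 ≤ ∑ i ∈ s, f i :=
      Finset.sum_nonneg fun i hi => hf i (Finset.mem_insert_of_mem hi)
    nlinarith

/-- The eigenvalues of 1 + W are at least one, and a product of numbers 1 + f with f ≥ 0 is at least
1 + ∑ f. -/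
lemma one_add_trace_le_det {d : ℕ} {W : Matrix (Fin d) (Fin d) ℝ} (hW : W.PosSemidef) :
    1 + W.trace ≤ (1 + W).det := by
  have hH : (1 + W).IsHermitian := (PosDef.one.add_posSemidef hW).isHermitian
  have h1 : ∀ j, 1 ≤ hH.eigenvalues j := by
    intro j
    have e := hH.mulVec_eigenvectorBasis j
    set v := hH.eigenvectorBasis j
    have hn : (v : EuclideanSpace ℝ (Fin d)) ⬝ᵥ v = (1 : ℝ) := by
      have h2 : inner ℝ v v = (1 : ℝ) := by
        rw [real_inner_self_eq_norm_sq, hH.eigenvectorBasis.orthonormal.1 j]; norm_num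
      rw [← h2, EuclideanSpace.inner_eq_star_dotProduct]; simp
    have h3 := congrArg (fun x => (v : EuclideanSpace ℝ (Fin d)) ⬝ᵥ x) e
    simp only [add_mulVec, one_mulVec, dotProduct_add, dotProduct_smul, hn, smul_eq_mul,
      mul_one] at h3
    have := hW.quad_nonneg v
    linarith
  have h2 := one_add_sum_le_prod_one_add Finset.univ
    (f := fun j => hH.eigenvalues j - 1) fun j _ => sub_nonneg.2 (h1 j)
  have e1 := hH.det_eq_prod_eigenvalues
  have e2 := hH.trace_eq_sum_eigenvalues
  simp only [RCLike.ofReal_real_eq_id, id_eq] at e1 e2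
  rw [trace_add, trace_one, Fintype.card_fin] at e2
  rw [e1]
  simp only [add_sub_cancel, Finset.sum_sub_distrib, Finset.sum_const, Finset.card_univ,
    Fintype.card_fin, nsmul_eq_mul, mul_one] at h2
  linarith

/-- Concavity of the logarithm: its tangent at `a` is summed over the eigenvalues. -/
lemma log_det_le {d : ℕ} {U : Matrix (Fin d) (Fin d) ℝ} (hU : U.PosDef) {a : ℝ} (ha : 0 < a)
    (htr : U.trace ≤ d * a) : Real.log U.det ≤ d * Real.log a := by
  have e1 := hU.isHermitian.det_eq_prod_eigenvalues
  have e2 := hU.isHermitian.trace_eq_sum_eigenvalues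
  simp only [RCLike.ofReal_real_eq_id, id_eq] at e1 e2
  rw [e1, Real.log_prod fun i _ => (hU.eigenvalues_pos i).ne']
  have h : ∀ i, Real.log (hU.isHermitian.eigenvalues i) ≤
      hU.isHermitian.eigenvalues i / a - 1 + Real.log a := by
    intro i
    have h1 := Real.log_le_sub_one_of_pos (div_pos (hU.eigenvalues_pos i) ha)
    rw [Real.log_div (hU.eigenvalues_pos i).ne' ha.ne'] at h1
    linarith
  refine (Finset.sum_le_sum fun i _ => h i).trans ?_
  rw [Finset.sum_add_distrib, Finset.sum_sub_distrib, ← Finset.sum_div, ← e2]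
  simp only [Finset.sum_const, Finset.card_univ, Fintype.card_fin, nsmul_eq_mul, mul_one]
  have : U.trace / a ≤ d := by rw [div_le_iff₀ ha]; exact htr
  linarith

/-- With M = BᵀB, det(U + M) = det U · det(1 + BU⁻¹Bᵀ). The increment `M` may have any rank, since
it will be an expected outer product rather than an observed one. -/
lemma log_det_add_ge {d : ℕ} {U M : Matrix (Fin d) (Fin d) ℝ} (hU : U.PosDef)
    (hM : M.PosSemidef) : Real.log U.det + Real.log (1 + (U⁻¹ * M).trace) ≤
      Real.log (U + M).det := by
  obtain ⟨B, rfl⟩ := exists_eq_transpose_mul_self hM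
  have hdet := hU.det_pos
  have hW : (B * U⁻¹ * Bᵀ).PosSemidef := by
    have := hU.inv.posSemidef.mul_mul_conjTranspose_same B
    rwa [conjTranspose_eq_transpose_of_trivial] at this
  have e1 : (U⁻¹ * (Bᵀ * B)).trace = (B * U⁻¹ * Bᵀ).trace := by
    rw [← Matrix.mul_assoc, trace_mul_comm, Matrix.mul_assoc]
  have h1 : 0 ≤ (B * U⁻¹ * Bᵀ).trace := hW.trace_nonneg
  rw [det_add_mul _ _ (isUnit_iff_ne_zero.2 hdet.ne'), e1, ← Real.log_mul hdet.ne' (by linarith)]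
  exact Real.log_le_log (by positivity)
    (mul_le_mul_of_nonneg_left (one_add_trace_le_det hW) hdet.le)

lemma trace_inv_mul_le_div {d : ℕ} {U M : Matrix (Fin d) (Fin d) ℝ} (hU : U.PosDef) {l : ℝ}
    (hl : 0 < l) (h : ∀ w, l * (w ⬝ᵥ w) ≤ w ⬝ᵥ U *ᵥ w) (hM : M.PosSemidef) :
    (U⁻¹ * M).trace ≤ M.trace / l := by
  obtain ⟨B, rfl⟩ := exists_eq_transpose_mul_self hM
  have e : ∀ W : Matrix (Fin d) (Fin d) ℝ, (W * (Bᵀ * B)).trace = ∑ i, B i ⬝ᵥ W *ᵥ B i := by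
    intro W
    rw [← Matrix.mul_assoc, trace_mul_comm, Matrix.trace]
    refine Finset.sum_congr rfl fun i _ => ?_
    rw [diag_apply, Matrix.mul_apply, dotProduct]
    refine Finset.sum_congr rfl fun j _ => ?_
    rw [Matrix.mul_apply, mulVec, dotProduct]
    rfl
  have e1 := e 1
  rw [Matrix.one_mul] at e1
  rw [e, e1, Finset.sum_div]
  refine Finset.sum_le_sum fun i _ => ?_
  rw [one_mulVec]
  exact hU.quad_inv_le_of_le hl h _

lemma quad_smul_one_add {d : ℕ} (l : ℝ) (M : Matrix (Fin d) (Fin d) ℝ) (w : Fin d → ℝ) :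
    w ⬝ᵥ (l • (1 : Matrix (Fin d) (Fin d) ℝ) + M) *ᵥ w = l * (w ⬝ᵥ w) + w ⬝ᵥ M *ᵥ w := by
  rw [add_mulVec, smul_mulVec, one_mulVec, dotProduct_add, dotProduct_smul, smul_eq_mul]

lemma posDef_smul_one_add {d : ℕ} {l : ℝ} (hl : 0 < l) {M : Matrix (Fin d) (Fin d) ℝ}
    (hM : M.PosSemidef) : (l • (1 : Matrix (Fin d) (Fin d) ℝ) + M).PosDef :=
  (PosDef.one.smul hl).add_posSemidef hM

/-- The elliptical potential lemma. -/
lemma sum_trace_inv_mul_le {d : ℕ} {l : ℝ} (hl : 1 ≤ l)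
    {M : ℕ → Matrix (Fin d) (Fin d) ℝ} (hM : ∀ n, (M n).PosSemidef) (htr : ∀ n, (M n).trace ≤ 1)
    (N : ℕ) :
    ∑ n ∈ Finset.range N,
      ((l • (1 : Matrix (Fin d) (Fin d) ℝ) + ∑ i ∈ Finset.range n, M i)⁻¹ * M n).trace ≤
      2 * d * Real.log (1 + N / l) := by
  have hl0 : 0 < l := by linarith
  have hS : ∀ n, (∑ i ∈ Finset.range n, M i).PosSemidef := fun n =>
    posSemidef_sum _ fun i _ => hM i
  have hU := fun n => posDef_smul_one_add hl0 (hS n)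
  have hlow : ∀ n w, l * (w ⬝ᵥ w) ≤
      w ⬝ᵥ (l • (1 : Matrix (Fin d) (Fin d) ℝ) + ∑ i ∈ Finset.range n, M i) *ᵥ w := by
    intro n w
    rw [quad_smul_one_add]
    linarith [(hS n).quad_nonneg w]
  set U := fun n => l • (1 : Matrix (Fin d) (Fin d) ℝ) + ∑ i ∈ Finset.range n, M i with hUdef
  have hstep : ∀ n, ((U n)⁻¹ * M n).trace ≤
      2 * (Real.log (U (n + 1)).det - Real.log (U n).det) := by
    intro n
    have h1 := log_det_add_ge (hU n) (hM n)
    have e : U (n + 1) = U n + M n := by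
      simp only [hUdef, Finset.sum_range_succ, add_assoc]
    rw [← e] at h1
    -- This uses `1 ≤ l`. On [0, 1] one has x/2 ≤ log(1 + x), the source of the factor 2.
    have h2 : ((U n)⁻¹ * M n).trace ≤ 1 :=
      ((trace_inv_mul_le_div (hU n) hl0 (hlow n) (hM n)).trans
        (div_le_one_of_le₀ ((htr n).trans hl) hl0.le))
    have h3 : 0 ≤ ((U n)⁻¹ * M n).trace := by
      obtain ⟨B, hB⟩ := exists_eq_transpose_mul_self (hM n)
      have hW : (B * (U n)⁻¹ * Bᵀ).PosSemidef := by
        have := (hU n).inv.posSemidef.mul_mul_conjTranspose_same B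
        rwa [conjTranspose_eq_transpose_of_trivial] at this
      have := hW.trace_nonneg
      rwa [Matrix.mul_assoc, trace_mul_comm, Matrix.mul_assoc, ← hB] at this
    set x := ((U n)⁻¹ * M n).trace
    have h4 : x / 2 ≤ Real.log (1 + x) := by
      have h5 := Real.one_sub_inv_le_log_of_pos (show 0 < 1 + x by linarith)
      refine le_trans ?_ h5
      have : 1 - (1 + x)⁻¹ = x / (1 + x) := by field_simp; ring
      rw [this]
      exact div_le_div_of_nonneg_left h3 (by linarith) (by linarith)
    linarith
  refine (Finset.sum_le_sum fun n _ => hstep n).trans ?_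
  rw [← Finset.mul_sum, Finset.sum_range_sub fun n => Real.log (U n).det]
  have h0 : Real.log (U 0).det = d * Real.log l := by
    simp [hUdef, Real.log_pow]
  rcases Nat.eq_zero_or_pos d with rfl | hd
  · simp
  have hd1 : (1 : ℝ) ≤ d := by exact_mod_cast hd
  have hN0 : (0 : ℝ) ≤ N := Nat.cast_nonneg N
  have h1 : Real.log (U N).det ≤ d * Real.log (l + N) := by
    refine log_det_le (hU N) (by positivity) ?_
    rw [trace_add, trace_smul, trace_one, Fintype.card_fin, trace_sum]
    have h2 : ∑ i ∈ Finset.range N, (M i).trace ≤ N := by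
      refine (Finset.sum_le_sum fun i _ => htr i).trans ?_
      simp
    simp only [smul_eq_mul]
    nlinarith
  have h2 : Real.log (1 + N / l) = Real.log (l + N) - Real.log l := by
    rw [← Real.log_div (by positivity) hl0.ne']
    congr 1
    field_simp
  rw [h0, h2]
  nlinarith

end Matrix
end

/-! ### Iterated integration of conditional densities, over iterations and over the steps of an
episode. -/

noncomputable section
namespace SafeRewardFree

open scoped ENNReal

section Telescoping

variable {n : ℕ} {E : Type*} [MeasurableSpace E] {μ : Fin n → Measure E} [∀ i, SigmaFinite (μ i)]

lemma lmarginal_ge_eq {Z : (Fin n → E) → ℝ≥0∞} (hZ : Measurable Z) (k : ℕ) (hk : k < n)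
    (y : Fin n → E) :
    lmarginal μ (Finset.univ.filter fun i : Fin n => k ≤ i.val) Z y =
      ∫⁻ z, lmarginal μ (Finset.univ.filter fun i : Fin n => k + 1 ≤ i.val) Z
        (Function.update y ⟨k, hk⟩ z) ∂μ ⟨k, hk⟩ := by
  have e : (Finset.univ.filter fun i : Fin n => k ≤ i.val) =
      insert ⟨k, hk⟩ (Finset.univ.filter fun i : Fin n => k + 1 ≤ i.val) := by
    ext i
    simp only [Finset.mem_filter, Finset.mem_univ, true_and, Finset.mem_insert, Fin.ext_iff]
    omega
  rw [e, lmarginal_insert Z hZ (by simp)]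

lemma lmarginal_ge_top (Z : (Fin n → E) → ℝ≥0∞) :
    lmarginal μ (Finset.univ.filter fun i : Fin n => n ≤ i.val) Z = Z := by
  have e : (Finset.univ.filter fun i : Fin n => n ≤ i.val) = ∅ := by
    ext i
    simp
  rw [e, lmarginal_empty]

lemma lmarginal_ge_zero (Z : (Fin n → E) → ℝ≥0∞) (y : Fin n → E) :
    lmarginal μ (Finset.univ.filter fun i : Fin n => 0 ≤ i.val) Z y =
      ∫⁻ x, Z x ∂Measure.pi μ := by
  have e : (Finset.univ.filter fun i : Fin n => 0 ≤ i.val) = Finset.univ := by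
    ext i
    simp
  rw [e, lmarginal_univ]

/-- A supermartingale argument without conditional expectations: coordinates are integrated out from
the last to the first, and `Z k` dominates the integral of `Z n` over the coordinates from `k` on.
-/
lemma lintegral_pi_le_of_step {Z : ℕ → (Fin n → E) → ℝ≥0∞} (hZ : Measurable (Z n))
    (hstep : ∀ k (hk : k < n) y,
      ∫⁻ z, Z (k + 1) (Function.update y ⟨k, hk⟩ z) ∂μ ⟨k, hk⟩ ≤ Z k y) (y : Fin n → E) :
    ∫⁻ x, Z n x ∂Measure.pi μ ≤ Z 0 y := by
  have key : ∀ k ≤ n, ∀ y, lmarginal μ (Finset.univ.filter fun i : Fin n => k ≤ i.val) (Z n) y ≤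
      Z k y := by
    intro k hk
    induction hk using Nat.decreasingInduction with
    | self => intro y; rw [lmarginal_ge_top]
    | of_succ k hk ih =>
      intro y
      rw [lmarginal_ge_eq hZ k hk]
      exact (lintegral_mono fun z => ih _).trans (hstep k hk y)
  rw [← lmarginal_ge_zero (Z n) y]
  exact key 0 (Nat.zero_le _) y

lemma lintegral_pi_eq_of_step {Z : ℕ → (Fin n → E) → ℝ≥0∞} (hZ : Measurable (Z n))
    (hstep : ∀ k (hk : k < n) y,
      ∫⁻ z, Z (k + 1) (Function.update y ⟨k, hk⟩ z) ∂μ ⟨k, hk⟩ = Z k y) (y : Fin n → E) :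
    ∫⁻ x, Z n x ∂Measure.pi μ = Z 0 y := by
  have key : ∀ k ≤ n, ∀ y, lmarginal μ (Finset.univ.filter fun i : Fin n => k ≤ i.val) (Z n) y =
      Z k y := by
    intro k hk
    induction hk using Nat.decreasingInduction with
    | self => intro y; rw [lmarginal_ge_top]
    | of_succ k hk ih =>
      intro y
      rw [lmarginal_ge_eq hZ k hk, ← hstep k hk y]
      exact lintegral_congr fun z => ih _
  rw [← lmarginal_ge_zero (Z n) y]
  exact key 0 (Nat.zero_le _) y

variable {w : Fin n → (Fin n → E) → E → ℝ≥0∞}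

/-- The conditional weights up to coordinate `k`, completed by the total masses `e`. -/
def partialWeight (w : Fin n → (Fin n → E) → E → ℝ≥0∞) (e : Fin n → ℝ≥0∞) (k : ℕ)
    (y : Fin n → E) : ℝ≥0∞ :=
  ∏ i : Fin n, if i.val < k then w i y (y i) else e i

lemma partialWeight_update (hw : ∀ i y y', (∀ j < i, y j = y' j) → w i y = w i y')
    (e : Fin n → ℝ≥0∞) (k : ℕ) (hk : k < n) (y : Fin n → E) (z : E) :
    partialWeight w e (k + 1) (Function.update y ⟨k, hk⟩ z) =
      (∏ i ∈ Finset.univ.erase (⟨k, hk⟩ : Fin n), if i.val < k then w i y (y i) else e i) *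
        w ⟨k, hk⟩ y z := by
  unfold partialWeight
  rw [← Finset.prod_erase_mul _ _ (Finset.mem_univ (⟨k, hk⟩ : Fin n))]
  congr 1
  · refine Finset.prod_congr rfl fun i hi => ?_
    have hne : i ≠ ⟨k, hk⟩ := Finset.ne_of_mem_erase hi
    have hne' : i.val ≠ k := fun h => hne (Fin.ext h)
    have hlt : i.val < k + 1 ↔ i.val < k := by omega
    by_cases h : i.val < k
    · rw [if_pos (hlt.2 h), if_pos h, Function.update_of_ne hne,
        hw i _ y fun j hj => Function.update_of_ne (ne_of_lt (lt_trans hj h)) _ _]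
    · rw [if_neg (fun h' => h (hlt.1 h')), if_neg h]
  · rw [if_pos (Nat.lt_succ_self k), Function.update_self,
      hw ⟨k, hk⟩ _ y fun j hj => Function.update_of_ne (ne_of_lt hj) _ _]

lemma partialWeight_eq (e : Fin n → ℝ≥0∞) (k : ℕ) (hk : k < n) (y : Fin n → E) :
    partialWeight w e k y =
      (∏ i ∈ Finset.univ.erase (⟨k, hk⟩ : Fin n), if i.val < k then w i y (y i) else e i) *
        e ⟨k, hk⟩ := by
  unfold partialWeight
  rw [← Finset.prod_erase_mul _ _ (Finset.mem_univ (⟨k, hk⟩ : Fin n)), if_neg (lt_irrefl k)]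

lemma measurable_partialWeight (hm : ∀ i, Measurable fun y : Fin n → E => w i y (y i))
    (e : Fin n → ℝ≥0∞) (k : ℕ) : Measurable (partialWeight w e k) := by
  refine Finset.measurable_prod _ fun i _ => ?_
  split_ifs
  · exact hm i
  · exact measurable_const

lemma measurable_weight (hm : ∀ i, Measurable fun y : Fin n → E => w i y (y i))
    (hw : ∀ i y y', (∀ j < i, y j = y' j) → w i y = w i y') (i : Fin n) (y : Fin n → E) :
    Measurable (w i y) := by
  have h : Measurable fun z => w i (Function.update y i z) (Function.update y i z i) :=
    (hm i).comp (measurable_update y)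
  have e : w i y = fun z => w i (Function.update y i z) (Function.update y i z i) := by
    funext z
    rw [Function.update_self, hw i (Function.update y i z) y fun j hj =>
      Function.update_of_ne (ne_of_lt hj) _ _]
  rwa [e]

/-- Here `w i y` depends on the earlier coordinates of `y` only, so integrating the last remaining
coordinate affects a single factor. This is how adaptively collected data are handled throughout. -/
lemma lintegral_pi_prod_le (hm : ∀ i, Measurable fun y : Fin n → E => w i y (y i))
    (hw : ∀ i y y', (∀ j < i, y j = y' j) → w i y = w i y') {e : Fin n → ℝ≥0∞}
    (h1 : ∀ i y, ∫⁻ z, w i y z ∂μ i ≤ e i) [Nonempty (Fin n → E)] :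
    ∫⁻ y, ∏ i, w i y (y i) ∂Measure.pi μ ≤ ∏ i, e i := by
  obtain ⟨y⟩ := ‹Nonempty (Fin n → E)›
  have := lintegral_pi_le_of_step (μ := μ) (Z := partialWeight w e)
    (measurable_partialWeight hm e n) (fun k hk y => by
      simp_rw [partialWeight_update hw]
      rw [lintegral_const_mul _ (measurable_weight hm hw _ _), partialWeight_eq e k hk]
      gcongr
      exact h1 _ _) y
  simpa [partialWeight] using this

lemma lintegral_pi_prod_eq (hm : ∀ i, Measurable fun y : Fin n → E => w i y (y i))
    (hw : ∀ i y y', (∀ j < i, y j = y' j) → w i y = w i y') {e : Fin n → ℝ≥0∞}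
    (h1 : ∀ i y, ∫⁻ z, w i y z ∂μ i = e i) [Nonempty (Fin n → E)] :
    ∫⁻ y, ∏ i, w i y (y i) ∂Measure.pi μ = ∏ i, e i := by
  obtain ⟨y⟩ := ‹Nonempty (Fin n → E)›
  have := lintegral_pi_eq_of_step (μ := μ) (Z := partialWeight w e)
    (measurable_partialWeight hm e n) (fun k hk y => by
      simp_rw [partialWeight_update hw]
      rw [lintegral_const_mul _ (measurable_weight hm hw _ _), partialWeight_eq e k hk, h1]) y
  simpa [partialWeight] using this

end Telescoping

/-- Actions form a finite discrete space, so joint measurability can be checked for one action at a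
time. -/
lemma measurable_apply_discrete {X A B : Type*} [MeasurableSpace X] [Fintype A] [MeasurableSpace A]
    [MeasurableSingletonClass A] [MeasurableSpace B] {f : A → X → B} (hf : ∀ a, Measurable (f a))
    {g : X → A} (hg : Measurable g) : Measurable fun x => f (g x) x := by
  have h : Measurable fun y : A × X => f y.1 y.2 := measurable_from_prod_countable_right hf
  exact h.comp (hg.prodMk measurable_id)

section Episode

variable {S A : Type*} [MeasurableSpace S] [Fintype A] [MeasurableSpace A]
  [MeasurableSingletonClass A] {ν : Measure S} [SigmaFinite ν] {H : ℕ}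

/-- The state at step `k` of the episode `e` that starts in `s₀`. -/
def epState (s₀ : S) (e : Fin H → A × S) (k : ℕ) : S :=
  if h : 0 < k ∧ k - 1 < H then (e ⟨k - 1, h.2⟩).2 else s₀

lemma measurable_epState (s₀ : S) (k : ℕ) :
    Measurable fun e : Fin H → A × S => epState s₀ e k := by
  unfold epState
  split_ifs with h
  · exact measurable_snd.comp (measurable_pi_apply _)
  · exact measurable_const

lemma epState_zero (s₀ : S) (e : Fin H → A × S) : epState s₀ e 0 = s₀ := by
  simp [epState]

lemma epState_succ_update (s₀ : S) (e : Fin H → A × S) (k : ℕ) (hk : k < H) (z : A × S) :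
    epState s₀ (Function.update e ⟨k, hk⟩ z) (k + 1) = z.2 := by
  simp [epState, hk]

lemma epState_update_of_le (s₀ : S) (e : Fin H → A × S) (k : ℕ) (hk : k < H) (z : A × S) (j : ℕ)
    (hj : j ≤ k) : epState s₀ (Function.update e ⟨k, hk⟩ z) j = epState s₀ e j := by
  unfold epState
  split_ifs with h
  · rw [Function.update_of_ne]
    intro h'
    have := congrArg Fin.val h'
    simp only at this
    omega
  · rfl

lemma lintegral_action_state {p : S → A → S → ℝ} (hp : IsDensity ν p) (π : MarkovPolicy S A)
    (h : ℕ) (s : S) {F : A → S → ℝ≥0∞} (hF : ∀ a, Measurable (F a)) {c : A → ℝ}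
    (hc0 : ∀ a, 0 ≤ c a)
    (hc : ∀ a, ∫⁻ s', ENNReal.ofReal (p s a s') * F a s' ∂ν = ENNReal.ofReal (c a)) :
    ∫⁻ z : A × S, ENNReal.ofReal (π.prob h s z.1 * p s z.1 z.2) * F z.1 z.2
      ∂((Measure.count : Measure A).prod ν) = ENNReal.ofReal (π.avg h s c) := by
  have hpm : ∀ a, Measurable (p s a) := fun a => (hp.meas a).comp measurable_prodMk_left
  rw [lintegral_prod]
  · rw [lintegral_count, tsum_fintype, MarkovPolicy.avg,
      ENNReal.ofReal_sum_of_nonneg fun a _ => mul_nonneg (π.nonneg _ _ _) (hc0 a)]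
    refine Finset.sum_congr rfl fun a _ => ?_
    rw [ENNReal.ofReal_mul (π.nonneg _ _ _), ← hc, ← lintegral_const_mul]
    · refine lintegral_congr fun s' => ?_
      rw [ENNReal.ofReal_mul (π.nonneg _ _ _), mul_assoc]
    · exact (hpm a).ennreal_ofReal.mul (hF a)
  · refine Measurable.aemeasurable ?_
    refine measurable_from_prod_countable_right fun a => ?_
    show Measurable fun y : S => ENNReal.ofReal (π.prob h s a * p s a y) * F a y
    exact ((hpm a).const_mul _).ennreal_ofReal.mul (hF a)

lemma lintegral_ofReal_mul_ofReal {p : S → A → S → ℝ} (hp : IsDensity ν p) {V : S → ℝ}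
    (hV : BddMeas V) (h0 : ∀ s, 0 ≤ V s) (s : S) (a : A) :
    ∫⁻ s', ENNReal.ofReal (p s a s') * ENNReal.ofReal (V s') ∂ν =
      ENNReal.ofReal (kint ν p V s a) := by
  rw [kint, ofReal_integral_eq_lintegral_ofReal (hp.integrable_mul hV s a)
    (Filter.Eventually.of_forall fun s' => mul_nonneg (hp.nonneg _ _ _) (h0 s'))]
  exact lintegral_congr fun s' => (ENNReal.ofReal_mul (hp.nonneg _ _ _)).symm

/-- The density of an episode under a Markov policy. -/
def epDensity (p : ℕ → S → A → S → ℝ) (π : ℕ → S → A → ℝ) (s₀ : S) (e : Fin H → A × S) : ℝ :=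
  ∏ j : Fin H, π j (epState s₀ e j) (e j).1 * p j (epState s₀ e j) (e j).1 (e j).2

lemma measurable_epDensity {p : ℕ → S → A → S → ℝ} (hp : ∀ h, IsDensity ν (p h))
    (π : MarkovPolicy S A) (s₀ : S) :
    Measurable (epDensity (H := H) p π.prob s₀) := by
  refine Finset.measurable_prod _ fun j _ => ?_
  refine measurable_apply_discrete
    (f := fun a (e : Fin H → A × S) => π.prob j (epState s₀ e j) a *
      p j (epState s₀ e j) a (e j).2) (fun a => ?_) (measurable_fst.comp (measurable_pi_apply j))
  exact ((π.measurable_prob j a).comp (measurable_epState s₀ _)).mul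
    (((hp j).meas a).comp ((measurable_epState s₀ _).prodMk
      (measurable_snd.comp (measurable_pi_apply j))))

/-- The expectation of a function of the transition at step `h`. -/
lemma lintegral_epDensity_mul {p : ℕ → S → A → S → ℝ} (hp : ∀ h, IsDensity ν (p h))
    (π : MarkovPolicy S A) (s₀ : S) (h : Fin H) {G : S → A → S → ℝ≥0∞}
    (hG : ∀ a, Measurable fun x : S × S => G x.1 a x.2) {g : S → A → ℝ}
    (hg : ∀ a, BddMeas fun s => g s a) (hg0 : ∀ s a, 0 ≤ g s a)
    (hGg : ∀ s a, ∫⁻ s', ENNReal.ofReal (p h s a s') * G s a s' ∂ν = ENNReal.ofReal (g s a))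
    [Nonempty A] :
    ∫⁻ e : Fin H → A × S, ENNReal.ofReal (epDensity p π.prob s₀ e) *
      G (epState s₀ e h) (e h).1 (e h).2
        ∂(Measure.pi fun _ : Fin H => (Measure.count : Measure A).prod ν) =
      ENNReal.ofReal (occ ν p π.prob g h 0 s₀) := by
  classical
  have hocc0 : ∀ k j s, 0 ≤ occ ν p π.prob g k j s := fun k j s => occ_nonneg hp hg hg0 π k j s
  have hGm : Measurable fun e : Fin H → A × S => G (epState s₀ e h) (e h).1 (e h).2 := by
    refine measurable_apply_discrete
      (f := fun a (e : Fin H → A × S) => G (epState s₀ e h) a (e h).2) (fun a => ?_)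
      (measurable_fst.comp (measurable_pi_apply h))
    exact (hG a).comp ((measurable_epState s₀ _).prodMk
      (measurable_snd.comp (measurable_pi_apply h)))
  set d : (Fin H → A × S) → Fin H → ℝ := fun e j =>
    π.prob j (epState s₀ e j) (e j).1 * p j (epState s₀ e j) (e j).1 (e j).2 with hd
  have hd0 : ∀ e j, 0 ≤ d e j := fun e j => mul_nonneg (π.nonneg _ _ _) ((hp _).nonneg _ _ _)
  -- The density of the first `k` steps times the conditional mean of the observable given them: an
  -- `occ` while step `h` lies ahead, the observed `G` once it lies behind.
  set Z : ℕ → (Fin H → A × S) → ℝ≥0∞ := fun k e =>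
    ENNReal.ofReal (∏ j : Fin H with j.val < k, d e j) *
      (if k ≤ h.val then ENNReal.ofReal (occ ν p π.prob g (h.val - k) k (epState s₀ e k))
        else G (epState s₀ e h) (e h).1 (e h).2) with hZ
  have hZH : Z H = fun e => ENNReal.ofReal (epDensity p π.prob s₀ e) *
      G (epState s₀ e h) (e h).1 (e h).2 := by
    funext e
    simp only [hZ]
    rw [if_neg (not_le.2 h.2), Finset.filter_true_of_mem fun j _ => j.2]
    rfl
  have hZ0 : ∀ e, Z 0 e = ENNReal.ofReal (occ ν p π.prob g h 0 s₀) := by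
    intro e
    simp [hZ, epState_zero]
  have hs : Nonempty (Fin H → A × S) := ⟨fun _ => (Classical.arbitrary A, s₀)⟩
  have key := lintegral_pi_eq_of_step (μ := fun _ : Fin H => (Measure.count : Measure A).prod ν)
    (Z := Z) (by
      rw [hZH]
      exact (measurable_epDensity hp π s₀).ennreal_ofReal.mul hGm) (fun k hk e => by
    have hprod : ∀ z, ENNReal.ofReal
        (∏ j : Fin H with j.val < k + 1, d (Function.update e ⟨k, hk⟩ z) j) =
        ENNReal.ofReal (∏ j : Fin H with j.val < k, d e j) * ENNReal.ofReal
          (π.prob k (epState s₀ e k) z.1 * p k (epState s₀ e k) z.1 z.2) := by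
      intro z
      have e1 : (Finset.univ.filter fun j : Fin H => j.val < k + 1) =
          insert ⟨k, hk⟩ (Finset.univ.filter fun j : Fin H => j.val < k) := by
        ext i
        simp only [Finset.mem_filter, Finset.mem_univ, true_and, Finset.mem_insert, Fin.ext_iff]
        omega
      rw [e1, Finset.prod_insert (by simp), mul_comm, ENNReal.ofReal_mul
        (Finset.prod_nonneg fun j _ => hd0 _ _)]
      congr 2
      · refine Finset.prod_congr rfl fun j hj => ?_
        have hj' : j.val < k := (Finset.mem_filter.1 hj).2
        have hne : j ≠ ⟨k, hk⟩ := fun h' => by rw [h'] at hj'; exact lt_irrefl _ hj'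
        simp only [hd]
        rw [epState_update_of_le _ _ _ _ _ _ hj'.le, Function.update_of_ne hne]
      · simp only [hd]
        rw [epState_update_of_le _ _ _ _ _ _ le_rfl, Function.update_self]
    simp only [hZ]
    simp_rw [hprod, mul_assoc]
    rw [lintegral_const_mul' _ _ ENNReal.ofReal_ne_top]
    congr 1
    rcases lt_trichotomy k h.val with hlt | heq | hgt
    · rw [if_pos hlt.le]
      simp_rw [if_pos (Nat.succ_le_of_lt hlt), epState_succ_update]
      rw [lintegral_action_state (hp k) π k _
        (F := fun _ s' => ENNReal.ofReal (occ ν p π.prob g (h.val - (k + 1)) (k + 1) s'))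
        (fun _ => (occ_bddMeas hp hg π _ _).meas.ennreal_ofReal)
        (c := fun a => kint ν (p k) (occ ν p π.prob g (h.val - (k + 1)) (k + 1))
          (epState s₀ e k) a)
        (fun a => (hp k).le_kint (occ_bddMeas hp hg π _ _) (hocc0 _ _) _ _)
        (fun a => lintegral_ofReal_mul_ofReal (hp k) (occ_bddMeas hp hg π _ _) (hocc0 _ _) _ _)]
      have e2 : h.val - k = h.val - (k + 1) + 1 := by omega
      rw [e2, occ_succ]
    · rw [if_pos heq.le]
      simp_rw [if_neg (show ¬ k + 1 ≤ h.val by omega)]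
      have hke : (⟨k, hk⟩ : Fin H) = h := Fin.ext heq
      have e3 : ∀ z, G (epState s₀ (Function.update e ⟨k, hk⟩ z) h)
          ((Function.update e ⟨k, hk⟩ z) h).1 ((Function.update e ⟨k, hk⟩ z) h).2 =
          G (epState s₀ e k) z.1 z.2 := by
        intro z
        rw [epState_update_of_le _ _ _ _ _ _ heq.ge, ← hke, Function.update_self]
      simp_rw [e3]
      rw [lintegral_action_state (hp k) π k _
        (F := fun a s' => G (epState s₀ e k) a s')
        (fun a => (hG a).comp measurable_prodMk_left)
        (c := fun a => g (epState s₀ e k) a) (fun a => hg0 _ _)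
        (fun a => by rw [heq]; exact hGg _ _)]
      rw [heq, Nat.sub_self, occ_zero]
    · rw [if_neg (not_le.2 hgt)]
      simp_rw [if_neg (show ¬ k + 1 ≤ h.val by omega)]
      have hne : h ≠ ⟨k, hk⟩ := fun h' => by rw [h'] at hgt; exact lt_irrefl _ hgt
      have e3 : ∀ z, G (epState s₀ (Function.update e ⟨k, hk⟩ z) h)
          ((Function.update e ⟨k, hk⟩ z) h).1 ((Function.update e ⟨k, hk⟩ z) h).2 =
          G (epState s₀ e h) (e h).1 (e h).2 := by
        intro z
        rw [epState_update_of_le _ _ _ _ _ _ hgt.le, Function.update_of_ne hne]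
      simp_rw [e3]
      rw [lintegral_mul_const]
      · have := lintegral_action_state (hp k) π k (epState s₀ e k)
          (F := fun _ _ => 1) (fun a => measurable_const)
          (c := fun a => 1) (fun a => zero_le_one) (fun a => by
            simp_rw [mul_one]
            rw [← ofReal_integral_eq_lintegral_ofReal ((hp k).integrable _ _)
              (Filter.Eventually.of_forall fun s' => (hp k).nonneg _ _ _), (hp k).integral])
        simp_rw [mul_one] at this
        rw [this, π.avg_const, ENNReal.ofReal_one, one_mul]
      · refine Measurable.ennreal_ofReal ?_
        refine measurable_from_prod_countable_right fun a => ?_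
        show Measurable fun y : S => π.prob k (epState s₀ e k) a * p k (epState s₀ e k) a y
        exact (((hp k).meas a).comp measurable_prodMk_left).const_mul _) (Classical.arbitrary _)
  rw [hZ0] at key
  rw [← key, hZH]

end Episode

end SafeRewardFree
end

/-! ### The law of the data and its exponential Markov inequality. -/

noncomputable section
namespace SafeRewardFree

open scoped ENNReal

lemma measurable_occ {S A X : Type*} [MeasurableSpace S] [Fintype A] [MeasurableSpace X]
    {ν : Measure S} [SigmaFinite ν] {p : ℕ → S → A → S → ℝ} (hp : ∀ h, IsDensity ν (p h))
    {g : S → A → ℝ} (hg : ∀ a, BddMeas fun s => g s a) (π : X → MarkovPolicy S A) {H : ℕ}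
    (hπ : ∀ h < H, ∀ a, Measurable fun x : X × S => (π x.1).prob h x.2 a) (k h : ℕ)
    (hk : h + k < H) : Measurable fun x : X × S => occ ν p (π x.1).prob g k h x.2 := by
  induction k generalizing h with
  | zero =>
    simp only [occ]
    exact Finset.measurable_sum _ fun a _ =>
      (hπ h (by omega) a).mul ((hg a).meas.comp measurable_snd)
  | succ k ih =>
    simp only [occ]
    refine Finset.measurable_sum _ fun a _ => (hπ h (by omega) a).mul ?_
    have h1 : Measurable fun y : (X × S) × S =>
        p h y.1.2 a y.2 * occ ν p (π y.1.1).prob g k (h + 1) y.2 := by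
      refine (((hp h).meas a).comp ((measurable_snd.comp measurable_fst).prodMk
        measurable_snd)).mul ?_
      exact (ih (h + 1) (by omega)).comp
        ((measurable_fst.comp measurable_fst).prodMk measurable_snd)
    exact (h1.stronglyMeasurable.integral_prod_right (ν := ν)).measurable

namespace LowRankMDP

variable {S A : Type*} [MeasurableSpace S] [Fintype A] (M : LowRankMDP S A)

instance : SigmaFinite M.base := M.sigmaFinite_base

/-- The true transition density, extended to all times. -/
def trans : ℕ → S → A → S → ℝ := fun h => M.density (min h (M.H - 1))

lemma clamp_lt (h : ℕ) : min h (M.H - 1) < M.H :=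
  lt_of_le_of_lt (min_le_right _ _) (Nat.sub_lt M.H_pos one_pos)

lemma clamp_eq {h : ℕ} (hh : h < M.H) : min h (M.H - 1) = h := min_eq_left (by omega)

lemma trans_isDensity (h : ℕ) : IsDensity M.base (M.trans h) :=
  (M.isLowRankStep _ (M.clamp_lt h)).isDensity

lemma trans_eq {h : ℕ} (hh : h < M.H) : M.trans h = M.density h := by
  unfold trans
  rw [M.clamp_eq hh]

end LowRankMDP

namespace Config

variable {S A : Type*} [MeasurableSpace S] [Fintype A] (P : Config S A)

lemma nonempty_action (P : Config S A) : Nonempty A := by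
  by_contra h
  rw [not_nonempty_iff] at h
  have := P.task.baseline.sum_eq_one 0 P.M.init
  simp at this

lemma ε₀_pos : 0 < P.ε₀ := div_pos P.task.κ_pos (by norm_num)

lemma ε₀_le : P.ε₀ ≤ 1 / 6 := by
  unfold ε₀
  have := P.task.κ_le.trans P.task.τ_le_one
  linarith

/-- The probability of a random action as an element of the unit interval. -/
def epsUnit : unitInterval := ⟨P.ε₀, P.ε₀_pos.le, P.ε₀_le.trans (by norm_num)⟩

lemma stateAt_eq (e : Fin P.M.H → A × S) (j : Fin P.M.H) :
    P.stateAt e j = epState P.M.init e j := by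
  unfold stateAt epState
  by_cases h : (j : ℕ) = 0
  · rw [if_pos h, dif_neg (by omega)]
  · rw [if_neg h, dif_pos ⟨by omega, lt_of_le_of_lt (Nat.sub_le _ _) j.2⟩]

end Config

namespace Choices

variable {S A : Type*} [MeasurableSpace S] [Fintype A] {P : Config S A} {β : ℝ}
  (R : Choices P β)

/-- The behavior policy of episode `k` in the iteration after the computation of `π⁽ⁱ⁾`. -/
def beh (i : ℕ) (ω : P.Data β) (k : ℕ) : MarkovPolicy S A :=
  haveI := P.nonempty_action
  (R.pol i ω).greedy P.epsUnit {j | j = k ∨ j + 1 = k}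

lemma beh_prob (i : ℕ) (ω : P.Data β) (k : ℕ) : (R.beh i ω k).prob = R.behavior i ω k := rfl

/-- The expectation of `g (s_h, a_h)` in episode `k` of the iteration after the computation
of `π⁽ⁱ⁾`. -/
def occB (i : ℕ) (ω : P.Data β) (k h : ℕ) (g : S → A → ℝ) : ℝ :=
  occ P.M.base P.M.trans (R.beh i ω k).prob g h 0 P.M.init

/-- The density of the episodes of an iteration. -/
def blockDensity (i : ℕ) (ω : P.Data β) (z : Fin P.M.H → Fin P.M.H → A × S) : ℝ :=
  ∏ k : Fin P.M.H, epDensity P.M.trans (R.beh i ω k).prob P.M.init (z k)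

variable [MeasurableSpace A] [MeasurableSingletonClass A]

lemma epDensity_nonneg {H : ℕ} {ν : Measure S} {p : ℕ → S → A → S → ℝ}
    (hp : ∀ h, IsDensity ν (p h)) (π : MarkovPolicy S A) (s₀ : S) (e : Fin H → A × S) :
    0 ≤ epDensity p π.prob s₀ e :=
  Finset.prod_nonneg fun _ _ => mul_nonneg (π.nonneg _ _ _) ((hp _).nonneg _ _ _)

lemma law_density_eq (ω : P.Data β) :
    (∏ i : Fin (P.N β), ∏ k : Fin P.M.H, ∏ j : Fin P.M.H,
      R.behavior i.val ω k.val j.val (P.stateAt (ω i k) j) (ω i k j).1 *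
        P.M.density j.val (P.stateAt (ω i k) j) (ω i k j).1 (ω i k j).2) =
    ∏ i : Fin (P.N β), R.blockDensity i ω (ω i) := by
  refine Finset.prod_congr rfl fun i _ => Finset.prod_congr rfl fun k _ =>
    Finset.prod_congr rfl fun j _ => ?_
  rw [P.stateAt_eq, P.M.trans_eq j.2]
  rfl

lemma blockDensity_nonneg (i : ℕ) (ω : P.Data β) (z : Fin P.M.H → Fin P.M.H → A × S) :
    0 ≤ R.blockDensity i ω z :=
  Finset.prod_nonneg fun _ _ => epDensity_nonneg P.M.trans_isDensity _ _ _

variable {R}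

lemma IsRun.measurable_beh (hR : R.IsRun) (i : ℕ) (hi : i ≤ P.N β) (k : ℕ) (h : ℕ) (hh : h < P.M.H) (a : A) :
    Measurable fun x : P.Data β × S => (R.beh i x.1 k).prob h x.2 a := by
  simp only [beh_prob, behavior, greedy]
  split_ifs
  · exact ((hR.pol_measurable i hi ⟨h, hh⟩ a).const_mul _).const_add _
  · exact hR.pol_measurable i hi ⟨h, hh⟩ a

lemma IsRun.beh_congr (hR : R.IsRun) (i : Fin (P.N β)) (ω ω' : P.Data β) (h : ∀ j < i, ω j = ω' j) (k : ℕ) :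
    R.beh i ω k = R.beh i ω' k := by
  unfold beh
  rw [hR.pol_adapted i i.2.le ω ω' fun m hm => h m hm]

lemma IsRun.measurable_occB (hR : R.IsRun) (i : ℕ) (hi : i ≤ P.N β) (k h : ℕ) (hh : h < P.M.H) {g : S → A → ℝ}
    (hg : ∀ a, BddMeas fun s => g s a) : Measurable fun ω => R.occB i ω k h g :=
  (measurable_occ P.M.trans_isDensity hg (fun ω => R.beh i ω k) (hR.measurable_beh i hi k) h 0
    (by omega)).comp measurable_prodMk_right

lemma measurable_obs {G : S → A → S → ℝ≥0∞}
    (hG : ∀ a, Measurable fun x : S × S => G x.1 a x.2) (i : Fin (P.N β)) (k h : Fin P.M.H) :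
    Measurable fun ω : P.Data β =>
      G (epState P.M.init (ω i k) h) (ω i k h).1 (ω i k h).2 := by
  have h1 : Measurable fun ω : P.Data β => ω i k :=
    (measurable_pi_apply k).comp (measurable_pi_apply i)
  have h2 : Measurable fun ω : P.Data β => ω i k h := (measurable_pi_apply h).comp h1
  refine measurable_apply_discrete
    (f := fun a (ω : P.Data β) => G (epState P.M.init (ω i k) h) a (ω i k h).2) (fun a => ?_)
    (measurable_fst.comp h2)
  exact (hG a).comp (((measurable_epState _ _).comp h1).prodMk (measurable_snd.comp h2))

lemma IsRun.measurable_blockDensity (hR : R.IsRun) (i : Fin (P.N β)) :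
    Measurable fun ω : P.Data β => R.blockDensity i ω (ω i) := by
  refine Finset.measurable_prod _ fun k _ => Finset.measurable_prod _ fun j _ => ?_
  have h1 : Measurable fun ω : P.Data β => ω i k :=
    (measurable_pi_apply k).comp (measurable_pi_apply i)
  have h2 : Measurable fun ω : P.Data β => ω i k j := (measurable_pi_apply j).comp h1
  refine measurable_apply_discrete
    (f := fun a (ω : P.Data β) => (R.beh i ω k).prob j (epState P.M.init (ω i k) j) a *
      P.M.trans j (epState P.M.init (ω i k) j) a (ω i k j).2) (fun a => ?_)
    (measurable_fst.comp h2)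
  have h3 := (measurable_epState (H := P.M.H) (A := A) P.M.init j).comp h1
  exact ((hR.measurable_beh i i.2.le k j j.2 a).comp (measurable_id.prodMk h3)).mul
    (((P.M.trans_isDensity j).meas a).comp (h3.prodMk (measurable_snd.comp h2)))

lemma nonempty_data : Nonempty (P.Data β) :=
  ⟨fun _ _ _ => (P.nonempty_action.some, P.M.init)⟩

lemma lintegral_blockDensity_mul (i : ℕ) (ω : P.Data β) (k h : Fin P.M.H) {G : S → A → S → ℝ≥0∞}
    (hG : ∀ a, Measurable fun x : S × S => G x.1 a x.2) {g : S → A → ℝ}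
    (hg : ∀ a, BddMeas fun s => g s a) (hg0 : ∀ s a, 0 ≤ g s a)
    (hGg : ∀ s a, ∫⁻ s', ENNReal.ofReal (P.M.trans h s a s') * G s a s' ∂P.M.base =
      ENNReal.ofReal (g s a)) :
    ∫⁻ z : Fin P.M.H → Fin P.M.H → A × S, ENNReal.ofReal (R.blockDensity i ω z) *
      G (epState P.M.init (z k) h) (z k h).1 (z k h).2
        ∂(Measure.pi fun _ : Fin P.M.H => Measure.pi fun _ : Fin P.M.H =>
          (Measure.count : Measure A).prod P.M.base) = ENNReal.ofReal (R.occB i ω k h g) := by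
  have hA := P.nonempty_action
  have hGm : Measurable fun e : Fin P.M.H → A × S => G (epState P.M.init e h) (e h).1 (e h).2 := by
    refine measurable_apply_discrete
      (f := fun a (e : Fin P.M.H → A × S) => G (epState P.M.init e h) a (e h).2) (fun a => ?_)
      (measurable_fst.comp (measurable_pi_apply h))
    exact (hG a).comp ((measurable_epState P.M.init _).prodMk
      (measurable_snd.comp (measurable_pi_apply h)))
  -- Given the past, the episodes of one iteration are independent; only episode `k` carries the
  -- factor `G`, and the others integrate to one.
  set w : Fin P.M.H → (Fin P.M.H → Fin P.M.H → A × S) → (Fin P.M.H → A × S) → ℝ≥0∞ :=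
    fun k' _ e => ENNReal.ofReal (epDensity P.M.trans (R.beh i ω k').prob P.M.init e) *
      if k' = k then G (epState P.M.init e h) (e h).1 (e h).2 else 1 with hw
  have hwm : ∀ k' y, Measurable (w k' y) := by
    intro k' y
    refine (measurable_epDensity P.M.trans_isDensity _ _).ennreal_ofReal.mul ?_
    split_ifs
    · exact hGm
    · exact measurable_const
  have hne : Nonempty (Fin P.M.H → Fin P.M.H → A × S) :=
    ⟨fun _ _ => (Classical.arbitrary A, P.M.init)⟩
  have key := lintegral_pi_prod_eq
    (μ := fun _ : Fin P.M.H => Measure.pi fun _ : Fin P.M.H =>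
      (Measure.count : Measure A).prod P.M.base) (w := w)
    (e := fun k' => if k' = k then ENNReal.ofReal (R.occB i ω k h g) else 1)
    (fun k' => (hwm k' (Classical.arbitrary _)).comp (measurable_pi_apply k'))
    (fun k' y y' _ => rfl) (fun k' y => by
      simp only [hw]
      by_cases hk : k' = k
      · subst hk
        simp only [if_true]
        exact lintegral_epDensity_mul P.M.trans_isDensity _ _ h hG hg hg0 hGg
      · simp only [hk, if_false]
        have := lintegral_epDensity_mul P.M.trans_isDensity (R.beh i ω k') P.M.init h
          (G := fun _ _ _ => 1) (fun _ => measurable_const) (g := fun _ _ => 1)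
          (fun _ => BddMeas.const _) (fun _ _ => zero_le_one) (fun s a => by
            simp_rw [mul_one]
            rw [← ofReal_integral_eq_lintegral_ofReal ((P.M.trans_isDensity h).integrable _ _)
              (Filter.Eventually.of_forall fun s' => (P.M.trans_isDensity h).nonneg _ _ _),
              (P.M.trans_isDensity h).integral])
        rw [this, occ_const P.M.trans_isDensity, ENNReal.ofReal_one])
  rw [Finset.prod_ite_eq' Finset.univ k] at key
  simp only [Finset.mem_univ, if_true] at key
  rw [← key]
  refine lintegral_congr fun z => ?_
  simp only [hw]
  rw [Finset.prod_mul_distrib, Finset.prod_ite_eq' Finset.univ k]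
  simp only [Finset.mem_univ, if_true]
  rw [blockDensity, ENNReal.ofReal_prod_of_nonneg fun _ _ =>
    epDensity_nonneg P.M.trans_isDensity _ _ _]

lemma lintegral_blockDensity (i : ℕ) (ω : P.Data β) :
    ∫⁻ z : Fin P.M.H → Fin P.M.H → A × S, ENNReal.ofReal (R.blockDensity i ω z)
        ∂(Measure.pi fun _ : Fin P.M.H => Measure.pi fun _ : Fin P.M.H =>
          (Measure.count : Measure A).prod P.M.base) = 1 := by
  have := lintegral_blockDensity_mul (R := R) i ω ⟨0, P.M.H_pos⟩ ⟨0, P.M.H_pos⟩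
    (G := fun _ _ _ => 1) (fun _ => measurable_const) (g := fun _ _ => 1)
    (fun _ => BddMeas.const _) (fun _ _ => zero_le_one) (fun s a => by
      simp_rw [mul_one]
      rw [← ofReal_integral_eq_lintegral_ofReal ((P.M.trans_isDensity 0).integrable _ _)
        (Filter.Eventually.of_forall fun s' => (P.M.trans_isDensity 0).nonneg _ _ _),
        (P.M.trans_isDensity 0).integral])
  simp_rw [mul_one] at this
  rw [this, occB, occ_const P.M.trans_isDensity, ENNReal.ofReal_one]

lemma law_eq : R.law = (Measure.pi fun _ : Fin (P.N β) => Measure.pi fun _ : Fin P.M.H =>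
    Measure.pi fun _ : Fin P.M.H => (Measure.count : Measure A).prod P.M.base).withDensity
      fun ω => ∏ i : Fin (P.N β), ENNReal.ofReal (R.blockDensity i ω (ω i)) := by
  unfold law
  congr 1
  funext ω
  rw [law_density_eq, ENNReal.ofReal_prod_of_nonneg fun _ _ => R.blockDensity_nonneg _ _ _]

lemma IsRun.blockDensity_congr (hR : R.IsRun) (i : Fin (P.N β)) (ω ω' : P.Data β) (h : ∀ j < i, ω j = ω' j) :
    R.blockDensity i ω = R.blockDensity i ω' := by
  funext z
  unfold blockDensity
  refine Finset.prod_congr rfl fun k _ => ?_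
  rw [hR.beh_congr i ω ω' h]

lemma IsRun.measurable_law_density (hR : R.IsRun) :
    Measurable fun ω => ∏ i : Fin (P.N β), ENNReal.ofReal (R.blockDensity i ω (ω i)) :=
  Finset.measurable_prod _ fun i _ => (hR.measurable_blockDensity i).ennreal_ofReal

lemma IsRun.isProbabilityMeasure_law (hR : R.IsRun) : IsProbabilityMeasure R.law := by
  refine ⟨?_⟩
  have := nonempty_data (P := P) (β := β)
  rw [law_eq (R := R), withDensity_apply _ MeasurableSet.univ, Measure.restrict_univ,
    lintegral_pi_prod_eq (w := fun i ω z => ENNReal.ofReal (R.blockDensity i ω z)) (e := fun _ => 1)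
      (fun i => (hR.measurable_blockDensity i).ennreal_ofReal)
      (fun i ω ω' h => by funext z; rw [hR.blockDensity_congr i ω ω' h])
      (fun i ω => lintegral_blockDensity _ _)]
  simp

/-- The density of the law contains these factors, so it vanishes wherever one of them does.
Positivity is needed to turn the comparison of likelihoods into one of ratios. -/
lemma IsRun.ae_density_pos (hR : R.IsRun) : ∀ᵐ ω ∂(R.law), ∀ (i : Fin (P.N β)) (k j : Fin P.M.H),
    0 < P.M.trans j (epState P.M.init (ω i k) j) (ω i k j).1 (ω i k j).2 := by
  rw [law_eq (R := R), ae_withDensity_iff hR.measurable_law_density]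
  refine Filter.Eventually.of_forall fun ω h i k j => ?_
  refine lt_of_le_of_ne ((P.M.trans_isDensity j).nonneg _ _ _) fun h0 => h ?_
  refine Finset.prod_eq_zero (Finset.mem_univ i) ?_
  rw [blockDensity, Finset.prod_eq_zero (Finset.mem_univ k), ENNReal.ofReal_zero]
  rw [epDensity, Finset.prod_eq_zero (Finset.mem_univ j)]
  rw [← h0, mul_zero]

/-- The exponential Markov inequality for sums over the first `n` iterations of a function of the
transition at step `h` in episode `k`. -/
lemma IsRun.law_ge_le (hR : R.IsRun) (n : ℕ) (k h : Fin P.M.H) {G : S → A → S → ℝ≥0∞}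
    (hG : ∀ a, Measurable fun x : S × S => G x.1 a x.2) {g q : S → A → ℝ}
    (hg : ∀ a, BddMeas fun s => g s a) (hg0 : ∀ s a, 0 ≤ g s a)
    (hGg : ∀ s a, ∫⁻ s', ENNReal.ofReal (P.M.trans h s a s') * G s a s' ∂P.M.base =
      ENNReal.ofReal (g s a)) (hq : ∀ a, BddMeas fun s => q s a)
    (hgq : ∀ s a, g s a ≤ 1 + q s a) {t : ℝ} (ht : 0 < t) :
    R.law {ω | ENNReal.ofReal t⁻¹ ≤ ∏ i : Fin (P.N β) with i.val < n,
      G (epState P.M.init (ω i k) h) (ω i k h).1 (ω i k h).2 *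
        ENNReal.ofReal (Real.exp (-R.occB i ω k h q))} ≤ ENNReal.ofReal t := by
  have := nonempty_data (P := P) (β := β)
  set F : Fin (P.N β) → P.Data β → (Fin P.M.H → Fin P.M.H → A × S) → ℝ≥0∞ := fun i ω z =>
    if i.val < n then G (epState P.M.init (z k) h) (z k h).1 (z k h).2 *
        ENNReal.ofReal (Real.exp (-R.occB i ω k h q)) else 1 with hF
  have hFm : ∀ i, Measurable fun ω => F i ω (ω i) := by
    intro i
    simp only [hF]
    split_ifs
    · exact (measurable_obs hG i k h).mul
        ((hR.measurable_occB i i.2.le k h h.2 hq).neg.exp.ennreal_ofReal)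
    · exact measurable_const
  have hprod : ∀ ω, (∏ i : Fin (P.N β) with i.val < n,
      G (epState P.M.init (ω i k) h) (ω i k h).1 (ω i k h).2 *
        ENNReal.ofReal (Real.exp (-R.occB i ω k h q))) = ∏ i, F i ω (ω i) := by
    intro ω
    rw [Finset.prod_filter]
  simp_rw [hprod]
  have hm : Measurable fun ω => ∏ i, F i ω (ω i) := Finset.measurable_prod _ fun i _ => hFm i
  -- Given the past, the mean of the factor of one iteration is the mean of g times exp(-mean of q),
  -- at most (1 + mean of q) exp(-mean of q) ≤ 1.
  have hint : ∫⁻ ω, ∏ i, F i ω (ω i) ∂(R.law) ≤ 1 := by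
    rw [law_eq (R := R), lintegral_withDensity_eq_lintegral_mul _ hR.measurable_law_density hm]
    have := lintegral_pi_prod_le (μ := fun _ : Fin (P.N β) => Measure.pi fun _ : Fin P.M.H =>
      Measure.pi fun _ : Fin P.M.H => (Measure.count : Measure A).prod P.M.base)
      (w := fun i ω z => ENNReal.ofReal (R.blockDensity i ω z) * F i ω z)
      (e := fun _ => 1) (fun i => (hR.measurable_blockDensity i).ennreal_ofReal.mul (hFm i))
      (fun i ω ω' h' => by
        funext z
        simp only [hF, occB]
        rw [hR.blockDensity_congr i ω ω' h', hR.beh_congr i ω ω' h'])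
      (fun i ω => by
        simp only [hF]
        split_ifs
        · simp_rw [← mul_assoc]
          rw [lintegral_mul_const' _ _ ENNReal.ofReal_ne_top,
            lintegral_blockDensity_mul i ω k h hG hg hg0 hGg,
            ← ENNReal.ofReal_mul (show 0 ≤ R.occB i ω k h g from
              occ_nonneg P.M.trans_isDensity hg hg0 _ _ _ _)]
          rw [← ENNReal.ofReal_one]
          refine ENNReal.ofReal_le_ofReal ?_
          have h1 : R.occB i ω k h g ≤ 1 + R.occB i ω k h q := by
            have h2 := occ_mono P.M.trans_isDensity hg
              (fun a => (BddMeas.const 1).add (hq a)) hgq (R.beh i ω k) h 0 P.M.init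
            rwa [occ_add P.M.trans_isDensity (fun a => BddMeas.const 1) hq,
              occ_const P.M.trans_isDensity] at h2
          have h3 : 1 + R.occB i ω k h q ≤ Real.exp (R.occB i ω k h q) := by
            rw [add_comm]; exact Real.add_one_le_exp _
          calc R.occB i ω k h g * Real.exp (-R.occB i ω k h q)
              ≤ Real.exp (R.occB i ω k h q) * Real.exp (-R.occB i ω k h q) :=
                mul_le_mul_of_nonneg_right (h1.trans h3) (Real.exp_pos _).le
            _ = 1 := by rw [← Real.exp_add]; simp
        · simp_rw [mul_one]
          exact (lintegral_blockDensity _ _).le)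
    simpa [Finset.prod_mul_distrib] using this
  have h1 := mul_meas_ge_le_lintegral (μ := R.law) hm (ENNReal.ofReal t⁻¹)
  have h2 := h1.trans hint
  rw [ENNReal.ofReal_inv_of_pos ht] at h2 ⊢
  have ht0 : ENNReal.ofReal t ≠ 0 := by simpa using ht
  calc _ = ENNReal.ofReal t * ((ENNReal.ofReal t)⁻¹ *
        R.law {ω | (ENNReal.ofReal t)⁻¹ ≤ ∏ i, F i ω (ω i)}) := by
        rw [← mul_assoc, ENNReal.mul_inv_cancel ht0 ENNReal.ofReal_ne_top, one_mul]
    _ ≤ ENNReal.ofReal t * 1 := by gcongr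
    _ = _ := mul_one _

end Choices

end SafeRewardFree
end

/-! ### Extension of utilities, and elementary bounds on the parameters of an instance. -/

noncomputable section
namespace SafeRewardFree

namespace LowRankMDP

variable {S A : Type*} [MeasurableSpace S] [Fintype A] (M : LowRankMDP S A)

/-- A utility, extended by zero to all times. -/
def ext (u : ℕ → S → A → ℝ) : ℕ → S → A → ℝ := fun h s a => if h < M.H then u h s a else 0

variable {M} {u : ℕ → S → A → ℝ}

lemma IsUtility.isUtil (hu : M.IsUtility u) : IsUtil M.H M.init (M.ext u) where
  measurable h a := by
    by_cases hh : h < M.H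
    · simp only [ext, hh, if_true]; exact hu.measurable h hh a
    · simp only [ext, hh, if_false]; exact measurable_const
  mem_Icc h s a := by
    by_cases hh : h < M.H
    · simp only [ext, hh, if_true]; exact hu.mem_Icc h hh s a
    · simp [ext, hh]
  sum_le_one s a hs := by
    refine (Finset.sum_le_sum fun h hh => ?_).trans (hu.sum_le_one s a hs)
    simp [ext, Finset.mem_range.1 hh]

variable (M u)

lemma V_eq (π : ℕ → S → A → ℝ) :
    M.V u π = bval M.base id M.trans (M.ext u) π M.H 0 M.init := by
  unfold V
  rw [value_eq_bval]
  refine congrFun (bval_congr _ _ (fun j _ hj => (M.trans_eq (by omega)).symm) (fun j _ hj => ?_)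
    fun _ _ _ => rfl) _
  funext s a
  simp [ext, show j < M.H by omega]

variable {u}

lemma V_nonneg (hu : M.IsUtility u) (π : MarkovPolicy S A) : 0 ≤ M.V u π.prob := by
  rw [V_eq]
  exact hu.isUtil.bval_nonneg M.trans_isDensity π _ _ _

lemma bddBelow_V (hu : M.IsUtility u) :
    BddBelow (Set.range fun π : MarkovPolicy S A => M.V u π.prob) :=
  ⟨0, by rintro _ ⟨π, rfl⟩; exact M.V_nonneg hu π⟩

lemma le_sub_margin {τ : ℝ} (m : MarkovPolicy S A)
    (hm : ∀ π : MarkovPolicy S A, M.V u m.prob ≤ M.V u π.prob) :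
    M.V u m.prob ≤ τ - M.margin u τ := by
  unfold margin
  have : Nonempty (MarkovPolicy S A) := ⟨m⟩
  have := le_ciInf hm
  linarith

lemma margin_le (hu : M.IsUtility u) (τ : ℝ) : M.margin u τ ≤ τ := by
  unfold margin
  have := Real.iInf_nonneg fun π : MarkovPolicy S A => M.V_nonneg hu π
  linarith

lemma le_margin (hu : M.IsUtility u) {τ κ : ℝ} {π : MarkovPolicy S A}
    (hπ : M.V u π.prob ≤ τ - κ) : κ ≤ M.margin u τ := by
  unfold margin
  have := ciInf_le (M.bddBelow_V hu) π
  linarith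

end LowRankMDP

namespace Config

variable {S A : Type*} [MeasurableSpace S] [Fintype A] (P : Config S A) {β : ℝ}

lemma one_le_card_Φ : (1 : ℝ) ≤ P.models.Φ.card := by
  exact_mod_cast Finset.card_pos.2 ⟨_, P.models.feature_mem 0 P.M.H_pos⟩

lemma one_le_card_Ψ : (1 : ℝ) ≤ P.models.Ψ.card := by
  exact_mod_cast Finset.card_pos.2 ⟨_, P.models.mu_mem 0 P.M.H_pos⟩

lemma one_le_H : (1 : ℝ) ≤ P.M.H := by exact_mod_cast P.M.H_pos

/-- In dimension zero all inner products vanish, and a density could not have integral one. -/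
lemma d_pos : 0 < P.M.d := by
  rcases Nat.eq_zero_or_pos P.M.d with h | h
  · have h1 := (P.M.isLowRankStep 0 P.M.H_pos).integral_density P.M.init P.nonempty_action.some
    have h2 : ∀ x y : EuclideanSpace ℝ (Fin P.M.d), inner ℝ x y = (0 : ℝ) := by
      intro x y
      have : IsEmpty (Fin P.M.d) := by rw [h]; infer_instance
      simp [EuclideanSpace.inner_eq_star_dotProduct, dotProduct]
    simp [h2] at h1
  · exact h

lemma one_le_d : (1 : ℝ) ≤ P.M.d := by exact_mod_cast P.d_pos

lemma one_le_card_action (P : Config S A) : (1 : ℝ) ≤ Fintype.card A := by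
  have := P.nonempty_action
  exact_mod_cast Fintype.card_pos

lemma κ_le_Δ : P.task.κ ≤ P.Δ := P.M.le_margin P.task.isUtility_c P.task.baseline_safe

lemma Δ_le_τ : P.Δ ≤ P.task.τ := P.M.margin_le P.task.isUtility_c _

lemma κ_le_one : P.task.κ ≤ 1 := P.task.κ_le.trans P.task.τ_le_one

lemma Δ_pos : 0 < P.Δ := P.task.κ_pos.trans_le P.κ_le_Δ

lemma Δ_le_one : P.Δ ≤ 1 := P.Δ_le_τ.trans P.task.τ_le_one

lemma acc_pos : 0 < P.acc := by
  have h1 := P.ε_mem.1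
  have h2 := P.task.Δmin_pos
  have h3 := P.task.τ_pos
  have h4 := P.task.κ_pos
  unfold acc
  refine lt_min (by positivity) (lt_min (by positivity) (lt_min (by positivity) (lt_min ?_ ?_))) <;>
    positivity

lemma acc_le_κ : P.acc ≤ P.task.κ / 24 :=
  (min_le_right _ _).trans ((min_le_right _ _).trans ((min_le_right _ _).trans (min_le_right _ _)))

lemma acc_le_Δmin : P.acc ≤ P.task.Δmin / 2 := (min_le_right _ _).trans (min_le_left _ _)

lemma acc_le_εΔmin : P.acc ≤ P.ε * P.task.Δmin / 5 :=
  (min_le_right _ _).trans ((min_le_right _ _).trans (min_le_left _ _))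

lemma threshold_pos : 0 < P.threshold := div_pos (mul_pos P.Δ_pos P.acc_pos) (by norm_num)

lemma Atilde_ge : 6 ≤ P.Atilde := by
  unfold Atilde
  rw [le_div_iff₀ P.ε₀_pos]
  have := P.ε₀_le
  have := P.one_le_card_action
  linarith

lemma Atilde_eq : P.Atilde = 6 * Fintype.card A / P.task.κ := by
  unfold Atilde ε₀
  field_simp

/-- The factor of `n` in the argument of the logarithm `logTerm`. -/
def logArg : ℝ := 2 * (P.models.Φ.card : ℝ) * (P.models.Ψ.card : ℝ) * (P.M.H : ℝ) / P.δ

/-- The factor of `ζ²` in the definition of `N`. -/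
def coefN (β : ℝ) : ℝ := 2 ^ 10 * β * (P.M.H : ℝ) ^ 2 * (P.M.d : ℝ) ^ 4 * P.Atilde ^ 2 /
  P.threshold ^ 2 + 2 ^ 12 * 3 ^ 2 * β * (P.M.H : ℝ) ^ 2 * (P.M.d : ℝ) ^ 4 * P.Atilde ^ 2 /
    P.task.κ ^ 2

lemma logTerm_eq (n : ℕ) : P.logTerm n = Real.log (P.logArg * n) := by
  unfold logTerm logArg
  congr 1
  ring

lemma two_le_logArg : 2 ≤ P.logArg := by
  unfold logArg
  have h1 := P.one_le_card_Φ
  have h2 := P.one_le_card_Ψ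
  have h3 := P.one_le_H
  have h4 := P.δ_mem
  rw [le_div_iff₀ h4.1]
  have h5 : 1 ≤ (P.models.Φ.card : ℝ) * P.models.Ψ.card := one_le_mul_of_one_le_of_one_le h1 h2
  have h6 : 1 ≤ (P.models.Φ.card : ℝ) * P.models.Ψ.card * P.M.H :=
    one_le_mul_of_one_le_of_one_le h5 h3
  have := h4.2
  nlinarith

/-- The set defining `N` is nonempty because log² grows more slowly than the identity; otherwise its
`sInf` would be the default value 0. -/
lemma exists_log_sq_le (K : ℝ) {a : ℝ} (ha : 0 < a) :
    ∃ n : ℕ, 1 ≤ n ∧ K * Real.log (a * n) ^ 2 ≤ n := by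
  have h2 : (fun x : ℝ => Real.log x ^ 2) =o[Filter.atTop] fun x : ℝ => x :=
    Real.isLittleO_pow_log_id_atTop
  have hc : 0 < (|K| + 1)⁻¹ * a⁻¹ := by positivity
  have h3 := h2.def hc
  have h4 : Filter.Tendsto (fun n : ℕ => a * (n : ℝ)) Filter.atTop Filter.atTop :=
    tendsto_natCast_atTop_atTop.const_mul_atTop ha
  obtain ⟨n, hn1, hn⟩ := ((h4.eventually h3).and (Filter.eventually_ge_atTop 1)).exists
  refine ⟨n, hn, ?_⟩
  have hn0 : (0 : ℝ) ≤ n := Nat.cast_nonneg n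
  rw [Real.norm_of_nonneg (sq_nonneg _), Real.norm_of_nonneg (by positivity)] at hn1
  calc K * Real.log (a * n) ^ 2 ≤ (|K| + 1) * Real.log (a * n) ^ 2 :=
        mul_le_mul_of_nonneg_right (by linarith [le_abs_self K]) (sq_nonneg _)
    _ ≤ (|K| + 1) * ((|K| + 1)⁻¹ * a⁻¹ * (a * n)) := by gcongr
    _ = n := by field_simp

lemma N_spec (β : ℝ) : 1 ≤ P.N β ∧ P.coefN β * P.ζ β ^ 2 ≤ P.N β := by
  have ha : 0 < P.logArg := by linarith [P.two_le_logArg]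
  have h := exists_log_sq_le (P.coefN β) ha
  have hne : {n : ℕ | 1 ≤ n ∧ P.coefN β * P.logTerm n ^ 2 ≤ n}.Nonempty := by
    obtain ⟨n, h1, h2⟩ := h
    exact ⟨n, h1, by rwa [P.logTerm_eq]⟩
  exact Nat.sInf_mem hne

/-- Minimality of `N`. -/
lemma lt_of_lt_N {n : ℕ} (h1 : 1 ≤ n) (hn : n < P.N β) :
    (n : ℝ) < P.coefN β * P.logTerm n ^ 2 := by
  by_contra h
  push Not at h
  exact Nat.notMem_of_lt_sInf hn ⟨h1, h⟩

lemma one_le_N (β : ℝ) : (1 : ℝ) ≤ P.N β := by exact_mod_cast (P.N_spec β).1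

lemma log_two_le_ζ (β : ℝ) : Real.log 2 ≤ P.ζ β := by
  rw [ζ, logTerm_eq]
  refine Real.log_le_log (by norm_num) ?_
  have := P.two_le_logArg
  have := P.one_le_N β
  nlinarith

/-- Feeds the bound `N ≥ 100 d`, from which all the logarithms are seen to be at least one. -/
lemma coefN_ge (hβ : 100 ≤ β) : 10 ^ 6 * (P.M.d : ℝ) ≤ P.coefN β := by
  have hd := P.one_le_d
  have hH := P.one_le_H
  have hA := P.Atilde_ge
  have hκ := P.κ_le_one
  have hκ0 := P.task.κ_pos
  have hT := P.threshold_pos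
  unfold coefN
  have h1 : (1 : ℝ) ≤ (P.M.H : ℝ) ^ 2 := one_le_pow₀ hH
  have h2 : (P.M.d : ℝ) ≤ (P.M.d : ℝ) ^ 4 := le_self_pow₀ hd (by norm_num)
  have h3 : (36 : ℝ) ≤ P.Atilde ^ 2 := by nlinarith
  have h4 : 2 ^ 12 * 3 ^ 2 * β * (P.M.H : ℝ) ^ 2 * (P.M.d : ℝ) ^ 4 * P.Atilde ^ 2 ≤
      2 ^ 12 * 3 ^ 2 * β * (P.M.H : ℝ) ^ 2 * (P.M.d : ℝ) ^ 4 * P.Atilde ^ 2 / P.task.κ ^ 2 :=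
    le_div_self (by positivity) (by positivity) (pow_le_one₀ hκ0.le hκ)
  have h5 : 0 ≤ 2 ^ 10 * β * (P.M.H : ℝ) ^ 2 * (P.M.d : ℝ) ^ 4 * P.Atilde ^ 2 /
    P.threshold ^ 2 := by positivity
  have h6 : 2 ^ 12 * 3 ^ 2 * 100 * 1 * (P.M.d : ℝ) * 36 ≤
      2 ^ 12 * 3 ^ 2 * β * (P.M.H : ℝ) ^ 2 * (P.M.d : ℝ) ^ 4 * P.Atilde ^ 2 := by gcongr
  linarith

lemma d_le_N (hβ : 100 ≤ β) : 100 * (P.M.d : ℝ) ≤ P.N β := by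
  have h1 := (P.N_spec β).2
  have h2 := P.log_two_le_ζ β
  have h3 := Real.log_two_gt_d9
  have h4 := P.coefN_ge hβ
  have h5 : (1 : ℝ) / 4 ≤ P.ζ β ^ 2 := by nlinarith
  have h6 := P.one_le_d
  have h7 := mul_le_mul h4 h5 (by norm_num) (by linarith)
  linarith

lemma one_le_ζ (hβ : 100 ≤ β) : 1 ≤ P.ζ β := by
  rw [ζ, logTerm_eq, Real.le_log_iff_exp_le]
  · have h1 := Real.exp_one_lt_d9
    have h2 := P.two_le_logArg
    have h3 := P.d_le_N hβ
    have h4 := P.one_le_d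
    nlinarith
  · have := P.two_le_logArg
    have := P.one_le_N β
    nlinarith

/-- The logarithm in the definition of `λ`. -/
def lamLog (β : ℝ) : ℝ := Real.log (2 * (P.N β : ℝ) * (P.M.H : ℝ) * (P.models.Φ.card : ℝ) / P.δ)

lemma lam_eq (β : ℝ) : P.lam β = β * P.M.d * P.lamLog β := rfl

lemma lamLog_le_ζ (β : ℝ) : P.lamLog β ≤ P.ζ β := by
  have h1 := P.one_le_card_Φ
  have h2 := P.one_le_card_Ψ
  have h3 := P.one_le_H
  have h4 := P.δ_mem.1
  have h5 := P.one_le_N β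
  unfold lamLog ζ logTerm
  refine Real.log_le_log (by positivity) ?_
  refine div_le_div_of_nonneg_right ?_ h4.le
  have : 2 * (P.N β : ℝ) * (P.M.H : ℝ) * (P.models.Φ.card : ℝ) * 1 ≤
    2 * (P.N β : ℝ) * (P.M.H : ℝ) * (P.models.Φ.card : ℝ) * P.models.Ψ.card := by gcongr
  linarith

lemma two_mul_N_le (β : ℝ) :
    2 * (P.N β : ℝ) ≤ 2 * (P.N β : ℝ) * (P.M.H : ℝ) * (P.models.Φ.card : ℝ) / P.δ := by
  have h1 := P.one_le_card_Φ
  have h3 := P.one_le_H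
  have h4 := P.δ_mem
  have h5 := P.one_le_N β
  rw [le_div_iff₀ h4.1]
  have : 2 * (P.N β : ℝ) * 1 * 1 ≤ 2 * (P.N β : ℝ) * (P.M.H : ℝ) * P.models.Φ.card := by gcongr
  have := h4.2
  nlinarith

lemma log_two_mul_N_le (β : ℝ) : Real.log (2 * (P.N β : ℝ)) ≤ P.lamLog β := by
  have := P.one_le_N β
  exact Real.log_le_log (by linarith) (P.two_mul_N_le β)

lemma one_le_lamLog (hβ : 100 ≤ β) : 1 ≤ P.lamLog β := by
  refine le_trans ?_ (P.log_two_mul_N_le β)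
  rw [Real.le_log_iff_exp_le (by linarith [P.one_le_N β])]
  linarith [Real.exp_one_lt_d9, P.d_le_N hβ, P.one_le_d]

/-- The logarithm of the reciprocal failure probability for a single point of the net. -/
def netLog (β : ℝ) : ℝ :=
  P.lamLog β + Real.log 2 + P.M.d * Real.log (2 * (P.N β * P.M.d : ℕ) + 1)

/-- The regulariser `λ` has to dominate the deviation term of the covariance comparison, up to twice
the exponent `netLog`, and the discretisation error 6 of `quad_le_of_net`. The logarithm of the size
of the net is absorbed using d ≤ N. -/
lemma netLog_le (hβ : 100 ≤ β) : 2 * P.netLog β + 6 ≤ P.lam β := by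
  have h1 := P.one_le_lamLog hβ
  have h2 := P.log_two_mul_N_le β
  have h3 := P.d_le_N hβ
  have h4 := P.one_le_d
  have hN := P.one_le_N β
  have h5 : Real.log (2 * (P.N β * P.M.d : ℕ) + 1) ≤ 2 * P.lamLog β := by
    have : Real.log (2 * (P.N β * P.M.d : ℕ) + 1) ≤ 2 * Real.log (2 * (P.N β : ℝ)) := by
      have e : 2 * Real.log (2 * (P.N β : ℝ)) = Real.log ((2 * (P.N β : ℝ)) ^ 2) := by
        rw [Real.log_pow]; norm_num
      rw [e]
      refine Real.log_le_log (by positivity) ?_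
      push_cast
      nlinarith
    linarith
  have h6 := Real.log_two_lt_d9
  rw [lam_eq]
  unfold netLog
  have h7 : P.lamLog β ≤ P.M.d * P.lamLog β := le_mul_of_one_le_left (by linarith) h4
  have h8 := mul_le_mul_of_nonneg_left h5 (by linarith : (0 : ℝ) ≤ P.M.d)
  have h9 : 100 * (P.M.d * P.lamLog β) ≤ β * (P.M.d * P.lamLog β) :=
    mul_le_mul_of_nonneg_right hβ (by nlinarith)
  nlinarith

end Config

end SafeRewardFree
end

/-! ### Nets of the unit ball and exponential moments. -/

noncomputable section
namespace SafeRewardFree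

open scoped ENNReal

/-- Truncation of a real number towards zero to a multiple of `1 / m`. -/
lemma exists_int_trunc {m : ℕ} (hm : 0 < m) {x : ℝ} (hx : |x| ≤ 1) :
    ∃ k : ℤ, k ∈ Finset.Icc (-(m : ℤ)) m ∧ |(k : ℝ) / m| ≤ |x| ∧ |x - k / m| ≤ 1 / m := by
  have hm' : (0 : ℝ) < m := by exact_mod_cast hm
  have pos : ∀ y : ℝ, 0 ≤ y → y ≤ 1 → ∃ k : ℤ, 0 ≤ k ∧ k ≤ m ∧ (k : ℝ) / m ≤ y ∧
      y - k / m ≤ 1 / m := by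
    intro y h0 h1
    refine ⟨⌊y * m⌋, Int.floor_nonneg.2 (by positivity), ?_, ?_, ?_⟩
    · have : (⌊y * m⌋ : ℝ) ≤ m := (Int.floor_le _).trans (by nlinarith)
      exact_mod_cast this
    · rw [div_le_iff₀ hm']; exact Int.floor_le _
    · rw [sub_le_iff_le_add, ← add_div, le_div_iff₀ hm', add_comm]
      exact (Int.lt_floor_add_one _).le
  rcases le_total 0 x with h | h
  · obtain ⟨k, k0, k1, k2, k3⟩ := pos x h (by rwa [abs_of_nonneg h] at hx)
    have hk : (0 : ℝ) ≤ (k : ℝ) / m := div_nonneg (by exact_mod_cast k0) hm'.le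
    refine ⟨k, Finset.mem_Icc.2 ⟨by omega, k1⟩, ?_, ?_⟩
    · rwa [abs_of_nonneg hk, abs_of_nonneg h]
    · rwa [abs_of_nonneg (by linarith)]
  · obtain ⟨k, k0, k1, k2, k3⟩ := pos (-x) (by linarith) (by rwa [abs_of_nonpos h] at hx)
    have hk : (0 : ℝ) ≤ (k : ℝ) / m := div_nonneg (by exact_mod_cast k0) hm'.le
    refine ⟨-k, Finset.mem_Icc.2 ⟨by omega, by omega⟩, ?_, ?_⟩
    · push_cast
      rw [neg_div, abs_neg, abs_of_nonneg hk, abs_of_nonpos h]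
      exact k2
    · push_cast
      rw [neg_div, sub_neg_eq_add, abs_of_nonpos (by linarith)]
      linarith

/-- A finite net of the unit ball. -/
lemma exists_net {d : ℕ} (hd : 0 < d) {N : ℕ} (hN : 0 < N) :
    ∃ T : Finset (EuclideanSpace ℝ (Fin d)), T.card ≤ (2 * (N * d) + 1) ^ d ∧
      (∀ y ∈ T, ‖y‖ ≤ 1) ∧ ∀ x : EuclideanSpace ℝ (Fin d), ‖x‖ ≤ 1 →
        ∃ y ∈ T, ‖x - y‖ ≤ 1 / N := by
  classical
  set m := N * d with hm
  have hm0 : 0 < m := Nat.mul_pos hN hd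
  have hN' : (0 : ℝ) < N := by exact_mod_cast hN
  have hd' : (1 : ℝ) ≤ d := by exact_mod_cast hd
  set f : (Fin d → ℤ) → EuclideanSpace ℝ (Fin d) := fun k => WithLp.toLp 2 fun j => (k j : ℝ) / m
  refine ⟨((Fintype.piFinset fun _ => Finset.Icc (-(m : ℤ)) m).image f).filter fun y => ‖y‖ ≤ 1,
    ?_, fun y hy => (Finset.mem_filter.1 hy).2, fun x hx => ?_⟩
  · refine (Finset.card_filter_le _ _).trans (Finset.card_image_le.trans ?_)
    rw [Fintype.card_piFinset]
    simp only [Int.card_Icc, Finset.prod_const, Finset.card_univ, Fintype.card_fin]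
    refine Nat.pow_le_pow_left ?_ d
    omega
  · have hxj : ∀ j, |x j| ≤ 1 := fun j => by
      have := PiLp.norm_apply_le x j
      rw [Real.norm_eq_abs] at this
      exact this.trans hx
    choose k hk1 hk2 hk3 using fun j => exists_int_trunc hm0 (hxj j)
    refine ⟨f k, Finset.mem_filter.2 ⟨Finset.mem_image_of_mem _ (Fintype.mem_piFinset.2 hk1), ?_⟩, ?_⟩
    -- Truncation towards zero does not increase any coordinate in modulus, so the grid point stays
    -- in the unit ball.
    · refine le_trans ?_ hx
      rw [EuclideanSpace.norm_eq, EuclideanSpace.norm_eq]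
      refine Real.sqrt_le_sqrt (Finset.sum_le_sum fun j _ => ?_)
      rw [Real.norm_eq_abs, Real.norm_eq_abs]
      exact pow_le_pow_left₀ (abs_nonneg _) (hk2 j) 2
    · rw [EuclideanSpace.norm_eq, Real.sqrt_le_left (by positivity)]
      have h1 : ∀ j : Fin d, ‖(x - f k) j‖ ^ 2 ≤ (1 / (N * d : ℝ)) ^ 2 := by
        intro j
        rw [Real.norm_eq_abs]
        refine pow_le_pow_left₀ (abs_nonneg _) ?_ 2
        have := hk3 j
        simpa [hm, f] using this
      refine (Finset.sum_le_sum fun j _ => h1 j).trans ?_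
      simp only [Finset.sum_const, Finset.card_univ, Fintype.card_fin, nsmul_eq_mul]
      -- Coordinate errors 1/(Nd) give a Euclidean error of √d/(Nd), which is at most 1/N.
      have h2 : (d : ℝ) * (1 / (N * d)) ^ 2 = (1 / N) ^ 2 / d := by field_simp
      rw [h2]
      exact div_le_self (by positivity) hd'

lemma abs_sq_inner_sub_le {d : ℕ} {x y v : EuclideanSpace ℝ (Fin d)} {r : ℝ} (hx : ‖x‖ ≤ 1)
    (hy : ‖y‖ ≤ 1) (hv : ‖v‖ ≤ 1) (hxy : ‖x - y‖ ≤ r) :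
    |inner ℝ x v ^ 2 - inner ℝ y v ^ 2| ≤ 2 * r := by
  have h1 : inner ℝ x v ^ 2 - inner ℝ y v ^ 2 = inner ℝ (x - y) v * inner ℝ (x + y) v := by
    rw [inner_sub_left, inner_add_left]; ring
  have h2 := abs_real_inner_le_norm (x - y) v
  have h3 := abs_real_inner_le_norm (x + y) v
  have h4 := norm_add_le x y
  have hr : 0 ≤ r := (norm_nonneg _).trans hxy
  have h5 : |inner ℝ (x - y) v| ≤ r :=
    h2.trans ((mul_le_mul hxy hv (norm_nonneg _) hr).trans_eq (mul_one r))
  have h6 : |inner ℝ (x + y) v| ≤ 2 :=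
    h3.trans ((mul_le_mul (h4.trans (by linarith)) hv (norm_nonneg _) zero_le_two).trans_eq
      (mul_one 2))
  rw [h1, abs_mul]
  nlinarith [abs_nonneg (inner ℝ (x - y) v), abs_nonneg (inner ℝ (x + y) v)]

/-- By convexity the exponential lies below its chord over [0, 1], whose slope e - 1 is less than 2.
-/
lemma exp_le_one_add_two_mul {x : ℝ} (h0 : 0 ≤ x) (h1 : x ≤ 1) : Real.exp x ≤ 1 + 2 * x := by
  have h := convexOn_exp.2 (Set.mem_univ (0 : ℝ)) (Set.mem_univ (1 : ℝ))
    (show 0 ≤ 1 - x by linarith) h0 (by ring)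
  simp only [smul_eq_mul, mul_zero, mul_one, zero_add, Real.exp_zero] at h
  nlinarith [Real.exp_one_lt_d9]

lemma exp_neg_le_one_sub_half {x : ℝ} (h0 : 0 ≤ x) (h1 : x ≤ 1) :
    Real.exp (-x) ≤ 1 - x / 2 := by
  have h := convexOn_exp.2 (Set.mem_univ (0 : ℝ)) (Set.mem_univ (-1 : ℝ))
    (show 0 ≤ 1 - x by linarith) h0 (by ring)
  simp only [smul_eq_mul, mul_zero, mul_neg, mul_one, zero_add, Real.exp_zero] at h
  have h3 : Real.exp (-1) ≤ 1 / 2 := by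
    rw [Real.exp_neg, inv_eq_one_div]
    exact one_div_le_one_div_of_le (by norm_num) (by linarith [Real.exp_one_gt_d9])
  nlinarith

lemma prod_ofReal_mul_exp {ι : Type*} (s : Finset ι) {f : ι → ℝ} (g : ι → ℝ)
    (hf : ∀ i ∈ s, 0 ≤ f i) :
    ∏ i ∈ s, ENNReal.ofReal (f i) * ENNReal.ofReal (Real.exp (g i)) =
      ENNReal.ofReal ((∏ i ∈ s, f i) * Real.exp (∑ i ∈ s, g i)) := by
  rw [Real.exp_sum, ← Finset.prod_mul_distrib, ENNReal.ofReal_prod_of_nonneg fun i hi =>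
    mul_nonneg (hf i hi) (Real.exp_pos _).le]
  exact Finset.prod_congr rfl fun i hi => (ENNReal.ofReal_mul (hf i hi)).symm

lemma ennreal_log_prod {ι : Type*} (s : Finset ι) (f : ι → ℝ≥0∞) :
    ∑ i ∈ s, ENNReal.log (f i) = ENNReal.log (∏ i ∈ s, f i) := by
  classical
  induction s using Finset.induction_on with
  | empty => simp
  | insert a s ha ih => rw [Finset.sum_insert ha, Finset.prod_insert ha, ENNReal.log_mul_add, ih]

namespace Choices

variable {S A : Type*} [MeasurableSpace S] [Fintype A] {P : Config S A} {β : ℝ}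
  {R : Choices P β} [MeasurableSpace A] [MeasurableSingletonClass A]

/-- The likelihood ratio of the data for step `h` is exponentially large with small
probability only. -/
lemma IsRun.law_likelihood_le (hR : R.IsRun) (n : ℕ) (h : Fin P.M.H) {p : S → A → S → ℝ}
    (hp : IsDensity P.M.base p) {t : ℝ} (ht : 0 < t) :
    R.law {ω | t⁻¹ ≤ (∏ i : Fin (P.N β) with i.val < n,
      √(p (epState P.M.init (ω i h) h) (ω i h h).1 (ω i h h).2 /
        P.M.trans h (epState P.M.init (ω i h) h) (ω i h h).1 (ω i h h).2)) *
      Real.exp (∑ i : Fin (P.N β) with i.val < n,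
        R.occB i ω h h fun s a => 1 - bhatta P.M.base p (P.M.trans h) s a)} ≤
    ENNReal.ofReal t := by
  have hq := P.M.trans_isDensity h
  have hb := bhatta_bddMeas hp hq
  -- Under the true density the mean of √(p/p*) is the Bhattacharyya coefficient b, which is 1 + q
  -- with q = -(1 - b). Where p* vanishes both integrands are zero, since division by zero gives
  -- zero.
  have key := hR.law_ge_le n h h
    (G := fun s a s' => ENNReal.ofReal √(p s a s' / P.M.trans h s a s'))
    (fun a => ((hp.meas a).div (hq.meas a)).sqrt.ennreal_ofReal) hb (fun s a => bhatta_nonneg s a)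
    (fun s a => by
      rw [bhatta, ofReal_integral_eq_lintegral_ofReal (integrable_sqrt_mul hp hq s a)
        (Filter.Eventually.of_forall fun s' => Real.sqrt_nonneg _)]
      refine lintegral_congr fun s' => ?_
      rw [← ENNReal.ofReal_mul (hq.nonneg _ _ _)]
      congr 1
      have h1 := hq.nonneg s a s'
      rcases h1.lt_or_eq with h1 | h1
      · nth_rewrite 1 [← Real.sqrt_sq h1.le]
        rw [← Real.sqrt_mul (sq_nonneg _)]
        congr 1
        field_simp
      · simp [← h1])
    (q := fun s a => -1 * (1 - bhatta P.M.base p (P.M.trans h) s a))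
    (fun a => ((BddMeas.const 1).sub (hb a)).const_mul _) (fun s a => by linarith) ht
  refine le_trans (measure_mono fun ω hω => ?_) key
  simp only [Set.mem_ofPred_eq] at hω ⊢
  rw [prod_ofReal_mul_exp _ _ fun i _ => Real.sqrt_nonneg _]
  refine ENNReal.ofReal_le_ofReal (hω.trans_eq ?_)
  congr 3
  funext i
  rw [occB, occB, occ_const_mul]
  ring

/-- Multiplicative Chernoff bounds in both directions. Giving up a factor 2 leaves a deviation of
order log(1/t) that does not grow with `n`; the regulariser `λ` can therefore absorb it. -/
lemma IsRun.law_feature_le (hR : R.IsRun) (n : ℕ) (k h : Fin P.M.H) {X : S → A → ℝ}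
    (hX : ∀ a, Measurable fun s => X s a) (h01 : ∀ s a, X s a ∈ Set.Icc (0 : ℝ) 1)
    {t : ℝ} (ht : 0 < t) :
    R.law {ω | 2 * (∑ i : Fin (P.N β) with i.val < n, R.occB i ω k h X) + Real.log t⁻¹ ≤
      ∑ i : Fin (P.N β) with i.val < n, X (epState P.M.init (ω i k) h) (ω i k h).1} ≤
        ENNReal.ofReal t ∧
    R.law {ω | 2 * (∑ i : Fin (P.N β) with i.val < n,
      X (epState P.M.init (ω i k) h) (ω i k h).1) + 2 * Real.log t⁻¹ ≤
      ∑ i : Fin (P.N β) with i.val < n, R.occB i ω k h X} ≤ ENNReal.ofReal t := by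
  have hXb : ∀ a, BddMeas fun s => X s a := fun a =>
    BddMeas.of_mem_Icc (hX a) fun s => h01 s a
  have hden := P.M.trans_isDensity h
  have hone : ∀ s a, ∫⁻ s', ENNReal.ofReal (P.M.trans h s a s') ∂P.M.base = 1 := fun s a => by
    rw [← ofReal_integral_eq_lintegral_ofReal (hden.integrable _ _)
      (Filter.Eventually.of_forall fun s' => hden.nonneg _ _ _), hden.integral, ENNReal.ofReal_one]
  have hlog : Real.log t⁻¹ = Real.log t⁻¹ := rfl
  constructor
  · have key := hR.law_ge_le n k h (G := fun s a _ => ENNReal.ofReal (Real.exp (X s a)))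
      (fun a => ((hX a).comp measurable_fst).exp.ennreal_ofReal)
      (g := fun s a => Real.exp (X s a))
      (fun a => (hXb a).comp_of_continuous Real.continuous_exp) (fun s a => (Real.exp_pos _).le)
      (fun s a => by
        rw [lintegral_mul_const' _ _ ENNReal.ofReal_ne_top, hone, one_mul])
      (q := fun s a => 2 * X s a) (fun a => (hXb a).const_mul 2)
      (fun s a => exp_le_one_add_two_mul (h01 s a).1 (h01 s a).2) ht
    refine le_trans (measure_mono fun ω hω => ?_) key
    simp only [Set.mem_ofPred_eq] at hω ⊢
    rw [prod_ofReal_mul_exp _ _ fun i _ => (Real.exp_pos _).le]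
    refine ENNReal.ofReal_le_ofReal ?_
    rw [← Real.exp_sum, ← Real.exp_add, ← Real.log_le_iff_le_exp (inv_pos.2 ht)]
    simp only [occB, occ_const_mul, Finset.sum_neg_distrib, ← Finset.mul_sum]
    simp only [occB] at hω
    linarith
  · have key := hR.law_ge_le n k h (G := fun s a _ => ENNReal.ofReal (Real.exp (-X s a)))
      (fun a => ((hX a).comp measurable_fst).neg.exp.ennreal_ofReal)
      (g := fun s a => Real.exp (-X s a))
      (fun a => (hXb a).neg.comp_of_continuous Real.continuous_exp)
      (fun s a => (Real.exp_pos _).le)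
      (fun s a => by
        rw [lintegral_mul_const' _ _ ENNReal.ofReal_ne_top, hone, one_mul])
      (q := fun s a => (-1 / 2) * X s a) (fun a => (hXb a).const_mul _)
      (fun s a => (exp_neg_le_one_sub_half (h01 s a).1 (h01 s a).2).trans_eq (by ring)) ht
    refine le_trans (measure_mono fun ω hω => ?_) key
    simp only [Set.mem_ofPred_eq] at hω ⊢
    rw [prod_ofReal_mul_exp _ _ fun i _ => (Real.exp_pos _).le]
    refine ENNReal.ofReal_le_ofReal ?_
    rw [← Real.exp_sum, ← Real.exp_add, ← Real.log_le_iff_le_exp (inv_pos.2 ht)]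
    simp only [occB, occ_const_mul, Finset.sum_neg_distrib, ← Finset.mul_sum]
    simp only [occB] at hω
    linarith

end Choices

end SafeRewardFree
end

/-! ### The good event and its probability. -/

noncomputable section
namespace SafeRewardFree

open scoped ENNReal

lemma measure_biUnion_le_of_forall_le {Ω ι : Type*} [MeasurableSpace Ω] (μ : Measure Ω)
    (s : Finset ι) (B : ι → Set Ω) {t : ℝ}
    (h : ∀ i ∈ s, μ (B i) ≤ ENNReal.ofReal t) :
    μ (⋃ i ∈ s, B i) ≤ ENNReal.ofReal (s.card * t) := by
  refine (measure_biUnion_finset_le s B).trans ((Finset.sum_le_sum h).trans ?_)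
  rw [Finset.sum_const, nsmul_eq_mul, ENNReal.ofReal_mul (Nat.cast_nonneg _),
    ENNReal.ofReal_natCast]

/-- Extension of a comparison of quadratic forms from a net to the whole space. -/
lemma quad_le_of_net {d : ℕ} {F G : EuclideanSpace ℝ (Fin d) → ℝ}
    (hF : ∀ (c : ℝ) x, F (c • x) = c ^ 2 * F x) (hG : ∀ (c : ℝ) x, G (c • x) = c ^ 2 * G x)
    {r : ℝ} (hFr : ∀ x y, ‖x‖ ≤ 1 → ‖y‖ ≤ 1 → ‖x - y‖ ≤ r → |F x - F y| ≤ 2)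
    (hGr : ∀ x y, ‖x‖ ≤ 1 → ‖y‖ ≤ 1 → ‖x - y‖ ≤ r → |G x - G y| ≤ 2)
    {T : Finset (EuclideanSpace ℝ (Fin d))} (hT1 : ∀ y ∈ T, ‖y‖ ≤ 1)
    (hT : ∀ x : EuclideanSpace ℝ (Fin d), ‖x‖ ≤ 1 → ∃ y ∈ T, ‖x - y‖ ≤ r) {l : ℝ}
    (hFG : ∀ y ∈ T, F y ≤ 2 * G y + l) (x : EuclideanSpace ℝ (Fin d)) :
    F x ≤ 2 * G x + (l + 6) * ‖x‖ ^ 2 := by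
  -- Passing to the net costs 2 for `F` and twice 2 for `G`, together 6. Homogeneity of degree two
  -- then reaches every vector.
  have unit : ∀ x : EuclideanSpace ℝ (Fin d), ‖x‖ ≤ 1 → F x ≤ 2 * G x + (l + 6) := by
    intro x hx
    obtain ⟨y, hy, hxy⟩ := hT x hx
    have h1 := (abs_le.1 (hFr x y hx (hT1 y hy) hxy)).2
    have h2 := (abs_le.1 (hGr x y hx (hT1 y hy) hxy)).1
    have h3 := hFG y hy
    linarith
  rcases eq_or_ne x 0 with rfl | hx
  · have h1 := hF 0 0
    have h2 := hG 0 0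
    simp only [zero_smul, ne_eq, OfNat.ofNat_ne_zero, not_false_eq_true, zero_pow, zero_mul] at h1 h2
    simp [h1, h2]
  · have hn : 0 < ‖x‖ := norm_pos_iff.2 hx
    have h1 := unit (‖x‖⁻¹ • x) (by rw [norm_smul, norm_inv, norm_norm, inv_mul_cancel₀ hn.ne'])
    rw [hF, hG] at h1
    have h2 : 0 < ‖x‖ ^ 2 := by positivity
    have h3 := mul_le_mul_of_nonneg_left h1 h2.le
    have e : ‖x‖ ^ 2 * (‖x‖⁻¹ ^ 2 * F x) = F x := by field_simp
    have e' : ‖x‖ ^ 2 * (2 * (‖x‖⁻¹ ^ 2 * G x) + (l + 6)) = 2 * G x + (l + 6) * ‖x‖ ^ 2 := by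
      field_simp
    rwa [e, e'] at h3

namespace Choices

variable {S A : Type*} [MeasurableSpace S] [Fintype A] {P : Config S A} {β : ℝ}
  {R : Choices P β} [MeasurableSpace A] [MeasurableSingletonClass A]

lemma sq_inner_mem_Icc {d : ℕ} {x v : EuclideanSpace ℝ (Fin d)} (hx : ‖x‖ ≤ 1) (hv : ‖v‖ ≤ 1) :
    inner ℝ x v ^ 2 ∈ Set.Icc (0 : ℝ) 1 := by
  refine ⟨sq_nonneg _, ?_⟩
  rw [sq_le_one_iff_abs_le_one]
  exact (abs_real_inner_le_norm x v).trans (mul_le_one₀ hx (norm_nonneg _) hv)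

lemma measurable_feature {φ : S → A → EuclideanSpace ℝ (Fin P.M.d)} (hφ : φ ∈ P.models.Φ) (a : A) :
    Measurable fun s => φ s a :=
  (P.models.isLowRankStep φ hφ _ (P.models.mu_mem 0 P.M.H_pos)).measurable_feature a

lemma norm_feature_le {φ : S → A → EuclideanSpace ℝ (Fin P.M.d)} (hφ : φ ∈ P.models.Φ) (s : S)
    (a : A) : ‖φ s a‖ ≤ 1 :=
  (P.models.isLowRankStep φ hφ _ (P.models.mu_mem 0 P.M.H_pos)).norm_feature_le s a

lemma sq_inner_bddMeas {φ : S → A → EuclideanSpace ℝ (Fin P.M.d)} (hφ : φ ∈ P.models.Φ)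
    (x : EuclideanSpace ℝ (Fin P.M.d)) (a : A) : BddMeas fun s => inner ℝ x (φ s a) ^ 2 := by
  refine BddMeas.of_mem_Icc (a := 0) (b := ‖x‖ ^ 2)
    ((measurable_const.inner (measurable_feature hφ a)).pow_const 2)
    fun s => ⟨sq_nonneg _, ?_⟩
  rw [sq_le_sq, abs_norm]
  exact (abs_real_inner_le_norm _ _).trans
    (mul_le_of_le_one_right (norm_nonneg _) (norm_feature_le hφ s a))

lemma card_filter_lt_le (n : ℕ) (β : ℝ) :
    ((Finset.univ.filter fun i : Fin (P.N β) => i.val < n).card : ℝ) ≤ P.N β := by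
  have := Finset.card_filter_le (Finset.univ : Finset (Fin (P.N β))) fun i => i.val < n
  rw [Finset.card_univ, Fintype.card_fin] at this
  exact_mod_cast this

lemma abs_sum_sub_sum_le (n : ℕ) {f g : Fin (P.N β) → ℝ}
    (h : ∀ i, |f i - g i| ≤ 2 * (1 / P.N β)) :
    |(∑ i : Fin (P.N β) with i.val < n, f i) - ∑ i : Fin (P.N β) with i.val < n, g i| ≤ 2 := by
  rw [← Finset.sum_sub_distrib]
  refine (Finset.abs_sum_le_sum_abs _ _).trans ((Finset.sum_le_sum fun i _ => h i).trans ?_)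
  rw [Finset.sum_const, nsmul_eq_mul]
  have h1 := card_filter_lt_le (P := P) n β
  have h2 : (0 : ℝ) < P.N β := by linarith [P.one_le_N β]
  have h3 : (P.N β : ℝ) * (2 * (1 / P.N β)) = 2 := by field_simp
  calc _ ≤ (P.N β : ℝ) * (2 * (1 / P.N β)) := mul_le_mul_of_nonneg_right h1 (by positivity)
    _ = 2 := h3

/-- The good event: the estimated densities are accurate on average over the data distributions,
and the empirical covariances are comparable with the expected ones. -/
structure Good (R : Choices P β) (ω : P.Data β) : Prop where
  tv : ∀ n, 1 ≤ n → n ≤ P.N β → ∀ h : Fin P.M.H,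
    ∑ i : Fin (P.N β) with i.val < n, R.occB i ω h h (fun s a =>
      tvDist P.M.base (R.phat n ω h) (P.M.trans h) s a ^ 2) ≤ 2 * P.ζ β
  cov_le : ∀ n, 1 ≤ n → n ≤ P.N β → ∀ (h : Fin P.M.H) (x : EuclideanSpace ℝ (Fin P.M.d)),
    ∑ i : Fin (P.N β) with i.val < n, inner ℝ x (R.φhat n h ω
      (epState P.M.init (ω i (P.covEpisode h)) h) (ω i (P.covEpisode h) h).1) ^ 2 ≤
    2 * (∑ i : Fin (P.N β) with i.val < n, R.occB i ω (P.covEpisode h) h fun s a =>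
      inner ℝ x (R.φhat n h ω s a) ^ 2) + P.lam β * ‖x‖ ^ 2
  le_cov : ∀ n, 1 ≤ n → n ≤ P.N β → ∀ (h : Fin P.M.H) (x : EuclideanSpace ℝ (Fin P.M.d)),
    ∑ i : Fin (P.N β) with i.val < n, R.occB i ω (P.covEpisode h) h (fun s a =>
      inner ℝ x (R.φhat n h ω s a) ^ 2) ≤
    2 * (∑ i : Fin (P.N β) with i.val < n, inner ℝ x (R.φhat n h ω
      (epState P.M.init (ω i (P.covEpisode h)) h) (ω i (P.covEpisode h) h).1) ^ 2) +
        P.lam β * ‖x‖ ^ 2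

/-- The maximiser is at least as likely as the truth, so the product of root likelihood ratios is at
least one. Outside the rare event of `law_likelihood_le` this forces the sum of the expected 1 - b
to be below ζ, and the squared total variation is at most 2(1 - b). -/
lemma IsRun.sum_tv_le (hR : R.IsRun) {ω : P.Data β}
    (hpos : ∀ (i : Fin (P.N β)) (k j : Fin P.M.H),
      0 < P.M.trans j (epState P.M.init (ω i k) j) (ω i k j).1 (ω i k j).2)
    {n : ℕ} (h1 : 1 ≤ n) (hn : n ≤ P.N β) (h : Fin P.M.H)
    (hω : ¬ (Real.exp (-P.ζ β))⁻¹ ≤ (∏ i : Fin (P.N β) with i.val < n,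
      √(R.phat n ω h (epState P.M.init (ω i h) h) (ω i h h).1 (ω i h h).2 /
        P.M.trans h (epState P.M.init (ω i h) h) (ω i h h).1 (ω i h h).2)) *
      Real.exp (∑ i : Fin (P.N β) with i.val < n,
        R.occB i ω h h fun s a => 1 - bhatta P.M.base (R.phat n ω h) (P.M.trans h) s a)) :
    ∑ i : Fin (P.N β) with i.val < n, R.occB i ω h h (fun s a =>
      tvDist P.M.base (R.phat n ω h) (P.M.trans h) s a ^ 2) ≤ 2 * P.ζ β := by
  have hp : IsDensity P.M.base (R.phat n ω h) :=
    (P.models.isLowRankStep _ (hR.φhat_mem n h1 hn h ω) _ (hR.μhat_mem n h1 hn h ω)).isDensity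
  have hq := P.M.trans_isDensity h
  have hb := bhatta_bddMeas hp hq
  set a : Fin (P.N β) → ℝ := fun i =>
    R.phat n ω h (epState P.M.init (ω i h) h) (ω i h h).1 (ω i h h).2 with ha
  set b : Fin (P.N β) → ℝ := fun i =>
    P.M.trans h (epState P.M.init (ω i h) h) (ω i h h).1 (ω i h h).2 with hbdef
  have ha0 : ∀ i, 0 ≤ a i := fun i => hp.nonneg _ _ _
  have hb0 : ∀ i, 0 < b i := fun i => hpos i h h
  have hmle : ∏ i : Fin (P.N β) with i.val < n, b i ≤ ∏ i : Fin (P.N β) with i.val < n, a i := by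
    have h2 := hR.mle n h1 hn h ω _ (P.models.feature_mem h h.2) _ (P.models.mu_mem h h.2)
    unfold Config.logLik at h2
    rw [ennreal_log_prod, ennreal_log_prod, ENNReal.log_le_log_iff,
      ← ENNReal.ofReal_prod_of_nonneg, ← ENNReal.ofReal_prod_of_nonneg,
      ENNReal.ofReal_le_ofReal_iff] at h2
    · refine le_trans (le_of_eq ?_) (h2.trans (le_of_eq ?_))
      · refine Finset.prod_congr rfl fun i _ => ?_
        simp only [hbdef]
        rw [P.M.trans_eq h.2, P.stateAt_eq]
        rfl
      · refine Finset.prod_congr rfl fun i _ => ?_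
        rw [P.stateAt_eq]
        rfl
    · refine Finset.prod_nonneg fun i _ => ?_
      rw [P.stateAt_eq]
      exact ha0 i
    · intro i _
      rw [P.stateAt_eq]
      exact ha0 i
    · intro i _
      exact (P.M.isLowRankStep h h.2).density_nonneg _ _ _
  have hprod : 1 ≤ ∏ i : Fin (P.N β) with i.val < n, √(a i / b i) := by
    rw [← Real.sqrt_prod _ fun i _ => div_nonneg (ha0 i) (hb0 i).le, Finset.prod_div_distrib,
      Real.one_le_sqrt, one_le_div (Finset.prod_pos fun i _ => hb0 i)]
    exact hmle
  push Not at hω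
  rw [← Real.exp_neg, neg_neg] at hω
  set X := ∑ i : Fin (P.N β) with i.val < n,
    R.occB i ω h h fun s a => 1 - bhatta P.M.base (R.phat n ω h) (P.M.trans h) s a
  have h3 : Real.exp X < Real.exp (P.ζ β) :=
    lt_of_le_of_lt (le_mul_of_one_le_left (Real.exp_pos _).le hprod) hω
  have h4 : X < P.ζ β := Real.exp_lt_exp.1 h3
  have h5 : ∑ i : Fin (P.N β) with i.val < n, R.occB i ω h h (fun s a =>
      tvDist P.M.base (R.phat n ω h) (P.M.trans h) s a ^ 2) ≤ 2 * X := by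
    rw [Finset.mul_sum]
    refine Finset.sum_le_sum fun i _ => ?_
    unfold occB
    rw [← occ_const_mul]
    exact occ_mono P.M.trans_isDensity (fun a => (tvDist_bddMeas hp hq a).pow 2)
      (fun a => ((BddMeas.const 1).sub (hb a)).const_mul 2)
      (fun s a => sq_tvDist_le hp hq s a) _ _ _ _
  linarith

lemma occB_sq_inner_sub_le {φ : S → A → EuclideanSpace ℝ (Fin P.M.d)} (hφ : φ ∈ P.models.Φ)
    (i : ℕ) (ω : P.Data β) (k h : ℕ) {x y : EuclideanSpace ℝ (Fin P.M.d)} {r : ℝ}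
    (hx : ‖x‖ ≤ 1) (hy : ‖y‖ ≤ 1) (hxy : ‖x - y‖ ≤ r) :
    |R.occB i ω k h (fun s a => inner ℝ x (φ s a) ^ 2) -
      R.occB i ω k h (fun s a => inner ℝ y (φ s a) ^ 2)| ≤ 2 * r := by
  unfold occB
  rw [← occ_sub P.M.trans_isDensity (sq_inner_bddMeas hφ x) (sq_inner_bddMeas hφ y), abs_le]
  have hb : ∀ a, BddMeas fun s => inner ℝ x (φ s a) ^ 2 - inner ℝ y (φ s a) ^ 2 := fun a =>
    (sq_inner_bddMeas hφ x a).sub (sq_inner_bddMeas hφ y a)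
  have hab := fun s a => abs_le.1 (abs_sq_inner_sub_le hx hy (norm_feature_le hφ s a) hxy)
  constructor
  · have := occ_mono P.M.trans_isDensity (fun a => BddMeas.const (-(2 * r))) hb
      (fun s a => (hab s a).1) (R.beh i ω k) h 0 P.M.init
    rwa [occ_const P.M.trans_isDensity] at this
  · exact occ_le P.M.trans_isDensity hb (fun s a => (hab s a).2) _ _ _ _

/-- The sums have at most `N` terms, each changing by at most 2/N between a unit vector and its
neighbour in the net. This is why the net has mesh 1/N. -/
lemma quad_compare (hβ : 100 ≤ β) {ω : P.Data β} (n : ℕ) (h : Fin P.M.H)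
    {φ : S → A → EuclideanSpace ℝ (Fin P.M.d)} (hφ : φ ∈ P.models.Φ)
    {T : Finset (EuclideanSpace ℝ (Fin P.M.d))} (hT1 : ∀ y ∈ T, ‖y‖ ≤ 1)
    (hT : ∀ x : EuclideanSpace ℝ (Fin P.M.d), ‖x‖ ≤ 1 → ∃ y ∈ T, ‖x - y‖ ≤ 1 / P.N β)
    (hup : ∀ y ∈ T, ¬ (2 * (∑ i : Fin (P.N β) with i.val < n, R.occB i ω (P.covEpisode h) h
        fun s a => inner ℝ y (φ s a) ^ 2) + Real.log (Real.exp (-P.netLog β))⁻¹ ≤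
      ∑ i : Fin (P.N β) with i.val < n, inner ℝ y (φ
        (epState P.M.init (ω i (P.covEpisode h)) h) (ω i (P.covEpisode h) h).1) ^ 2))
    (hlow : ∀ y ∈ T, ¬ (2 * (∑ i : Fin (P.N β) with i.val < n, inner ℝ y (φ
        (epState P.M.init (ω i (P.covEpisode h)) h) (ω i (P.covEpisode h) h).1) ^ 2) +
          2 * Real.log (Real.exp (-P.netLog β))⁻¹ ≤
      ∑ i : Fin (P.N β) with i.val < n, R.occB i ω (P.covEpisode h) h
        fun s a => inner ℝ y (φ s a) ^ 2)) (x : EuclideanSpace ℝ (Fin P.M.d)) :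
    ∑ i : Fin (P.N β) with i.val < n, inner ℝ x (φ
      (epState P.M.init (ω i (P.covEpisode h)) h) (ω i (P.covEpisode h) h).1) ^ 2 ≤
    2 * (∑ i : Fin (P.N β) with i.val < n, R.occB i ω (P.covEpisode h) h fun s a =>
      inner ℝ x (φ s a) ^ 2) + P.lam β * ‖x‖ ^ 2 ∧
    ∑ i : Fin (P.N β) with i.val < n, R.occB i ω (P.covEpisode h) h (fun s a =>
      inner ℝ x (φ s a) ^ 2) ≤
    2 * (∑ i : Fin (P.N β) with i.val < n, inner ℝ x (φ
      (epState P.M.init (ω i (P.covEpisode h)) h) (ω i (P.covEpisode h) h).1) ^ 2) +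
        P.lam β * ‖x‖ ^ 2 := by
  rw [← Real.exp_neg, Real.log_exp, neg_neg] at hup hlow
  have hnet := P.netLog_le hβ
  have hl0 : 0 ≤ P.netLog β := by
    unfold Config.netLog
    have h1 := P.one_le_lamLog hβ
    have h2 := Real.log_nonneg (show (1 : ℝ) ≤ 2 by norm_num)
    have h3 : 0 ≤ Real.log (2 * ((P.N β * P.M.d : ℕ) : ℝ) + 1) :=
      Real.log_nonneg (by linarith [Nat.cast_nonneg (α := ℝ) (P.N β * P.M.d)])
    positivity
  set F : EuclideanSpace ℝ (Fin P.M.d) → ℝ := fun x =>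
    ∑ i : Fin (P.N β) with i.val < n, inner ℝ x (φ
      (epState P.M.init (ω i (P.covEpisode h)) h) (ω i (P.covEpisode h) h).1) ^ 2 with hFdef
  set G : EuclideanSpace ℝ (Fin P.M.d) → ℝ := fun x =>
    ∑ i : Fin (P.N β) with i.val < n, R.occB i ω (P.covEpisode h) h fun s a =>
      inner ℝ x (φ s a) ^ 2 with hGdef
  have hF : ∀ (c : ℝ) x, F (c • x) = c ^ 2 * F x := by
    intro c x
    simp only [hFdef, Finset.mul_sum, real_inner_smul_left, mul_pow]
  have hG : ∀ (c : ℝ) x, G (c • x) = c ^ 2 * G x := by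
    intro c x
    simp only [hGdef, Finset.mul_sum, real_inner_smul_left, mul_pow, occB, occ_const_mul]
  have hFr : ∀ x y, ‖x‖ ≤ 1 → ‖y‖ ≤ 1 → ‖x - y‖ ≤ 1 / P.N β → |F x - F y| ≤ 2 :=
    fun x y hx hy hxy => abs_sum_sub_sum_le n fun i =>
      abs_sq_inner_sub_le hx hy (norm_feature_le hφ _ _) hxy
  have hGr : ∀ x y, ‖x‖ ≤ 1 → ‖y‖ ≤ 1 → ‖x - y‖ ≤ 1 / P.N β → |G x - G y| ≤ 2 :=
    fun x y hx hy hxy => abs_sum_sub_sum_le n fun i => occB_sq_inner_sub_le hφ _ _ _ _ hx hy hxy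
  have k1 := quad_le_of_net hF hG hFr hGr hT1 hT (l := P.netLog β)
    (fun y hy => (not_le.1 (hup y hy)).le) x
  have k2 := quad_le_of_net hG hF hGr hFr hT1 hT (l := 2 * P.netLog β)
    (fun y hy => (not_le.1 (hlow y hy)).le) x
  have hx0 : 0 ≤ ‖x‖ ^ 2 := sq_nonneg _
  constructor
  · refine k1.trans ?_
    have := mul_le_mul_of_nonneg_right (show P.netLog β + 6 ≤ P.lam β by linarith) hx0
    linarith
  · refine k2.trans ?_
    have := mul_le_mul_of_nonneg_right hnet hx0
    linarith

/-- The estimates depend on the data, so the union bound runs over the whole model class, all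
iterations and all steps. The definition of ζ makes the likelihood events cost exactly δ/2; each of
the two families of covariance events costs at most δ/4. -/
lemma IsRun.exists_good_event (hR : R.IsRun) (hβ : 100 ≤ β) :
    ∃ E : Set (P.Data β), MeasurableSet E ∧ ENNReal.ofReal (1 - P.δ) ≤ R.law E ∧
      ∀ ω ∈ E, R.Good ω := by
  classical
  have hprob := hR.isProbabilityMeasure_law
  have hN1 : 0 < P.N β := (P.N_spec β).1
  obtain ⟨T, hTcard, hT1, hT⟩ := exists_net P.d_pos hN1
  have hδ := P.δ_mem
  set B0 : Set (P.Data β) := {ω | ¬ ∀ (i : Fin (P.N β)) (k j : Fin P.M.H),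
    0 < P.M.trans j (epState P.M.init (ω i k) j) (ω i k j).1 (ω i k j).2}
  have hB0 : R.law B0 = 0 := hR.ae_density_pos
  set I1 := Finset.Icc 1 (P.N β) ×ˢ (Finset.univ : Finset (Fin P.M.H)) ×ˢ
    P.models.Φ ×ˢ P.models.Ψ with hI1
  set I2 := Finset.Icc 1 (P.N β) ×ˢ (Finset.univ : Finset (Fin P.M.H)) ×ˢ
    P.models.Φ ×ˢ T with hI2
  set B1 : (ℕ × Fin P.M.H × (S → A → EuclideanSpace ℝ (Fin P.M.d)) ×
      (S → EuclideanSpace ℝ (Fin P.M.d))) → Set (P.Data β) := fun y =>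
    {ω | (Real.exp (-P.ζ β))⁻¹ ≤ (∏ i : Fin (P.N β) with i.val < y.1,
      √(inner ℝ (y.2.2.1 (epState P.M.init (ω i y.2.1) y.2.1) (ω i y.2.1 y.2.1).1)
        (y.2.2.2 (ω i y.2.1 y.2.1).2) /
        P.M.trans y.2.1 (epState P.M.init (ω i y.2.1) y.2.1) (ω i y.2.1 y.2.1).1
          (ω i y.2.1 y.2.1).2)) *
      Real.exp (∑ i : Fin (P.N β) with i.val < y.1,
        R.occB i ω y.2.1 y.2.1 fun s a => 1 - bhatta P.M.base
          (fun s a s' => inner ℝ (y.2.2.1 s a) (y.2.2.2 s')) (P.M.trans y.2.1) s a)} with hB1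
  set B2 : (ℕ × Fin P.M.H × (S → A → EuclideanSpace ℝ (Fin P.M.d)) ×
      EuclideanSpace ℝ (Fin P.M.d)) → Set (P.Data β) := fun y =>
    {ω | 2 * (∑ i : Fin (P.N β) with i.val < y.1, R.occB i ω (P.covEpisode y.2.1) y.2.1
        fun s a => inner ℝ y.2.2.2 (y.2.2.1 s a) ^ 2) + Real.log (Real.exp (-P.netLog β))⁻¹ ≤
      ∑ i : Fin (P.N β) with i.val < y.1, inner ℝ y.2.2.2 (y.2.2.1
        (epState P.M.init (ω i (P.covEpisode y.2.1)) y.2.1)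
          (ω i (P.covEpisode y.2.1) y.2.1).1) ^ 2} with hB2
  set B3 : (ℕ × Fin P.M.H × (S → A → EuclideanSpace ℝ (Fin P.M.d)) ×
      EuclideanSpace ℝ (Fin P.M.d)) → Set (P.Data β) := fun y =>
    {ω | 2 * (∑ i : Fin (P.N β) with i.val < y.1, inner ℝ y.2.2.2 (y.2.2.1
        (epState P.M.init (ω i (P.covEpisode y.2.1)) y.2.1)
          (ω i (P.covEpisode y.2.1) y.2.1).1) ^ 2) + 2 * Real.log (Real.exp (-P.netLog β))⁻¹ ≤
      ∑ i : Fin (P.N β) with i.val < y.1, R.occB i ω (P.covEpisode y.2.1) y.2.1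
        fun s a => inner ℝ y.2.2.2 (y.2.2.1 s a) ^ 2} with hB3
  have h1 : R.law (⋃ y ∈ I1, B1 y) ≤ ENNReal.ofReal (P.δ / 2) := by
    refine (measure_biUnion_le_of_forall_le R.law I1 B1 (t := Real.exp (-P.ζ β)) ?_).trans
      (ENNReal.ofReal_le_ofReal ?_)
    · rintro ⟨n, h, φ, μ⟩ hy
      simp only [hI1, Finset.mem_product] at hy
      exact hR.law_likelihood_le n h (P.models.isLowRankStep φ hy.2.2.1 μ hy.2.2.2).isDensity
        (Real.exp_pos _)
    · have hc : (0 : ℝ) < 2 * P.models.Φ.card * P.models.Ψ.card * P.N β * P.M.H / P.δ := by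
        have a1 := P.one_le_card_Φ
        have a2 := P.one_le_card_Ψ
        have a3 := P.one_le_H
        have a4 := P.one_le_N β
        have a5 := hδ.1
        positivity
      rw [Real.exp_neg, Config.ζ, Config.logTerm, Real.exp_log hc]
      simp only [hI1, Finset.card_product, Nat.card_Icc, Finset.card_univ, Fintype.card_fin,
        Nat.add_sub_cancel]
      push_cast
      have a1 := P.one_le_card_Φ
      have a2 := P.one_le_card_Ψ
      have a3 := P.one_le_H
      have a4 := P.one_le_N β
      have a5 := hδ.1
      apply le_of_eq
      field_simp
  have hcard2 : (I2.card : ℝ) * Real.exp (-P.netLog β) ≤ P.δ / 4 := by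
    have a1 := P.one_le_card_Φ
    have a3 := P.one_le_H
    have a4 := P.one_le_N β
    have a5 := hδ.1
    have hc : (0 : ℝ) < 2 * P.N β * P.M.H * P.models.Φ.card / P.δ := by positivity
    have hm : (0 : ℝ) < 2 * (P.N β * P.M.d : ℕ) + 1 := by positivity
    have e1 : Real.exp (P.netLog β) = (2 * P.N β * P.M.H * P.models.Φ.card / P.δ) * 2 *
        (2 * (P.N β * P.M.d : ℕ) + 1) ^ P.M.d := by
      rw [Config.netLog, Config.lamLog, Real.exp_add, Real.exp_add, Real.exp_log hc,
        Real.exp_log two_pos, ← Real.log_pow, Real.exp_log (by positivity)]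
    have e2 : (T.card : ℝ) ≤ (2 * (P.N β * P.M.d : ℕ) + 1) ^ P.M.d := by exact_mod_cast hTcard
    rw [Real.exp_neg, e1, ← div_eq_mul_inv, div_le_iff₀ (by positivity)]
    simp only [hI2, Finset.card_product, Nat.card_Icc, Finset.card_univ, Fintype.card_fin,
      Nat.add_sub_cancel]
    rw [Nat.cast_mul, Nat.cast_mul, Nat.cast_mul]
    have e3 : P.δ / 4 * (2 * P.N β * P.M.H * P.models.Φ.card / P.δ * 2 *
        (2 * ((P.N β * P.M.d : ℕ) : ℝ) + 1) ^ P.M.d) =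
        P.N β * (P.M.H * (P.models.Φ.card * (2 * ((P.N β * P.M.d : ℕ) : ℝ) + 1) ^ P.M.d)) := by
      field_simp
      ring
    rw [e3]
    gcongr
  have hfeat : ∀ φ ∈ P.models.Φ, ∀ y ∈ T, ∀ (n : ℕ) (h : Fin P.M.H), _ := fun φ hφ y hy n h =>
    hR.law_feature_le n (P.covEpisode h) h (X := fun s a => inner ℝ y (φ s a) ^ 2)
        (fun a => (sq_inner_bddMeas hφ y a).meas)
        (fun s a => sq_inner_mem_Icc (hT1 y hy) (norm_feature_le hφ s a))
        (Real.exp_pos (-P.netLog β))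
  have h2 : R.law (⋃ y ∈ I2, B2 y) ≤ ENNReal.ofReal (P.δ / 4) := by
    refine (measure_biUnion_le_of_forall_le R.law I2 B2 (t := Real.exp (-P.netLog β)) ?_).trans
      (ENNReal.ofReal_le_ofReal hcard2)
    rintro ⟨n, h, φ, y⟩ hy
    simp only [hI2, Finset.mem_product] at hy
    exact (hfeat φ hy.2.2.1 y hy.2.2.2 n h).1
  have h3 : R.law (⋃ y ∈ I2, B3 y) ≤ ENNReal.ofReal (P.δ / 4) := by
    refine (measure_biUnion_le_of_forall_le R.law I2 B3 (t := Real.exp (-P.netLog β)) ?_).trans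
      (ENNReal.ofReal_le_ofReal hcard2)
    rintro ⟨n, h, φ, y⟩ hy
    simp only [hI2, Finset.mem_product] at hy
    exact (hfeat φ hy.2.2.1 y hy.2.2.2 n h).2
  set B := B0 ∪ ((⋃ y ∈ I1, B1 y) ∪ ((⋃ y ∈ I2, B2 y) ∪ ⋃ y ∈ I2, B3 y)) with hB
  have hBδ : R.law B ≤ ENNReal.ofReal P.δ := by
    have e : ENNReal.ofReal P.δ = 0 + (ENNReal.ofReal (P.δ / 2) + (ENNReal.ofReal (P.δ / 4) +
        ENNReal.ofReal (P.δ / 4))) := by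
      have a5 := hδ.1
      rw [zero_add, ← ENNReal.ofReal_add (by positivity) (by positivity),
        ← ENNReal.ofReal_add (by positivity) (by positivity)]
      congr 1
      ring
    rw [e]
    refine (measure_union_le _ _).trans (add_le_add hB0.le ?_)
    refine (measure_union_le _ _).trans (add_le_add h1 ?_)
    exact (measure_union_le _ _).trans (add_le_add h2 h3)
  -- A measurable hull of the bad set has the same measure, so measurability of the bad events need
  -- not be checked.
  refine ⟨(toMeasurable R.law B)ᶜ, (measurableSet_toMeasurable _ _).compl, ?_, fun ω hω => ?_⟩
  · rw [prob_compl_eq_one_sub (measurableSet_toMeasurable _ _), measure_toMeasurable,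
      ENNReal.ofReal_sub _ hδ.1.le, ENNReal.ofReal_one]
    exact tsub_le_tsub_left hBδ 1
  · have hωB : ω ∉ B := fun h => hω (subset_toMeasurable _ _ h)
    simp only [hB, Set.mem_union, not_or] at hωB
    obtain ⟨g0, g1, g2, g3⟩ := hωB
    have hpos : ∀ (i : Fin (P.N β)) (k j : Fin P.M.H),
        0 < P.M.trans j (epState P.M.init (ω i k) j) (ω i k j).1 (ω i k j).2 := not_not.1 g0
    simp only [Set.mem_iUnion, not_exists] at g1 g2 g3
    have hcov : ∀ n, 1 ≤ n → n ≤ P.N β → ∀ h : Fin P.M.H, _ := fun n hn1 hn h =>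
      quad_compare (R := R) hβ (ω := ω) n h (hR.φhat_mem n hn1 hn h ω) hT1 hT
        (fun y hy => g2 (n, h, R.φhat n h ω, y) (by
          simp only [hI2, Finset.mem_product, Finset.mem_Icc, Finset.mem_univ, true_and]
          exact ⟨⟨hn1, hn⟩, hR.φhat_mem n hn1 hn h ω, hy⟩))
        (fun y hy => g3 (n, h, R.φhat n h ω, y) (by
          simp only [hI2, Finset.mem_product, Finset.mem_Icc, Finset.mem_univ, true_and]
          exact ⟨⟨hn1, hn⟩, hR.φhat_mem n hn1 hn h ω, hy⟩))
    refine ⟨fun n hn1 hn h => ?_, fun n hn1 hn h x => (hcov n hn1 hn h x).1,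
      fun n hn1 hn h x => (hcov n hn1 hn h x).2⟩
    exact hR.sum_tv_le hpos hn1 hn h (g1 (n, h, R.φhat n h ω, R.μhat n h ω) (by
      simp only [hI1, Finset.mem_product, Finset.mem_Icc, Finset.mem_univ, true_and]
      exact ⟨⟨hn1, hn⟩, hR.φhat_mem n hn1 hn h ω, hR.μhat_mem n hn1 hn h ω⟩))

end Choices

end SafeRewardFree
end

/-! ### Simulation lemmas: model error against truncated bonus. -/

noncomputable section
namespace SafeRewardFree

variable {S A : Type*} [MeasurableSpace S] [Fintype A] {ν : Measure S} [SigmaFinite ν]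
  {p q : ℕ → S → A → S → ℝ} {b f u : ℕ → S → A → ℝ} {H : ℕ} {s₀ : S}

/-- One step of the simulation lemma. -/
theorem abs_bval_succ_sub_le (π : MarkovPolicy S A) (k h : ℕ) (s : S) :
    |bval ν id p u π.prob (k + 1) h s - bval ν id q u π.prob (k + 1) h s| ≤
      π.avg h s fun a => |kint ν (p h) (bval ν id p u π.prob k (h + 1)) s a -
        kint ν (q h) (bval ν id q u π.prob k (h + 1)) s a| := by
  rw [bval_succ, bval_succ, id, id, ← π.avg_sub]
  refine (π.abs_avg_le h s).trans (π.avg_mono h s fun a => le_of_eq ?_)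
  congr 1
  ring

theorem abs_kint_bval_sub_le (hp : ∀ h, IsDensity ν (p h)) (hq : ∀ h, IsDensity ν (q h))
    (hu : IsUtil H s₀ u) (π : MarkovPolicy S A) (k h : ℕ) (hk : k + 1 + h = H) (s : S) (a : A) :
    |kint ν (p h) (bval ν id p u π.prob k (h + 1)) s a -
        kint ν (q h) (bval ν id q u π.prob k (h + 1)) s a| ≤
      kint ν (p h) (fun s' => |bval ν id p u π.prob k (h + 1) s' -
        bval ν id q u π.prob k (h + 1) s'|) s a + tvDist ν (p h) (q h) s a := by
  have hV := bval_bddMeas continuous_id hp hu.bddMeas π k (h + 1)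
  have hW := bval_bddMeas continuous_id hq hu.bddMeas π k (h + 1)
  have h1 := (hp h).abs_kint_sub_le hV hW s a
  have h2 := abs_kint_sub_kint_le (hp h) (hq h) hW (fun s' =>
    ⟨hu.bval_nonneg hq π k (h + 1) s', hu.bval_le_one hq π k (h + 1) (by omega) s'
      (fun h0 => by omega)⟩) s a
  exact (abs_sub_le _ _ _).trans (add_le_add h1 h2)

theorem abs_kint_bval_sub_le_one (hp : ∀ h, IsDensity ν (p h)) (hq : ∀ h, IsDensity ν (q h))
    (hu : IsUtil H s₀ u) (π : MarkovPolicy S A) (k h : ℕ) (hk : k + 1 + h = H) (s : S) (a : A) :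
    |kint ν (p h) (bval ν id p u π.prob k (h + 1)) s a -
        kint ν (q h) (bval ν id q u π.prob k (h + 1)) s a| ≤ 1 := by
  have hV := bval_bddMeas continuous_id hp hu.bddMeas π k (h + 1)
  have hW := bval_bddMeas continuous_id hq hu.bddMeas π k (h + 1)
  have a1 := (hp h).le_kint hV (hu.bval_nonneg hp π k (h + 1)) s a
  have a2 := (hq h).le_kint hW (hu.bval_nonneg hq π k (h + 1)) s a
  have a3 := (hp h).kint_le hV (fun s' => hu.bval_le_one hp π k (h + 1) (by omega) s'
    (fun h0 => by omega)) s a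
  have a4 := (hq h).kint_le hW (fun s' => hu.bval_le_one hq π k (h + 1) (by omega) s'
    (fun h0 => by omega)) s a
  rw [abs_le]
  constructor <;> linarith

/-- The error `f` of the current step is kept outside the truncated value. Going back one step, its
mean under `p` is paid by the bonus there (`hg`), and a new current error appears. The cap at one is
harmless because the two values differ by at most one. -/
theorem abs_bval_sub_le_of_bonus (hp : ∀ h, IsDensity ν (p h)) (hq : ∀ h, IsDensity ν (q h))
    (hu : IsUtil H s₀ u) (hb : ∀ h a, BddMeas fun s => b h s a)
    (hf : ∀ h a, BddMeas fun s => f h s a) (hf0 : ∀ h s a, 0 ≤ f h s a)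
    (hfp : ∀ h < H, ∀ s a, tvDist ν (p h) (q h) s a ≤ f h s a)
    (π : MarkovPolicy S A)
    (hg : ∀ h, 1 ≤ h → h < H → ∀ s a,
      kint ν (p h) (fun s' => π.avg (h + 1) s' (f (h + 1) s')) s a ≤ b h s a)
    (k h : ℕ) (hk : k + h = H) (hh : 1 ≤ h) (s : S) :
    |bval ν id p u π.prob k h s - bval ν id q u π.prob k h s| ≤
      π.avg h s (f h s) + bval ν (min 1) p b π.prob k h s := by
  induction k generalizing h s with
  | zero =>
    simp only [bval, sub_self, abs_zero, add_zero]
    exact π.le_avg h s fun a => hf0 h s a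
  | succ k ih =>
    have hB := bval_bddMeas (lipschitzWith_min 1).continuous hp hb π k (h + 1)
    have hF := π.avg_bddMeas (h + 1) (hf (h + 1))
    have hV := bval_bddMeas continuous_id hp hu.bddMeas π k (h + 1)
    have hW := bval_bddMeas continuous_id hq hu.bddMeas π k (h + 1)
    have h0 : 0 ≤ π.avg h s (f h s) := π.le_avg h s fun a => hf0 h s a
    have h1 : |bval ν id p u π.prob (k + 1) h s - bval ν id q u π.prob (k + 1) h s| ≤ 1 :=
      (abs_bval_succ_sub_le π k h s).trans
        (π.avg_le h s fun a => abs_kint_bval_sub_le_one hp hq hu π k h hk s a)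
    have h2 : |bval ν id p u π.prob (k + 1) h s - bval ν id q u π.prob (k + 1) h s| ≤
        π.avg h s (f h s) + π.avg h s fun a =>
          b h s a + kint ν (p h) (bval ν (min 1) p b π.prob k (h + 1)) s a := by
      rw [← π.avg_add]
      refine (abs_bval_succ_sub_le π k h s).trans (π.avg_mono h s fun a => ?_)
      have h3 := (hp h).kint_mono (hV.sub hW).abs (hF.add hB) (ih (h + 1) (by omega) (by omega)) s a
      rw [(hp h).kint_add hF hB] at h3
      have h4 := abs_kint_bval_sub_le hp hq hu π k h hk s a
      have h5 := hg h hh (by omega) s a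
      have h6 := hfp h (by omega) s a
      linarith
    rw [bval_succ ν (min 1), ← sub_le_iff_le_add']
    refine le_min ?_ ?_ <;> linarith

/-- Validity of the bonus: the truncated value of the bonus bounds the error of the estimated
value of every utility. -/
theorem abs_bval_sub_le_truncValue (hp : ∀ h, IsDensity ν (p h)) (hq : ∀ h, IsDensity ν (q h))
    (hu : IsUtil H s₀ u) (hb : ∀ h a, BddMeas fun s => b h s a) (hb0 : ∀ h s a, 0 ≤ b h s a)
    (hf : ∀ h a, BddMeas fun s => f h s a) (hf0 : ∀ h s a, 0 ≤ f h s a)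
    (hfp : ∀ h < H, ∀ s a, tvDist ν (p h) (q h) s a ≤ f h s a) (π : MarkovPolicy S A)
    (hg : ∀ h, 1 ≤ h → h < H → ∀ s a,
      kint ν (p h) (fun s' => π.avg (h + 1) s' (f (h + 1) s')) s a ≤ b h s a)
    (hg0 : ∀ a, 1 ≤ b 0 s₀ a ∨
      f 0 s₀ a + kint ν (p 0) (fun s' => π.avg 1 s' (f 1 s')) s₀ a ≤ b 0 s₀ a) :
    |bval ν id p u π.prob H 0 s₀ - bval ν id q u π.prob H 0 s₀| ≤
      bval ν (min 1) p b π.prob H 0 s₀ := by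
  rcases H with _ | k
  · simp [bval]
  have hB := bval_bddMeas (lipschitzWith_min 1).continuous hp hb π k 1
  have hF := π.avg_bddMeas 1 (hf 1)
  have hV := bval_bddMeas continuous_id hp hu.bddMeas π k 1
  have hW := bval_bddMeas continuous_id hq hu.bddMeas π k 1
  have hB0 : ∀ (k h : ℕ) s, 0 ≤ bval ν (min 1) p b π.prob k h s := by
    intro k
    induction k with
    | zero => intro h s; exact le_rfl
    | succ k ih =>
      intro h s
      refine le_min zero_le_one (π.le_avg h s fun a => add_nonneg (hb0 h s a) ?_)
      exact (hp h).le_kint (bval_bddMeas (lipschitzWith_min 1).continuous hp hb π k (h + 1))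
        (ih (h + 1)) s a
  refine (abs_bval_succ_sub_le π k 0 s₀).trans ?_
  rw [bval_succ]
  refine le_min (π.avg_le 0 s₀ fun a => abs_kint_bval_sub_le_one hp hq hu π k 0 rfl s₀ a)
    (π.avg_mono 0 s₀ fun a => ?_)
  have h0 := (hp 0).le_kint hB (hB0 k 1) s₀ a
  -- No bonus precedes the first step, so `b 0` must pay for `f 0` as well; where it is at least
  -- one, the trivial bound suffices.
  rcases hg0 a with h | h
  · exact (abs_kint_bval_sub_le_one hp hq hu π k 0 rfl s₀ a).trans (by linarith)
  · have h3 := (hp 0).kint_mono (hV.sub hW).abs (hF.add hB) (fun s =>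
      abs_bval_sub_le_of_bonus hp hq hu hb hf hf0 hfp π hg k 1 (by omega) le_rfl s) s₀ a
    rw [(hp 0).kint_add hF hB] at h3
    have h4 := abs_kint_bval_sub_le hp hq hu π k 0 rfl s₀ a
    have h6 := hfp 0 (by omega) s₀ a
    simp only [zero_add] at *
    linarith

/-- The truncated value in the estimated model is at most the expected sum of the bonuses and of
the errors of the transition densities in the true model. -/
theorem truncValue_le_sum_occ (hp : ∀ h, IsDensity ν (p h)) (hq : ∀ h, IsDensity ν (q h))
    (hb : ∀ h a, BddMeas fun s => b h s a) (hb0 : ∀ h s a, 0 ≤ b h s a)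
    (hf : ∀ h a, BddMeas fun s => f h s a)
    (hfp : ∀ h < H, ∀ s a, tvDist ν (p h) (q h) s a ≤ f h s a) (π : MarkovPolicy S A) (s : S) :
    bval ν (min 1) p b π.prob H 0 s ≤
      ∑ h ∈ Finset.range H, (occ ν q π.prob (b h) h 0 s + occ ν q π.prob (f h) h 0 s) := by
  have hbf : ∀ h a, BddMeas fun s => b h s a + f h s a := fun h a => (hb h a).add (hf h a)
  -- Truncation keeps the continuation in [0, 1], so exchanging `p` for `q` in one step costs only
  -- the total variation error, whatever the size of the remaining bonuses.
  have key : ∀ k h, k + h = H → ∀ s, bval ν (min 1) p b π.prob k h s ≤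
      bval ν id q (fun h s a => b h s a + f h s a) π.prob k h s ∧
      bval ν (min 1) p b π.prob k h s ∈ Set.Icc (0 : ℝ) 1 := by
    intro k
    induction k with
    | zero => intro h _ s; simp [bval]
    | succ k ih =>
      intro h hk s
      have hB := bval_bddMeas (lipschitzWith_min 1).continuous hp hb π k (h + 1)
      have hW := bval_bddMeas continuous_id hq hbf π k (h + 1)
      have ih' := ih (h + 1) (by omega)
      rw [bval_succ, bval_succ, id]
      refine ⟨(min_le_right _ _).trans (π.avg_mono h s fun a => ?_),
        le_min zero_le_one (π.le_avg h s fun a => add_nonneg (hb0 h s a)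
          ((hp h).le_kint hB (fun s => (ih' s).2.1) s a)), min_le_left _ _⟩
      have h1 := (abs_le.1 (abs_kint_sub_kint_le (hp h) (hq h) hB (fun s => (ih' s).2) s a)).2
      have h2 := (hq h).kint_mono hB hW (fun s => (ih' s).1) s a
      have h3 := hfp h (by omega) s a
      linarith
  refine (key H 0 rfl s).1.trans (le_of_eq ?_)
  rw [bval_id_eq_sum_occ hq hbf]
  refine Finset.sum_congr rfl fun h _ => ?_
  rw [zero_add, ← occ_add hq (hb h) (hf h)]

end SafeRewardFree
end

/-! ### Change of policy through random actions, and the elliptical bound of the next error. -/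

noncomputable section
namespace SafeRewardFree

/-- Integration against a low-rank density is linear in the feature. -/
theorem IsLowRankStep.exists_kint_eq_inner {S A : Type*} [MeasurableSpace S] {d : ℕ} {ν : Measure S}
    {φ : S → A → EuclideanSpace ℝ (Fin d)} {μ : S → EuclideanSpace ℝ (Fin d)}
    (hφ : IsLowRankStep ν φ μ) {v : S → ℝ} (hv : Measurable v) (h01 : ∀ s, v s ∈ Set.Icc (0 : ℝ) 1) :
    ∃ w : EuclideanSpace ℝ (Fin d), ‖w‖ ^ 2 ≤ d ∧
      ∀ s a, kint ν (fun s a s' => inner ℝ (φ s a) (μ s')) v s a = inner ℝ (φ s a) w := by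
  refine ⟨∫ s, v s • μ s ∂ν, ?_, fun s a => ?_⟩
  · calc _ ≤ √(d : ℝ) ^ 2 :=
        pow_le_pow_left₀ (norm_nonneg _) (hφ.norm_integral_mu_le v hv h01) 2
      _ = d := Real.sq_sqrt (Nat.cast_nonneg d)
  · have hi : Integrable (fun s => v s • μ s) ν := by
      refine hφ.integrable_mu.bdd_smul (C := 1) hv.aestronglyMeasurable
        (Filter.Eventually.of_forall fun s => ?_)
      rw [Real.norm_of_nonneg (h01 s).1]
      exact (h01 s).2
    rw [kint, ← integral_inner hi]
    refine integral_congr_ae (Filter.Eventually.of_forall fun s' => ?_)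
    simp only [real_inner_smul_right]
    ring

lemma real_inner_eq_dotProduct {d : ℕ} (x y : EuclideanSpace ℝ (Fin d)) :
    inner ℝ x y = WithLp.ofLp x ⬝ᵥ WithLp.ofLp y := by
  rw [EuclideanSpace.inner_eq_star_dotProduct, dotProduct_comm]
  simp

lemma sum_fin_filter_lt {N n : ℕ} (hn : n ≤ N) (F : ℕ → ℝ) :
    ∑ i : Fin N with i.val < n, F i = ∑ i ∈ Finset.range n, F i := by
  rw [Finset.sum_filter, Fin.sum_univ_eq_sum_range (fun i => if i < n then F i else 0),
    ← Finset.sum_filter]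
  congr 1
  ext i
  simp only [Finset.mem_filter, Finset.mem_range]
  omega

namespace Choices

variable {S A : Type*} [MeasurableSpace S] [Fintype A] {P : Config S A} {β : ℝ}
  (R : Choices P β)

/-- The estimated transition density, extended to all times. -/
def ptil (n : ℕ) (ω : P.Data β) : ℕ → S → A → S → ℝ := fun h => R.phat n ω (min h (P.M.H - 1))

/-- The total variation error of the estimated transition density. -/
def err (n : ℕ) (ω : P.Data β) : ℕ → S → A → ℝ := fun h s a =>
  if h < P.M.H then tvDist P.M.base (R.phat n ω h) (P.M.trans h) s a else 0

section Greedy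

variable (i : ℕ) (ω : P.Data β) (k j : ℕ) (s : S) (a : A)

lemma one_le_mul_beh (hj : j = k ∨ j + 1 = k) : 1 ≤ P.Atilde * (R.beh i ω k).prob j s a := by
  rw [beh_prob, behavior, greedy, if_pos (show j ∈ {j | j = k ∨ j + 1 = k} from hj)]
  have h1 := P.ε₀_pos
  have h2 := P.ε₀_le
  have h3 := P.one_le_card_action
  have h4 := (R.pol i ω).nonneg j s a
  have h5 : P.Atilde * (P.ε₀ / Fintype.card A) = 1 := by
    unfold Config.Atilde
    field_simp
  have h6 : 0 ≤ P.Atilde * ((1 - P.ε₀) * (R.pol i ω).prob j s a) :=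
    mul_nonneg (by linarith [P.Atilde_ge]) (mul_nonneg (by linarith) h4)
  rw [mul_add, h5]
  linarith

/-- The policy is followed with probability at least 1 - ε₀ ≥ 5/6 even at a randomised step. -/
lemma pol_le_beh : (R.pol i ω).prob j s a ≤ 6 / 5 * (R.beh i ω k).prob j s a := by
  rw [beh_prob, behavior, greedy]
  have h1 := P.ε₀_pos
  have h2 := P.ε₀_le
  have h4 := (R.pol i ω).nonneg j s a
  split_ifs
  · have h5 : 0 ≤ P.ε₀ / Fintype.card A := div_nonneg h1.le (Nat.cast_nonneg _)
    nlinarith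
  · linarith

lemma beh_eq_pol (h1 : j ≠ k) (h2 : j + 1 ≠ k) : (R.beh i ω k).prob j = (R.pol i ω).prob j := by
  funext s a
  rw [beh_prob, behavior, greedy, if_neg]
  simp only [Set.mem_ofPred_eq, not_or]
  exact ⟨h1, h2⟩

lemma avg_le_mul_avg_beh (hj : j = k ∨ j + 1 = k) (π : MarkovPolicy S A) {g : A → ℝ}
    (hg : ∀ a, 0 ≤ g a) : π.avg j s g ≤ P.Atilde * (R.beh i ω k).avg j s g := by
  unfold MarkovPolicy.avg
  rw [Finset.mul_sum]
  refine Finset.sum_le_sum fun a _ => ?_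
  rw [← mul_assoc]
  refine mul_le_mul_of_nonneg_right ?_ (hg a)
  exact (π.prob_le_one j s a).trans (R.one_le_mul_beh i ω k j s a hj)

variable {g : S → A → ℝ} (hg : ∀ a, BddMeas fun s => g s a) (hg0 : ∀ s a, 0 ≤ g s a)

include hg hg0

lemma kint_avg_le (h : ℕ) (hh : h + 1 = k ∨ h + 2 = k) (π : MarkovPolicy S A) :
    kint P.M.base (P.M.trans h) (fun s' => π.avg (h + 1) s' (g s')) s a ≤
      P.Atilde * kint P.M.base (P.M.trans h)
        (fun s' => (R.beh i ω k).avg (h + 1) s' (g s')) s a := by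
  rw [← IsDensity.kint_const_mul]
  exact (P.M.trans_isDensity h).kint_mono (π.avg_bddMeas _ hg)
    (((R.beh i ω k).avg_bddMeas _ hg).const_mul _)
    (fun s' => R.avg_le_mul_avg_beh i ω k (h + 1) s' (by omega) π (hg0 s')) s a

lemma kint_avg_nonneg (h : ℕ) (π : MarkovPolicy S A) :
    0 ≤ kint P.M.base (P.M.trans h) (fun s' => π.avg (h + 1) s' (g s')) s a :=
  (P.M.trans_isDensity h).le_kint (π.avg_bddMeas _ hg) (fun s' => π.le_avg _ _ (hg0 s')) s a

/-- Before step `k`, the behavior policy of episode `k` deviates from the reference policy only at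
step k - 1, so the factor 6/5 occurs at most once. -/
lemma prod_ite_le (h k : ℕ) : ∏ j ∈ Finset.range (h + 1), (if 0 + j + 1 = k then (6 / 5 : ℝ) else 1) ≤
    6 / 5 := by
  rw [Finset.prod_ite]
  simp only [Finset.prod_const, one_pow, mul_one]
  have : ((Finset.range (h + 1)).filter fun j => 0 + j + 1 = k).card ≤ 1 := by
    rw [Finset.card_le_one]
    intro a ha b hb
    simp only [Finset.mem_filter] at ha hb
    omega
  calc (6 / 5 : ℝ) ^ ((Finset.range (h + 1)).filter fun j => 0 + j + 1 = k).card
      ≤ (6 / 5 : ℝ) ^ 1 := pow_le_pow_right₀ (by norm_num) this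
    _ = 6 / 5 := pow_one _

lemma occB_nonneg (h : ℕ) : 0 ≤ R.occB i ω k h g := occ_nonneg P.M.trans_isDensity hg hg0 _ _ _ _

/-- The expectation of `g` at step `h + 1` when `π⁽ⁱ⁾` is followed up to step `h` and then `π`. -/
lemma occ_pol_le_occB (h : ℕ) (hh : h + 1 = k ∨ h + 2 = k) (π : MarkovPolicy S A) :
    occ P.M.base P.M.trans (R.pol i ω).prob (fun s a => kint P.M.base (P.M.trans h)
      (fun s' => π.avg (h + 1) s' (g s')) s a) h 0 P.M.init ≤
        6 / 5 * P.Atilde * R.occB i ω k (h + 1) g := by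
  have hA : 0 ≤ P.Atilde := by linarith [P.Atilde_ge]
  have hden := P.M.trans_isDensity
  have hm : ∀ ρ : MarkovPolicy S A, ∀ a, BddMeas fun s => kint P.M.base (P.M.trans h)
      (fun s' => ρ.avg (h + 1) s' (g s')) s a := fun ρ a =>
    (hden h).kint_bddMeas (ρ.avg_bddMeas _ hg) a
  have h1 := occ_mono hden (hm π) (fun a => (hm (R.beh i ω k) a).const_mul P.Atilde)
    (fun s a => R.kint_avg_le i ω k s a hg hg0 h hh π) (R.pol i ω) h 0 P.M.init
  rw [occ_const_mul] at h1
  have h2 := occ_le_prod_mul hden (hm (R.beh i ω k)) (fun s a => kint_avg_nonneg s a hg hg0 h _)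
    (R.pol i ω) (R.beh i ω k) (K := fun j => if j + 1 = k then 6 / 5 else 1)
    (fun j => by split_ifs <;> norm_num) h 0 (fun j _ hj s a => by
      split_ifs with hjk
      · exact R.pol_le_beh i ω k j s a
      · rw [R.beh_eq_pol i ω k j (by omega) hjk, one_mul]) P.M.init
  have h3 : occ P.M.base P.M.trans (R.beh i ω k).prob (fun s a => kint P.M.base (P.M.trans h)
      (fun s' => (R.beh i ω k).avg (h + 1) s' (g s')) s a) h 0 P.M.init =
      R.occB i ω k (h + 1) g := by
    unfold occB
    rw [occ_succ_right, zero_add]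
    rfl
  rw [h3] at h2
  have h4 := h2.trans (mul_le_mul_of_nonneg_right (prod_ite_le hg hg0 h k)
    (R.occB_nonneg i ω k hg hg0 (h + 1)))
  have h5 := mul_le_mul_of_nonneg_left h4 hA
  linarith

/-- Episode h + 1 also randomises at step h + 1, where its action probabilities dominate those of
any `π` up to Ã. The last transition is then folded back by `occ_succ_right`. -/
lemma occB_kint_le (h : ℕ) (π : MarkovPolicy S A) :
    R.occB i ω (h + 1) h (fun s a => kint P.M.base (P.M.trans h)
      (fun s' => π.avg (h + 1) s' (g s')) s a) ≤ P.Atilde * R.occB i ω (h + 1) (h + 1) g := by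
  have hden := P.M.trans_isDensity
  have hm : ∀ ρ : MarkovPolicy S A, ∀ a, BddMeas fun s => kint P.M.base (P.M.trans h)
      (fun s' => ρ.avg (h + 1) s' (g s')) s a := fun ρ a =>
    (hden h).kint_bddMeas (ρ.avg_bddMeas _ hg) a
  have h1 := occ_mono hden (hm π) (fun a => (hm (R.beh i ω (h + 1)) a).const_mul P.Atilde)
    (fun s a => R.kint_avg_le i ω (h + 1) s a hg hg0 h (Or.inl rfl) π) (R.beh i ω (h + 1)) h 0
      P.M.init
  rw [occ_const_mul] at h1
  refine h1.trans (le_of_eq ?_)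
  congr 1
  unfold occB
  rw [occ_succ_right, zero_add]
  rfl

/-- This passes from the covariance episode h + 1 to the likelihood episode h. Both randomise at
step h; up to that step they differ only at step h - 1, where only the latter does. -/
lemma occB_succ_le (h : ℕ) : R.occB i ω (h + 1) h g ≤ 6 / 5 * R.occB i ω h h g := by
  have h2 := occ_le_prod_mul P.M.trans_isDensity hg hg0 (R.beh i ω (h + 1)) (R.beh i ω h)
    (K := fun j => if j + 1 = h then 6 / 5 else 1)
    (fun j => by split_ifs <;> norm_num) h 0 (fun j _ hj s a => by
      split_ifs with hjk
      · rw [R.beh_eq_pol i ω (h + 1) j (by omega) (by omega)]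
        exact R.pol_le_beh i ω h j s a
      · rw [one_mul]
        rcases eq_or_ne j h with rfl | hne
        · rw [beh_prob, beh_prob, behavior, behavior, greedy, greedy,
            if_pos (show j ∈ {l | l = j + 1 ∨ l + 1 = j + 1} from Or.inr rfl),
            if_pos (show j ∈ {l | l = j ∨ l + 1 = j} from Or.inl rfl)]
        · rw [R.beh_eq_pol i ω (h + 1) j (by omega) (by omega), R.beh_eq_pol i ω h j hne hjk])
      P.M.init
  exact h2.trans (mul_le_mul_of_nonneg_right (prod_ite_le hg hg0 h h)
    (R.occB_nonneg i ω h hg hg0 h))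

lemma avg_zero_le_occB (hk : k = 0 ∨ k = 1) (π : MarkovPolicy S A) :
    π.avg 0 P.M.init (g P.M.init) ≤ P.Atilde * R.occB i ω k 0 g := by
  unfold occB
  rw [occ_zero]
  exact R.avg_le_mul_avg_beh i ω k 0 _ (by omega) π (hg0 _)

end Greedy

section Estimates

variable {R} [MeasurableSpace A] [MeasurableSingletonClass A]

lemma IsRun.isLowRankStep (hR : R.IsRun) {n : ℕ} (h1 : 1 ≤ n) (hn : n ≤ P.N β) (ω : P.Data β)
    {h : ℕ} (hh : h < P.M.H) : IsLowRankStep P.M.base (R.φhat n h ω) (R.μhat n h ω) :=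
  P.models.isLowRankStep _ (hR.φhat_mem n h1 hn ⟨h, hh⟩ ω) _ (hR.μhat_mem n h1 hn ⟨h, hh⟩ ω)

lemma IsRun.ptil_isDensity (hR : R.IsRun) {n : ℕ} (h1 : 1 ≤ n) (hn : n ≤ P.N β) (ω : P.Data β)
    (h : ℕ) : IsDensity P.M.base (R.ptil n ω h) :=
  (hR.isLowRankStep h1 hn ω (P.M.clamp_lt h)).isDensity

lemma ptil_eq (n : ℕ) (ω : P.Data β) {h : ℕ} (hh : h < P.M.H) :
    R.ptil n ω h = R.phat n ω h := by
  unfold ptil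
  rw [P.M.clamp_eq hh]

lemma IsRun.err_bddMeas (hR : R.IsRun) {n : ℕ} (h1 : 1 ≤ n) (hn : n ≤ P.N β) (ω : P.Data β)
    (h : ℕ) (a : A) : BddMeas fun s => R.err n ω h s a := by
  by_cases hh : h < P.M.H
  · simp only [err, hh, if_true]
    exact tvDist_bddMeas (hR.isLowRankStep h1 hn ω hh).isDensity (P.M.trans_isDensity h) a
  · simp only [err, hh, if_false]
    exact BddMeas.const 0

lemma IsRun.err_mem_Icc (hR : R.IsRun) {n : ℕ} (h1 : 1 ≤ n) (hn : n ≤ P.N β) (ω : P.Data β)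
    (h : ℕ) (s : S) (a : A) : R.err n ω h s a ∈ Set.Icc (0 : ℝ) 1 := by
  by_cases hh : h < P.M.H
  · simp only [err, hh, if_true]
    exact ⟨tvDist_nonneg s a,
      tvDist_le_one (hR.isLowRankStep h1 hn ω hh).isDensity (P.M.trans_isDensity h) s a⟩
  · simp [err, hh]

lemma Good.sum_err_le {ω : P.Data β} (hω : R.Good ω) {n : ℕ} (h1 : 1 ≤ n)
    (hn : n ≤ P.N β) {h : ℕ} (hh : h < P.M.H) :
    ∑ i ∈ Finset.range n, R.occB i ω h h (fun s a => R.err n ω h s a ^ 2) ≤ 2 * P.ζ β := by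
  have := hω.tv n h1 hn ⟨h, hh⟩
  rw [sum_fin_filter_lt hn fun i => R.occB i ω h h (fun s a =>
      tvDist P.M.base (R.phat n ω h) (P.M.trans h) s a ^ 2)] at this
  simpa only [err, hh, if_true] using this

/-- The squared length of the estimated feature in the norm of the inverse covariance. -/
def ellip (R : Choices P β) (n : ℕ) (ω : P.Data β) (h : Fin P.M.H) (s : S) (a : A) : ℝ :=
  WithLp.ofLp (R.φhat n h ω s a) ⬝ᵥ
    Matrix.mulVec (R.cov n ω h)⁻¹ (WithLp.ofLp (R.φhat n h ω s a))

lemma cov_quad (n : ℕ) (ω : P.Data β) (h : Fin P.M.H) (x : EuclideanSpace ℝ (Fin P.M.d)) :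
    WithLp.ofLp x ⬝ᵥ Matrix.mulVec (R.cov n ω h) (WithLp.ofLp x) =
      ∑ i : Fin (P.N β) with i.val < n, inner ℝ x (R.φhat n h ω
        (epState P.M.init (ω i (P.covEpisode h)) h) (ω i (P.covEpisode h) h).1) ^ 2 +
      P.lam β * ‖x‖ ^ 2 := by
  unfold cov
  rw [add_comm, Matrix.quad_smul_one_add, ← real_inner_eq_dotProduct, real_inner_self_eq_norm_sq,
    add_comm, Matrix.sum_mulVec, dotProduct_sum]
  congr 1
  refine Finset.sum_congr rfl fun i _ => ?_
  rw [Matrix.vecMulVec_mulVec, P.stateAt_eq, real_inner_eq_dotProduct]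
  rw [dotProduct_comm (WithLp.ofLp (R.φhat n h ω _ _)), dotProduct_smul, op_smul_eq_smul,
    smul_eq_mul, sq]

lemma lam_pos (hβ : 100 ≤ β) : 0 < P.lam β := by
  rw [P.lam_eq]
  have h1 := P.one_le_lamLog hβ
  have h2 := P.one_le_d
  positivity

lemma cov_posDef (hβ : 100 ≤ β) (n : ℕ) (ω : P.Data β) (h : Fin P.M.H) :
    (R.cov n ω h).PosDef := by
  unfold cov
  rw [add_comm]
  refine Matrix.posDef_smul_one_add (lam_pos hβ) (Matrix.posSemidef_sum _ fun i _ => ?_)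
  have := Matrix.posSemidef_vecMulVec_self_star (WithLp.ofLp (R.φhat n h ω
    (P.stateAt (ω i (P.covEpisode h)) h) (ω i (P.covEpisode h) h).1))
  simpa using this

lemma ellip_nonneg (hβ : 100 ≤ β) (n : ℕ) (ω : P.Data β) (h : Fin P.M.H) (s : S) (a : A) :
    0 ≤ R.ellip n ω h s a := (cov_posDef hβ n ω h).quad_inv_nonneg _

lemma bonus_eq (n : ℕ) (ω : P.Data β) (h : Fin P.M.H) (s : S) (a : A) :
    R.bonus n ω h s a = min (P.αhat β * √(R.ellip n ω h s a)) 1 := by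
  unfold bonus
  rw [dif_pos h.2]
  rfl

lemma αhat_nonneg : 0 ≤ P.αhat β := by unfold Config.αhat; positivity

lemma αhat_sq (hβ : 100 ≤ β) :
    P.αhat β ^ 2 = 25 * (β * P.ζ β * (P.Atilde + (P.M.d : ℝ) ^ 2)) := by
  unfold Config.αhat
  have h1 := P.one_le_ζ hβ
  have h2 := P.Atilde_ge
  rw [mul_pow, Real.sq_sqrt (by positivity)]
  norm_num

lemma bonus_mem_Icc (n : ℕ) (ω : P.Data β) (h : ℕ) (s : S) (a : A) :
    R.bonus n ω h s a ∈ Set.Icc (0 : ℝ) 1 := by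
  by_cases hh : h < P.M.H
  · rw [bonus_eq n ω ⟨h, hh⟩]
    exact ⟨le_min (mul_nonneg αhat_nonneg (Real.sqrt_nonneg _)) zero_le_one, min_le_right _ _⟩
  · simp [bonus, hh]

lemma IsRun.measurable_ellip (hR : R.IsRun) {n : ℕ} (h1 : 1 ≤ n) (hn : n ≤ P.N β) (ω : P.Data β)
    (h : Fin P.M.H) (a : A) : Measurable fun s => R.ellip n ω h s a := by
  have hm : Measurable fun s => WithLp.ofLp (R.φhat n h ω s a) :=
    (WithLp.measurable_ofLp 2 _).comp ((hR.isLowRankStep h1 hn ω h.2).measurable_feature a)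
  have hm' : ∀ j, Measurable fun s => WithLp.ofLp (R.φhat n h ω s a) j := fun j =>
    (measurable_pi_apply j).comp hm
  unfold ellip
  simp only [dotProduct, Matrix.mulVec]
  exact Finset.measurable_sum _ fun j _ => (hm' j).mul
    (Finset.measurable_sum _ fun l _ => (hm' l).const_mul _)

lemma IsRun.bonus_bddMeas (hR : R.IsRun) {n : ℕ} (h1 : 1 ≤ n) (hn : n ≤ P.N β) (ω : P.Data β)
    (h : ℕ) (a : A) : BddMeas fun s => R.bonus n ω h s a := by
  refine BddMeas.of_mem_Icc (a := 0) (b := 1) ?_ fun s => bonus_mem_Icc n ω h s a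
  by_cases hh : h < P.M.H
  · simp_rw [bonus_eq n ω ⟨h, hh⟩]
    exact (((hR.measurable_ellip h1 hn ω ⟨h, hh⟩ a).sqrt).const_mul _).min measurable_const
  · simp only [bonus, hh, dif_neg, not_false_eq_true]
    exact measurable_const

/-- The Cauchy–Schwarz inequality for the empirical covariance. -/
lemma sq_inner_feature_le (hβ : 100 ≤ β) (n : ℕ) (ω : P.Data β) (h : Fin P.M.H) (s : S) (a : A)
    (w : EuclideanSpace ℝ (Fin P.M.d)) :
    inner ℝ (R.φhat n h ω s a) w ^ 2 ≤ R.ellip n ω h s a *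
      (∑ i : Fin (P.N β) with i.val < n, inner ℝ w (R.φhat n h ω
        (epState P.M.init (ω i (P.covEpisode h)) h) (ω i (P.covEpisode h) h).1) ^ 2 +
      P.lam β * ‖w‖ ^ 2) := by
  rw [← cov_quad, real_inner_eq_dotProduct]
  exact (cov_posDef hβ n ω h).sq_dotProduct_le _ _

lemma covEpisode_eq {h : ℕ} (hh : h + 1 < P.M.H) :
    (P.covEpisode ⟨h, by omega⟩ : ℕ) = h + 1 := by
  simp only [Config.covEpisode]
  omega

/-- The estimated expectation of the next transition error is at most a fixed fraction of
the bonus before truncation. -/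
lemma Good.sq_kint_err_le (hR : R.IsRun) (hβ : 100 ≤ β) {ω : P.Data β} (hω : R.Good ω) {n : ℕ}
    (h1 : 1 ≤ n) (hn : n ≤ P.N β) {h : ℕ} (hh : h + 1 < P.M.H) (π : MarkovPolicy S A) (s : S)
    (a : A) : kint P.M.base (R.ptil n ω h) (fun s' => π.avg (h + 1) s' (R.err n ω (h + 1) s')) s a
      ^ 2 ≤ 2 / 25 * (P.αhat β ^ 2 * R.ellip n ω ⟨h, by omega⟩ s a) := by
  have hh' : h < P.M.H := by omega
  have hlr := hR.isLowRankStep h1 hn ω hh'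
  have hden := P.M.trans_isDensity
  have hem : ∀ (h : ℕ) a, BddMeas fun s => R.err n ω h s a := fun h => hR.err_bddMeas h1 hn ω h
  have he := fun (h : ℕ) s a => hR.err_mem_Icc h1 hn ω h s a
  have hvm := π.avg_bddMeas (h + 1) (hem (h + 1))
  have hv01 : ∀ s', π.avg (h + 1) s' (R.err n ω (h + 1) s') ∈ Set.Icc (0 : ℝ) 1 := fun s' =>
    ⟨π.le_avg _ _ fun a => (he (h + 1) s' a).1, π.avg_le _ _ fun a => (he (h + 1) s' a).2⟩
  -- The integrand depends on the next state only, so a single vector `w` of squared norm at most d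
  -- represents its estimated mean at all pairs.
  obtain ⟨w, hw, hkw⟩ := hlr.exists_kint_eq_inner hvm.meas hv01
  have hkw' : ∀ s a, kint P.M.base (R.ptil n ω h)
      (fun s' => π.avg (h + 1) s' (R.err n ω (h + 1) s')) s a = inner ℝ (R.φhat n h ω s a) w := by
    intro s a
    rw [ptil_eq n ω hh']
    exact hkw s a
  have hcs := sq_inner_feature_le (R := R) hβ n ω ⟨h, hh'⟩ s a w
  have hcov := hω.cov_le n h1 hn ⟨h, hh'⟩ w
  simp only [covEpisode_eq hh] at hcov
  rw [sum_fin_filter_lt hn fun i => R.occB i ω (h + 1) h fun s a =>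
    inner ℝ w (R.φhat n h ω s a) ^ 2] at hcov
  set v : S → ℝ := fun s' => π.avg (h + 1) s' (R.err n ω (h + 1) s') with hv
  -- The estimated mean is replaced by the true mean at the price of the error of step `h` itself;
  -- Jensen then moves the square inside.
  have hsq : ∀ s a, inner ℝ w (R.φhat n h ω s a) ^ 2 ≤
      2 * kint P.M.base (P.M.trans h)
        (fun s' => π.avg (h + 1) s' fun a => R.err n ω (h + 1) s' a ^ 2) s a +
      2 * R.err n ω h s a ^ 2 := by
    intro s a
    rw [real_inner_comm, ← hkw' s a, ptil_eq n ω hh']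
    have e1 := abs_kint_sub_kint_le hlr.isDensity (hden h) hvm hv01 s a
    have e2 : R.err n ω h s a = tvDist P.M.base (R.phat n ω h) (P.M.trans h) s a := by
      simp [err, hh']
    have e3 := (hden h).sq_kint_le hvm s a
    have e4 := (hden h).kint_mono (hvm.pow 2)
      (π.avg_bddMeas (h + 1) fun a => (hem (h + 1) a).pow 2)
      (fun s' => π.sq_avg_le (h + 1) s') s a
    have e5 : |kint P.M.base (R.phat n ω h) v s a - kint P.M.base (P.M.trans h) v s a| ≤
        R.err n ω h s a := by rw [e2]; exact e1
    have e6 := sq_le_sq' (by linarith [(abs_le.1 e5).1]) (abs_le.1 e5).2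
    set x := kint P.M.base (R.phat n ω h) v s a
    set y := kint P.M.base (P.M.trans h) v s a
    have e7 : y ^ 2 ≤ kint P.M.base (P.M.trans h)
        (fun s' => π.avg (h + 1) s' fun a => R.err n ω (h + 1) s' a ^ 2) s a := e3.trans e4
    have e8 : x ^ 2 ≤ 2 * y ^ 2 + 2 * (x - y) ^ 2 := by nlinarith [sq_nonneg (x - 2 * y)]
    change x ^ 2 ≤ _
    linarith
  have hφ := hR.φhat_mem n h1 hn ⟨h, hh'⟩ ω
  -- Both parts become in-sample squared errors, each at most 2ζ: that of step h + 1 with factor 2Ã,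
  -- that of step h with factor 12/5.
  have hpop : ∑ i ∈ Finset.range n, R.occB i ω (h + 1) h (fun s a =>
      inner ℝ w (R.φhat n h ω s a) ^ 2) ≤ (4 * P.Atilde + 24 / 5) * P.ζ β := by
    have hkm : ∀ a, BddMeas fun s => kint P.M.base (P.M.trans h)
        (fun s' => π.avg (h + 1) s' fun a => R.err n ω (h + 1) s' a ^ 2) s a := fun a =>
      (hden h).kint_bddMeas (π.avg_bddMeas (h + 1) fun a => (hem (h + 1) a).pow 2) a
    have hstep : ∀ i ∈ Finset.range n, R.occB i ω (h + 1) h (fun s a =>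
        inner ℝ w (R.φhat n h ω s a) ^ 2) ≤
        2 * P.Atilde * R.occB i ω (h + 1) (h + 1) (fun s a => R.err n ω (h + 1) s a ^ 2) +
        12 / 5 * R.occB i ω h h (fun s a => R.err n ω h s a ^ 2) := by
      intro i _
      have a1 := occ_mono hden (sq_inner_bddMeas hφ w)
        (fun a => ((hkm a).const_mul 2).add (((hem h a).pow 2).const_mul 2)) hsq
        (R.beh i ω (h + 1)) h 0 P.M.init
      rw [occ_add hden (fun a => (hkm a).const_mul 2) (fun a => ((hem h a).pow 2).const_mul 2),
        occ_const_mul, occ_const_mul] at a1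
      have a2 := R.occB_kint_le i ω (fun a => (hem (h + 1) a).pow 2)
        (fun s a => sq_nonneg _) h π
      have a3 := R.occB_succ_le i ω (fun a => (hem h a).pow 2) (fun s a => sq_nonneg _) h
      unfold occB at a2 a3 ⊢
      linarith
    refine (Finset.sum_le_sum hstep).trans ?_
    rw [Finset.sum_add_distrib, ← Finset.mul_sum, ← Finset.mul_sum]
    have b1 := hω.sum_err_le h1 hn hh
    have b2 := hω.sum_err_le h1 hn hh'
    have b3 := mul_le_mul_of_nonneg_left b1 (show 0 ≤ 2 * P.Atilde by linarith [P.Atilde_ge])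
    linarith
  have hlam : P.lam β * ‖w‖ ^ 2 ≤ β * P.ζ β * (P.M.d : ℝ) ^ 2 := by
    have c1 := P.lamLog_le_ζ β
    have c2 := P.one_le_d
    have c3 := P.one_le_lamLog hβ
    have c4 : 0 ≤ β := by linarith
    have c5 : 0 ≤ P.ζ β := by linarith
    rw [P.lam_eq]
    calc β * P.M.d * P.lamLog β * ‖w‖ ^ 2 ≤ β * P.M.d * P.ζ β * P.M.d := by gcongr
      _ = _ := by ring
  have hquad : ∑ i : Fin (P.N β) with i.val < n, inner ℝ w (R.φhat n h ω
        (epState P.M.init (ω i (P.covEpisode ⟨h, hh'⟩)) h) (ω i (P.covEpisode ⟨h, hh'⟩) ⟨h, hh'⟩).1) ^ 2 +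
      P.lam β * ‖w‖ ^ 2 ≤ 2 * (β * P.ζ β * (P.Atilde + (P.M.d : ℝ) ^ 2)) := by
    have c1 := P.one_le_ζ hβ
    have c2 := P.Atilde_ge
    have c3 : (8 * P.Atilde + 48 / 5) * P.ζ β ≤ 2 * (β * P.ζ β * P.Atilde) := by
      have c4 : (8 * P.Atilde + 48 / 5) ≤ 200 * P.Atilde := by linarith
      have c5 := mul_le_mul_of_nonneg_right c4 (show 0 ≤ P.ζ β by linarith)
      have c6 : 100 * (P.ζ β * P.Atilde) ≤ β * (P.ζ β * P.Atilde) :=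
        mul_le_mul_of_nonneg_right hβ (by positivity)
      linarith
    linarith
  rw [hkw' s a]
  refine hcs.trans ((mul_le_mul_of_nonneg_left hquad (ellip_nonneg hβ n ω _ s a)).trans
    (le_of_eq ?_))
  rw [αhat_sq hβ]
  ring

lemma kint_err_eq_zero (n : ℕ) (ω : P.Data β) {h : ℕ} (hh : ¬ h + 1 < P.M.H)
    (π : MarkovPolicy S A) (s : S) (a : A) : kint P.M.base (R.ptil n ω h)
      (fun s' => π.avg (h + 1) s' (R.err n ω (h + 1) s')) s a = 0 := by
  simp [err, hh, kint, MarkovPolicy.avg]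

/-- The initial state is fixed and every action is tried there with probability at least 1/Ã in each
iteration, so the squared error at the first step decays like 1/n. -/
lemma Good.sq_err_zero_le (hR : R.IsRun) {ω : P.Data β} (hω : R.Good ω) {n : ℕ}
    (h1 : 1 ≤ n) (hn : n ≤ P.N β) (π : MarkovPolicy S A) :
    n * π.avg 0 P.M.init (fun a => R.err n ω 0 P.M.init a ^ 2) ≤ 2 * P.Atilde * P.ζ β := by
  have h2 := hω.sum_err_le h1 hn P.M.H_pos
  have h3 : ∀ i ∈ Finset.range n, π.avg 0 P.M.init (fun a => R.err n ω 0 P.M.init a ^ 2) ≤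
      P.Atilde * R.occB i ω 0 0 (fun s a => R.err n ω 0 s a ^ 2) := fun i _ =>
    R.avg_zero_le_occB i ω 0 (g := fun s a => R.err n ω 0 s a ^ 2)
      (fun a => (hR.err_bddMeas h1 hn ω 0 a).pow 2) (fun s a => sq_nonneg _) (Or.inl rfl) π
  have h4 := Finset.sum_le_sum h3
  rw [Finset.sum_const, Finset.card_range, nsmul_eq_mul, ← Finset.mul_sum] at h4
  have h5 := mul_le_mul_of_nonneg_left h2 (show 0 ≤ P.Atilde by linarith [P.Atilde_ge])
  linarith

end Estimates

end Choices

end SafeRewardFree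
end

/-! ### The bonus at the first step, validity of the bonus, and its in-sample size. -/

noncomputable section
namespace SafeRewardFree

/-- The policy that always plays the action `a`. -/
def MarkovPolicy.always {S A : Type*} [MeasurableSpace S] [Fintype A] [DecidableEq A] (a : A) :
    MarkovPolicy S A where
  prob _ _ a' := if a' = a then 1 else 0
  nonneg _ _ a' := by split_ifs <;> norm_num
  sum_eq_one _ _ := by simp
  measurable_prob _ _ := measurable_const

lemma MarkovPolicy.avg_always {S A : Type*} [MeasurableSpace S] [Fintype A] [DecidableEq A] (a : A)
    (h : ℕ) (s : S) (g : A → ℝ) : (MarkovPolicy.always a).avg h s g = g a := by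
  simp [MarkovPolicy.avg, MarkovPolicy.always]

lemma sum_inv_sqrt_le (n : ℕ) : ∑ i ∈ Finset.Icc 1 n, (√(i : ℝ))⁻¹ ≤ 2 * √(n : ℝ) := by
  induction n with
  | zero => simp
  | succ n ih =>
    rw [Finset.sum_Icc_succ_top (by omega)]
    refine (add_le_add_left ih _).trans ?_
    push_cast
    have h0 : (0 : ℝ) ≤ n := Nat.cast_nonneg n
    have hx := Real.sq_sqrt h0
    have hy := Real.sq_sqrt (show (0 : ℝ) ≤ n + 1 by linarith)
    have hy0 : 0 < √((n : ℝ) + 1) := Real.sqrt_pos.2 (by linarith)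
    have hx0 := Real.sqrt_nonneg (n : ℝ)
    set x := √(n : ℝ)
    set y := √((n : ℝ) + 1)
    have h1 : y⁻¹ = y - x ^ 2 / y := by
      field_simp
      linarith
    have h2 : 0 ≤ (y - x) ^ 2 / y := by positivity
    have h3 : (y - x) ^ 2 / y = y - 2 * x + x ^ 2 / y := by
      field_simp
      ring
    linarith

namespace Choices

variable {S A : Type*} [MeasurableSpace S] [Fintype A] {P : Config S A} {β : ℝ}
  {R : Choices P β}

/-- The truncated value of the bonus in the estimated model. -/
def bonusVal (R : Choices P β) (n : ℕ) (ω : P.Data β) (π : MarkovPolicy S A) : ℝ :=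
  bval P.M.base (min 1) (R.ptil n ω) (R.bonus n ω) π.prob P.M.H 0 P.M.init

variable [MeasurableSpace A] [MeasurableSingletonClass A]

lemma U_eq (n : ℕ) (ω : P.Data β) (π : MarkovPolicy S A) :
    R.U n ω π = R.bonusVal n ω π + √(P.Atilde * P.ζ β / (n : ℝ)) := by
  unfold U bonusVal
  rw [truncValue_eq_bval]
  congr 1
  exact congrFun (bval_congr _ _ (fun j _ hj => (ptil_eq n ω (by omega)).symm) (fun _ _ _ => rfl)
    fun _ _ _ => rfl) _

lemma Vhat_eq (n : ℕ) (ω : P.Data β) (u : ℕ → S → A → ℝ) (π : MarkovPolicy S A) :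
    R.Vhat n ω u π = bval P.M.base id (R.ptil n ω) (P.M.ext u) π.prob P.M.H 0 P.M.init := by
  unfold Vhat
  rw [value_eq_bval]
  refine congrFun (bval_congr _ _ (fun j _ hj => (ptil_eq n ω (by omega)).symm) (fun j _ hj => ?_)
    fun _ _ _ => rfl) _
  funext s a
  simp [LowRankMDP.ext, show j < P.M.H by omega]

lemma Good.kint_err_le_bonus (hR : R.IsRun) (hβ : 100 ≤ β) {ω : P.Data β} (hω : R.Good ω) {n : ℕ}
    (h1 : 1 ≤ n) (hn : n ≤ P.N β) (π : MarkovPolicy S A) (h : ℕ) (hh : h < P.M.H) (s : S)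
    (a : A) : kint P.M.base (R.ptil n ω h)
      (fun s' => π.avg (h + 1) s' (R.err n ω (h + 1) s')) s a ≤ R.bonus n ω h s a := by
  by_cases hh1 : h + 1 < P.M.H
  · rw [bonus_eq n ω ⟨h, hh⟩]
    refine le_min ?_ ?_
    · have h2 := hω.sq_kint_err_le hR hβ h1 hn hh1 π s a
      refine (le_abs_self _).trans (abs_le_of_sq_le_sq ?_ ?_)
      · rw [mul_pow, Real.sq_sqrt (ellip_nonneg hβ n ω _ s a)]
        have h3 : 0 ≤ P.αhat β ^ 2 * R.ellip n ω ⟨h, hh⟩ s a :=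
          mul_nonneg (sq_nonneg _) (ellip_nonneg hβ n ω _ s a)
        linarith
      · exact mul_nonneg αhat_nonneg (Real.sqrt_nonneg _)
    · exact (hR.ptil_isDensity h1 hn ω h).kint_le
        (π.avg_bddMeas _ (hR.err_bddMeas h1 hn ω _))
        (fun s' => π.avg_le _ _ fun a => (hR.err_mem_Icc h1 hn ω _ _ a).2) s a
  · rw [kint_err_eq_zero n ω hh1]
    exact (bonus_mem_Icc n ω h s a).1

/-- Below the cap, the mean of the next error uses at most half of the bonus, since √(2/25) < 1/2.
The error of the first step uses at most a quarter: it decays like n^(-1/2), and the bonus cannot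
decay faster. -/
lemma Good.err_zero_add_le (hR : R.IsRun) (hβ : 100 ≤ β) {ω : P.Data β} (hω : R.Good ω) {n : ℕ}
    (h1 : 1 ≤ n) (hn : n ≤ P.N β) (π : MarkovPolicy S A) (a : A) :
    1 ≤ R.bonus n ω 0 P.M.init a ∨
      R.err n ω 0 P.M.init a + kint P.M.base (R.ptil n ω 0)
        (fun s' => π.avg 1 s' (R.err n ω 1 s')) P.M.init a ≤ R.bonus n ω 0 P.M.init a := by
  classical
  have hH := P.M.H_pos
  rw [bonus_eq n ω ⟨0, hH⟩]
  set X := R.ellip n ω ⟨0, hH⟩ P.M.init a with hX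
  have hX0 : 0 ≤ X := ellip_nonneg hβ n ω _ _ a
  set y := P.αhat β * √X with hy
  have hy0 : 0 ≤ y := mul_nonneg αhat_nonneg (Real.sqrt_nonneg _)
  have hy2 : y ^ 2 = P.αhat β ^ 2 * X := by rw [hy, mul_pow, Real.sq_sqrt hX0]
  rcases le_or_gt 1 y with h | h
  · left
    rw [min_eq_right h]
  right
  rw [min_eq_left h.le]
  set e := R.err n ω 0 P.M.init a with he
  have he0 : 0 ≤ e := (hR.err_mem_Icc h1 hn ω 0 P.M.init a).1
  have hg : kint P.M.base (R.ptil n ω 0) (fun s' => π.avg 1 s' (R.err n ω 1 s')) P.M.init a ≤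
      y / 2 := by
    by_cases hh1 : 0 + 1 < P.M.H
    · have h2 := hω.sq_kint_err_le hR hβ h1 hn hh1 π P.M.init a
      refine (le_abs_self _).trans (abs_le_of_sq_le_sq ?_ (by positivity))
      rw [← hX, ← hy2] at h2
      refine h2.trans ?_
      rw [div_pow]
      have : 0 ≤ y ^ 2 := sq_nonneg _
      linarith
    · rw [kint_err_eq_zero n ω hh1]
      positivity
  have hn0 : (0 : ℝ) < n := by exact_mod_cast h1
  have hζ := P.one_le_ζ hβ
  have hA := P.Atilde_ge
  have hd := P.one_le_d
  have he2 : n * e ^ 2 ≤ 2 * P.Atilde * P.ζ β := by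
    have := hω.sq_err_zero_le hR h1 hn (MarkovPolicy.always a)
    rwa [MarkovPolicy.avg_always] at this
  -- Densities integrate to one, so the constant function 1 gives a vector with inner product 1
  -- against every estimated feature. Its quadratic form in the covariance is at most n + βζd²,
  -- which bounds the elliptical norm of every feature from below.
  have hlow : P.αhat β ^ 2 ≤ y ^ 2 * (n + β * P.ζ β * (P.M.d : ℝ) ^ 2) := by
    have hlr := hR.isLowRankStep h1 hn ω hH
    obtain ⟨w, hw, hkw⟩ := hlr.exists_kint_eq_inner (v := fun _ => 1) measurable_const
      (fun _ => ⟨zero_le_one, le_rfl⟩)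
    have hone : ∀ s a, inner ℝ (R.φhat n 0 ω s a) w = (1 : ℝ) := fun s a => by
      rw [← hkw s a, hlr.isDensity.kint_const]
    have hcard : (∑ i : Fin (P.N β) with i.val < n, (1 : ℝ) ^ 2) = n := by
      rw [sum_fin_filter_lt hn fun _ => (1 : ℝ) ^ 2]
      simp
    have hlam : P.lam β * ‖w‖ ^ 2 ≤ β * P.ζ β * (P.M.d : ℝ) ^ 2 := by
      have c1 := P.lamLog_le_ζ β
      have c3 := P.one_le_lamLog hβ
      have c4 : 0 ≤ β := by linarith
      have c5 : 0 ≤ P.ζ β := by linarith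
      rw [P.lam_eq]
      calc β * P.M.d * P.lamLog β * ‖w‖ ^ 2 ≤ β * P.M.d * P.ζ β * P.M.d := by gcongr
        _ = _ := by ring
    have h3 : 1 ≤ X * (n + β * P.ζ β * (P.M.d : ℝ) ^ 2) := by
      have e1 : ∀ i : Fin (P.N β), inner ℝ w (R.φhat n 0 ω
          (epState P.M.init (ω i (P.covEpisode ⟨0, hH⟩)) 0)
            (ω i (P.covEpisode ⟨0, hH⟩) ⟨0, hH⟩).1) = (1 : ℝ) := fun i => by
        rw [real_inner_comm, hone]
      have hcs' := sq_inner_feature_le (R := R) hβ n ω ⟨0, hH⟩ P.M.init a w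
      simp only [e1, hone] at hcs'
      rw [hcard, one_pow] at hcs'
      exact hcs'.trans (mul_le_mul_of_nonneg_left (by linarith) hX0)
    rw [hy2]
    calc P.αhat β ^ 2 = P.αhat β ^ 2 * 1 := (mul_one _).symm
      _ ≤ P.αhat β ^ 2 * (X * (n + β * P.ζ β * (P.M.d : ℝ) ^ 2)) :=
        mul_le_mul_of_nonneg_left h3 (sq_nonneg _)
      _ = _ := by ring
  rw [αhat_sq hβ] at hlow
  have hy1 : y ^ 2 ≤ 1 := pow_le_one₀ hy0 h.le
  have hK : 0 ≤ β * P.ζ β * (P.M.d : ℝ) ^ 2 := by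
    have : 0 ≤ β := by linarith
    positivity
  have hK2 : 100 * (P.ζ β * P.Atilde) ≤ β * (P.ζ β * P.Atilde) :=
    mul_le_mul_of_nonneg_right hβ (by positivity)
  have h4 : n * (16 * e ^ 2) ≤ n * y ^ 2 := by
    have h5 := mul_le_mul_of_nonneg_right hy1 hK
    nlinarith
  have h6 : e ≤ y / 4 := by
    refine (le_abs_self _).trans (abs_le_of_sq_le_sq ?_ (by positivity))
    have := le_of_mul_le_mul_left h4 hn0
    rw [div_pow]
    linarith
  linarith

/-- On the good event, the bonus is valid: its truncated value bounds the error of the estimated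
value of every utility and every policy. -/
lemma Good.abs_Vhat_sub_V_le (hR : R.IsRun) (hβ : 100 ≤ β) {ω : P.Data β} (hω : R.Good ω) {n : ℕ}
    (h1 : 1 ≤ n) (hn : n ≤ P.N β) {u : ℕ → S → A → ℝ} (hu : IsUtil P.M.H P.M.init u)
    (π : MarkovPolicy S A) :
    |bval P.M.base id (R.ptil n ω) u π.prob P.M.H 0 P.M.init -
      bval P.M.base id P.M.trans u π.prob P.M.H 0 P.M.init| ≤ R.bonusVal n ω π :=
  abs_bval_sub_le_truncValue (hR.ptil_isDensity h1 hn ω) P.M.trans_isDensity hu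
    (hR.bonus_bddMeas h1 hn ω) (fun h s a => (bonus_mem_Icc n ω h s a).1)
    (hR.err_bddMeas h1 hn ω) (fun h s a => (hR.err_mem_Icc h1 hn ω h s a).1)
    (fun h hh s a => by rw [ptil_eq n ω hh]; simp [err, hh]) π
    (fun h _ hh s a => hω.kint_err_le_bonus hR hβ h1 hn π h hh s a)
    (fun a => hω.err_zero_add_le hR hβ h1 hn π a)

/-- The expected outer product of a feature. -/
def occMat {d : ℕ} (P : Config S A) (φ : S → A → EuclideanSpace ℝ (Fin d)) (π : MarkovPolicy S A)
    (h : ℕ) : Matrix (Fin d) (Fin d) ℝ := Matrix.of fun j l =>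
  occ P.M.base P.M.trans π.prob (fun s a => φ s a j * φ s a l) h 0 P.M.init

section OccMat

variable {d : ℕ} {φ : S → A → EuclideanSpace ℝ (Fin d)} (hφm : ∀ a, Measurable fun s => φ s a)
  (hφ1 : ∀ s a, ‖φ s a‖ ≤ 1) (π : MarkovPolicy S A) (h : ℕ)

include hφm hφ1

lemma feature_bddMeas (a : A) (j : Fin d) : BddMeas fun s => φ s a j := by
  refine BddMeas.of_mem_Icc (a := -1) (b := 1) ((measurable_pi_apply j).comp
    ((WithLp.measurable_ofLp 2 _).comp (hφm a))) fun s => ?_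
  have := PiLp.norm_apply_le (φ s a) j
  rw [Real.norm_eq_abs] at this
  exact ⟨by linarith [(abs_le.1 (this.trans (hφ1 s a))).1], (abs_le.1 (this.trans (hφ1 s a))).2⟩

lemma trace_mul_occMat (W : Matrix (Fin d) (Fin d) ℝ) :
    (W * occMat P φ π h).trace = occ P.M.base P.M.trans π.prob
      (fun s a => WithLp.ofLp (φ s a) ⬝ᵥ Matrix.mulVec W (WithLp.ofLp (φ s a))) h 0 P.M.init := by
  have hb : ∀ a j l, BddMeas fun s => φ s a j * φ s a l := fun a j l =>
    (feature_bddMeas hφm hφ1 a j).mul (feature_bddMeas hφm hφ1 a l)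
  have e : (fun s a => WithLp.ofLp (φ s a) ⬝ᵥ Matrix.mulVec W (WithLp.ofLp (φ s a))) =
      fun s a => ∑ j, ∑ l, W j l * (φ s a l * φ s a j) := by
    funext s a
    simp only [dotProduct, Matrix.mulVec, Finset.mul_sum]
    refine Finset.sum_congr rfl fun j _ => Finset.sum_congr rfl fun l _ => ?_
    ring
  rw [e, occ_sum P.M.trans_isDensity Finset.univ (F := fun j s a => ∑ l, W j l * (φ s a l * φ s a j))
    fun j _ a => BddMeas.sum _ fun l _ => (hb a l j).const_mul _]
  rw [Matrix.trace]
  refine Finset.sum_congr rfl fun j _ => ?_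
  rw [occ_sum P.M.trans_isDensity Finset.univ (F := fun l s a => W j l * (φ s a l * φ s a j))
    fun l _ a => (hb a l j).const_mul _]
  rw [Matrix.diag_apply, Matrix.mul_apply]
  refine Finset.sum_congr rfl fun l _ => ?_
  rw [occ_const_mul]
  rfl

lemma occMat_quad (x : EuclideanSpace ℝ (Fin d)) :
    WithLp.ofLp x ⬝ᵥ Matrix.mulVec (occMat P φ π h) (WithLp.ofLp x) =
      occ P.M.base P.M.trans π.prob (fun s a => inner ℝ x (φ s a) ^ 2) h 0 P.M.init := by
  have e1 : WithLp.ofLp x ⬝ᵥ Matrix.mulVec (occMat P φ π h) (WithLp.ofLp x) =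
      (Matrix.vecMulVec (WithLp.ofLp x) (WithLp.ofLp x) * occMat P φ π h).trace := by
    rw [Matrix.vecMulVec_mul, Matrix.trace_vecMulVec, Matrix.dotProduct_mulVec,
      dotProduct_comm]
  rw [e1, trace_mul_occMat hφm hφ1]
  congr 1
  funext s a
  rw [Matrix.vecMulVec_mulVec, real_inner_eq_dotProduct, dotProduct_smul, op_smul_eq_smul,
    smul_eq_mul, dotProduct_comm (WithLp.ofLp (φ s a)), sq]

lemma occMat_posSemidef : (occMat P φ π h).PosSemidef := by
  refine Matrix.PosSemidef.of_dotProduct_mulVec_nonneg ?_ fun x => ?_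
  · ext j l
    rw [Matrix.conjTranspose_apply, star_trivial]
    simp only [occMat, Matrix.of_apply]
    congr 1
    funext s a
    ring
  · have := occMat_quad (P := P) hφm hφ1 π h (WithLp.toLp 2 x)
    simp only [star_trivial]
    rw [show x ⬝ᵥ Matrix.mulVec (occMat P φ π h) x = _ from this]
    have hb : ∀ a, BddMeas fun s => inner ℝ (WithLp.toLp 2 x) (φ s a) ^ 2 := fun a => by
      simp_rw [real_inner_eq_dotProduct, dotProduct]
      exact (BddMeas.sum _ fun j _ => (feature_bddMeas hφm hφ1 a j).const_mul _).pow 2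
    exact occ_nonneg P.M.trans_isDensity hb (fun s a => sq_nonneg _) _ _ _ _

lemma trace_occMat_le : (occMat P φ π h).trace ≤ 1 := by
  have := trace_mul_occMat (P := P) hφm hφ1 π h 1
  rw [Matrix.one_mul] at this
  rw [this]
  simp only [Matrix.one_mulVec]
  refine occ_le P.M.trans_isDensity (fun a => ?_) (fun s a => ?_) _ _ _ _
  · simp only [dotProduct]
    exact BddMeas.sum _ fun j _ => (feature_bddMeas hφm hφ1 a j).mul (feature_bddMeas hφm hφ1 a j)
  · rw [← real_inner_eq_dotProduct, real_inner_self_eq_norm_sq]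
    exact pow_le_one₀ (norm_nonneg _) (hφ1 s a)

end OccMat

/-- In-sample bound of the squared bonus. -/
lemma Good.sum_bonus_le (hR : R.IsRun) (hβ : 100 ≤ β) {ω : P.Data β} (hω : R.Good ω) {n : ℕ}
    (h1 : 1 ≤ n) (hn : n ≤ P.N β) (h : Fin P.M.H) :
    ∑ i ∈ Finset.range n, R.occB i ω (P.covEpisode h) h (fun s a => R.bonus n ω h s a ^ 2) ≤
      2 * P.M.d * P.αhat β ^ 2 := by
  have hlr := hR.isLowRankStep h1 hn ω h.2
  have hm := hlr.measurable_feature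
  have h1' := hlr.norm_feature_le
  have hpd := cov_posDef (R := R) hβ n ω h
  set M := ∑ i ∈ Finset.range n, occMat P (R.φhat n h ω) (R.beh i ω (P.covEpisode h)) h with hM
  -- The term λ|x|² of the good event is absorbed by the regulariser of the covariance. The trace of
  -- its inverse times `M` is then at most 2d.
  have hquad : ∀ x, x ⬝ᵥ Matrix.mulVec M x ≤ 2 * (x ⬝ᵥ Matrix.mulVec (R.cov n ω h) x) := by
    intro x
    have e1 := cov_quad (R := R) n ω h (WithLp.toLp 2 x)
    have e2 : x ⬝ᵥ Matrix.mulVec M x = ∑ i ∈ Finset.range n, R.occB i ω (P.covEpisode h) h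
        (fun s a => inner ℝ (WithLp.toLp 2 x) (R.φhat n h ω s a) ^ 2) := by
      rw [hM, Matrix.sum_mulVec, dotProduct_sum]
      exact Finset.sum_congr rfl fun i _ => occMat_quad hm h1' _ _ (WithLp.toLp 2 x)
    have e3 := hω.le_cov n h1 hn h (WithLp.toLp 2 x)
    rw [sum_fin_filter_lt hn fun i => R.occB i ω (P.covEpisode h) h (fun s a =>
      inner ℝ (WithLp.toLp 2 x) (R.φhat n h ω s a) ^ 2), ← e2] at e3
    have e4 : 0 ≤ P.lam β * ‖(WithLp.toLp 2 x : EuclideanSpace ℝ (Fin P.M.d))‖ ^ 2 :=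
      mul_nonneg (lam_pos hβ).le (sq_nonneg _)
    rw [show x ⬝ᵥ Matrix.mulVec (R.cov n ω h) x = _ from e1]
    linarith
  have htr := hpd.trace_inv_mul_le hquad
  have e5 : ((R.cov n ω h)⁻¹ * M).trace =
      ∑ i ∈ Finset.range n, R.occB i ω (P.covEpisode h) h (R.ellip n ω h) := by
    rw [hM, Matrix.mul_sum, Matrix.trace_sum]
    exact Finset.sum_congr rfl fun i _ => trace_mul_occMat hm h1' _ _ _
  have hem : ∀ a, BddMeas fun s => R.ellip n ω h s a := fun a => by
    simp only [ellip, dotProduct, Matrix.mulVec]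
    exact BddMeas.sum _ fun j _ => (feature_bddMeas hm h1' a j).mul
      (BddMeas.sum _ fun l _ => (feature_bddMeas hm h1' a l).const_mul _)
  have hstep : ∀ i ∈ Finset.range n, R.occB i ω (P.covEpisode h) h
      (fun s a => R.bonus n ω h s a ^ 2) ≤
      P.αhat β ^ 2 * R.occB i ω (P.covEpisode h) h (R.ellip n ω h) := by
    intro i _
    unfold occB
    rw [← occ_const_mul]
    refine occ_mono P.M.trans_isDensity (fun a => (hR.bonus_bddMeas h1 hn ω h a).pow 2)
      (fun a => (hem a).const_mul _) (fun s a => ?_) _ _ _ _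
    have e6 : R.bonus n ω h s a ≤ P.αhat β * √(R.ellip n ω h s a) := by
      rw [bonus_eq]
      exact min_le_left _ _
    refine (pow_le_pow_left₀ (bonus_mem_Icc n ω h s a).1 e6 2).trans (le_of_eq ?_)
    rw [mul_pow, Real.sq_sqrt (ellip_nonneg hβ n ω h s a)]
  refine (Finset.sum_le_sum hstep).trans ?_
  rw [← Finset.mul_sum, ← e5]
  refine (mul_le_mul_of_nonneg_left htr (sq_nonneg _)).trans (le_of_eq ?_)
  ring

end Choices

end SafeRewardFree
end

/-! ### Regret of the exploration phase. -/

noncomputable section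
namespace SafeRewardFree

lemma le_sqrt_mul_inv_sqrt {x c n : ℝ} (hn : 0 < n) (hc : 0 ≤ c) (h : n * x ^ 2 ≤ c) :
    x ≤ √c * (√n)⁻¹ := by
  rw [← Real.sqrt_inv, ← Real.sqrt_mul hc]
  refine Real.le_sqrt_of_sq_le ?_
  rw [← div_eq_mul_inv, le_div_iff₀ hn]
  linarith

namespace Config

variable {S A : Type*} [MeasurableSpace S] [Fintype A] (P : Config S A)

/-- The logarithmic factor of the elliptical potential after `n` iterations. -/
def logPot (β : ℝ) (n : ℕ) : ℝ := 1 + Real.log (1 + ((n : ℝ) + 1) / (β * P.ζ β))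

/-- The factor in the regret bound of the exploration phase that does not depend on `n`. -/
def potScale (β : ℝ) : ℝ := β * P.ζ β * (P.M.d : ℝ) ^ 4 * P.Atilde ^ 2

lemma one_le_logPot {β : ℝ} (hβ : 100 ≤ β) (n : ℕ) : 1 ≤ P.logPot β n := by
  have h1 := P.one_le_ζ hβ
  unfold logPot
  have h2 : 0 ≤ ((n : ℝ) + 1) / (β * P.ζ β) := by positivity
  have := Real.log_nonneg (show 1 ≤ 1 + ((n : ℝ) + 1) / (β * P.ζ β) by linarith)
  linarith

lemma potScale_nonneg {β : ℝ} (hβ : 100 ≤ β) : 0 ≤ P.potScale β := by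
  have h1 := P.one_le_ζ hβ
  unfold potScale
  positivity

lemma Atilde_add_le : P.Atilde + (P.M.d : ℝ) ^ 2 ≤ 7 / 6 * (P.Atilde * (P.M.d : ℝ) ^ 2) := by
  have h1 := P.Atilde_ge
  have h2 := P.one_le_d
  have h3 : (1 : ℝ) ≤ (P.M.d : ℝ) ^ 2 := one_le_pow₀ h2
  nlinarith [mul_nonneg (sub_nonneg.2 h1) (sub_nonneg.2 h3)]

end Config

namespace Choices

variable {S A : Type*} [MeasurableSpace S] [Fintype A] {P : Config S A} {β : ℝ}
  {R : Choices P β}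

variable [MeasurableSpace A] [MeasurableSingletonClass A]

/-- The expectation at step `h + 1` is controlled by the covariance of the true features at
step `h` and the in-sample sum of squares. -/
lemma sq_occ_succ_le {ω : P.Data β} {l : ℝ} (hl : 0 < l) {n h k : ℕ} (hh : h + 1 < P.M.H)
    (hk : h + 1 = k ∨ h + 2 = k) {g : S → A → ℝ} (hg : ∀ a, BddMeas fun s => g s a)
    (h01 : ∀ s a, g s a ∈ Set.Icc (0 : ℝ) 1) {G : ℝ}
    (hG : ∑ i ∈ Finset.range n, R.occB i ω k (h + 1) (fun s a => g s a ^ 2) ≤ G)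
    (π : MarkovPolicy S A) :
    occ P.M.base P.M.trans π.prob g (h + 1) 0 P.M.init ^ 2 ≤
      ((l • (1 : Matrix (Fin P.M.d) (Fin P.M.d) ℝ) +
        ∑ i ∈ Finset.range n, occMat P (P.M.feature h) (R.pol i ω) h)⁻¹ *
          occMat P (P.M.feature h) π h).trace * (l * P.M.d + 6 / 5 * P.Atilde * G) := by
  have hh' : h < P.M.H := by omega
  have hlr := P.M.isLowRankStep h hh'
  have hden := P.M.trans_isDensity
  have hvm := π.avg_bddMeas (h + 1) hg
  have hv01 : ∀ s', π.avg (h + 1) s' (g s') ∈ Set.Icc (0 : ℝ) 1 := fun s' =>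
    ⟨π.le_avg _ _ fun a => (h01 s' a).1, π.avg_le _ _ fun a => (h01 s' a).2⟩
  obtain ⟨w, hw, hkw⟩ := hlr.exists_kint_eq_inner hvm.meas hv01
  have hkw' : ∀ s a, kint P.M.base (P.M.trans h) (fun s' => π.avg (h + 1) s' (g s')) s a =
      inner ℝ (P.M.feature h s a) w := fun s a => by
    rw [P.M.trans_eq hh']
    exact hkw s a
  have hm := hlr.measurable_feature
  have hf1 := hlr.norm_feature_le
  set M := ∑ i ∈ Finset.range n, occMat P (P.M.feature h) (R.pol i ω) h with hM
  have hMpsd : M.PosSemidef := Matrix.posSemidef_sum _ fun i _ => occMat_posSemidef hm hf1 _ _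
  have hU := Matrix.posDef_smul_one_add hl hMpsd
  set U := l • (1 : Matrix (Fin P.M.d) (Fin P.M.d) ℝ) + M with hUdef
  have hquad : WithLp.ofLp w ⬝ᵥ Matrix.mulVec U (WithLp.ofLp w) ≤
      l * P.M.d + 6 / 5 * P.Atilde * G := by
    rw [hUdef, Matrix.quad_smul_one_add, ← real_inner_eq_dotProduct, real_inner_self_eq_norm_sq]
    refine add_le_add (mul_le_mul_of_nonneg_left hw hl.le) ?_
    rw [hM, Matrix.sum_mulVec, dotProduct_sum]
    have hA := P.Atilde_ge
    refine le_trans ?_ (mul_le_mul_of_nonneg_left hG (by positivity))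
    rw [Finset.mul_sum]
    refine Finset.sum_le_sum fun i _ => ?_
    rw [occMat_quad hm hf1]
    refine le_trans ?_ (R.occ_pol_le_occB i ω k (fun a => (hg a).pow 2) (fun s a => sq_nonneg _)
      h hk π)
    refine occ_mono hden (fun a => ?_) (fun a => (hden h).kint_bddMeas
      (π.avg_bddMeas (h + 1) fun a => (hg a).pow 2) a) (fun s a => ?_) _ _ _ _
    · have e : ∀ s, inner ℝ w (P.M.feature h s a) = _ := fun s =>
        (real_inner_comm _ _).trans (hkw' s a).symm
      simp_rw [e]
      exact ((hden h).kint_bddMeas hvm a).pow 2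
    · rw [real_inner_comm, ← hkw']
      exact ((hden h).sq_kint_le hvm s a).trans ((hden h).kint_mono (hvm.pow 2)
        (π.avg_bddMeas (h + 1) fun a => (hg a).pow 2) (fun s' => π.sq_avg_le (h + 1) s') s a)
  have e1 : occ P.M.base P.M.trans π.prob g (h + 1) 0 P.M.init =
      occ P.M.base P.M.trans π.prob (fun s a => inner ℝ (P.M.feature h s a) w) h 0 P.M.init := by
    rw [occ_succ_right, zero_add]
    congr 1
    funext s a
    exact hkw' s a
  have hwm : ∀ a, BddMeas fun s => inner ℝ (P.M.feature h s a) w := fun a => by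
    simp_rw [← hkw']
    exact (hden h).kint_bddMeas hvm a
  have hqm : ∀ a, BddMeas fun s => WithLp.ofLp (P.M.feature h s a) ⬝ᵥ
      Matrix.mulVec U⁻¹ (WithLp.ofLp (P.M.feature h s a)) := fun a => by
    simp only [dotProduct, Matrix.mulVec]
    exact BddMeas.sum _ fun j _ => (feature_bddMeas hm hf1 a j).mul
      (BddMeas.sum _ fun l _ => (feature_bddMeas hm hf1 a l).const_mul _)
  rw [e1]
  refine (sq_occ_le hden hwm π h 0 P.M.init).trans ?_
  refine (occ_mono hden (fun a => (hwm a).pow 2) (fun a => (hqm a).const_mul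
    (WithLp.ofLp w ⬝ᵥ Matrix.mulVec U (WithLp.ofLp w))) (fun s a => ?_) π h 0 P.M.init).trans ?_
  · rw [real_inner_eq_dotProduct, mul_comm]
    exact hU.sq_dotProduct_le _ _
  · rw [occ_const_mul, ← trace_mul_occMat hm hf1, mul_comm]
    refine mul_le_mul_of_nonneg_left hquad ?_
    rw [trace_mul_occMat hm hf1]
    exact occ_nonneg hden hqm (fun s a => hU.quad_inv_nonneg _) _ _ _ _

/-- Cauchy–Schwarz over the iterations, then the elliptical potential of the expected outer products
of the true features at step `h`. The functions may change with `n`; only their in-sample sums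
matter. -/
lemma sum_occ_succ_le {ω : P.Data β} {l : ℝ} (hl : 1 ≤ l) {n' h k : ℕ} (hh : h + 1 < P.M.H)
    (hk : h + 1 = k ∨ h + 2 = k) {g : ℕ → S → A → ℝ}
    (hg : ∀ n, 1 ≤ n → n ≤ n' → ∀ a, BddMeas fun s => g n s a)
    (h01 : ∀ n s a, g n s a ∈ Set.Icc (0 : ℝ) 1) {G : ℝ} (hG0 : 0 ≤ G)
    (hG : ∀ n, 1 ≤ n → n ≤ n' →
      ∑ i ∈ Finset.range n, R.occB i ω k (h + 1) (fun s a => g n s a ^ 2) ≤ G) :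
    (∑ n ∈ Finset.Icc 1 n', occ P.M.base P.M.trans (R.pol n ω).prob (g n) (h + 1) 0 P.M.init) ^ 2 ≤
      n' * (2 * P.M.d * Real.log (1 + ((n' : ℝ) + 1) / l) * (l * P.M.d + 6 / 5 * P.Atilde * G)) := by
  have hlr := P.M.isLowRankStep h (by omega)
  have hm := hlr.measurable_feature
  have hf1 := hlr.norm_feature_le
  have hA := P.Atilde_ge
  have hl0 : 0 < l := by linarith
  set M := fun i => occMat P (P.M.feature h) (R.pol i ω) h with hM
  have hMpsd : ∀ i, (M i).PosSemidef := fun i => occMat_posSemidef hm hf1 _ _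
  -- The potential starts with the baseline at index 0, while the regret is summed from 1 to n';
  -- hence n' + 1 terms.
  have h1 := Matrix.sum_trace_inv_mul_le hl hMpsd (fun i => trace_occMat_le hm hf1 _ _) (n' + 1)
  have hnn : ∀ n, 0 ≤ ((l • (1 : Matrix (Fin P.M.d) (Fin P.M.d) ℝ) +
      ∑ i ∈ Finset.range n, M i)⁻¹ * M n).trace := fun n => by
    have hU := Matrix.posDef_smul_one_add hl0
      (Matrix.posSemidef_sum (Finset.range n) fun i _ => hMpsd i)
    simp only [hM]
    rw [trace_mul_occMat hm hf1]
    refine occ_nonneg P.M.trans_isDensity (fun a => ?_) (fun s a => hU.quad_inv_nonneg _) _ _ _ _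
    simp only [dotProduct, Matrix.mulVec]
    exact BddMeas.sum _ fun j _ => (feature_bddMeas hm hf1 a j).mul
      (BddMeas.sum _ fun l _ => (feature_bddMeas hm hf1 a l).const_mul _)
  have h2 : ∑ n ∈ Finset.Icc 1 n', ((l • (1 : Matrix (Fin P.M.d) (Fin P.M.d) ℝ) +
      ∑ i ∈ Finset.range n, M i)⁻¹ * M n).trace ≤
      2 * P.M.d * Real.log (1 + ((n' : ℝ) + 1) / l) := by
    push_cast at h1
    refine le_trans (Finset.sum_le_sum_of_subset_of_nonneg ?_ fun i _ _ => hnn i) h1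
    intro i hi
    rw [Finset.mem_Icc] at hi
    exact Finset.mem_range.2 (by omega)
  have hW : 0 ≤ l * P.M.d + 6 / 5 * P.Atilde * G := by positivity
  refine sq_sum_le_card_mul_sum_sq.trans ?_
  rw [Nat.card_Icc, Nat.add_sub_cancel]
  refine mul_le_mul_of_nonneg_left ?_ (Nat.cast_nonneg _)
  refine le_trans ?_ (mul_le_mul_of_nonneg_right h2 hW)
  rw [Finset.sum_mul]
  refine Finset.sum_le_sum fun n hn => ?_
  rw [Finset.mem_Icc] at hn
  exact sq_occ_succ_le hl0 hh hk (hg n hn.1 hn.2) (h01 n) (hG n hn.1 hn.2) _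

lemma sum_occ_succ_le_sqrt (hβ : 100 ≤ β) {ω : P.Data β} {n' h k : ℕ} (hh : h + 1 < P.M.H)
    (hk : h + 1 = k ∨ h + 2 = k) {g : ℕ → S → A → ℝ}
    (hg : ∀ n, 1 ≤ n → n ≤ n' → ∀ a, BddMeas fun s => g n s a)
    (h01 : ∀ n s a, g n s a ∈ Set.Icc (0 : ℝ) 1)
    (hG : ∀ n, 1 ≤ n → n ≤ n' →
      ∑ i ∈ Finset.range n, R.occB i ω k (h + 1) (fun s a => g n s a ^ 2) ≤
        2 * P.M.d * P.αhat β ^ 2) :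
    ∑ n ∈ Finset.Icc 1 n', occ P.M.base P.M.trans (R.pol n ω).prob (g n) (h + 1) 0 P.M.init ≤
      12 * √(n' * (P.potScale β * P.logPot β n')) := by
  have hζ := P.one_le_ζ hβ
  have hA := P.Atilde_ge
  have hd := P.one_le_d
  -- The potential is regularised by βζ instead of 1. Its contribution βζd is of no larger order
  -- than the in-sample term, and ζ will cancel from the logarithm in `logPot_le`.
  have hl : 1 ≤ β * P.ζ β := by nlinarith
  have h1 := sum_occ_succ_le hl hh hk hg h01 (by positivity) hG
  have hL := P.one_le_logPot hβ n'
  have hL0 : 0 ≤ Real.log (1 + ((n' : ℝ) + 1) / (β * P.ζ β)) :=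
    Real.log_nonneg (le_add_of_nonneg_right (by positivity))
  have hLL : Real.log (1 + ((n' : ℝ) + 1) / (β * P.ζ β)) ≤ P.logPot β n' := by
    unfold Config.logPot; linarith
  have hW : β * P.ζ β * P.M.d + 6 / 5 * P.Atilde * (2 * P.M.d * P.αhat β ^ 2) ≤
      72 * (β * P.ζ β * P.M.d ^ 3 * P.Atilde ^ 2) := by
    rw [αhat_sq hβ]
    have c1 := P.Atilde_add_le
    have c2 : (P.M.d : ℝ) ≤ P.M.d ^ 3 * P.Atilde ^ 2 := by
      have e1 : (1 : ℝ) ≤ P.M.d ^ 2 := one_le_pow₀ hd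
      have e2 : (1 : ℝ) ≤ P.Atilde ^ 2 := one_le_pow₀ (by linarith)
      have e3 : (1 : ℝ) ≤ P.M.d ^ 2 * P.Atilde ^ 2 := by nlinarith
      calc (P.M.d : ℝ) = P.M.d * 1 := (mul_one _).symm
        _ ≤ P.M.d * (P.M.d ^ 2 * P.Atilde ^ 2) := mul_le_mul_of_nonneg_left e3 (by linarith)
        _ = _ := by ring
    have c3 := mul_le_mul_of_nonneg_left c1 (show 0 ≤ 60 * (P.Atilde * P.M.d * (β * P.ζ β)) by
      positivity)
    have c4 := mul_le_mul_of_nonneg_left c2 (show 0 ≤ β * P.ζ β by linarith)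
    have c5 : 0 ≤ β * P.ζ β * (P.M.d ^ 3 * P.Atilde ^ 2) := by positivity
    linarith
  refine (le_abs_self _).trans (abs_le_of_sq_le_sq (h1.trans ?_) (by positivity))
  rw [mul_pow, Real.sq_sqrt (mul_nonneg (Nat.cast_nonneg _)
    (mul_nonneg (P.potScale_nonneg hβ) (by linarith)))]
  calc (n' : ℝ) * (2 * P.M.d * Real.log (1 + ((n' : ℝ) + 1) / (β * P.ζ β)) *
        (β * P.ζ β * P.M.d + 6 / 5 * P.Atilde * (2 * P.M.d * P.αhat β ^ 2)))
      ≤ n' * (2 * P.M.d * P.logPot β n' * (72 * (β * P.ζ β * P.M.d ^ 3 * P.Atilde ^ 2))) := by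
        gcongr
    _ = _ := by unfold Config.potScale; ring

/-- Regret bound for the exploration phase. -/
theorem Good.sum_U_le (hR : R.IsRun) (hβ : 100 ≤ β) {ω : P.Data β} (hω : R.Good ω) {n' : ℕ}
    (hn' : n' ≤ P.N β) :
    ∑ n ∈ Finset.Icc 1 n', R.U n ω (R.pol n ω) ≤
      24 * P.M.H * √(n' * (P.potScale β * P.logPot β n')) := by
  have hζ := P.one_le_ζ hβ
  have hA := P.Atilde_ge
  have hd := P.one_le_d
  have hH := P.M.H_pos
  have hβ0 : 0 < β := by linarith
  have hden := P.M.trans_isDensity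
  have hL := P.one_le_logPot hβ n'
  have hY0 := P.potScale_nonneg hβ
  set Q := √(n' * (P.potScale β * P.logPot β n')) with hQ
  have hA2 : P.Atilde * P.ζ β ≤ P.potScale β := by
    have e1 : (1 : ℝ) ≤ P.M.d ^ 4 := one_le_pow₀ hd
    have e2 : 1 ≤ β * P.Atilde := by nlinarith
    unfold Config.potScale
    calc P.Atilde * P.ζ β = P.Atilde * P.ζ β * (1 * 1) := by ring
      _ ≤ P.Atilde * P.ζ β * ((β * P.Atilde) * P.M.d ^ 4) := by gcongr
      _ = _ := by ring
  have hA3 : 2 * P.Atilde * P.ζ β ≤ P.potScale β := by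
    have e1 : (1 : ℝ) ≤ P.M.d ^ 4 := one_le_pow₀ hd
    have e2 : 2 ≤ β * P.Atilde := by nlinarith
    unfold Config.potScale
    calc 2 * P.Atilde * P.ζ β = P.Atilde * P.ζ β * (2 * 1) := by ring
      _ ≤ P.Atilde * P.ζ β * ((β * P.Atilde) * P.M.d ^ 4) := by gcongr
      _ = _ := by ring
  -- the first step
  have hfirst : ∀ n ∈ Finset.Icc 1 n',
      occ P.M.base P.M.trans (R.pol n ω).prob (R.bonus n ω 0) 0 0 P.M.init +
      occ P.M.base P.M.trans (R.pol n ω).prob (R.err n ω 0) 0 0 P.M.init +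
      √(P.Atilde * P.ζ β / (n : ℝ)) ≤ 10 * √(P.potScale β) * (√(n : ℝ))⁻¹ := by
    intro n hn
    rw [Finset.mem_Icc] at hn
    have hnN : n ≤ P.N β := hn.2.trans hn'
    have hn0 : (0 : ℝ) < n := by exact_mod_cast hn.1
    have a1 : √(P.Atilde * P.ζ β / (n : ℝ)) ≤ √(P.potScale β) * (√(n : ℝ))⁻¹ := by
      rw [div_eq_mul_inv, Real.sqrt_mul (by positivity), Real.sqrt_inv]
      exact mul_le_mul_of_nonneg_right (Real.sqrt_le_sqrt hA2) (by positivity)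
    have a2 : occ P.M.base P.M.trans (R.pol n ω).prob (R.err n ω 0) 0 0 P.M.init ≤
        √(P.potScale β) * (√(n : ℝ))⁻¹ := by
      refine le_sqrt_mul_inv_sqrt hn0 hY0 ?_
      rw [occ_zero]
      have b1 := hω.sq_err_zero_le hR hn.1 hnN (R.pol n ω)
      have b2 := mul_le_mul_of_nonneg_left
        ((R.pol n ω).sq_avg_le 0 P.M.init (f := R.err n ω 0 P.M.init)) hn0.le
      linarith
    have a3 : occ P.M.base P.M.trans (R.pol n ω).prob (R.bonus n ω 0) 0 0 P.M.init ≤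
        √(64 * P.potScale β) * (√(n : ℝ))⁻¹ := by
      refine le_sqrt_mul_inv_sqrt hn0 (by positivity) ?_
      rw [occ_zero]
      have b2 := mul_le_mul_of_nonneg_left
        ((R.pol n ω).sq_avg_le 0 P.M.init (f := R.bonus n ω 0 P.M.init)) hn0.le
      have b3 := hω.sum_bonus_le hR hβ hn.1 hnN ⟨0, hH⟩
      have b4 : ∀ i ∈ Finset.range n,
          (R.pol n ω).avg 0 P.M.init (fun a => R.bonus n ω 0 P.M.init a ^ 2) ≤
          P.Atilde * R.occB i ω (P.covEpisode ⟨0, hH⟩) 0 (fun s a => R.bonus n ω 0 s a ^ 2) :=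
        fun i _ => R.avg_zero_le_occB i ω _ (g := fun s a => R.bonus n ω 0 s a ^ 2)
          (fun a => (hR.bonus_bddMeas hn.1 hnN ω 0 a).pow 2) (fun s a => sq_nonneg _)
          (by simp only [Config.covEpisode]; omega) _
      have b5 := Finset.sum_le_sum b4
      rw [Finset.sum_const, Finset.card_range, nsmul_eq_mul, ← Finset.mul_sum] at b5
      have b6 := mul_le_mul_of_nonneg_left b3 (show 0 ≤ P.Atilde by linarith)
      have b7 : P.Atilde * (2 * P.M.d * P.αhat β ^ 2) ≤ 64 * P.potScale β := by
        rw [αhat_sq hβ]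
        have c3 := mul_le_mul_of_nonneg_left P.Atilde_add_le
          (show 0 ≤ 50 * (P.Atilde * P.M.d * (β * P.ζ β)) by positivity)
        have c4 : (P.M.d : ℝ) ^ 3 ≤ P.M.d ^ 4 := pow_le_pow_right₀ hd (by norm_num)
        have c5 := mul_le_mul_of_nonneg_left c4 (show 0 ≤ β * P.ζ β * P.Atilde ^ 2 by positivity)
        have c6 : 0 ≤ β * P.ζ β * P.Atilde ^ 2 * (P.M.d : ℝ) ^ 4 := by positivity
        unfold Config.potScale
        linarith
      exact b2.trans (b5.trans (b6.trans b7))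
    rw [Real.sqrt_mul (by norm_num), show (64 : ℝ) = 8 ^ 2 by norm_num,
      Real.sqrt_sq (by norm_num)] at a3
    linarith
  have hfirst' : ∑ n ∈ Finset.Icc 1 n',
      (occ P.M.base P.M.trans (R.pol n ω).prob (R.bonus n ω 0) 0 0 P.M.init +
      occ P.M.base P.M.trans (R.pol n ω).prob (R.err n ω 0) 0 0 P.M.init +
      √(P.Atilde * P.ζ β / (n : ℝ))) ≤ 24 * Q := by
    refine (Finset.sum_le_sum hfirst).trans ?_
    rw [← Finset.mul_sum]
    have a1 := mul_le_mul_of_nonneg_left (sum_inv_sqrt_le n')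
      (show 0 ≤ 10 * √(P.potScale β) by positivity)
    have a2 : √(P.potScale β) * √(n' : ℝ) ≤ Q := by
      rw [← Real.sqrt_mul hY0]
      refine Real.sqrt_le_sqrt ?_
      rw [mul_comm]
      exact mul_le_mul_of_nonneg_left (le_mul_of_one_le_right hY0 hL) (Nat.cast_nonneg _)
    have a3 : 0 ≤ Q := Real.sqrt_nonneg _
    nlinarith
  have hstep : ∀ h, h + 1 < P.M.H → ∑ n ∈ Finset.Icc 1 n',
      (occ P.M.base P.M.trans (R.pol n ω).prob (R.bonus n ω (h + 1)) (h + 1) 0 P.M.init +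
      occ P.M.base P.M.trans (R.pol n ω).prob (R.err n ω (h + 1)) (h + 1) 0 P.M.init) ≤
      24 * Q := by
    intro h hh
    rw [Finset.sum_add_distrib]
    -- The bonus of step h + 1 is controlled in its covariance episode, the transition error in the
    -- likelihood episode h + 1. Both episodes randomise at step h + 1, so one change of policy
    -- serves both.
    have a1 := sum_occ_succ_le_sqrt (R := R) (ω := ω) (n' := n') hβ hh
      (k := P.covEpisode ⟨h + 1, hh⟩) (by simp only [Config.covEpisode]; omega)
      (g := fun n => R.bonus n ω (h + 1))
      (fun n h1 h2 => hR.bonus_bddMeas h1 (h2.trans hn') ω _)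
      (fun n s a => bonus_mem_Icc n ω _ s a)
      (fun n h1 h2 => hω.sum_bonus_le hR hβ h1 (h2.trans hn') ⟨h + 1, hh⟩)
    -- The error is replaced by zero outside 1 ≤ n ≤ n', where the estimates need not belong to the
    -- model class and it need not be at most one.
    have a2 := sum_occ_succ_le_sqrt (R := R) (ω := ω) (n' := n') hβ hh
      (k := h + 1) (Or.inl rfl) (g := fun n => if 1 ≤ n ∧ n ≤ n' then R.err n ω (h + 1) else 0)
      (fun n h1 h2 => by
        rw [if_pos ⟨h1, h2⟩]; exact hR.err_bddMeas h1 (h2.trans hn') ω _)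
      (fun n s a => by
        split_ifs with hc
        · exact hR.err_mem_Icc hc.1 (hc.2.trans hn') ω _ s a
        · simp)
      (fun n h1 h2 => by
        rw [if_pos ⟨h1, h2⟩]
        refine (hω.sum_err_le h1 (h2.trans hn') hh).trans ?_
        rw [αhat_sq hβ]
        have e1 : 1 ≤ β * (P.Atilde + (P.M.d : ℝ) ^ 2) := by nlinarith
        have e2 : 1 ≤ P.M.d * (β * (P.Atilde + (P.M.d : ℝ) ^ 2)) := by nlinarith
        have e3 := mul_le_mul_of_nonneg_left e2 (show 0 ≤ P.ζ β by linarith)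
        have e4 : 0 ≤ P.ζ β * (P.M.d * (β * (P.Atilde + (P.M.d : ℝ) ^ 2))) := by positivity
        linarith)
    have a3 : ∑ n ∈ Finset.Icc 1 n',
        occ P.M.base P.M.trans (R.pol n ω).prob (R.err n ω (h + 1)) (h + 1) 0 P.M.init =
        ∑ n ∈ Finset.Icc 1 n', occ P.M.base P.M.trans (R.pol n ω).prob
          (if 1 ≤ n ∧ n ≤ n' then R.err n ω (h + 1) else 0) (h + 1) 0 P.M.init := by
      refine Finset.sum_congr rfl fun n hn => ?_
      rw [if_pos (Finset.mem_Icc.1 hn)]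
    rw [a3]
    linarith
  have hB : ∀ n ∈ Finset.Icc 1 n', R.U n ω (R.pol n ω) ≤
      ∑ h ∈ Finset.range P.M.H,
        (occ P.M.base P.M.trans (R.pol n ω).prob (R.bonus n ω h) h 0 P.M.init +
        occ P.M.base P.M.trans (R.pol n ω).prob (R.err n ω h) h 0 P.M.init) +
        √(P.Atilde * P.ζ β / (n : ℝ)) := by
    intro n hn
    rw [Finset.mem_Icc] at hn
    have hnN := hn.2.trans hn'
    rw [U_eq]
    refine add_le_add_left (truncValue_le_sum_occ (hR.ptil_isDensity hn.1 hnN ω) hden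
      (hR.bonus_bddMeas hn.1 hnN ω) (fun h s a => (bonus_mem_Icc n ω h s a).1)
      (hR.err_bddMeas hn.1 hnN ω) (fun h hh s a => ?_) _ _) _
    rw [ptil_eq n ω hh]
    simp [err, hh]
  refine (Finset.sum_le_sum hB).trans ?_
  obtain ⟨m, hm⟩ : ∃ m, P.M.H = m + 1 := ⟨P.M.H - 1, by omega⟩
  have e1 : ∀ n ∈ Finset.Icc 1 n', ∑ h ∈ Finset.range P.M.H,
        (occ P.M.base P.M.trans (R.pol n ω).prob (R.bonus n ω h) h 0 P.M.init +
        occ P.M.base P.M.trans (R.pol n ω).prob (R.err n ω h) h 0 P.M.init) +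
        √(P.Atilde * P.ζ β / (n : ℝ)) =
      ∑ h ∈ Finset.range m,
        (occ P.M.base P.M.trans (R.pol n ω).prob (R.bonus n ω (h + 1)) (h + 1) 0 P.M.init +
        occ P.M.base P.M.trans (R.pol n ω).prob (R.err n ω (h + 1)) (h + 1) 0 P.M.init) +
      (occ P.M.base P.M.trans (R.pol n ω).prob (R.bonus n ω 0) 0 0 P.M.init +
      occ P.M.base P.M.trans (R.pol n ω).prob (R.err n ω 0) 0 0 P.M.init +
      √(P.Atilde * P.ζ β / (n : ℝ))) := by
    intro n _
    rw [hm, Finset.sum_range_succ']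
    ring
  rw [Finset.sum_congr rfl e1, Finset.sum_add_distrib, Finset.sum_comm]
  have e2 := Finset.sum_le_sum (s := Finset.range m) fun h hh =>
    hstep h (by rw [Finset.mem_range] at hh; omega)
  rw [Finset.sum_const, Finset.card_range, nsmul_eq_mul] at e2
  have e3 : (P.M.H : ℝ) = m + 1 := by exact_mod_cast hm
  rw [e3]
  linarith

end Choices

end SafeRewardFree
end

/-! ### Termination, safety and planning on the good event. -/

noncomputable section
namespace SafeRewardFree

namespace Config

variable {S A : Type*} [MeasurableSpace S] [Fintype A] (P : Config S A)

lemma threshold_le_κ : P.threshold ≤ P.task.κ / 72 := by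
  unfold threshold
  have h1 := P.acc_le_κ
  have h2 := P.Δ_le_one
  have h3 := P.acc_pos
  nlinarith

lemma logPot_le_ζ {β : ℝ} (hβ : 100 ≤ β) {n : ℕ} (hn : n ≤ P.N β) : P.logPot β n ≤ P.ζ β := by
  have hζ := P.one_le_ζ hβ
  have hN := P.d_le_N hβ
  have hd := P.one_le_d
  have hn' : (n : ℝ) ≤ P.N β := by exact_mod_cast hn
  have h1 : 100 ≤ β * P.ζ β := by nlinarith
  have h2 : ((n : ℝ) + 1) / (β * P.ζ β) ≤ (P.N β + 1) / 100 := by gcongr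
  have h3 : 0 ≤ ((n : ℝ) + 1) / (β * P.ζ β) := by positivity
  have he := Real.exp_one_lt_d9
  have he0 := Real.exp_pos 1
  have hζeq : P.ζ β = Real.log (P.logArg * P.N β) := P.logTerm_eq _
  rw [logPot]
  refine le_trans ?_ hζeq.ge
  nth_rewrite 1 [← Real.log_exp 1]
  rw [← Real.log_mul he0.ne' (by linarith)]
  refine Real.log_le_log (by positivity) ?_
  have h4 := P.two_le_logArg
  calc Real.exp 1 * (1 + ((n : ℝ) + 1) / (β * P.ζ β)) ≤ 3 * (1 + (P.N β + 1) / 100) := by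
        gcongr
        linarith
    _ ≤ 2 * P.N β := by linarith
    _ ≤ P.logArg * P.N β := by gcongr

end Config

namespace Choices

variable {S A : Type*} [MeasurableSpace S] [Fintype A] {P : Config S A} {β : ℝ}
  {R : Choices P β} [MeasurableSpace A] [MeasurableSingletonClass A]

lemma bonusVal_le_U (n : ℕ) (ω : P.Data β) (π : MarkovPolicy S A) :
    R.bonusVal n ω π ≤ R.U n ω π := by
  rw [U_eq]
  exact le_add_of_nonneg_right (Real.sqrt_nonneg _)

lemma Good.abs_Vhat_sub_le (hR : R.IsRun) (hβ : 100 ≤ β) {ω : P.Data β} (hω : R.Good ω) {n : ℕ}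
    (h1 : 1 ≤ n) (hn : n ≤ P.N β) {u : ℕ → S → A → ℝ} (hu : P.M.IsUtility u)
    (π : MarkovPolicy S A) : |R.Vhat n ω u π - P.M.V u π.prob| ≤ R.bonusVal n ω π := by
  rw [Vhat_eq, P.M.V_eq]
  exact hω.abs_Vhat_sub_V_le hR hβ h1 hn hu.isUtil π

/-- Before termination, the reference policy has a large value of `U⁽ⁿ⁾`. -/
lemma Good.threshold_lt_U (hR : R.IsRun) (hβ : 100 ≤ β) {ω : P.Data β} (hω : R.Good ω) {n : ℕ}
    (h1 : 1 ≤ n) (hn : n ≤ P.N β) (hT : ∀ m, 1 ≤ m → m ≤ n → ¬ R.Terminates m ω) :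
    P.threshold < R.U n ω (R.pol n ω) := by
  have hmem := hR.pol_mem n h1 hn ω fun m h h' => hT m h h'.le
  have hTn := hT n h1 le_rfl
  unfold Terminates at hTn
  by_cases hb : R.BaselineAccurate n ω
  · by_contra hc
    exact hTn ⟨hb, not_lt.1 hc⟩
  -- The baseline is the policy chosen. Its true cost is at most τ - κ, yet the accuracy test fails
  -- at τ - 2κ/3, so twice its `U` is at least κ/3; this is far above the threshold, which is at
  -- most κ/72.
  · unfold safeSet at hmem
    rw [if_neg hb, Set.mem_singleton_iff] at hmem
    rw [hmem]
    unfold BaselineAccurate at hb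
    push Not at hb
    have e1 := (abs_le.1 (hω.abs_Vhat_sub_le hR hβ h1 hn P.task.isUtility_c P.task.baseline)).2
    have e2 := bonusVal_le_U (R := R) n ω P.task.baseline
    have e3 := P.task.baseline_safe
    have e4 := P.threshold_le_κ
    have e5 := P.task.κ_pos
    linarith

/-- As long as exploration has not ended, the number of iterations is small. -/
lemma Good.mul_sq_threshold_le (hR : R.IsRun) (hβ : 100 ≤ β) {ω : P.Data β} (hω : R.Good ω)
    {n : ℕ} (hn : n ≤ P.N β) (hT : ∀ m, 1 ≤ m → m ≤ n → ¬ R.Terminates m ω) :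
    n * P.threshold ^ 2 ≤ 576 * P.M.H ^ 2 * (P.potScale β * P.logPot β n) := by
  have hY : 0 ≤ P.potScale β * P.logPot β n :=
    mul_nonneg (P.potScale_nonneg hβ) (zero_le_one.trans (P.one_le_logPot hβ n))
  rcases Nat.eq_zero_or_pos n with rfl | hn0
  · rw [Nat.cast_zero, zero_mul]
    positivity
  have h1 : n * P.threshold ≤ ∑ m ∈ Finset.Icc 1 n, R.U m ω (R.pol m ω) := by
    have := Finset.sum_le_sum (s := Finset.Icc 1 n) (f := fun _ => P.threshold)
      (g := fun m => R.U m ω (R.pol m ω)) fun m hm => by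
        rw [Finset.mem_Icc] at hm
        exact (hω.threshold_lt_U hR hβ hm.1 (hm.2.trans hn)
          fun j hj hjm => hT j hj (hjm.trans hm.2)).le
    rwa [Finset.sum_const, Nat.card_Icc, Nat.add_sub_cancel, nsmul_eq_mul] at this
  have hT0 := P.threshold_pos
  have h2 := pow_le_pow_left₀ (by positivity) (h1.trans (hω.sum_U_le hR hβ hn)) 2
  have hn' : (0 : ℝ) < n := by exact_mod_cast hn0
  rw [mul_pow, mul_pow _ (√_), Real.sq_sqrt (by positivity)] at h2
  refine le_of_mul_le_mul_left ?_ hn'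
  linarith

/-- Without termination up to `N`, the regret bound gives N T² ≤ 576 X ζ², whereas the definition of
`N` gives at least 1024 X ζ². The bound is recorded for the iteration `m` before the stopping one,
where it still applies. -/
theorem Good.exists_stopsAt (hR : R.IsRun) (hβ : 100 ≤ β) {ω : P.Data β} (hω : R.Good ω) :
    ∃ m, R.StopsAt (m + 1) ω ∧
      m * P.threshold ^ 2 ≤ 576 * P.M.H ^ 2 * (P.potScale β * P.logPot β m) := by
  have hex : ∃ m, 1 ≤ m ∧ m ≤ P.N β ∧ R.Terminates m ω := by
    by_contra hc
    push Not at hc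
    have h1 := hω.mul_sq_threshold_le hR hβ le_rfl fun m h h' => hc m h h'
    have h2 := (P.N_spec β).2
    have hζ := P.one_le_ζ hβ
    have hA := P.Atilde_ge
    have hd := P.one_le_d
    have hH := P.one_le_H
    have hT0 := P.threshold_pos
    have hκ := P.task.κ_pos
    have hβ0 : 0 < β := by linarith
    set X := β * (P.M.H : ℝ) ^ 2 * (P.M.d : ℝ) ^ 4 * P.Atilde ^ 2 with hX
    have hX0 : 0 < X := by positivity
    have h3 : 1024 * X * P.ζ β ^ 2 ≤ P.N β * P.threshold ^ 2 := by
      have e1 : 1024 * X / P.threshold ^ 2 ≤ P.coefN β := by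
        unfold Config.coefN
        refine le_trans (le_of_eq ?_) (le_add_of_nonneg_right (by positivity))
        rw [hX]
        ring
      have e2 := (mul_le_mul_of_nonneg_right e1 (sq_nonneg (P.ζ β))).trans h2
      rw [div_mul_eq_mul_div, div_le_iff₀ (by positivity)] at e2
      exact e2
    have h4 : 576 * P.M.H ^ 2 * (P.potScale β * P.logPot β (P.N β)) ≤ 576 * X * P.ζ β ^ 2 := by
      have := P.logPot_le_ζ hβ le_rfl
      calc 576 * P.M.H ^ 2 * (P.potScale β * P.logPot β (P.N β))
          = 576 * X * P.ζ β * P.logPot β (P.N β) := by rw [hX]; unfold Config.potScale; ring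
        _ ≤ 576 * X * P.ζ β * P.ζ β := by gcongr
        _ = _ := by ring
    have h5 : 0 < X * P.ζ β ^ 2 := by positivity
    linarith
  classical
  have hspec := Nat.find_spec hex
  have hmin : ∀ j, 1 ≤ j → j < Nat.find hex → ¬ R.Terminates j ω := fun j hj hjn hTj =>
    Nat.find_min hex hjn ⟨hj, hjn.le.trans hspec.2.1, hTj⟩
  obtain ⟨m, hm⟩ : ∃ m, Nat.find hex = m + 1 := ⟨Nat.find hex - 1, by omega⟩
  rw [hm] at hspec hmin
  exact ⟨m, ⟨hspec.1, hspec.2.1, hspec.2.2, hmin⟩,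
    hω.mul_sq_threshold_le hR hβ (by omega) fun j hj hjm => hmin j hj (by omega)⟩

/-- The reference policies of the exploration phase are safe with a margin. -/
lemma Good.V_pol_le (hR : R.IsRun) (hβ : 100 ≤ β) {ω : P.Data β} (hω : R.Good ω) {n : ℕ}
    (hn : n ≤ P.N β) (hT : ∀ m, 1 ≤ m → m < n → ¬ R.Terminates m ω) :
    P.M.V P.task.c (R.pol n ω).prob ≤ P.task.τ - P.task.κ / 3 := by
  have hκ := P.task.κ_pos
  have hbase := P.task.baseline_safe
  rcases Nat.eq_zero_or_pos n with rfl | h1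
  · rw [hR.pol_zero]
    linarith
  have hmem := hR.pol_mem n h1 hn ω hT
  unfold safeSet at hmem
  split_ifs at hmem with hb
  · have hmem' : R.Vhat n ω P.task.c (R.pol n ω) + R.U n ω (R.pol n ω) ≤
      P.task.τ - P.task.κ / 3 := hmem
    have e1 := (abs_le.1 (hω.abs_Vhat_sub_le hR hβ h1 hn P.task.isUtility_c (R.pol n ω))).1
    have e2 := bonusVal_le_U (R := R) n ω (R.pol n ω)
    linarith
  · rw [Set.mem_singleton_iff] at hmem
    rw [hmem]
    linarith

/-- At most two randomised steps at ε₀ = κ/6 each consume exactly the margin κ/3 kept by the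
reference policies. For `k = 0` the set {k, k - 1} collapses to one step, by truncated subtraction.
-/
lemma V_behavior_le (i : ℕ) (ω : P.Data β) (k : ℕ) :
    P.M.V P.task.c (R.behavior i ω k) ≤ P.M.V P.task.c (R.pol i ω).prob + P.task.κ / 3 := by
  have := P.nonempty_action
  have h1 := bval_greedy_le P.M.trans_isDensity P.task.isUtility_c.isUtil (R.pol i ω) P.epsUnit
    {k, k - 1} P.M.H 0 (by simp) P.M.init fun _ => rfl
  have h2 : ((({k, k - 1} : Finset ℕ).filter fun j => 0 ≤ j).card : ℝ) ≤ 2 := by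
    exact_mod_cast (Finset.card_filter_le _ _).trans Finset.card_le_two
  have h3 : (P.epsUnit : ℝ) = P.task.κ / 6 := rfl
  have h4 : P.M.V P.task.c (R.behavior i ω k) ≤ bval P.M.base id P.M.trans (P.M.ext P.task.c)
      ((R.pol i ω).greedy P.epsUnit ({k, k - 1} : Finset ℕ)).prob P.M.H 0 P.M.init := by
    rw [P.M.V_eq]
    rcases Nat.eq_zero_or_pos k with rfl | hk
    · refine le_of_eq ?_
      congr 1
      unfold behavior MarkovPolicy.greedy
      congr 1
      ext j
      simp
    · refine le_of_eq ?_
      congr 1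
      unfold behavior MarkovPolicy.greedy
      congr 1
      ext j
      simp
      omega
  rw [P.M.V_eq P.task.c (R.pol i ω).prob]
  have hκ := P.task.κ_pos
  rw [h3] at h1
  have h5 := mul_le_mul_of_nonneg_left h2 (show 0 ≤ P.task.κ / 6 by linarith)
  linarith

/-- After the exploration phase, the error function is small for every policy. -/
lemma Good.U_le_acc (hR : R.IsRun) (hβ : 100 ≤ β) {ω : P.Data β} (hω : R.Good ω) {n : ℕ}
    (hs : R.StopsAt n ω) (π : MarkovPolicy S A) : R.U n ω π ≤ P.acc := by
  obtain ⟨h1, hn, ⟨hb, hU⟩, hT⟩ := hs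
  have := P.nonempty_action
  have hmax := hR.pol_max n h1 hn ω hT
  rw [U_eq]
  refine bonus_value_le_of_safe (hR.ptil_isDensity h1 hn ω) P.M.trans_isDensity
    (hR.bonus_bddMeas h1 hn ω) (bonus_mem_Icc n ω) P.task.isUtility_c.isUtil
    (Real.sqrt_nonneg _) P.task.κ_pos P.κ_le_Δ P.Δ_le_τ P.task.τ_le_one P.acc_pos P.acc_le_κ
    (fun π => hω.abs_Vhat_sub_V_le hR hβ h1 hn P.task.isUtility_c.isUtil π) P.task.baseline
    ?_ ?_ (fun m hm => ?_) (fun π hπ => ?_) π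
  · rw [← P.M.V_eq]
    exact P.task.baseline_safe
  · unfold BaselineAccurate at hb
    rwa [U_eq, Vhat_eq] at hb
  · simp only [← P.M.V_eq] at hm ⊢
    exact P.M.le_sub_margin m hm
  · have hmem : π ∈ R.safeSet n ω := by
      unfold safeSet
      rw [if_pos hb]
      change R.Vhat n ω P.task.c π + R.U n ω π ≤ P.task.τ - P.task.κ / 3
      rw [U_eq, Vhat_eq]
      exact hπ
    have := (hmax π hmem).trans hU
    rwa [U_eq] at this

/-- Planning succeeds after the exploration phase. -/
theorem Good.planning (hR : R.IsRun) (hβ : 100 ≤ β) {ω : P.Data β} (hω : R.Good ω) {n : ℕ}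
    (hs : R.StopsAt n ω) {r c : ℕ → S → A → ℝ} {τ : ℝ} (hr : P.M.IsUtility r)
    (hc : P.M.IsUtility c) (hτ : P.task.Δmin ≤ P.M.margin c τ) :
    (∃ π, R.PlanFeasible n ω c τ π) ∧
      ∀ π, R.IsPlan n ω r c τ π → P.M.IsEpsOptimalSafe P.ε r c τ π := by
  have := P.nonempty_action
  have hU := hω.U_le_acc hR hβ hs
  obtain ⟨h1, hn, -, -⟩ := hs
  have hΔ1 : P.task.Δmin ≤ 1 := P.task.Δmin_le.trans P.Δ_le_one
  have key := planning_succeeds (hR.ptil_isDensity h1 hn ω) P.M.trans_isDensity hc.isUtil hr.isUtil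
    (U := R.U n ω) (τ := τ) P.ε_mem.1 P.ε_mem.2 P.task.Δmin_pos hΔ1 P.acc_le_Δmin P.acc_le_εΔmin hU
    (fun π => (hω.abs_Vhat_sub_V_le hR hβ h1 hn hc.isUtil π).trans (bonusVal_le_U n ω π))
    (fun π => (hω.abs_Vhat_sub_V_le hR hβ h1 hn hr.isUtil π).trans (bonusVal_le_U n ω π))
    (fun m hm => by
      simp only [← P.M.V_eq] at hm ⊢
      have := P.M.le_sub_margin (τ := τ) m hm
      linarith)
  simp only [← P.M.V_eq, ← Vhat_eq] at key
  exact ⟨key.1, fun π hπ => key.2 π hπ.1 hπ.2⟩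

end Choices

end SafeRewardFree
end

/-! ### Solving the logarithmic inequalities for the number of iterations. -/

noncomputable section
namespace SafeRewardFree

/-- With u the fourth root of y, log y ≤ 4u turns the hypothesis into u⁴ ≤ 16 B u², so √y ≤ 16 B.
The next lemma does the same with a square root. -/
lemma log_le_of_le_mul_sq_log {y B : ℝ} (hy : 1 ≤ y) (hB : y ≤ B * Real.log y ^ 2) :
    Real.log y ≤ 2 * Real.log (16 * B) := by
  set u := √(√y) with hu
  have hu0 : 0 < u := Real.sqrt_pos.2 (Real.sqrt_pos.2 (by linarith))
  have hu2 : (u ^ 2) ^ 2 = y := by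
    rw [hu, Real.sq_sqrt (Real.sqrt_nonneg _), Real.sq_sqrt (by linarith)]
  have h1 : Real.log y = 2 * Real.log (u ^ 2) := by rw [← hu2, Real.log_pow]; norm_num
  have h2 : Real.log y ≤ 4 * u := by
    rw [h1, Real.log_pow]
    have := Real.log_le_sub_one_of_pos hu0
    push_cast
    linarith
  have h3 : Real.log y ^ 2 ≤ 16 * u ^ 2 := by
    have := pow_le_pow_left₀ (Real.log_nonneg hy) h2 2
    linarith
  have hB0 : 0 < B := by
    by_contra hc
    have := mul_nonpos_of_nonpos_of_nonneg (not_lt.1 hc) (sq_nonneg (Real.log y))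
    linarith
  have h4 : u ^ 2 * u ^ 2 ≤ u ^ 2 * (16 * B) := by
    have := mul_le_mul_of_nonneg_left h3 hB0.le
    linarith
  have h5 := le_of_mul_le_mul_left h4 (by positivity)
  rw [h1]
  have := Real.log_le_log (by positivity) h5
  linarith

lemma log_le_of_le_mul_log {z B : ℝ} (hz : 1 ≤ z) (hB0 : 0 < B) (hB : z ≤ B * (1 + Real.log z)) :
    Real.log z ≤ 2 * Real.log (2 * B) := by
  set u := √z with hu
  have hu0 : 0 < u := Real.sqrt_pos.2 (by linarith)
  have hu2 : u ^ 2 = z := by rw [hu, Real.sq_sqrt (by linarith)]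
  have h1 : Real.log z = 2 * Real.log u := by rw [← hu2, Real.log_pow]; norm_num
  have h2 : 1 + Real.log z ≤ 2 * u := by
    rw [h1]
    have := Real.log_le_sub_one_of_pos hu0
    linarith
  have h4 : u * u ≤ u * (2 * B) := by
    have := mul_le_mul_of_nonneg_left h2 hB0.le
    linarith
  have h5 := le_of_mul_le_mul_left h4 hu0
  rw [h1]
  have := Real.log_le_log hu0 h5
  linarith

lemma log_two_pow_mul_le {X : ℝ} (hX : 0 < X) (k : ℕ) :
    Real.log (2 ^ k * X) ≤ k * 0.6931471808 + Real.log X := by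
  rw [Real.log_mul (by positivity) hX.ne', Real.log_pow]
  have := mul_le_mul_of_nonneg_left Real.log_two_lt_d9.le (Nat.cast_nonneg (α := ℝ) k)
  linarith

namespace Config

variable {S A : Type*} [MeasurableSpace S] [Fintype A] (P : Config S A)

/-- The first summand of `scale`. -/
def scale₁ : ℝ := (P.M.H : ℝ) ^ 2 * (P.M.d : ℝ) ^ 4 * (Fintype.card A : ℝ) ^ 2 /
  (P.task.κ ^ 2 * P.Δ ^ 2 * P.acc ^ 2)

/-- The second summand of `scale`. -/
def scale₂ : ℝ := (P.M.H : ℝ) ^ 2 * (P.M.d : ℝ) ^ 4 * (Fintype.card A : ℝ) ^ 2 / P.task.κ ^ 4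

lemma scale_eq : P.scale = P.scale₁ + P.scale₂ := rfl

lemma one_le_numerator : 1 ≤ (P.M.H : ℝ) ^ 2 * (P.M.d : ℝ) ^ 4 * (Fintype.card A : ℝ) ^ 2 :=
  one_le_mul_of_one_le_of_one_le (one_le_mul_of_one_le_of_one_le (one_le_pow₀ P.one_le_H)
    (one_le_pow₀ P.one_le_d)) (one_le_pow₀ P.one_le_card_action)

lemma scale₂_nonneg : 0 ≤ P.scale₂ := by
  unfold scale₂
  positivity

lemma scale₁_ge : 576 ≤ P.scale₁ := by
  have h1 := P.one_le_numerator
  have hκ := P.task.κ_pos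
  have hΔ := P.Δ_pos
  have ha := P.acc_pos
  have e1 : P.task.κ ^ 2 ≤ 1 := pow_le_one₀ hκ.le P.κ_le_one
  have e2 : P.Δ ^ 2 ≤ 1 := pow_le_one₀ hΔ.le P.Δ_le_one
  have e3 : P.acc ^ 2 ≤ (1 / 24) ^ 2 :=
    pow_le_pow_left₀ ha.le (by linarith [P.acc_le_κ, P.κ_le_one]) 2
  have e4 : P.task.κ ^ 2 * P.Δ ^ 2 * P.acc ^ 2 ≤ 1 * 1 * (1 / 24) ^ 2 := by gcongr
  unfold scale₁
  rw [le_div_iff₀ (by positivity)]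
  linarith

lemma scale_ge : 576 ≤ P.scale := by
  rw [scale_eq]
  linarith [P.scale₁_ge, P.scale₂_nonneg]

lemma scale₁_le : P.scale₁ ≤ P.scale := by
  rw [scale_eq]
  linarith [P.scale₂_nonneg]

lemma six_le_log {x : ℝ} (hx : 576 ≤ x) : 6 ≤ Real.log x := by
  rw [Real.le_log_iff_exp_le (by linarith)]
  have h1 : Real.exp 6 = Real.exp 1 ^ 6 := by rw [← Real.exp_nat_mul]; norm_num
  rw [h1]
  have := pow_le_pow_left₀ (Real.exp_pos 1).le Real.exp_one_lt_d9.le 6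
  refine this.trans (le_trans ?_ hx)
  norm_num

lemma coefN_le : P.coefN 100 ≤ 2 ^ 27 * P.scale := by
  have h1 := P.one_le_numerator
  have hκ := P.task.κ_pos
  have hΔ := P.Δ_pos
  have ha := P.acc_pos
  have e1 : P.coefN 100 = 33177600 * P.scale₁ + 132710400 * P.scale₂ := by
    unfold coefN scale₁ scale₂ threshold
    rw [P.Atilde_eq]
    field_simp
    ring
  rw [e1, scale_eq]
  linarith [P.scale₁_ge, P.scale₂_nonneg]

/-- The product of the sizes of the model classes and the horizon. -/
def size : ℝ := (P.models.Φ.card : ℝ) * (P.models.Ψ.card : ℝ) * (P.M.H : ℝ)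

lemma one_le_size : 1 ≤ P.size :=
  one_le_mul_of_one_le_of_one_le (one_le_mul_of_one_le_of_one_le P.one_le_card_Φ P.one_le_card_Ψ)
    P.one_le_H

lemma iota_eq : P.iota = Real.log (P.scale * P.size / P.δ) ^ 2 := by
  unfold iota size
  simp only [mul_assoc]

lemma logFactor_eq : P.logFactor = Real.log (P.scale * P.size) ^ 2 := by
  unfold logFactor size
  simp only [mul_assoc]

lemma scale_le_scale_mul_size : P.scale ≤ P.scale * P.size :=
  le_mul_of_one_le_right (by linarith [P.scale_ge]) P.one_le_size

lemma scale_mul_size_le : P.scale * P.size ≤ P.scale * P.size / P.δ := by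
  have := P.δ_mem
  exact le_div_self (by nlinarith [P.scale_ge, P.one_le_size]) this.1 this.2.le

/-- By minimality, N - 1 violates the inequality that defines `N`, so it is bounded by a multiple of
its own squared logarithm, which can be inverted. The additive constants are absorbed since log 576
≥ 6. -/
lemma ζ_le : P.ζ 100 ≤ 11 * Real.log (P.scale * P.size / P.δ) := by
  have hN := P.d_le_N (β := 100) le_rfl
  have hd := P.one_le_d
  have hX := P.scale_ge
  set Z := P.scale * P.size / P.δ with hZ
  have hZ576 : 576 ≤ Z := hX.trans (P.scale_le_scale_mul_size.trans P.scale_mul_size_le)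
  have hlog := six_le_log hZ576
  have hN' : (100 : ℝ) ≤ P.N 100 := by linarith
  have hN2 : 100 ≤ P.N 100 := by exact_mod_cast hN'
  obtain ⟨n, hn⟩ : ∃ n, P.N 100 = n + 1 := ⟨P.N 100 - 1, by omega⟩
  have h1 := P.lt_of_lt_N (β := 100) (n := n) (by omega) (by omega)
  have ha := P.two_le_logArg
  have hn1 : (1 : ℝ) ≤ n := by
    have : 1 ≤ n := by omega
    exact_mod_cast this
  rw [logTerm_eq] at h1
  have h2 : P.logArg * n ≤ (P.logArg * (2 ^ 27 * P.scale)) * Real.log (P.logArg * n) ^ 2 := by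
    rw [mul_assoc]
    refine mul_le_mul_of_nonneg_left (h1.le.trans ?_) (by linarith)
    exact mul_le_mul_of_nonneg_right P.coefN_le (sq_nonneg _)
  have h3 := log_le_of_le_mul_sq_log (by nlinarith) h2
  have h4 : 16 * (P.logArg * (2 ^ 27 * P.scale)) = 2 ^ 32 * Z := by
    rw [hZ]
    unfold logArg size
    ring
  rw [h4] at h3
  have h5 : Real.log (2 ^ 32 * Z) ≤ 23 + Real.log Z :=
    (log_two_pow_mul_le (by linarith) 32).trans (by norm_num)
  generalize Real.log (2 ^ 32 * Z) = y at h3 h5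
  have h6 : P.ζ 100 ≤ Real.log 2 + Real.log (P.logArg * n) := by
    have e : P.ζ 100 = Real.log (P.logArg * (n + 1)) := by
      have := P.logTerm_eq (P.N 100)
      rw [hn] at this
      push_cast at this
      rw [← this, ζ, hn]
    rw [e, ← Real.log_mul (by norm_num) (by positivity)]
    refine Real.log_le_log (by positivity) ?_
    nlinarith
  have h7 := Real.log_two_lt_d9
  linarith

lemma log_one_div_δ_nonneg : 0 ≤ Real.log (1 / P.δ) :=
  Real.log_nonneg (by rw [le_div_iff₀ P.δ_mem.1, one_mul]; exact P.δ_mem.2.le)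

lemma log_div_δ_le : Real.log (P.scale * P.size / P.δ) ≤
    Real.log (P.scale * P.size) * (1 + Real.log (1 / P.δ)) := by
  have hW := six_le_log (P.scale_ge.trans P.scale_le_scale_mul_size)
  have h1 := P.log_one_div_δ_nonneg
  have h2 : 0 < P.scale * P.size := by nlinarith [P.scale_ge, P.one_le_size]
  rw [div_eq_mul_one_div, Real.log_mul h2.ne' (one_div_pos.2 P.δ_mem.1).ne']
  nlinarith

variable {m : ℕ}

/-- The constant is 576 · 100 · 36 · 9, from the regret bound, β, Ã² and T², plus one unit for the
final iteration. -/
lemma succ_le_mul_logPot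
    (hm : m * P.threshold ^ 2 ≤ 576 * P.M.H ^ 2 * (P.potScale 100 * P.logPot 100 m)) :
    (m : ℝ) + 1 ≤ 18662401 * P.scale * (P.ζ 100 * P.logPot 100 m) := by
  have hκ := P.task.κ_pos
  have hΔ := P.Δ_pos
  have ha := P.acc_pos
  have hT := P.threshold_pos
  have hζ := P.one_le_ζ (β := 100) le_rfl
  have hL := P.one_le_logPot (β := 100) le_rfl m
  have h1 : (m : ℝ) ≤ 18662400 * P.scale₁ * (P.ζ 100 * P.logPot 100 m) := by
    rw [← le_div_iff₀ (by positivity)] at hm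
    refine hm.trans (le_of_eq ?_)
    unfold potScale scale₁ threshold
    rw [P.Atilde_eq]
    field_simp
    ring
  have h2 : 1 ≤ P.ζ 100 * P.logPot 100 m := one_le_mul_of_one_le_of_one_le hζ hL
  have h3 := mul_le_mul_of_nonneg_right P.scale₁_le (show 0 ≤ P.ζ 100 * P.logPot 100 m by linarith)
  have h4 : 1 ≤ P.scale * (P.ζ 100 * P.logPot 100 m) :=
    one_le_mul_of_one_le_of_one_le (by linarith [P.scale_ge]) h2
  linarith

lemma succ_le_mul_iota (hmN : m ≤ P.N 100)
    (hm : m * P.threshold ^ 2 ≤ 576 * P.M.H ^ 2 * (P.potScale 100 * P.logPot 100 m)) :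
    (m : ℝ) + 1 ≤ (121 * 18662401) * (P.scale * P.iota) := by
  have hζ := P.one_le_ζ (β := 100) le_rfl
  have hL := P.one_le_logPot (β := 100) le_rfl m
  have hX := P.scale_ge
  have hLζ := P.logPot_le_ζ (β := 100) le_rfl hmN
  have h1 := P.ζ_le
  have h2 : P.ζ 100 * P.logPot 100 m ≤ 121 * P.iota := by
    rw [iota_eq]
    calc P.ζ 100 * P.logPot 100 m ≤ P.ζ 100 * P.ζ 100 := by gcongr
      _ = P.ζ 100 ^ 2 := by ring
      _ ≤ (11 * Real.log (P.scale * P.size / P.δ)) ^ 2 := by gcongr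
      _ = _ := by ring
  have h3 := mul_le_mul_of_nonneg_left h2 (show 0 ≤ 18662401 * P.scale by linarith)
  linarith [P.succ_le_mul_logPot hm]

/-- The number of iterations is at most a multiple of scale · ζ · `logPot`, and the argument of the
logarithm in `logPot` divides it by 100 ζ. So ζ, the only source of δ, cancels, and a self-bounding
inequality free of δ remains. -/
lemma logPot_le
    (hm : m * P.threshold ^ 2 ≤ 576 * P.M.H ^ 2 * (P.potScale 100 * P.logPot 100 m)) :
    P.logPot 100 m ≤ 7 * Real.log (P.scale * P.size) := by
  have hζ := P.one_le_ζ (β := 100) le_rfl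
  have hL := P.one_le_logPot (β := 100) le_rfl m
  have hX := P.scale_ge
  have h1 := P.succ_le_mul_logPot hm
  set z := 1 + ((m : ℝ) + 1) / (100 * P.ζ 100) with hz
  have hLz : P.logPot 100 m = 1 + Real.log z := rfl
  have hz1 : 1 ≤ z := le_add_of_nonneg_right (by positivity)
  have h2 : z ≤ (2 ^ 18 * P.scale) * (1 + Real.log z) := by
    rw [← hLz]
    have e1 : ((m : ℝ) + 1) / (100 * P.ζ 100) ≤ 186625 * (P.scale * P.logPot 100 m) := by
      rw [div_le_iff₀ (by positivity)]
      have : 0 ≤ P.scale * (P.ζ 100 * P.logPot 100 m) := by positivity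
      linarith
    have e2 : 1 ≤ P.scale * P.logPot 100 m :=
      one_le_mul_of_one_le_of_one_le (by linarith) hL
    rw [hz]
    linarith
  have h3 := log_le_of_le_mul_log hz1 (by linarith) h2
  have h4 : 2 * (2 ^ 18 * P.scale) = 2 ^ 19 * P.scale := by ring
  rw [h4] at h3
  have h5 : Real.log (2 ^ 19 * P.scale) ≤ 14 + Real.log P.scale :=
    (log_two_pow_mul_le (by linarith) 19).trans (by norm_num)
  generalize Real.log (2 ^ 19 * P.scale) = y at h3 h5
  have h6 := six_le_log hX
  have h7 := Real.log_le_log (by linarith) P.scale_le_scale_mul_size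
  rw [hLz]
  linarith

/-- Of the two logarithms only ζ contains δ, and it is linear in log(1/δ). -/
lemma succ_le_mul_logFactor
    (hm : m * P.threshold ^ 2 ≤ 576 * P.M.H ^ 2 * (P.potScale 100 * P.logPot 100 m)) :
    (m : ℝ) + 1 ≤ (121 * 18662401) * (P.logFactor * (P.scale * (1 + Real.log (1 / P.δ)))) := by
  have hL := P.one_le_logPot (β := 100) le_rfl m
  have hX := P.scale_ge
  have hW := six_le_log (hX.trans P.scale_le_scale_mul_size)
  have hδ := P.log_one_div_δ_nonneg
  have h1 := P.ζ_le.trans (mul_le_mul_of_nonneg_left P.log_div_δ_le (by norm_num))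
  have h2 : P.ζ 100 * P.logPot 100 m ≤ 77 * (P.logFactor * (1 + Real.log (1 / P.δ))) := by
    rw [logFactor_eq]
    calc P.ζ 100 * P.logPot 100 m
        ≤ (11 * (Real.log (P.scale * P.size) * (1 + Real.log (1 / P.δ)))) *
          (7 * Real.log (P.scale * P.size)) := by
          have := P.logPot_le hm
          gcongr
      _ = _ := by ring
  have h3 := mul_le_mul_of_nonneg_left h2 (show 0 ≤ 18662401 * P.scale by linarith)
  have h4 : 0 ≤ P.logFactor * (P.scale * (1 + Real.log (1 / P.δ))) := by
    rw [logFactor_eq]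
    positivity
  linarith [P.succ_le_mul_logPot hm]

/-- Here `acc` is at least ε/24 and the margin equals one, so the first summand contributes 24² =
576; the second contributes one more. -/
lemma scale_le_of_unconstrained (hκ : P.task.κ = 1) (hτ : P.task.τ = 1) (hΔ : P.task.Δmin = 1) :
    P.scale ≤ 577 * ((P.M.H : ℝ) ^ 2 * (P.M.d : ℝ) ^ 4 * (Fintype.card A : ℝ) ^ 2 / P.ε ^ 2) := by
  have h1 := P.one_le_numerator
  have hε := P.ε_mem
  have ha : P.ε / 24 ≤ P.acc := by
    unfold acc
    rw [hκ, hτ, hΔ]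
    have := hε.1
    have := hε.2
    refine le_min ?_ (le_min ?_ (le_min ?_ (le_min ?_ ?_))) <;> linarith
  have hΔ1 : P.Δ = 1 := le_antisymm P.Δ_le_one (hκ.symm.trans_le P.κ_le_Δ)
  have e1 : P.scale₁ ≤ 576 *
      ((P.M.H : ℝ) ^ 2 * (P.M.d : ℝ) ^ 4 * (Fintype.card A : ℝ) ^ 2 / P.ε ^ 2) := by
    have e2 : (P.ε / 24) ^ 2 ≤ P.acc ^ 2 :=
      pow_le_pow_left₀ (div_nonneg hε.1.le (by norm_num)) ha 2
    have hε0 := hε.1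
    have := P.acc_pos
    unfold scale₁
    rw [hκ, hΔ1, one_pow, one_mul, one_mul, ← mul_div_assoc, div_le_div_iff₀ (by positivity)
      (by positivity)]
    nlinarith
  have e3 : P.scale₂ ≤ (P.M.H : ℝ) ^ 2 * (P.M.d : ℝ) ^ 4 * (Fintype.card A : ℝ) ^ 2 / P.ε ^ 2 := by
    unfold scale₂
    rw [hκ, one_pow, div_one]
    exact le_div_self (by linarith) (pow_pos hε.1 2) (pow_le_one₀ hε.1.le hε.2.le)
  rw [scale_eq]
  linarith

end Config

end SafeRewardFree
end

/-! ### Assembly of the theorem. -/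

theorem theorem3 :
    ∃ β C : ℝ, 0 < β ∧ 0 < C ∧
      ∀ (S : Type*) (A : Type*) [MeasurableSpace S] [Fintype A] [MeasurableSpace A]
        [MeasurableSingletonClass A] (P : SafeRewardFree.Config S A)
        (R : SafeRewardFree.Choices P β), R.IsRun →
        MeasureTheory.IsProbabilityMeasure R.law ∧
        ∃ E : Set (P.Data β), MeasurableSet E ∧ ENNReal.ofReal (1 - P.δ) ≤ R.law E ∧
          ∀ ω ∈ E, ∃ n : ℕ, R.StopsAt n ω ∧
            -- every episode of the exploration phase is safe
            (∀ i < n, ∀ k < P.M.H, P.M.V P.task.c (R.behavior i ω k) ≤ P.task.τ) ∧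
            -- planning succeeds for every reward and every constraint
            (∀ (r c : ℕ → S → A → ℝ) (τ : ℝ), P.M.IsUtility r → P.M.IsUtility c →
              0 < τ → τ ≤ 1 → P.task.Δmin ≤ P.M.margin c τ →
              (∃ π, R.PlanFeasible n ω c τ π) ∧
                ∀ π, R.IsPlan n ω r c τ π → P.M.IsEpsOptimalSafe P.ε r c τ π) ∧
            -- the number of trajectories, with explicit logarithmic factor
            ((P.M.H * n : ℕ) : ℝ) ≤
              C * ((P.M.H : ℝ) ^ 3 * (P.M.d : ℝ) ^ 4 * (Fintype.card A : ℝ) ^ 2 * P.iota /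
                    (P.task.κ ^ 2 * P.Δ ^ 2 * P.acc ^ 2) +
                (P.M.H : ℝ) ^ 3 * (P.M.d : ℝ) ^ 4 * (Fintype.card A : ℝ) ^ 2 * P.iota /
                    P.task.κ ^ 4) ∧
            -- the number of trajectories, linear in `log (1 / δ)` up to logarithms without `δ`
            ((P.M.H * n : ℕ) : ℝ) ≤
              C * P.logFactor *
                ((P.M.H : ℝ) ^ 3 * (P.M.d : ℝ) ^ 4 * (Fintype.card A : ℝ) ^ 2 *
                    (1 + Real.log (1 / P.δ)) / (P.task.κ ^ 2 * P.Δ ^ 2 * P.acc ^ 2) +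
                (P.M.H : ℝ) ^ 3 * (P.M.d : ℝ) ^ 4 * (Fintype.card A : ℝ) ^ 2 *
                    (1 + Real.log (1 / P.δ)) / P.task.κ ^ 4) ∧
            -- the constraint-free case
            ((∀ h < P.M.H, ∀ s a, P.task.c h s a = 0) → P.task.τ = 1 → P.task.κ = 1 →
              P.task.Δmin = 1 →
              ((P.M.H * n : ℕ) : ℝ) ≤
                C * P.logFactor * (1 + Real.log (1 / P.δ)) *
                  ((P.M.H : ℝ) ^ 3 * (P.M.d : ℝ) ^ 4 * (Fintype.card A : ℝ) ^ 2 / P.ε ^ 2)) := by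
  -- Any β ≥ 100 suits the concentration bounds. The factor 577 is needed only in the
  -- constraint-free case; 121 = 11² comes from `ζ_le`.
  refine ⟨100, 577 * (121 * 18662401), by norm_num, by norm_num, ?_⟩
  intro S A _ _ _ _ P R hR
  refine ⟨hR.isProbabilityMeasure_law, ?_⟩
  obtain ⟨E, hE, hδE, hgood⟩ := hR.exists_good_event le_rfl
  refine ⟨E, hE, hδE, fun ω hω => ?_⟩
  have hG := hgood ω hω
  obtain ⟨m, hend, hm⟩ := hG.exists_stopsAt hR le_rfl
  have hmN : m ≤ P.N 100 := by
    have := hend.2.1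
    omega
  have hH := P.one_le_H
  have hX := P.scale_ge
  have hδ := P.log_one_div_δ_nonneg
  have hι : 0 ≤ P.scale * P.iota := mul_nonneg (by linarith) (sq_nonneg _)
  have hlf : 0 ≤ P.logFactor := sq_nonneg _
  have h3 := P.succ_le_mul_logFactor hm
  refine ⟨m + 1, hend, fun i hi k _ => ?_, fun r c τ hr hc _ _ hτ =>
    hG.planning hR le_rfl hend hr hc hτ, ?_, ?_, fun _ hτ hκ hΔ => ?_⟩
  · have h1 := hG.V_pol_le hR le_rfl (n := i) (by omega) fun j hj hji =>
      hend.2.2.2 j hj (by omega)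
    have h2 := SafeRewardFree.Choices.V_behavior_le (R := R) i ω k
    linarith
  · have h1 := P.succ_le_mul_iota hmN hm
    have e : (P.M.H : ℝ) ^ 3 * (P.M.d : ℝ) ^ 4 * (Fintype.card A : ℝ) ^ 2 * P.iota /
          (P.task.κ ^ 2 * P.Δ ^ 2 * P.acc ^ 2) +
        (P.M.H : ℝ) ^ 3 * (P.M.d : ℝ) ^ 4 * (Fintype.card A : ℝ) ^ 2 * P.iota /
          P.task.κ ^ 4 = P.M.H * (P.scale * P.iota) := by
      unfold SafeRewardFree.Config.scale
      ring
    rw [e]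
    push_cast
    have h2 := mul_le_mul_of_nonneg_left h1 (show (0 : ℝ) ≤ P.M.H by linarith)
    have h4 : 0 ≤ (P.M.H : ℝ) * (P.scale * P.iota) := mul_nonneg (by linarith) hι
    linarith
  · have e : (P.M.H : ℝ) ^ 3 * (P.M.d : ℝ) ^ 4 * (Fintype.card A : ℝ) ^ 2 *
          (1 + Real.log (1 / P.δ)) / (P.task.κ ^ 2 * P.Δ ^ 2 * P.acc ^ 2) +
        (P.M.H : ℝ) ^ 3 * (P.M.d : ℝ) ^ 4 * (Fintype.card A : ℝ) ^ 2 *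
          (1 + Real.log (1 / P.δ)) / P.task.κ ^ 4 =
        P.M.H * (P.scale * (1 + Real.log (1 / P.δ))) := by
      unfold SafeRewardFree.Config.scale
      ring
    rw [e]
    push_cast
    have h2 := mul_le_mul_of_nonneg_left h3 (show (0 : ℝ) ≤ P.M.H by linarith)
    have h4 : 0 ≤ (P.M.H : ℝ) * (P.logFactor * (P.scale * (1 + Real.log (1 / P.δ)))) := by
      positivity
    linarith
  · have h1 := P.scale_le_of_unconstrained hκ hτ hΔ
    have e : (P.M.H : ℝ) ^ 3 * (P.M.d : ℝ) ^ 4 * (Fintype.card A : ℝ) ^ 2 / P.ε ^ 2 =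
        P.M.H * ((P.M.H : ℝ) ^ 2 * (P.M.d : ℝ) ^ 4 * (Fintype.card A : ℝ) ^ 2 / P.ε ^ 2) := by
      ring
    rw [e]
    push_cast
    have h2 := mul_le_mul_of_nonneg_left h3 (show (0 : ℝ) ≤ P.M.H by linarith)
    have h4 := mul_le_mul_of_nonneg_left h1
      (show 0 ≤ (P.M.H : ℝ) * (P.logFactor * (1 + Real.log (1 / P.δ))) by positivity)
    linarith
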